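/- Let $q\in\mathbb C^\times$ be not a root of unity, and let $|1|=\bar 0$, $|2|=\bar 1$, $q_1=q$, $q_2=q^{-1}$. Let $$R(z,w)=\sum_{i}(zq_i-wq_i^{-1})E_{ii}\otimes E_{ii}+(z-w)\sum_{i\ne j}E_{ii}\otimes E_{jj}+z(q-q^{-1})E_{21}\otimes E_{12}+w(q^{-1}-q)E_{12}\otimes E_{21}$$ be the Perk–Schultz matrix on $\mathbb V^{\otimes 2}$, $\mathbb V=\mathbb C^{1|1}$. Let $U=U_q(\widehat{\mathfrak{gl}(1,1)})$ be the superalgebra generated by $s_{ij}^{(n)},t_{ij}^{(n)}$ ($i,j\in\{1,2\}$, $n\ge 0$) of parity $|i|+|j|$ with the relations (for $S(z)=\sum s_{ij}(z)\otimes E_{ij}$, $s_{ij}(z)=\sum_n s_{ij}^{(n)}z^n$, $T(z)=\sum t_{ij}(z)\otimes E_{ij}$, $t_{ij}(z)=\sum_n t_{ij}^{(n)}z^{-n}$, multiplied by the super sign rule) $$R_{23}(z,w)T_{12}(z)T_{13}(w)=T_{13}(w)T_{12}(z)R_{23}(z,w),\quad R_{23}(z,w)S_{12}(z)S_{13}(w)=S_{13}(w)S_{12}(z)R_{23}(z,w),$$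 $$R_{23}(z,w)T_{12}(z)S_{13}(w)=S_{13}(w)T_{12}(z)R_{23}(z,w),\qquad t_{12}^{(0)}=s_{21}^{(0)}=0,\quad t_{ii}^{(0)}s_{ii}^{(0)}=s_{ii}^{(0)}t_{ii}^{(0)}=1 .$$ It is a Hopf superalgebra with $\Delta(s_{ij}(z))=\sum_k(-1)^{(|i|+|k|)(|k|+|j|)}s_{ik}(z)\otimes s_{kj}(z)$, similarly for $t_{ij}(z)$, and counit $\varepsilon(s_{ij}(z))=\varepsilon(t_{ij}(z))=\delta_{ij}$. Let $A$ (resp. $B$) be the subalgebra generated by all $s_{ij}^{(n)}$ and the $t_{ii}^{(0)}$ (resp. all $t_{ij}^{(n)}$ and the $s_{ii}^{(0)}$); $A$ and $B$ are sub-bialgebras of $U$. Define the Drinfeld generators by the Gauss decompositions of $S(z)$ and $T(z)$ in the super matrix product, that is $$s_{11}=K_1^+,\quad s_{12}=K_1^+E^+,\quad s_{21}=F^+K_1^+,\quad s_{22}=K_2^+-F^+K_1^+E^+$$ as series in $z$, and in the same way for $t_{ij}$ with $K_i^-,E^-,F^-$ as series in $z^{-1}$, where $$E^+(z)=\sum_{n\ge0}E_nz^n,\quad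 F^+(z)=-\sum_{n\ge1}F_nz^n,\quad E^-(z)=-\sum_{n\ge 1}E_{-n}z^{-n},\quad F^-(z)=\sum_{n\ge0}F_{-n}z^{-n},$$ $$K_1^\pm(z)=(s_{11}^{(0)})^{\pm1}\exp\Bigl(\pm(q-q^{-1})\sum_{s>0}h_{\pm s}z^{\pm s}\Bigr),\qquad (K_1^\pm(z))^{-1}K_2^\pm(z)=\phi_0^\pm\exp\Bigl(\pm(q-q^{-1})\sum_{s>0}C_{\pm s}z^{\pm s}\Bigr),$$ with $\phi_0^{\pm}=((s_{11}^{(0)})^{-1}s_{22}^{(0)})^{\pm1}$. Then there is exactly one even bilinear form $\varphi:A\times B\to\mathbb C$ such that, for homogeneous $a,a'\in A$, $b,b'\in B$, $$\varphi(a,bb')=(-1)^{|b||b'|}\varphi(a_{(1)},b)\varphi(a_{(2)},b'),\quad \varphi(aa',b)=\varphi(a',b_{(1)})\varphi(a,b_{(2)}),\quad \varphi(a,1)=\varepsilon(a),\quad \varphi(1,b)=\varepsilon(b),$$ $$\sum_{i,j,a,b}\varphi(s_{ij}(w),t_{ab}(z))\,E_{ab}\otimes E_{ij}=\frac{R(z,w)}{zq-wq^{-1}}\in\operatorname{End}(\mathbb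 V^{\otimes2})[[w/z]],$$ and it has the following property. Let $\mathcal B\subset A$ be the ordered family $$\cdots<(\phi_0^+)^{-1}F_2<(\phi_0^+)^{-1}F_1<h_1<h_2<\cdots<C_1<C_2<\cdots<E_0<E_1<\cdots$$ ($F$ and $E$ elements are odd, $h$ and $C$ elements even), and let $b\mapsto b^-\in B$ be given by $$((\phi_0^+)^{-1}F_s)^-=(\phi_0^-)^{-1}E_{-s},\quad h_s^-=C_{-s},\quad C_s^-=h_{-s},\quad E_n^-=F_{-n}\qquad(s\ge 1,\ n\ge0).$$ Let $\Gamma$ be the set of finitely supported functions $f:\mathcal B\to\mathbb Z_{\ge0}$ with $f(b)\le1$ for $b$ odd, and for $f\in\Gamma$ let $E(f)=\prod^{\to}_{b\in\mathcal B}b^{f(b)}\in A$ and $F(f)=\prod^{\to}_{b\in\mathcal B}(b^-)^{f(b)}\in B$ be the products in increasing order from left to right. Then for all $f,g\in\Gamma$ and all products $k,k'$ of the $(s_{ii}^{(0)})^{\pm1}$, $i=1,2$, $$\varphi(kE(f),k'F(g))=\varphi(k,k')\,\delta_{f,g}\,(-1)^{\sum_{b<b'}f(b)f(b')|b||b'|}\prod_{b\in\mathcal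 B}f(b)!\,\varphi(b,b^-)^{f(b)}.$$ -/

import Mathlib

open scoped TensorProduct PowerSeries

noncomputable section

namespace QAffineGL11

/-- The RTT generators `s_{ij}^{(n)}`, `t_{ij}^{(n)}`. The usual indices `1, 2` are written
`0, 1 : Fin 2`, so that the parity `|i|` of an index is its value `(i : ℕ)` modulo `2`. -/
inductive Gen : Type
  | s (i j : Fin 2) (n : ℕ) : Gen
  | t (i j : Fin 2) (n : ℕ) : Gen

/-- Coefficient of `z` at `E_{ab} ⊗ E_{cd}` in the Perk-Schultz matrix
`R(z,w) = ∑ᵢ (z qᵢ - w qᵢ⁻¹) Eᵢᵢ ⊗ Eᵢᵢ + (z - w) ∑_{i≠j} Eᵢᵢ ⊗ Eⱼⱼ + z (q - q⁻¹) E₂₁ ⊗ E₁₂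
+ w (q⁻¹ - q) E₁₂ ⊗ E₂₁`, where `q₁ = q`, `q₂ = q⁻¹`. -/
def rZ (q : ℂ) (a b c d : Fin 2) : ℂ :=
  if a = b ∧ c = d then (if a = c then (if a = 0 then q else q⁻¹) else 1)
  else if a = 1 ∧ b = 0 ∧ c = 0 ∧ d = 1 then q - q⁻¹
  else 0

/-- Coefficient of `w` at `E_{ab} ⊗ E_{cd}` in the Perk-Schultz matrix `R(z,w)`. -/
def rW (q : ℂ) (a b c d : Fin 2) : ℂ :=
  if a = b ∧ c = d then (if a = c then (if a = 0 then -q⁻¹ else -q) else -1)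
  else if a = 0 ∧ b = 1 ∧ c = 1 ∧ d = 0 then q⁻¹ - q
  else 0

section RTT

variable {P : Type*} [Ring P] [Algebra ℂ P]

/-- Coefficient of `E_{ab} ⊗ E_{cd}` in the Perk-Schultz matrix, with `α, β` put for `z, w`. -/
def rho (q : ℂ) (α β : P) (a b c d : Fin 2) : P := rZ q a b c d • α + rW q a b c d • β

/-- Let `X = ∑ X_{ij} ⊗ E_{ij}`, `Y = ∑ Y_{ij} ⊗ E_{ij}`, with `X_{ij}, Y_{ij}` of parity
`|i| + |j|`. This is the coefficient of `E_{aj} ⊗ E_{cl}` in `R₂₃ X₁₂ Y₁₃`, where everything is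
multiplied by the super rule `(x ⊗ y)(x' ⊗ y') = (-1)^{|y||x'|} xx' ⊗ yy'`. Indeed
`X₁₂ Y₁₃ = ∑ (-1)^{(|b|+|j|)(|d|+|l|)} X_{bj} Y_{dl} ⊗ E_{bj} ⊗ E_{dl}` and
`(E_{ab} ⊗ E_{cd})(E_{bj} ⊗ E_{dl}) = (-1)^{(|c|+|d|)(|b|+|j|)} E_{aj} ⊗ E_{cl}`. -/
def rttLeft (q : ℂ) (α β : P) (X Y : Fin 2 → Fin 2 → P) (a j c l : Fin 2) : P :=
  ∑ b : Fin 2, ∑ d : Fin 2, (-1 : ℂ) ^ (((b : ℕ) + j) * ((c : ℕ) + l)) •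
    (rho q α β a b c d * (X b j * Y d l))

/-- With the conventions of `rttLeft`, the coefficient of `E_{aj} ⊗ E_{cl}` in `Y₁₃ X₁₂ R₂₃`. Indeed
`Y₁₃ X₁₂ = ∑ Y_{cf} X_{ae} ⊗ E_{ae} ⊗ E_{cf}` (the two signs cancel) and
`(E_{ae} ⊗ E_{cf})(E_{ej} ⊗ E_{fl}) = (-1)^{(|c|+|f|)(|e|+|j|)} E_{aj} ⊗ E_{cl}`. -/
def rttRight (q : ℂ) (α β : P) (X Y : Fin 2 → Fin 2 → P) (a j c l : Fin 2) : P :=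
  ∑ e : Fin 2, ∑ f : Fin 2, (-1 : ℂ) ^ (((c : ℕ) + f) * ((e : ℕ) + j)) •
    ((Y c f * X a e) * rho q α β e j f l)

/-- Coefficients of the product of `∑ X_{ij} ⊗ E_{ij}` and `∑ Y_{ij} ⊗ E_{ij}`, with `X_{ij}, Y_{ij}`
of parity `|i| + |j|`, in the super tensor product with `End 𝕍`: a sign
`ε(i,j,k) = (-1)^{(|i|+|k|)(|k|+|j|)}` appears. -/
def superMul (X Y : Fin 2 → Fin 2 → P) (i j : Fin 2) : P :=
  ∑ k : Fin 2, (-1 : ℂ) ^ (((i : ℕ) + k) * ((k : ℕ) + j)) • (X i k * Y k j)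

theorem rho_sign (q : ℂ) (α β : P) (a b c d : Fin 2) (m n : ℕ)
    (h : Even ((a : ℕ) + b + c + d) → (Even m ↔ Even n)) :
    (-1 : ℂ) ^ m • rho q α β a b c d = (-1 : ℂ) ^ n • rho q α β a b c d := by
  by_cases he : Even ((a : ℕ) + b + c + d)
  · have := h he
    congr 1
    by_cases hm : Even m
    · rw [hm.neg_one_pow, (this.1 hm).neg_one_pow]
    · rw [(Nat.not_even_iff_odd.1 hm).neg_one_pow,
        (Nat.not_even_iff_odd.1 (fun hn => hm (this.2 hn))).neg_one_pow]
  · have : rho q α β a b c d = 0 := by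
      revert he
      fin_cases a <;> fin_cases b <;> fin_cases c <;> fin_cases d <;>
        simp +decide [rho, rZ, rW]
    rw [this, smul_zero, smul_zero]

theorem rho_sign_mul (q : ℂ) (α β : P) (a b c d : Fin 2) (m n : ℕ) (x : P)
    (h : Even ((a : ℕ) + b + c + d) → (Even m ↔ Even n)) :
    (-1 : ℂ) ^ m • (rho q α β a b c d * x) = (-1 : ℂ) ^ n • (rho q α β a b c d * x) := by
  rw [← smul_mul_assoc, rho_sign q α β a b c d m n h, smul_mul_assoc]

theorem rtt_superMul (q : ℂ) (α β : P) (hα : ∀ x, α * x = x * α) (hβ : ∀ x, β * x = x * β)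
    (X₁ X₂ Y₁ Y₂ : Fin 2 → Fin 2 → P)
    (h₁ : rttLeft q α β X₁ Y₁ = rttRight q α β X₁ Y₁)
    (h₂ : rttLeft q α β X₂ Y₂ = rttRight q α β X₂ Y₂)
    (hXY : ∀ i j k l : Fin 2, X₂ i j * Y₁ k l =
      (-1 : ℂ) ^ (((i : ℕ) + j) * ((k : ℕ) + l)) • (Y₁ k l * X₂ i j))
    (hYX : ∀ i j k l : Fin 2, Y₂ i j * X₁ k l =
      (-1 : ℂ) ^ (((i : ℕ) + j) * ((k : ℕ) + l)) • (X₁ k l * Y₂ i j)) :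
    rttLeft q α β (superMul X₁ X₂) (superMul Y₁ Y₂) = rttRight q α β (superMul X₁ X₂) (superMul Y₁ Y₂) := by
  have hρ : ∀ a b c d x, rho q α β a b c d * x = x * rho q α β a b c d := by
    intro a b c d x
    simp only [rho, add_mul, mul_add, smul_mul_assoc, mul_smul_comm, hα, hβ]
  have comm4 : ∀ f : Fin 2 → Fin 2 → Fin 2 → Fin 2 → P,
      ∑ b, ∑ d, ∑ k, ∑ k', f b d k k' = ∑ k, ∑ k', ∑ b, ∑ d, f b d k k' := by
    intro f
    simp only [Fin.sum_univ_two]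
    abel
  funext a j c l
  let τ : Fin 2 → Fin 2 → ℕ := fun k k' => (a + j) * (c + l) + (a + k) * (k + j) +
    (c + k') * (k' + l) + (k + j) * (c + k') + (a + k) * (c + k')
  let τ' : Fin 2 → Fin 2 → ℕ := fun e f => τ e f + (e + j) * (f + l)
  have e1 : rttLeft q α β (superMul X₁ X₂) (superMul Y₁ Y₂) a j c l =
      ∑ k : Fin 2, ∑ k' : Fin 2, (-1 : ℂ) ^ (τ k k') •
        (rttLeft q α β X₁ Y₁ a k c k' * (X₂ k j * Y₂ k' l)) := by
    simp only [rttLeft, superMul, Finset.mul_sum, Finset.sum_mul,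
      Finset.smul_sum]
    conv_rhs => rw [← comm4]
    refine Finset.sum_congr rfl fun b _ => Finset.sum_congr rfl fun d _ => ?_
    rw [Finset.sum_comm]
    refine Finset.sum_congr rfl fun k _ => Finset.sum_congr rfl fun k' _ => ?_
    have key : X₁ b k * X₂ k j * (Y₁ d k' * Y₂ k' l) =
        (-1 : ℂ) ^ (((k : ℕ) + j) * ((d : ℕ) + k')) • (X₁ b k * Y₁ d k' * (X₂ k j * Y₂ k' l)) := by
      rw [mul_assoc, ← mul_assoc (X₂ k j), hXY]
      simp only [smul_mul_assoc, mul_smul_comm, mul_assoc]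
    simp only [smul_mul_assoc, mul_smul_comm, key, smul_smul, ← pow_add]
    rw [mul_assoc (rho q α β a b c d)]
    apply rho_sign_mul
    simp only [τ', τ, Nat.even_add, Nat.even_mul]
    grind
  have e2 : ∑ k : Fin 2, ∑ k' : Fin 2, (-1 : ℂ) ^ (τ k k') •
        (rttRight q α β X₁ Y₁ a k c k' * (X₂ k j * Y₂ k' l)) =
      ∑ e : Fin 2, ∑ f : Fin 2, (-1 : ℂ) ^ (τ' e f) •
        (Y₁ c f * X₁ a e * rttLeft q α β X₂ Y₂ e j f l) := by
    simp only [rttLeft, rttRight, Finset.mul_sum, Finset.sum_mul, Finset.smul_sum]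
    rw [comm4]
    refine Finset.sum_congr rfl fun e _ => Finset.sum_congr rfl fun f _ => ?_
    refine Finset.sum_congr rfl fun k _ => Finset.sum_congr rfl fun k' _ => ?_
    simp only [smul_mul_assoc, mul_smul_comm, smul_smul, ← pow_add]
    have key : Y₁ c f * X₁ a e * (rho q α β e k f k' * (X₂ k j * Y₂ k' l)) =
        rho q α β e k f k' * (Y₁ c f * X₁ a e) * (X₂ k j * Y₂ k' l) := by
      rw [← mul_assoc, ← hρ]
    rw [key, ← hρ, mul_assoc (rho q α β e k f k')]
    apply rho_sign_mul
    simp only [τ', τ, Nat.even_add, Nat.even_mul]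
    grind
  have e3 : ∑ e : Fin 2, ∑ f : Fin 2, (-1 : ℂ) ^ (τ' e f) •
        (Y₁ c f * X₁ a e * rttRight q α β X₂ Y₂ e j f l) =
      rttRight q α β (superMul X₁ X₂) (superMul Y₁ Y₂) a j c l := by
    simp only [rttRight, superMul, Finset.mul_sum, Finset.sum_mul,
      Finset.smul_sum]
    conv_rhs => rw [comm4]
    refine Finset.sum_congr rfl fun e _ => Finset.sum_congr rfl fun f _ => ?_
    refine Finset.sum_congr rfl fun g _ => Finset.sum_congr rfl fun h _ => ?_
    have key : Y₁ c f * Y₂ f h * (X₁ a e * X₂ e g) =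
        (-1 : ℂ) ^ (((f : ℕ) + h) * ((a : ℕ) + e)) • (Y₁ c f * X₁ a e * (Y₂ f h * X₂ e g)) := by
      rw [mul_assoc, ← mul_assoc (Y₂ f h), hYX]
      simp only [smul_mul_assoc, mul_smul_comm, mul_assoc]
    simp only [smul_mul_assoc, mul_smul_comm, key, smul_smul, ← pow_add]
    rw [← mul_assoc, ← hρ]
    apply rho_sign_mul
    simp only [τ', τ, Nat.even_add, Nat.even_mul]
    grind
  rw [e1, h₁, e2, h₂, e3]

end RTT

section Series

variable {M M' : Type*} [Ring M] [Algebra ℂ M] [Ring M'] [Algebra ℂ M']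

/-- A one-variable series, seen as a two-variable series in the first variable. -/
def inFst (f : M⟦X⟧) : M⟦X⟧⟦X⟧ := PowerSeries.C f

/-- A one-variable series, seen as a two-variable series in the second variable. -/
def inSnd (f : M⟦X⟧) : M⟦X⟧⟦X⟧ := PowerSeries.map PowerSeries.C f

/-- The first of the two commuting variables. -/
def var₁ : M⟦X⟧⟦X⟧ := PowerSeries.C PowerSeries.X

/-- The second of the two commuting variables. -/
def var₂ : M⟦X⟧⟦X⟧ := PowerSeries.X

/-- The defining relations of `U`, for families `s i j n`, `t i j n` in an algebra. A series in
`z⁻¹, w⁻¹` (relation `tt`), in `z, w` (relation `ss`), in `z⁻¹, w` (relation `ts`) is a series in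
`var₁, var₂`. The matrix `R(z,w)` is multiplied by `z⁻¹ w⁻¹` in the first case and by `z⁻¹` in
the third case, to become polynomial in these variables. -/
structure IsRTT (q : ℂ) (s t : Fin 2 → Fin 2 → ℕ → M) : Prop where
  tt : rttLeft q var₂ var₁ (fun i j => inFst (.mk (t i j))) (fun i j => inSnd (.mk (t i j))) =
    rttRight q var₂ var₁ (fun i j => inFst (.mk (t i j))) (fun i j => inSnd (.mk (t i j)))
  ss : rttLeft q var₁ var₂ (fun i j => inFst (.mk (s i j))) (fun i j => inSnd (.mk (s i j))) =
    rttRight q var₁ var₂ (fun i j => inFst (.mk (s i j))) (fun i j => inSnd (.mk (s i j)))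
  ts : rttLeft q 1 (var₁ * var₂) (fun i j => inFst (.mk (t i j))) (fun i j => inSnd (.mk (s i j))) =
    rttRight q 1 (var₁ * var₂) (fun i j => inFst (.mk (t i j))) (fun i j => inSnd (.mk (s i j)))
  t_zero : t 0 1 0 = 0
  s_zero : s 1 0 0 = 0
  t_mul_s : ∀ i, t i i 0 * s i i 0 = 1
  s_mul_t : ∀ i, s i i 0 * t i i 0 = 1

theorem map_rttLeft (q : ℂ) (f : M →ₐ[ℂ] M') (α β : M) (X Y : Fin 2 → Fin 2 → M)
    (a j c l : Fin 2) :
    f (rttLeft q α β X Y a j c l) =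
      rttLeft q (f α) (f β) (fun i j => f (X i j)) (fun i j => f (Y i j)) a j c l := by
  simp [rttLeft, rho]

theorem map_rttRight (q : ℂ) (f : M →ₐ[ℂ] M') (α β : M) (X Y : Fin 2 → Fin 2 → M)
    (a j c l : Fin 2) :
    f (rttRight q α β X Y a j c l) =
      rttRight q (f α) (f β) (fun i j => f (X i j)) (fun i j => f (Y i j)) a j c l := by
  simp [rttRight, rho]

/-- An algebra homomorphism, applied to all coefficients. -/
def map₂ (f : M →ₐ[ℂ] M') : M⟦X⟧⟦X⟧ →ₐ[ℂ] M'⟦X⟧⟦X⟧ :=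
  PowerSeries.mapAlgHom (PowerSeries.mapAlgHom f)

theorem coeff_map₂ (f : M →ₐ[ℂ] M') (x : M⟦X⟧⟦X⟧) (m n : ℕ) :
    (PowerSeries.coeff m) (PowerSeries.coeff n (map₂ f x)) =
      f (PowerSeries.coeff m (PowerSeries.coeff n x)) := by
  simp [map₂, PowerSeries.mapAlgHom_apply]

theorem map₂_var₁ (f : M →ₐ[ℂ] M') : map₂ f var₁ = var₁ := by
  simp [map₂, PowerSeries.mapAlgHom_apply, var₁]

theorem map₂_var₂ (f : M →ₐ[ℂ] M') : map₂ f var₂ = var₂ := by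
  simp [map₂, PowerSeries.mapAlgHom_apply, var₂]

theorem map₂_inFst (f : M →ₐ[ℂ] M') (x : ℕ → M) :
    map₂ f (inFst (.mk x)) = inFst (.mk fun n => f (x n)) := by
  ext m n
  simp [map₂, PowerSeries.mapAlgHom_apply, inFst, PowerSeries.coeff_C]
  split_ifs <;> simp

theorem map₂_inSnd (f : M →ₐ[ℂ] M') (x : ℕ → M) :
    map₂ f (inSnd (.mk x)) = inSnd (.mk fun n => f (x n)) := by
  ext m n
  simp [map₂, PowerSeries.mapAlgHom_apply, inSnd, PowerSeries.coeff_C]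

theorem var₁_mul (x : M⟦X⟧⟦X⟧) : var₁ * x = x * var₁ := by
  ext m n : 2
  simp [var₁, PowerSeries.X_mul]

theorem var₂_mul (x : M⟦X⟧⟦X⟧) : var₂ * x = x * var₂ := PowerSeries.X_mul


theorem coeff_inFst_mul_inSnd (f g : M⟦X⟧) (m n : ℕ) :
    PowerSeries.coeff m (PowerSeries.coeff n (inFst f * inSnd g)) =
      PowerSeries.coeff m f * PowerSeries.coeff n g := by
  simp [inFst, inSnd]

theorem coeff_inSnd_mul_inFst (f g : M⟦X⟧) (m n : ℕ) :
    PowerSeries.coeff m (PowerSeries.coeff n (inSnd g * inFst f)) =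
      PowerSeries.coeff n g * PowerSeries.coeff m f := by
  simp [inFst, inSnd]

theorem coeff_smul_two (r : ℂ) (x : M⟦X⟧⟦X⟧) (m n : ℕ) :
    PowerSeries.coeff m (PowerSeries.coeff n (r • x)) =
      r • PowerSeries.coeff m (PowerSeries.coeff n x) := by
  rfl

theorem inFst_smul (r : ℂ) (x : M⟦X⟧) : inFst (r • x) = r • inFst x := by
  ext n m
  simp only [inFst, PowerSeries.coeff_C, PowerSeries.coeff_smul]
  split_ifs <;> simp

theorem inSnd_smul (r : ℂ) (x : M⟦X⟧) : inSnd (r • x) = r • inSnd x := by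
  ext n m
  simp only [inSnd, PowerSeries.coeff_C, PowerSeries.coeff_map, PowerSeries.coeff_smul]
  split_ifs <;> simp

theorem IsRTT.map {q : ℂ} {s t : Fin 2 → Fin 2 → ℕ → M} (h : IsRTT q s t) (f : M →ₐ[ℂ] M') :
    IsRTT q (fun i j n => f (s i j n)) (fun i j n => f (t i j n)) where
  tt := by
    funext a j c l
    have := congrArg (map₂ f) (congrFun (congrFun (congrFun (congrFun h.tt a) j) c) l)
    simpa only [map_rttLeft, map_rttRight, map₂_inFst, map₂_inSnd, map₂_var₁, map₂_var₂] using this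
  ss := by
    funext a j c l
    have := congrArg (map₂ f) (congrFun (congrFun (congrFun (congrFun h.ss a) j) c) l)
    simpa only [map_rttLeft, map_rttRight, map₂_inFst, map₂_inSnd, map₂_var₁, map₂_var₂] using this
  ts := by
    funext a j c l
    have := congrArg (map₂ f) (congrFun (congrFun (congrFun (congrFun h.ts a) j) c) l)
    simpa only [map_rttLeft, map_rttRight, map₂_inFst, map₂_inSnd, map₂_var₁, map₂_var₂,
      map_mul, map_one] using this
  t_zero := by rw [h.t_zero, map_zero]
  s_zero := by rw [h.s_zero, map_zero]
  t_mul_s i := by rw [← map_mul, h.t_mul_s, map_one]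
  s_mul_t i := by rw [← map_mul, h.s_mul_t, map_one]

theorem rttLeft_sign (q : ℂ) (α β : M) (X Y : Fin 2 → Fin 2 → M) (a j c l : Fin 2) :
    rttLeft q α β (fun i j => (-1 : ℂ) ^ ((i : ℕ) + j) • X i j)
      (fun i j => (-1 : ℂ) ^ ((i : ℕ) + j) • Y i j) a j c l =
    (-1 : ℂ) ^ ((a : ℕ) + j + (c + l)) • rttLeft q α β X Y a j c l := by
  simp only [rttLeft, Finset.smul_sum]
  refine Finset.sum_congr rfl fun b _ => Finset.sum_congr rfl fun d _ => ?_
  simp only [smul_mul_assoc, mul_smul_comm, smul_smul, ← pow_add]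
  apply rho_sign_mul
  simp only [Nat.even_add, Nat.even_mul]
  grind

theorem rttRight_sign (q : ℂ) (α β : M) (X Y : Fin 2 → Fin 2 → M) (a j c l : Fin 2) :
    rttRight q α β (fun i j => (-1 : ℂ) ^ ((i : ℕ) + j) • X i j)
      (fun i j => (-1 : ℂ) ^ ((i : ℕ) + j) • Y i j) a j c l =
    (-1 : ℂ) ^ ((a : ℕ) + j + (c + l)) • rttRight q α β X Y a j c l := by
  simp only [rttRight, Finset.smul_sum]
  refine Finset.sum_congr rfl fun b _ => Finset.sum_congr rfl fun d _ => ?_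
  simp only [smul_mul_assoc, mul_smul_comm, smul_smul, ← pow_add]
  rw [← mul_smul_comm, ← mul_smul_comm]
  congr 1
  apply rho_sign
  simp only [Nat.even_add, Nat.even_mul]
  grind

theorem mk_smul' (r : ℂ) (x : ℕ → M) :
    (PowerSeries.mk fun n => r • x n) = r • PowerSeries.mk x := by
  ext n; simp

theorem IsRTT.sign {q : ℂ} {s t : Fin 2 → Fin 2 → ℕ → M} (h : IsRTT q s t) :
    IsRTT q (fun i j n => (-1 : ℂ) ^ ((i : ℕ) + j) • s i j n)
      (fun i j n => (-1 : ℂ) ^ ((i : ℕ) + j) • t i j n) where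
  tt := by
    funext a j c l
    simp only [mk_smul', inFst_smul, inSnd_smul]
    rw [rttLeft_sign, rttRight_sign, h.tt]
  ss := by
    funext a j c l
    simp only [mk_smul', inFst_smul, inSnd_smul]
    rw [rttLeft_sign, rttRight_sign, h.ss]
  ts := by
    funext a j c l
    simp only [mk_smul', inFst_smul, inSnd_smul]
    rw [rttLeft_sign, rttRight_sign, h.ts]
  t_zero := by rw [h.t_zero, smul_zero]
  s_zero := by rw [h.s_zero, smul_zero]
  t_mul_s i := by simp [← two_mul, pow_mul, h.t_mul_s]
  s_mul_t i := by simp [← two_mul, pow_mul, h.s_mul_t]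

theorem isRTT_counit (q : ℂ) :
    IsRTT q (M := ℂ) (fun i j n => if i = j ∧ n = 0 then 1 else 0)
      (fun i j n => if i = j ∧ n = 0 then 1 else 0) := by
  have hF : ∀ i j : Fin 2, inFst (.mk fun n => if i = j ∧ n = 0 then (1 : ℂ) else 0) =
      if i = j then 1 else 0 := by
    intro i j
    ext m n
    by_cases h : i = j <;> by_cases hm : m = 0 <;> by_cases hn : n = 0 <;>
      simp [inFst, PowerSeries.coeff_C, PowerSeries.coeff_one, h, hm, hn]
  have hS : ∀ i j : Fin 2, inSnd (.mk fun n => if i = j ∧ n = 0 then (1 : ℂ) else 0) =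
      if i = j then 1 else 0 := by
    intro i j
    ext m n
    by_cases h : i = j <;> by_cases hm : m = 0 <;> by_cases hn : n = 0 <;>
      simp [inSnd, PowerSeries.coeff_C, PowerSeries.coeff_one, h, hm, hn]
  have key : ∀ α β : ℂ⟦X⟧⟦X⟧, rttLeft q α β (fun i j => if i = j then 1 else 0)
      (fun i j => if i = j then 1 else 0) = rttRight q α β (fun i j => if i = j then 1 else 0)
      (fun i j => if i = j then 1 else 0) := by
    intro α β
    funext a j c l
    simp [rttLeft, rttRight, ← two_mul, pow_mul]
  constructor
  · simp only [hF, hS, key]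
  · simp only [hF, hS, key]
  · simp only [hF, hS, key]
  all_goals simp

end Series

/-- The generator `s_{ij}^{(n)}` of the free algebra. -/
def genS (i j : Fin 2) (n : ℕ) : FreeAlgebra ℂ Gen := FreeAlgebra.ι ℂ (.s i j n)

/-- The generator `t_{ij}^{(n)}` of the free algebra. -/
def genT (i j : Fin 2) (n : ℕ) : FreeAlgebra ℂ Gen := FreeAlgebra.ι ℂ (.t i j n)

/-- The defining relations of `U`: the relations of `IsRTT`, coefficient by coefficient. -/
inductive Rel (q : ℂ) : FreeAlgebra ℂ Gen → FreeAlgebra ℂ Gen → Prop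
  | tt (a j c l : Fin 2) (m n : ℕ) : Rel q
      (PowerSeries.coeff m (PowerSeries.coeff n (rttLeft q var₂ var₁
        (fun i j => inFst (.mk (genT i j)))
        (fun i j => inSnd (.mk (genT i j))) a j c l)))
      (PowerSeries.coeff m (PowerSeries.coeff n (rttRight q var₂ var₁
        (fun i j => inFst (.mk (genT i j)))
        (fun i j => inSnd (.mk (genT i j))) a j c l)))
  | ss (a j c l : Fin 2) (m n : ℕ) : Rel q
      (PowerSeries.coeff m (PowerSeries.coeff n (rttLeft q var₁ var₂
        (fun i j => inFst (.mk (genS i j)))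
        (fun i j => inSnd (.mk (genS i j))) a j c l)))
      (PowerSeries.coeff m (PowerSeries.coeff n (rttRight q var₁ var₂
        (fun i j => inFst (.mk (genS i j)))
        (fun i j => inSnd (.mk (genS i j))) a j c l)))
  | ts (a j c l : Fin 2) (m n : ℕ) : Rel q
      (PowerSeries.coeff m (PowerSeries.coeff n (rttLeft q 1 (var₁ * var₂)
        (fun i j => inFst (.mk (genT i j)))
        (fun i j => inSnd (.mk (genS i j))) a j c l)))
      (PowerSeries.coeff m (PowerSeries.coeff n (rttRight q 1 (var₁ * var₂)
        (fun i j => inFst (.mk (genT i j)))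
        (fun i j => inSnd (.mk (genS i j))) a j c l)))
  | t_zero : Rel q (genT 0 1 0) 0
  | s_zero : Rel q (genS 1 0 0) 0
  | t_mul_s (i : Fin 2) : Rel q (genT i i 0 * genS i i 0) 1
  | s_mul_t (i : Fin 2) : Rel q (genS i i 0 * genT i i 0) 1

/-- The quantum affine superalgebra `U = U_q(gl(1,1)^)`, defined by the RTT presentation. -/
def Uq (q : ℂ) : Type := RingQuot (Rel q)

instance (q : ℂ) : Ring (Uq q) := inferInstanceAs (Ring (RingQuot (Rel q)))

instance (q : ℂ) : Algebra ℂ (Uq q) := inferInstanceAs (Algebra ℂ (RingQuot (Rel q)))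

namespace Uq

variable (q : ℂ)

/-- The projection from the free algebra. -/
def mk : FreeAlgebra ℂ Gen →ₐ[ℂ] Uq q := RingQuot.mkAlgHom ℂ (Rel q)

/-- `s_{ij}^{(n)}` in `U`. -/
def s (i j : Fin 2) (n : ℕ) : Uq q := mk q (genS i j n)

/-- `t_{ij}^{(n)}` in `U`. -/
def t (i j : Fin 2) (n : ℕ) : Uq q := mk q (genT i j n)

theorem isRTT : IsRTT q (s q) (t q) := by
  have hrel : ∀ {x y}, Rel q x y → mk q x = mk q y := fun h => RingQuot.mkAlgHom_rel ℂ h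
  have hs : ∀ i j, s q i j = fun n => mk q (genS i j n) := fun i j => rfl
  have ht : ∀ i j, t q i j = fun n => mk q (genT i j n) := fun i j => rfl
  constructor
  · funext a j c l
    ext n m
    have := hrel (.tt a j c l m n)
    rw [← coeff_map₂, ← coeff_map₂] at this
    simpa only [map_rttLeft, map_rttRight, map₂_inFst, map₂_inSnd, map₂_var₁, map₂_var₂,
      hs, ht] using this
  · funext a j c l
    ext n m
    have := hrel (.ss a j c l m n)
    rw [← coeff_map₂, ← coeff_map₂] at this
    simpa only [map_rttLeft, map_rttRight, map₂_inFst, map₂_inSnd, map₂_var₁, map₂_var₂,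
      hs, ht] using this
  · funext a j c l
    ext n m
    have := hrel (.ts a j c l m n)
    rw [← coeff_map₂, ← coeff_map₂] at this
    simpa only [map_rttLeft, map_rttRight, map₂_inFst, map₂_inSnd, map₂_var₁, map₂_var₂,
      map_mul, map_one, hs, ht] using this
  · exact (hrel .t_zero).trans (map_zero _)
  · exact (hrel .s_zero).trans (map_zero _)
  · intro i
    exact (map_mul _ _ _).symm.trans ((hrel (.t_mul_s i)).trans (map_one _))
  · intro i
    exact (map_mul _ _ _).symm.trans ((hrel (.s_mul_t i)).trans (map_one _))

variable {q} {M : Type*} [Ring M] [Algebra ℂ M]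

/-- The universal property of `U`. -/
def lift {s t : Fin 2 → Fin 2 → ℕ → M} (h : IsRTT q s t) : Uq q →ₐ[ℂ] M :=
  RingQuot.liftAlgHom ℂ ⟨FreeAlgebra.lift ℂ fun
    | .s i j n => s i j n
    | .t i j n => t i j n, by
    intro x y hxy
    cases hxy with
    | tt a j c l m n =>
      have := h.tt
      rw [← coeff_map₂, ← coeff_map₂]
      simp only [map_rttLeft, map_rttRight, map₂_inFst, map₂_inSnd, map₂_var₁, map₂_var₂,
        genS, genT, FreeAlgebra.lift_ι_apply]
      rw [this]
    | ss a j c l m n =>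
      have := h.ss
      rw [← coeff_map₂, ← coeff_map₂]
      simp only [map_rttLeft, map_rttRight, map₂_inFst, map₂_inSnd, map₂_var₁, map₂_var₂,
        genS, genT, FreeAlgebra.lift_ι_apply]
      rw [this]
    | ts a j c l m n =>
      have := h.ts
      rw [← coeff_map₂, ← coeff_map₂]
      simp only [map_rttLeft, map_rttRight, map₂_inFst, map₂_inSnd, map₂_var₁, map₂_var₂,
        map_mul, map_one, genS, genT, FreeAlgebra.lift_ι_apply]
      rw [this]
    | t_zero => simp [genS, genT, h.t_zero]
    | s_zero => simp [genS, genT, h.s_zero]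
    | t_mul_s i => simp [genS, genT, h.t_mul_s]
    | s_mul_t i => simp [genS, genT, h.s_mul_t]⟩

@[simp]
theorem lift_s {s' t' : Fin 2 → Fin 2 → ℕ → M} (h : IsRTT q s' t') (i j : Fin 2) (n : ℕ) :
    lift h (s q i j n) = s' i j n := by
  exact (RingQuot.liftAlgHom_mkAlgHom_apply _ _ _ _).trans (by simp [genS])

@[simp]
theorem lift_t {s' t' : Fin 2 → Fin 2 → ℕ → M} (h : IsRTT q s' t') (i j : Fin 2) (n : ℕ) :
    lift h (t q i j n) = t' i j n := by
  exact (RingQuot.liftAlgHom_mkAlgHom_apply _ _ _ _).trans (by simp [genT])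

theorem hom_ext {f g : Uq q →ₐ[ℂ] M} (hs : ∀ i j n, f (s q i j n) = g (s q i j n))
    (ht : ∀ i j n, f (t q i j n) = g (t q i j n)) : f = g := by
  apply RingQuot.ringQuot_ext'
  apply FreeAlgebra.hom_ext
  funext x
  cases x with
  | s i j n => exact hs i j n
  | t i j n => exact ht i j n

variable (q)

/-- The parity automorphism `x ↦ (-1)^{|x|} x`, given on generators by `|s_{ij}^{(n)}| = |t_{ij}^{(n)}| = |i| + |j|`. -/
def parity : Uq q →ₐ[ℂ] Uq q := lift (isRTT q).sign

theorem parity_s (i j : Fin 2) (n : ℕ) :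
    parity q (s q i j n) = (-1 : ℂ) ^ ((i : ℕ) + j) • s q i j n := lift_s _ i j n

theorem parity_t (i j : Fin 2) (n : ℕ) :
    parity q (t q i j n) = (-1 : ℂ) ^ ((i : ℕ) + j) • t q i j n := lift_t _ i j n

theorem parity_parity (x : Uq q) : parity q (parity q x) = x := by
  have : (parity q).comp (parity q) = AlgHom.id ℂ (Uq q) := by
    apply hom_ext
    · intro i j n
      simp [parity_s, smul_smul, ← mul_pow]
    · intro i j n
      simp [parity_t, smul_smul, ← mul_pow]
  exact congrArg (fun f : Uq q →ₐ[ℂ] Uq q => f x) this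

/-- The elements of `U` of parity `i`. -/
def homog (i : ZMod 2) : Submodule ℂ (Uq q) where
  carrier := {x | parity q x = (-1 : ℂ) ^ i.val • x}
  add_mem' {x y} hx hy := by
    simp only [Set.mem_ofPred_eq] at hx hy ⊢
    rw [map_add, hx, hy, smul_add]
  zero_mem' := by simp
  smul_mem' c x hx := by
    simp only [Set.mem_ofPred_eq] at hx ⊢
    rw [map_smul, hx, smul_comm]

theorem mem_homog {i : ZMod 2} {x : Uq q} :
    x ∈ homog q i ↔ parity q x = (-1 : ℂ) ^ i.val • x := Iff.rfl

theorem neg_one_pow_val_add (i j : ZMod 2) :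
    (-1 : ℂ) ^ (i + j).val = (-1 : ℂ) ^ i.val * (-1 : ℂ) ^ j.val := by
  rw [ZMod.val_add, ← pow_add, neg_one_pow_eq_pow_mod_two (R := ℂ) (i.val + j.val)]

instance : SetLike.GradedMonoid (homog q) where
  one_mem := by simp [mem_homog]
  mul_mem i j x y hx hy := by
    rw [mem_homog] at hx hy ⊢
    rw [map_mul, hx, hy, neg_one_pow_val_add, smul_mul_smul_comm]

/-- The even component of an element. -/
def evenPart (x : Uq q) : homog q 0 := ⟨(2⁻¹ : ℂ) • (x + parity q x), by
  rw [mem_homog, map_smul, map_add, parity_parity, add_comm x]; simp⟩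

/-- The odd component of an element. -/
def oddPart (x : Uq q) : homog q 1 := ⟨(2⁻¹ : ℂ) • (x - parity q x), by
  rw [mem_homog, map_smul, map_sub, parity_parity]
  have : (1 : ZMod 2).val = 1 := rfl
  rw [this, pow_one, neg_one_smul, ← smul_neg, neg_sub]⟩

theorem evenPart_add_oddPart (x : Uq q) : (evenPart q x : Uq q) + oddPart q x = x := by
  simp only [evenPart, oddPart, ← smul_add]
  rw [add_add_sub_cancel, ← two_smul ℂ, smul_smul]
  norm_num

theorem zmod_two_cases (i : ZMod 2) : i = 0 ∨ i = 1 := by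
  revert i; decide

instance : GradedAlgebra (homog q) where
  decompose' x := DirectSum.of (fun i => homog q i) 0 (evenPart q x) +
    DirectSum.of (fun i => homog q i) 1 (oddPart q x)
  left_inv x := by
    simp [evenPart_add_oddPart]
  right_inv x := by
    induction x using DirectSum.induction_on with
    | zero =>
      have h0 : evenPart q 0 = 0 := by ext; simp [evenPart]
      have h1 : oddPart q 0 = 0 := by ext; simp [oddPart]
      simp [h0, h1]
    | add x y hx hy =>
      have h0 : ∀ x y, evenPart q (x + y) = evenPart q x + evenPart q y := by
        intro x y; ext; simp [evenPart]; abel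
      have h1 : ∀ x y, oddPart q (x + y) = oddPart q x + oddPart q y := by
        intro x y; ext; simp [oddPart, ← smul_add]; abel
      simp only [map_add, h0, h1] at hx hy ⊢
      rw [add_add_add_comm, hx, hy]
    | of i x =>
      have hx := (mem_homog q).1 x.2
      rw [DirectSum.coeAddMonoidHom_of]
      rcases zmod_two_cases i with rfl | rfl
      · have h0 : evenPart q (x : Uq q) = x := by
          ext
          simp only [evenPart]
          rw [hx, ZMod.val_zero, pow_zero, one_smul, ← two_smul ℂ, smul_smul]
          norm_num
        have h1 : oddPart q (x : Uq q) = 0 := by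
          ext
          simp only [oddPart]
          rw [hx, ZMod.val_zero, pow_zero, one_smul, sub_self, smul_zero]
          rfl
        simp only [h0, h1, map_zero, add_zero]
      · have hv : (1 : ZMod 2).val = 1 := rfl
        have h0 : evenPart q (x : Uq q) = 0 := by
          ext
          simp only [evenPart]
          rw [hx, hv, pow_one, neg_one_smul, add_neg_cancel, smul_zero]
          rfl
        have h1 : oddPart q (x : Uq q) = x := by
          ext
          simp only [oddPart]
          rw [hx, hv, pow_one, neg_one_smul, sub_neg_eq_add, ← two_smul ℂ, smul_smul]
          norm_num
        simp only [h0, h1, map_zero, zero_add]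

theorem s_mem (i j : Fin 2) (n : ℕ) : s q i j n ∈ homog q ((((i : ℕ) + j : ℕ)) : ZMod 2) := by
  rw [mem_homog, parity_s, ZMod.val_natCast, ← neg_one_pow_eq_pow_mod_two]

theorem t_mem (i j : Fin 2) (n : ℕ) : t q i j n ∈ homog q ((((i : ℕ) + j : ℕ)) : ZMod 2) := by
  rw [mem_homog, parity_t, ZMod.val_natCast, ← neg_one_pow_eq_pow_mod_two]

/-- The super tensor product `U ⊗ U`, with `(x ⊗ y)(x' ⊗ y') = (-1)^{|y||x'|} xx' ⊗ yy'`. -/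
abbrev UU : Type := homog q ᵍ⊗[ℂ] homog q

open GradedTensorProduct in
theorem tmul_mul_tmul {m n : ℕ} {x y x' y' : Uq q} (hy : y ∈ homog q (m : ZMod 2))
    (hx' : x' ∈ homog q (n : ZMod 2)) :
    (x ᵍ⊗ₜ[ℂ] y * x' ᵍ⊗ₜ[ℂ] y' : UU q) = (-1 : ℂ) ^ (m * n) • ((x * x') ᵍ⊗ₜ[ℂ] (y * y')) := by
  have := tmul_coe_mul_coe_tmul (R := ℂ) (homog q) (homog q) x ⟨y, hy⟩ ⟨x', hx'⟩ y'
  rw [this, ← Nat.cast_mul, uzpow_natCast]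
  rcases neg_one_pow_eq_or ℤˣ (m * n) with h | h
  · have h2 : (-1 : ℂ) ^ (m * n) = 1 := by
      have := congrArg (fun u : ℤˣ => ((u : ℤ) : ℂ)) h
      simpa using this
    rw [h, h2, one_smul, one_smul]
  · have h2 : (-1 : ℂ) ^ (m * n) = -1 := by
      have := congrArg (fun u : ℤˣ => ((u : ℤ) : ℂ)) h
      simpa using this
    rw [h, h2, Units.neg_smul, one_smul, neg_one_smul]

open GradedTensorProduct in
/-- The coefficient of index `n` of `∑ₖ ε(i,j,k) x_{ik}(z) ⊗ x_{kj}(z)`. -/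
def comulFam (x : Fin 2 → Fin 2 → ℕ → Uq q) (i j : Fin 2) (n : ℕ) : UU q :=
  ∑ k : Fin 2, (-1 : ℂ) ^ (((i : ℕ) + k) * ((k : ℕ) + j)) •
    ∑ p ∈ Finset.HasAntidiagonal.antidiagonal n, (x i k p.1) ᵍ⊗ₜ[ℂ] (x k j p.2)

open GradedTensorProduct

theorem tmul_eq (x y : Uq q) :
    (x ᵍ⊗ₜ[ℂ] y : UU q) = includeLeft (homog q) (homog q) x * includeRight (homog q) (homog q) y := by
  have h1 : (1 : Uq q) ∈ homog q ((0 : ℕ) : ZMod 2) := by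
    simpa using SetLike.GradedOne.one_mem (A := homog q)
  have := tmul_mul_tmul q (x := x) (y' := y) h1 h1
  simpa using this.symm

theorem tmul_zero' (x : Uq q) : (x ᵍ⊗ₜ[ℂ] (0 : Uq q) : UU q) = 0 := by
  rw [tmul_eq, map_zero, mul_zero]

theorem zero_tmul' (x : Uq q) : ((0 : Uq q) ᵍ⊗ₜ[ℂ] x : UU q) = 0 := by
  rw [tmul_eq, map_zero, zero_mul]

theorem mk_comulFam (x : Fin 2 → Fin 2 → ℕ → Uq q) (i j : Fin 2) :
    PowerSeries.mk (comulFam q x i j) =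
      superMul (fun i j => .mk fun n => includeLeft (homog q) (homog q) (x i j n))
        (fun i j => .mk fun n => includeRight (homog q) (homog q) (x i j n)) i j := by
  ext n
  simp only [superMul, map_sum, PowerSeries.coeff_mk, PowerSeries.coeff_smul, PowerSeries.coeff_mul,
    comulFam, tmul_eq]

theorem inFst_superMul {M : Type*} [Ring M] [Algebra ℂ M] (X Y : Fin 2 → Fin 2 → M⟦X⟧) (i j : Fin 2) :
    inFst (superMul X Y i j) = superMul (fun i j => inFst (X i j)) (fun i j => inFst (Y i j)) i j := by
  have h1 : ∀ x y : M⟦X⟧, inFst (x + y) = inFst x + inFst y := fun x y => map_add _ x y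
  have h2 : ∀ x y : M⟦X⟧, inFst (x * y) = inFst x * inFst y := fun x y => map_mul _ x y
  simp only [superMul, Fin.sum_univ_two, h1, h2, inFst_smul]

theorem inSnd_superMul {M : Type*} [Ring M] [Algebra ℂ M] (X Y : Fin 2 → Fin 2 → M⟦X⟧) (i j : Fin 2) :
    inSnd (superMul X Y i j) = superMul (fun i j => inSnd (X i j)) (fun i j => inSnd (Y i j)) i j := by
  have h1 : ∀ x y : M⟦X⟧, inSnd (x + y) = inSnd x + inSnd y := fun x y => map_add _ x y
  have h2 : ∀ x y : M⟦X⟧, inSnd (x * y) = inSnd x * inSnd y := fun x y => map_mul _ x y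
  simp only [superMul, Fin.sum_univ_two, h1, h2, inSnd_smul]

theorem includeRight_mul_includeLeft {m n : ℕ} {x y : Uq q} (hx : x ∈ homog q (m : ZMod 2))
    (hy : y ∈ homog q (n : ZMod 2)) :
    includeRight (homog q) (homog q) x * includeLeft (homog q) (homog q) y =
      (-1 : ℂ) ^ (m * n) •
        (includeLeft (homog q) (homog q) y * includeRight (homog q) (homog q) x) := by
  have := tmul_mul_tmul q (x := 1) (y' := 1) hx hy
  rw [one_mul, mul_one] at this
  rw [← tmul_eq, ← this]
  rfl

theorem comul_rtt (α β : (UU q)⟦X⟧⟦X⟧) (hα : ∀ x, α * x = x * α) (hβ : ∀ x, β * x = x * β)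
    (x y : Fin 2 → Fin 2 → ℕ → Uq q)
    (hx : ∀ (i j : Fin 2) (n : ℕ), x i j n ∈ homog q ((((i : ℕ) + j : ℕ)) : ZMod 2))
    (hy : ∀ (i j : Fin 2) (n : ℕ), y i j n ∈ homog q ((((i : ℕ) + j : ℕ)) : ZMod 2))
    (h : ∀ f : Uq q →ₐ[ℂ] UU q,
      rttLeft q α β (fun i j => inFst (.mk fun n => f (x i j n)))
        (fun i j => inSnd (.mk fun n => f (y i j n))) =
      rttRight q α β (fun i j => inFst (.mk fun n => f (x i j n)))
        (fun i j => inSnd (.mk fun n => f (y i j n)))) :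
    rttLeft q α β (fun i j => inFst (.mk (comulFam q x i j)))
        (fun i j => inSnd (.mk (comulFam q y i j))) =
      rttRight q α β (fun i j => inFst (.mk (comulFam q x i j)))
        (fun i j => inSnd (.mk (comulFam q y i j))) := by
  simp only [mk_comulFam, inFst_superMul, inSnd_superMul]
  refine rtt_superMul q α β hα hβ _ _ _ _ (h _) (h _) ?_ ?_
  · intro i j k l
    ext n m
    rw [coeff_smul_two, coeff_inFst_mul_inSnd, coeff_inSnd_mul_inFst]
    simp only [PowerSeries.coeff_mk]
    exact includeRight_mul_includeLeft q (hx _ _ _) (hy _ _ _)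
  · intro i j k l
    ext n m
    rw [coeff_smul_two, coeff_inFst_mul_inSnd, coeff_inSnd_mul_inFst]
    simp only [PowerSeries.coeff_mk]
    exact includeRight_mul_includeLeft q (hy _ _ _) (hx _ _ _)

theorem isRTT_comul : IsRTT q (comulFam q (s q)) (comulFam q (t q)) where
  tt := comul_rtt q _ _ var₂_mul var₁_mul _ _ (t_mem q) (t_mem q) fun f => ((isRTT q).map f).tt
  ss := comul_rtt q _ _ var₁_mul var₂_mul _ _ (s_mem q) (s_mem q) fun f => ((isRTT q).map f).ss
  ts := comul_rtt q _ _ (fun x => by rw [one_mul, mul_one])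
    (fun x => by rw [mul_assoc, var₂_mul x, ← mul_assoc, var₁_mul, mul_assoc]) _ _
    (t_mem q) (s_mem q) fun f => ((isRTT q).map f).ts
  t_zero := by norm_num [comulFam, tmul_zero', zero_tmul', (isRTT q).t_zero]
  s_zero := by norm_num [comulFam, tmul_zero', zero_tmul', (isRTT q).s_zero]
  t_mul_s i := by
    have h1 : comulFam q (t q) i i 0 = t q i i 0 ᵍ⊗ₜ[ℂ] t q i i 0 := by
      fin_cases i <;> norm_num [comulFam, tmul_zero', zero_tmul', (isRTT q).t_zero]
    have h2 : comulFam q (s q) i i 0 = s q i i 0 ᵍ⊗ₜ[ℂ] s q i i 0 := by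
      fin_cases i <;> norm_num [comulFam, tmul_zero', zero_tmul', (isRTT q).s_zero]
    rw [h1, h2, tmul_mul_tmul q (t_mem q i i 0) (s_mem q i i 0), (isRTT q).t_mul_s]
    simp [← two_mul, mul_assoc, pow_mul]
    rfl
  s_mul_t i := by
    have h1 : comulFam q (t q) i i 0 = t q i i 0 ᵍ⊗ₜ[ℂ] t q i i 0 := by
      fin_cases i <;> norm_num [comulFam, tmul_zero', zero_tmul', (isRTT q).t_zero]
    have h2 : comulFam q (s q) i i 0 = s q i i 0 ᵍ⊗ₜ[ℂ] s q i i 0 := by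
      fin_cases i <;> norm_num [comulFam, tmul_zero', zero_tmul', (isRTT q).s_zero]
    rw [h1, h2, tmul_mul_tmul q (s_mem q i i 0) (t_mem q i i 0), (isRTT q).s_mul_t]
    simp [← two_mul, mul_assoc, pow_mul]
    rfl

/-- The coproduct `Δ : U → U ⊗ U`. -/
def comul : Uq q →ₐ[ℂ] UU q := lift (isRTT_comul q)

/-- The counit `ε : U → ℂ`. -/
def counit : Uq q →ₐ[ℂ] ℂ := lift (isRTT_counit q)

/-- The subalgebra `A` generated by the `s_{ij}^{(n)}` and the `t_{ii}^{(0)}`. -/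
def A : Subalgebra ℂ (Uq q) :=
  Algebra.adjoin ℂ ({x | ∃ i j n, x = s q i j n} ∪ {x | ∃ i, x = t q i i 0})

/-- The subalgebra `B` generated by the `t_{ij}^{(n)}` and the `s_{ii}^{(0)}`. -/
def B : Subalgebra ℂ (Uq q) :=
  Algebra.adjoin ℂ ({x | ∃ i j n, x = t q i j n} ∪ {x | ∃ i, x = s q i i 0})

/-- The inclusion of `S ⊗ S` in `U ⊗ U`, for a subalgebra `S` of `U`. -/
def tensorIncl (S : Subalgebra ℂ (Uq q)) : S ⊗[ℂ] S →ₗ[ℂ] UU q :=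
  (GradedTensorProduct.of ℂ (homog q) (homog q)).toLinearMap ∘ₗ
    TensorProduct.map S.val.toLinearMap S.val.toLinearMap

theorem tensorIncl_tmul (S : Subalgebra ℂ (Uq q)) (x y : S) :
    tensorIncl q S (x ⊗ₜ y) = (x : Uq q) ᵍ⊗ₜ[ℂ] (y : Uq q) := rfl

theorem exists_tensor_comul (G : Set (Uq q))
    (hG : ∀ x ∈ G, parity q x ∈ Algebra.adjoin ℂ G)
    (hΔ : ∀ x ∈ G, ∃ τ, tensorIncl q (Algebra.adjoin ℂ G) τ = comul q x)
    (x : Uq q) (hx : x ∈ Algebra.adjoin ℂ G) :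
    ∃ τ, tensorIncl q (Algebra.adjoin ℂ G) τ = comul q x := by
  have hpar : ∀ x ∈ Algebra.adjoin ℂ G, parity q x ∈ Algebra.adjoin ℂ G := by
    intro x hx
    have : Algebra.adjoin ℂ G ≤ (Algebra.adjoin ℂ G).comap (parity q) := Algebra.adjoin_le hG
    exact this hx
  have hpure : ∀ x y x' y' : Algebra.adjoin ℂ G,
      ((x : Uq q) ᵍ⊗ₜ[ℂ] (y : Uq q) * (x' : Uq q) ᵍ⊗ₜ[ℂ] (y' : Uq q) : UU q) ∈
        LinearMap.range (tensorIncl q (Algebra.adjoin ℂ G)) := by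
    intro x y x' y'
    have he : ∀ z : Algebra.adjoin ℂ G, (evenPart q z : Uq q) ∈ Algebra.adjoin ℂ G := fun z =>
      Subalgebra.smul_mem _ (add_mem z.2 (hpar _ z.2)) _
    have ho : ∀ z : Algebra.adjoin ℂ G, (oddPart q z : Uq q) ∈ Algebra.adjoin ℂ G := fun z =>
      Subalgebra.smul_mem _ (sub_mem z.2 (hpar _ z.2)) _
    have hh : ∀ (m n : ℕ) (u v : Uq q), u ∈ Algebra.adjoin ℂ G → v ∈ Algebra.adjoin ℂ G →
        u ∈ homog q (m : ZMod 2) → v ∈ homog q (n : ZMod 2) →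
        ((x : Uq q) ᵍ⊗ₜ[ℂ] u * v ᵍ⊗ₜ[ℂ] (y' : Uq q) : UU q) ∈
          LinearMap.range (tensorIncl q (Algebra.adjoin ℂ G)) := by
      intro m n u v hu hv hum hvn
      rw [tmul_mul_tmul q hum hvn]
      exact Submodule.smul_mem _ _ ⟨(x * ⟨v, hv⟩) ⊗ₜ (⟨u, hu⟩ * y'), rfl⟩
    have e0 : ∀ z : Uq q, (evenPart q z : Uq q) ∈ homog q ((0 : ℕ) : ZMod 2) := fun z => by
      simp
    have e1 : ∀ z : Uq q, (oddPart q z : Uq q) ∈ homog q ((1 : ℕ) : ZMod 2) := fun z => by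
      simp
    have hy : ((x : Uq q) ᵍ⊗ₜ[ℂ] (y : Uq q) : UU q) =
        (x : Uq q) ᵍ⊗ₜ[ℂ] (evenPart q y : Uq q) + (x : Uq q) ᵍ⊗ₜ[ℂ] (oddPart q y : Uq q) := by
      conv_lhs => rw [← evenPart_add_oddPart q y]
      simp only [tmul_eq, map_add, mul_add]
    have hx' : ((x' : Uq q) ᵍ⊗ₜ[ℂ] (y' : Uq q) : UU q) =
        (evenPart q x' : Uq q) ᵍ⊗ₜ[ℂ] (y' : Uq q) + (oddPart q x' : Uq q) ᵍ⊗ₜ[ℂ] (y' : Uq q) := by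
      conv_lhs => rw [← evenPart_add_oddPart q x']
      simp only [tmul_eq, map_add, add_mul]
    rw [hy, hx', add_mul, mul_add, mul_add]
    exact add_mem
      (add_mem (hh _ _ _ _ (he y) (he x') (e0 _) (e0 _)) (hh _ _ _ _ (he y) (ho x') (e0 _) (e1 _)))
      (add_mem (hh _ _ _ _ (ho y) (he x') (e1 _) (e0 _)) (hh _ _ _ _ (ho y) (ho x') (e1 _) (e1 _)))
  induction hx using Algebra.adjoin_induction with
  | mem x hx => exact hΔ x hx
  | algebraMap r =>
    refine ⟨algebraMap ℂ _ r ⊗ₜ 1, ?_⟩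
    rw [AlgHom.commutes]
    rfl
  | add x y _ _ hx hy =>
    obtain ⟨τ, hτ⟩ := hx
    obtain ⟨τ', hτ'⟩ := hy
    exact ⟨τ + τ', by rw [map_add, map_add, hτ, hτ']⟩
  | mul x y _ _ hx hy =>
    obtain ⟨τ, hτ⟩ := hx
    obtain ⟨τ', hτ'⟩ := hy
    rw [map_mul, ← hτ, ← hτ']
    clear hτ hτ'
    change _ ∈ LinearMap.range (tensorIncl q (Algebra.adjoin ℂ G))
    induction τ with
    | zero => rw [map_zero, zero_mul]; exact zero_mem _
    | add a b ha hb => rw [map_add, add_mul]; exact add_mem ha hb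
    | tmul a b =>
      induction τ' with
      | zero => rw [map_zero, mul_zero]; exact zero_mem _
      | add a b ha hb => rw [map_add, mul_add]; exact add_mem ha hb
      | tmul c d => exact hpure a b c d

theorem comulFam_mem (S : Subalgebra ℂ (Uq q)) (x : Fin 2 → Fin 2 → ℕ → Uq q) (i j : Fin 2) (n : ℕ)
    (h : ∀ k, ∀ p ∈ Finset.HasAntidiagonal.antidiagonal n,
      (x i k p.1 ∈ S ∧ x k j p.2 ∈ S) ∨ x i k p.1 = 0 ∨ x k j p.2 = 0) :
    ∃ τ, tensorIncl q S τ = comulFam q x i j n := by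
  change _ ∈ LinearMap.range (tensorIncl q S)
  refine sum_mem fun k _ => Submodule.smul_mem _ _ (sum_mem fun p hp => ?_)
  rcases h k p hp with ⟨h1, h2⟩ | h | h
  · exact ⟨⟨_, h1⟩ ⊗ₜ ⟨_, h2⟩, rfl⟩
  · rw [h, zero_tmul']; exact zero_mem _
  · rw [h, tmul_zero']; exact zero_mem _

/-- `Δ(A) ⊆ A ⊗ A`. -/
theorem exists_comul_A (a : A q) : ∃ τ, tensorIncl q (A q) τ = comul q a := by
  have hs : ∀ i j n, s q i j n ∈ A q := fun i j n =>
    Algebra.subset_adjoin (Or.inl ⟨i, j, n, rfl⟩)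
  have ht : ∀ i, t q i i 0 ∈ A q := fun i => Algebra.subset_adjoin (Or.inr ⟨i, rfl⟩)
  refine exists_tensor_comul q _ ?_ ?_ a a.2
  · rintro x (⟨i, j, n, rfl⟩ | ⟨i, rfl⟩)
    · rw [parity_s]
      exact Subalgebra.smul_mem _ (hs i j n) _
    · rw [parity_t]
      exact Subalgebra.smul_mem _ (ht i) _
  · rintro x (⟨i, j, n, rfl⟩ | ⟨i, rfl⟩)
    · rw [comul, lift_s]
      exact comulFam_mem q (A q) _ _ _ _ fun k p _ => Or.inl ⟨hs _ _ _, hs _ _ _⟩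
    · rw [comul, lift_t]
      refine comulFam_mem q (A q) _ _ _ _ fun k p hp => ?_
      have hp' : p = (0, 0) := by simpa using hp
      subst hp'
      fin_cases i <;> fin_cases k
      · exact Or.inl ⟨ht 0, ht 0⟩
      · exact Or.inr (Or.inl (isRTT q).t_zero)
      · exact Or.inr (Or.inr (isRTT q).t_zero)
      · exact Or.inl ⟨ht 1, ht 1⟩

/-- `Δ(B) ⊆ B ⊗ B`. -/
theorem exists_comul_B (b : B q) : ∃ τ, tensorIncl q (B q) τ = comul q b := by
  have ht : ∀ i j n, t q i j n ∈ B q := fun i j n =>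
    Algebra.subset_adjoin (Or.inl ⟨i, j, n, rfl⟩)
  have hs : ∀ i, s q i i 0 ∈ B q := fun i => Algebra.subset_adjoin (Or.inr ⟨i, rfl⟩)
  refine exists_tensor_comul q _ ?_ ?_ b b.2
  · rintro x (⟨i, j, n, rfl⟩ | ⟨i, rfl⟩)
    · rw [parity_t]
      exact Subalgebra.smul_mem _ (ht i j n) _
    · rw [parity_s]
      exact Subalgebra.smul_mem _ (hs i) _
  · rintro x (⟨i, j, n, rfl⟩ | ⟨i, rfl⟩)
    · rw [comul, lift_t]
      exact comulFam_mem q (B q) _ _ _ _ fun k p _ => Or.inl ⟨ht _ _ _, ht _ _ _⟩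
    · rw [comul, lift_s]
      refine comulFam_mem q (B q) _ _ _ _ fun k p hp => ?_
      have hp' : p = (0, 0) := by simpa using hp
      subst hp'
      fin_cases i <;> fin_cases k
      · exact Or.inl ⟨hs 0, hs 0⟩
      · exact Or.inr (Or.inr (isRTT q).s_zero)
      · exact Or.inr (Or.inl (isRTT q).s_zero)
      · exact Or.inl ⟨hs 1, hs 1⟩

/-- `s_{ij}^{(n)}` in `A`. -/
def sA (i j : Fin 2) (n : ℕ) : A q :=
  ⟨s q i j n, Algebra.subset_adjoin (Or.inl ⟨i, j, n, rfl⟩)⟩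

/-- `t_{ij}^{(n)}` in `B`. -/
def tB (i j : Fin 2) (n : ℕ) : B q :=
  ⟨t q i j n, Algebra.subset_adjoin (Or.inl ⟨i, j, n, rfl⟩)⟩

/-- `s_{ii}^{(0)}` as a unit of `A`. -/
def kA (i : Fin 2) : (A q)ˣ where
  val := sA q i i 0
  inv := ⟨t q i i 0, Algebra.subset_adjoin (Or.inr ⟨i, rfl⟩)⟩
  val_inv := Subtype.ext ((isRTT q).s_mul_t i)
  inv_val := Subtype.ext ((isRTT q).t_mul_s i)

/-- `s_{ii}^{(0)}` as a unit of `B`. -/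
def kB (i : Fin 2) : (B q)ˣ where
  val := ⟨s q i i 0, Algebra.subset_adjoin (Or.inr ⟨i, rfl⟩)⟩
  inv := tB q i i 0
  val_inv := Subtype.ext ((isRTT q).s_mul_t i)
  inv_val := Subtype.ext ((isRTT q).t_mul_s i)

end Uq

open Uq

/-- The linear form `x ⊗ y ↦ f(x) g(y)`. -/
def tensorEval {V : Type*} [AddCommGroup V] [Module ℂ V] (f g : V →ₗ[ℂ] ℂ) : V ⊗[ℂ] V →ₗ[ℂ] ℂ :=
  LinearMap.mul' ℂ ℂ ∘ₗ TensorProduct.map f g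

/-- `φ : A × B → ℂ` is the Hopf pairing normalized by `R(z,w)`. The coproducts of `a ∈ A` and
`b ∈ B` are read in `A ⊗ A` and `B ⊗ B` (see `exists_comul_A`, `exists_comul_B`; the inclusions
of these in `U ⊗ U` are injective). -/
structure IsHopfPairing (q : ℂ) (φ : A q →ₗ[ℂ] B q →ₗ[ℂ] ℂ) : Prop where
  even : ∀ (i j : ZMod 2) (a : A q) (b : B q), (a : Uq q) ∈ homog q i → (b : Uq q) ∈ homog q j →
    i ≠ j → φ a b = 0
  /-- `φ(a, bb') = (-1)^{|b||b'|} φ(a₍₁₎, b) φ(a₍₂₎, b')` -/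
  apply_mul : ∀ (i j : ZMod 2) (a : A q) (b b' : B q), (b : Uq q) ∈ homog q i →
    (b' : Uq q) ∈ homog q j → ∀ τ : A q ⊗[ℂ] A q, tensorIncl q (A q) τ = comul q a →
    φ a (b * b') = (-1) ^ (i.val * j.val) * tensorEval (φ.flip b) (φ.flip b') τ
  apply_one : ∀ a : A q, φ a 1 = counit q a
  /-- `φ(aa', b) = φ(a', b₍₁₎) φ(a, b₍₂₎)` -/
  mul_apply : ∀ (a a' : A q) (b : B q),
    ∀ τ : B q ⊗[ℂ] B q, tensorIncl q (B q) τ = comul q b →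
    φ (a * a') b = tensorEval (φ a') (φ a) τ
  one_apply : ∀ b : B q, φ 1 b = counit q b
  /-- `∑ φ(s_{ij}(w), t_{ab}(z)) E_{ab} ⊗ E_{ij} = R(z,w) / (zq - wq⁻¹)` as series in `w/z`. -/
  normalization : ∀ (i j a b : Fin 2) (m n : ℕ), φ (sA q i j m) (tB q a b n) =
    if m = n then PowerSeries.coeff n
      ((PowerSeries.C (rZ q a b i j) + PowerSeries.C (rW q a b i j) * PowerSeries.X) *
        (PowerSeries.C q - PowerSeries.C q⁻¹ * PowerSeries.X)⁻¹)
    else 0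

section Gauss

variable {R : Type*} [Ring R] [Algebra ℂ R]

/-- The series `E(z)` in the Gauss decomposition below. -/
def gaussE (x : Fin 2 → Fin 2 → R⟦X⟧) (u : Rˣ) : R⟦X⟧ := PowerSeries.invOfUnit (x 0 0) u * x 0 1

/-- The series `F(z)` in the Gauss decomposition below. -/
def gaussF (x : Fin 2 → Fin 2 → R⟦X⟧) (u : Rˣ) : R⟦X⟧ := x 1 0 * PowerSeries.invOfUnit (x 0 0) u

/-- The series `K₂(z)` in the Gauss decomposition below. -/
def gaussK₂ (x : Fin 2 → Fin 2 → R⟦X⟧) (u : Rˣ) : R⟦X⟧ :=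
  x 1 1 + x 1 0 * PowerSeries.invOfUnit (x 0 0) u * x 0 1

/-- The series `φ(z) = K₁(z)⁻¹ K₂(z)`, where `K₁ = x₁₁`. -/
def gaussPhi (x : Fin 2 → Fin 2 → R⟦X⟧) (u : Rˣ) : R⟦X⟧ :=
  PowerSeries.invOfUnit (x 0 0) u * gaussK₂ x u

/-- The Gauss decomposition of `∑ x_{ij} ⊗ E_{ij}` as a product of super matrices, lower
unitriangular, diagonal and upper unitriangular. In entries, `x₁₁ = K₁`, `x₁₂ = K₁ E`,
`x₂₁ = F K₁` and, by the sign rule, `x₂₂ = K₂ - F K₁ E`. -/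
theorem gauss_decomposition (x : Fin 2 → Fin 2 → R⟦X⟧) (u : Rˣ)
    (hu : PowerSeries.constantCoeff (x 0 0) = u) :
    superMul (superMul !![1, 0; gaussF x u, 1] !![x 0 0, 0; 0, gaussK₂ x u])
      !![1, gaussE x u; 0, 1] = x := by
  have h1 := PowerSeries.mul_invOfUnit (x 0 0) u hu
  have h2 := PowerSeries.invOfUnit_mul (x 0 0) u hu
  have h3 : gaussF x u * x 0 0 = x 1 0 := by rw [gaussF, mul_assoc, h2, mul_one]
  have h4 : x 0 0 * gaussE x u = x 0 1 := by rw [gaussE, ← mul_assoc, h1, one_mul]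
  funext i j
  fin_cases i <;> fin_cases j
  · simp [superMul, h3, h4]
  · simp [superMul, h3, h4]
  · simp [superMul, h3, h4]
  · norm_num [superMul, h3, gaussK₂, gaussE, mul_assoc]

/-- The coefficient of index `n` of `log f = ∑_{k ≥ 1} (-1)^{k+1} (f - 1)^k / k`, for a series `f`
with constant term `1`. -/
def logCoeff (f : R⟦X⟧) (n : ℕ) : R :=
  ∑ k ∈ Finset.Icc 1 n, ((-1 : ℂ) ^ (k + 1) / k) • PowerSeries.coeff n ((f - 1) ^ k)

end Gauss

section Drinfeld

variable (q : ℂ)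

/-- The matrix `(s_{ij}(z))` of series in `z` over `A`. -/
def sSeries (i j : Fin 2) : (A q)⟦X⟧ := .mk (sA q i j)

/-- The matrix `(t_{ij}(z))` of series in `z⁻¹` over `B`. -/
def tSeries (i j : Fin 2) : (B q)⟦X⟧ := .mk (tB q i j)

/-- `φ₀⁺ = (s₁₁⁽⁰⁾)⁻¹ s₂₂⁽⁰⁾`. -/
def phiPlus₀ : (A q)ˣ := (kA q 0)⁻¹ * kA q 1

/-- `φ₀⁻ = ((s₁₁⁽⁰⁾)⁻¹ s₂₂⁽⁰⁾)⁻¹`. -/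
def phiMinus₀ : (B q)ˣ := ((kB q 0)⁻¹ * kB q 1)⁻¹

/-- `E_n` for `n ≥ 0`, from `E⁺(z) = ∑_{n ≥ 0} E_n zⁿ`. -/
def ePos (n : ℕ) : A q := PowerSeries.coeff n (gaussE (sSeries q) (kA q 0))

/-- `F_n` for `n ≥ 1`, from `F⁺(z) = - ∑_{n ≥ 1} F_n zⁿ`. -/
def fPos (n : ℕ) : A q := - PowerSeries.coeff n (gaussF (sSeries q) (kA q 0))

/-- `h_n` for `n ≥ 1`, from `K₁⁺(z) = s₁₁⁽⁰⁾ exp((q - q⁻¹) ∑_{n ≥ 1} h_n zⁿ)`. -/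
def hPos (n : ℕ) : A q :=
  (q - q⁻¹)⁻¹ • logCoeff (PowerSeries.C (((kA q 0)⁻¹ : (A q)ˣ) : A q) * sSeries q 0 0) n

/-- `C_n` for `n ≥ 1`, from `φ⁺(z) = φ₀⁺ exp((q - q⁻¹) ∑_{n ≥ 1} C_n zⁿ)`. -/
def cPos (n : ℕ) : A q :=
  (q - q⁻¹)⁻¹ • logCoeff (PowerSeries.C (((phiPlus₀ q)⁻¹ : (A q)ˣ) : A q) *
    gaussPhi (sSeries q) (kA q 0)) n

/-- `E_{-n}` for `n ≥ 1`, from `E⁻(z) = - ∑_{n ≥ 1} E_{-n} z⁻ⁿ`. -/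
def eNeg (n : ℕ) : B q := - PowerSeries.coeff n (gaussE (tSeries q) (kB q 0)⁻¹)

/-- `F_{-n}` for `n ≥ 0`, from `F⁻(z) = ∑_{n ≥ 0} F_{-n} z⁻ⁿ`. -/
def fNeg (n : ℕ) : B q := PowerSeries.coeff n (gaussF (tSeries q) (kB q 0)⁻¹)

/-- `h_{-n}` for `n ≥ 1`, from `K₁⁻(z) = (s₁₁⁽⁰⁾)⁻¹ exp(-(q - q⁻¹) ∑_{n ≥ 1} h_{-n} z⁻ⁿ)`. -/
def hNeg (n : ℕ) : B q :=
  -(q - q⁻¹)⁻¹ • logCoeff (PowerSeries.C (kB q 0 : B q) * tSeries q 0 0) n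

/-- `C_{-n}` for `n ≥ 1`, from `φ⁻(z) = φ₀⁻ exp(-(q - q⁻¹) ∑_{n ≥ 1} C_{-n} z⁻ⁿ)`. -/
def cNeg (n : ℕ) : B q :=
  -(q - q⁻¹)⁻¹ • logCoeff (PowerSeries.C (((phiMinus₀ q)⁻¹ : (B q)ˣ) : B q) *
    gaussPhi (tSeries q) (kB q 0)⁻¹) n

end Drinfeld

/-- Index set of `𝓑`. -/
inductive Idx : Type
  | F (s : ℕ+) : Idx
  | h (s : ℕ+) : Idx
  | C (s : ℕ+) : Idx
  | E (n : ℕ) : Idx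

namespace Idx

/-- The position of an element of `𝓑`: first the row, then the position in the row. -/
def key : Idx → ℕ ×ₗ ℤ
  | F s => toLex (0, -(s : ℤ))
  | h s => toLex (1, (s : ℤ))
  | C s => toLex (2, (s : ℤ))
  | E n => toLex (3, (n : ℤ))

theorem key_injective : Function.Injective key := by
  intro x y hxy
  cases x <;> cases y <;> simp_all [key]

/-- The order `⋯ < F 2 < F 1 < h 1 < h 2 < ⋯ < C 1 < C 2 < ⋯ < E 0 < E 1 < ⋯`. -/
instance : LinearOrder Idx := LinearOrder.lift' key key_injective

/-- The element `b ∈ 𝓑 ⊆ A`. -/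
def elt (q : ℂ) : Idx → A q
  | F s => (((phiPlus₀ q)⁻¹ : (A q)ˣ) : A q) * fPos q s
  | h s => hPos q s
  | C s => cPos q s
  | E n => ePos q n

/-- The element `b⁻ ∈ B`. -/
def eltMinus (q : ℂ) : Idx → B q
  | F s => (((phiMinus₀ q)⁻¹ : (B q)ˣ) : B q) * eNeg q s
  | h s => cNeg q s
  | C s => hNeg q s
  | E n => fNeg q n

/-- The parity `|b|`. -/
def par : Idx → ℕ
  | F _ => 1
  | h _ => 0
  | C _ => 0
  | E _ => 1

end Idx

/-- The set `Γ` of finitely supported functions `f` with `f(b) ≤ 1` for `b ∈ 𝓑₋ ∪ 𝓑₊`. -/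
def Gam : Set (Idx →₀ ℕ) :=
  {f | (∀ s, f (.F s) ≤ 1) ∧ ∀ n, f (.E n) ≤ 1}

/-- The ordered product `∏ x_b^{f(b)}`, increasing in `b` from left to right. -/
def orderedProd {R : Type*} [Monoid R] (x : Idx → R) (f : Idx →₀ ℕ) : R :=
  ((f.support.sort (· ≤ ·)).map fun b => x b ^ f b).prod

/-- The ordered monomial `E(f) ∈ A`. -/
def monE (q : ℂ) (f : Idx →₀ ℕ) : A q := orderedProd (Idx.elt q) f

/-- The ordered monomial `F(f) ∈ B`. -/
def monF (q : ℂ) (f : Idx →₀ ℕ) : B q := orderedProd (Idx.eltMinus q) f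

/-- The exponent `∑_{b < b'} f(b) f(b') |b| |b'|`. -/
def signExp (f : Idx →₀ ℕ) : ℕ :=
  ∑ p ∈ (f.support ×ˢ f.support) with p.1 < p.2, f p.1 * f p.2 * p.1.par * p.2.par

end QAffineGL11

end

open QAffineGL11 QAffineGL11.Uq

/-!
# The Hopf pairing of `U_q(gl(1,1)^)` on ordered monomials of Drinfeld generators

Existence. By the Yang-Baxter equation (`rttLeft_blockL`, `rttLeft_blockR`) the blocks of the
Perk-Schultz matrix in either tensor factor satisfy the defining relations (`isRTT_famL`,
`isRTT_famR`), the two expansions of `R(z,w)` playing the roles of `T` and `S`. The matrix entries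
of the resulting evaluation representations are the linear forms `φ(s_{ij}^{(m)}, ·)` on `B` and
`φ(·, t_{ab}^{(n)})` on `A`. Convolution with the former, `b ↦ φ(s_{ij}^{(m)}, b₁) b₂` up to signs,
gives an operator on `B` for every generator of `A`, and the latter provide the orbit maps
`a ↦ a · b` of generators `b`. Orbit maps can be multiplied, so they exist for all `b`
(`exists_isOrbitMap`); hence the operators define an action `opAct` of `A` on `B`, which satisfies a
Leibniz rule with respect to the coproduct of `A` and commutes with the coaction of `B`. Then
`φ(a, b) = ε(a · b)` is a Hopf pairing (`isHopfPairing_pairing`). A Hopf pairing is determined by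
its values on generators (`IsHopfPairing.unique`).

Evaluation. As `φ(a, b) = ε(a · b)`, the value `φ(kE(f), k'F(g))` is computed by letting the factors
of `E(f)` act on `F(g)` one after the other, beginning with the last. The Leibniz rules for the
Drinfeld currents follow from the coproduct of `s_{ij}(z)` by the Gauss decomposition. For operators
on `B⟦z⟧⟦w⟧` they are first proved with a generator as first factor and then for all words
(`gaussLeibniz`): the current `φ⁺(z) = K₁⁺(z)⁻¹ K₂⁺(z)` acts by algebra homomorphisms, `E⁺(z)` and
`F⁺(z)` by superderivations twisted by `φ⁺(z)`. The action on the generating series of `B` is read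
off from the entries of `R`. It follows that `E_n` acts on ordered monomials by a superderivation,
that `C_s` acts by a derivation, that `h_s` acts by a derivation of the subalgebra `borelB`
generated without the `F_{-n}`, and that `(φ₀⁺)⁻¹ F_s` acts by a superderivation on products of the
`(φ₀⁻)⁻¹ E_{-m}`, modulo the ideal generated by the higher coefficients of `(φ₀⁻)⁻¹ φ⁻(z)`. The
passage from `K₁⁺`, `φ⁺` to their logarithms `h_s`, `C_s` rests on `logCoeff_derivation`: the
logarithm of a multiplicative series of operators acts by derivations. Each of these maps sends
exactly one of the factors `b⁻` it meets to a scalar and annihilates the others, so its value on an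
ordered monomial is a multiple of a single monomial (`skewDerivation_orderedProd`).

The characters `φ(k, ·)` of `B` annihilate all `b⁻` (`grpChar_eltMinus`). Outside the domains where
the derivation properties hold, an ordered monomial lies in a left ideal which is annihilated by
these characters and stable under the remaining factors of `E(f)`, thanks to the order of the
family. So removing the last factor `b` of `E(f)` always removes one factor `b⁻` of `F(g)`
(`grpChar_monE_elt`), and induction on the number of factors gives the formula
(`grpChar_monE_monF`). The factors `k`, `k'` split off because the currents act linearly with
respect to the group-like elements of `B`.
-/

noncomputable section

namespace QAffineGL11

open Finset.HasAntidiagonal (antidiagonal)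

/-! ### Sub-bialgebras and their coproducts -/

theorem sign_congr {m n : ℕ} (h : Even m ↔ Even n) : (-1 : ℂ) ^ m = (-1 : ℂ) ^ n := by
  by_cases hm : Even m
  · rw [hm.neg_one_pow, (h.1 hm).neg_one_pow]
  · rw [(Nat.not_even_iff_odd.1 hm).neg_one_pow,
      (Nat.not_even_iff_odd.1 (fun hn => hm (h.2 hn))).neg_one_pow]

theorem sum_antidiagonal_assoc {M : Type*} [AddCommMonoid M] (f : ℕ → ℕ → ℕ → M) (n : ℕ) :
    ∑ p ∈ antidiagonal n, ∑ r ∈ antidiagonal p.2, f p.1 r.1 r.2 =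
      ∑ p ∈ antidiagonal n, ∑ r ∈ antidiagonal p.1, f r.1 r.2 p.2 := by
  simp only [Finset.sum_sigma']
  apply Finset.sum_nbij' (fun ⟨⟨i, _j⟩, ⟨k, l⟩⟩ => ⟨(i + k, l), (i, k)⟩)
    (fun ⟨⟨_i, j⟩, ⟨k, l⟩⟩ => ⟨(k, l + j), (l, j)⟩)
  all_goals
    rintro ⟨⟨a, b⟩, ⟨c, d⟩⟩ h
    simp only [Finset.mem_sigma, Finset.HasAntidiagonal.mem_antidiagonal] at h
    obtain ⟨rfl, rfl⟩ := h
    simp [add_assoc]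

/-- Subalgebras `S` of `U` stable under the parity automorphism and with `Δ(S) ⊆ S ⊗ S`. Both `A`
and `B` are such; everything up to the coproduct of generators is shared between them. -/
class IsSubBialgebra {q : ℂ} (S : Subalgebra ℂ (Uq q)) : Prop where
  parity_mem : ∀ x ∈ S, parity q x ∈ S
  exists_comul : ∀ x : S, ∃ τ, tensorIncl q S τ = comul q x

section SubBialgebra

variable {q : ℂ} (S : Subalgebra ℂ (Uq q))

/-- Over a field `S ⊗ S` embeds into `U ⊗ U`, so the coproduct of `S` can be read in the plain
tensor product, without the signs of the super tensor product `U ⊗ U`. -/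
theorem tensorIncl_injective : Function.Injective (tensorIncl q S) := by
  intro x y h
  have h' := (GradedTensorProduct.of ℂ (homog q) (homog q)).injective h
  exact TensorProduct.map_injective_of_flat_flat S.val.toLinearMap S.val.toLinearMap
    Subtype.val_injective Subtype.val_injective h'

variable [hS : IsSubBialgebra S]

/-- The parity automorphism of `S`. -/
def par : S →ₐ[ℂ] S :=
  ((parity q).comp S.val).codRestrict S fun x => hS.parity_mem x x.2

/-- The counit of `S`. -/
def eps (S : Subalgebra ℂ (Uq q)) : S →ₐ[ℂ] ℂ := (counit q).comp S.val

/-- The coproduct of `S`, with values in the plain tensor product `S ⊗ S`. -/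
def cop : S →ₗ[ℂ] S ⊗[ℂ] S :=
  (LinearEquiv.ofInjective (tensorIncl q S) (tensorIncl_injective S)).symm.toLinearMap ∘ₗ
    ((comul q).toLinearMap ∘ₗ S.val.toLinearMap).codRestrict _ fun x => hS.exists_comul x

theorem tensorIncl_cop (x : S) : tensorIncl q S (cop S x) = comul q x := by
  have := LinearEquiv.apply_symm_apply
    (LinearEquiv.ofInjective (tensorIncl q S) (tensorIncl_injective S))
    (((comul q).toLinearMap ∘ₗ S.val.toLinearMap).codRestrict _ (fun x => hS.exists_comul x) x)
  exact congrArg Subtype.val this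

theorem cop_eq_iff {x : S} {τ : S ⊗[ℂ] S} : cop S x = τ ↔ tensorIncl q S τ = comul q x := by
  rw [← tensorIncl_cop S x]
  exact ⟨fun h => by rw [h], fun h => (tensorIncl_injective S h).symm⟩

theorem par_par (x : S) : par S (par S x) = x := Subtype.ext (parity_parity q _)

theorem par_pow_add_two (n : ℕ) (x : S) : (par S ^ (n + 2)) x = (par S ^ n) x := by
  rw [pow_add, pow_two]; exact congrArg _ (par_par S x)

variable {S} in
theorem par_pow_apply {x : S} {e : ℕ} (hx : par S x = (-1 : ℂ) ^ e • x) (n : ℕ) :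
    (par S ^ n) x = (-1 : ℂ) ^ (n * e) • x := by
  induction n with
  | zero => simp
  | succ n ih =>
    rw [pow_succ', AlgHom.mul_apply, ih, map_smul, hx, smul_smul, ← pow_add, add_mul, one_mul]

/-- The product `(x ⊗ y)(x' ⊗ y') = (-1)^{|y||x'|} xx' ⊗ yy'` of the super tensor product, as a
bilinear map on the plain tensor product. The sign is produced by the parity automorphism `P`:
`(x ⊗ y)(x' ⊗ y') = xx' ⊗ y₀y' + xP(x') ⊗ y₁y'` where `y₀, y₁ = (y ± P(y)) / 2`. -/
def superTensorMul : S ⊗[ℂ] S →ₗ[ℂ] S ⊗[ℂ] S →ₗ[ℂ] S ⊗[ℂ] S :=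
  (2⁻¹ : ℂ) • (TensorProduct.map₂ (LinearMap.mul ℂ S)
      (LinearMap.mul ℂ S ∘ₗ (LinearMap.id + (par S).toLinearMap)) +
    TensorProduct.map₂ ((LinearMap.mul ℂ S).compl₂ (par S).toLinearMap)
      (LinearMap.mul ℂ S ∘ₗ (LinearMap.id - (par S).toLinearMap)))

theorem superTensorMul_tmul (x y x' y' : S) : superTensorMul S (x ⊗ₜ y) (x' ⊗ₜ y') =
    (2⁻¹ : ℂ) • ((x * x') ⊗ₜ ((y + par S y) * y') + (x * par S x') ⊗ₜ ((y - par S y) * y')) := by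
  simp [superTensorMul, add_mul, sub_mul]

theorem superTensorMul_tmul_of_homog {y : S} {p : ℕ} (hy : par S y = (-1 : ℂ) ^ p • y)
    (x x' y' : S) : superTensorMul S (x ⊗ₜ y) (x' ⊗ₜ y') = (x * (par S ^ p) x') ⊗ₜ (y * y') := by
  rw [superTensorMul_tmul]
  have h2 : ∀ n, (par S ^ n) x' = if Even n then x' else par S x' := by
    intro n
    induction n using Nat.twoStepInduction with
    | zero => simp
    | one => simp
    | more n ih _ => rw [par_pow_add_two, ih]; simp [Nat.even_add]
  rw [h2, hy]
  by_cases he : Even p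
  · rw [if_pos he, he.neg_one_pow, one_smul, sub_self, zero_mul, TensorProduct.tmul_zero, add_zero,
      ← two_smul ℂ, smul_mul_assoc, TensorProduct.tmul_smul, smul_smul]
    norm_num
  · rw [if_neg he, (Nat.not_even_iff_odd.1 he).neg_one_pow, neg_one_smul, add_neg_cancel,
      zero_mul, TensorProduct.tmul_zero, zero_add, sub_neg_eq_add, ← two_smul ℂ, smul_mul_assoc,
      TensorProduct.tmul_smul, smul_smul]
    norm_num

open GradedTensorProduct in
theorem tensorIncl_superTensorMul (a b : S ⊗[ℂ] S) :
    tensorIncl q S (superTensorMul S a b) = tensorIncl q S a * tensorIncl q S b := by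
  induction a with
  | zero => simp
  | add a a' ha ha' => simp only [map_add, LinearMap.add_apply, add_mul, ha, ha']
  | tmul x y =>
    induction b with
    | zero => simp
    | add b b' hb hb' => simp only [map_add, mul_add, hb, hb']
    | tmul x' y' =>
            -- Both sides are expanded in the even and odd parts of `y` and `x'`; `l1`-`l4` are the
            -- bilinearity of the graded tensor, which is a type synonym opaque to `simp`.
      have e0 : ∀ z : Uq q, (evenPart q z : Uq q) ∈ homog q ((0 : ℕ) : ZMod 2) := fun z => by simp
      have e1 : ∀ z : Uq q, (oddPart q z : Uq q) ∈ homog q ((1 : ℕ) : ZMod 2) := fun z => by simp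
      have l1 : ∀ u v w : Uq q, ((u + v) ᵍ⊗ₜ[ℂ] w : UU q) = u ᵍ⊗ₜ[ℂ] w + v ᵍ⊗ₜ[ℂ] w :=
          fun u v w => by
        simp only [tmul_eq, map_add, add_mul]
      have l2 : ∀ u v w : Uq q, (w ᵍ⊗ₜ[ℂ] (u + v) : UU q) = w ᵍ⊗ₜ[ℂ] u + w ᵍ⊗ₜ[ℂ] v :=
          fun u v w => by
        simp only [tmul_eq, map_add, mul_add]
      have l3 : ∀ (r : ℂ) (u w : Uq q), ((r • u) ᵍ⊗ₜ[ℂ] w : UU q) = r • (u ᵍ⊗ₜ[ℂ] w) :=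
          fun r u w => by
        simp only [tmul_eq, map_smul, smul_mul_assoc]
      have l4 : ∀ (r : ℂ) (u w : Uq q), (w ᵍ⊗ₜ[ℂ] (r • u) : UU q) = r • (w ᵍ⊗ₜ[ℂ] u) :=
          fun r u w => by
        simp only [tmul_eq, map_smul, mul_smul_comm]
      have hp : ∀ z : Uq q, parity q z = evenPart q z + (-1 : ℂ) • (oddPart q z : Uq q) :=
          fun z => by
        simp only [evenPart, oddPart, smul_smul]
        module
      have hl : tensorIncl q S (superTensorMul S (x ⊗ₜ y) (x' ⊗ₜ y')) =
          ((x : Uq q) * x') ᵍ⊗ₜ[ℂ] ((evenPart q y : Uq q) * y') +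
            ((x : Uq q) * parity q x') ᵍ⊗ₜ[ℂ] ((oddPart q y : Uq q) * y') := by
        rw [superTensorMul_tmul, map_smul, map_add, tensorIncl_tmul, tensorIncl_tmul]
        simp only [evenPart, oddPart, smul_mul_assoc, l4]
        rw [smul_add]
        rfl
      rw [hl, tensorIncl_tmul, tensorIncl_tmul, hp]
      conv_rhs => rw [← evenPart_add_oddPart q y, ← evenPart_add_oddPart q x', l1, l2, add_mul,
        mul_add, mul_add, tmul_mul_tmul q (e0 _) (e0 _), tmul_mul_tmul q (e0 _) (e1 _),
        tmul_mul_tmul q (e1 _) (e0 _), tmul_mul_tmul q (e1 _) (e1 _)]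
      conv_lhs => enter [1]; rw [← evenPart_add_oddPart q (x' : Uq q)]
      simp only [mul_add, l1, l3, mul_smul_comm]
      norm_num

theorem cop_mul (x y : S) : cop S (x * y) = superTensorMul S (cop S x) (cop S y) := by
  rw [cop_eq_iff, tensorIncl_superTensorMul, tensorIncl_cop, tensorIncl_cop]
  exact (map_mul _ _ _).symm

theorem cop_one : cop S 1 = 1 ⊗ₜ 1 := by
  rw [cop_eq_iff, tensorIncl_tmul]
  exact (map_one (comul q)).symm

theorem eps_par (x : S) : eps S (par S x) = eps S x := by
  have : (counit q).comp (parity q) = counit q := by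
    apply hom_ext
    · intro i j n
      simp only [AlgHom.comp_apply, parity_s, map_smul, counit, lift_s]
      split_ifs with h
      · simp [h.1, ← two_mul]
      · simp
    · intro i j n
      simp only [AlgHom.comp_apply, parity_t, map_smul, counit, lift_t]
      split_ifs with h
      · simp [h.1, ← two_mul]
      · simp
  exact congrArg (fun f : Uq q →ₐ[ℂ] ℂ => f x) this

end SubBialgebra

/-! ### The generators of `A` and `B` -/

section Generators

variable (q : ℂ)

theorem s_mem_A (i j : Fin 2) (n : ℕ) : s q i j n ∈ A q := (sA q i j n).2

theorem t_mem_A (i : Fin 2) : t q i i 0 ∈ A q := (((kA q i)⁻¹ : (A q)ˣ) : A q).2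

theorem t_mem_B (i j : Fin 2) (n : ℕ) : t q i j n ∈ B q := (tB q i j n).2

theorem s_mem_B (i : Fin 2) : s q i i 0 ∈ B q := (kB q i : B q).2

instance : IsSubBialgebra (A q) where
  parity_mem x hx := by
    have : A q ≤ (A q).comap (parity q) := by
      refine Algebra.adjoin_le ?_
      rintro x (⟨i, j, n, rfl⟩ | ⟨i, rfl⟩)
      · change parity q _ ∈ A q
        rw [parity_s]
        exact Subalgebra.smul_mem _ (s_mem_A q i j n) _
      · change parity q _ ∈ A q
        rw [parity_t]
        exact Subalgebra.smul_mem _ (t_mem_A q i) _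
    exact this hx
  exists_comul := exists_comul_A q

instance : IsSubBialgebra (B q) where
  parity_mem x hx := by
    have : B q ≤ (B q).comap (parity q) := by
      refine Algebra.adjoin_le ?_
      rintro x (⟨i, j, n, rfl⟩ | ⟨i, rfl⟩)
      · change parity q _ ∈ B q
        rw [parity_t]
        exact Subalgebra.smul_mem _ (t_mem_B q i j n) _
      · change parity q _ ∈ B q
        rw [parity_s]
        exact Subalgebra.smul_mem _ (s_mem_B q i) _
    exact this hx
  exists_comul := exists_comul_B q

theorem par_sA (i j : Fin 2) (n : ℕ) :
    par (A q) (sA q i j n) = (-1 : ℂ) ^ ((i : ℕ) + j) • sA q i j n := Subtype.ext (parity_s q i j n)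

theorem par_tB (i j : Fin 2) (n : ℕ) :
    par (B q) (tB q i j n) = (-1 : ℂ) ^ ((i : ℕ) + j) • tB q i j n := Subtype.ext (parity_t q i j n)

theorem par_kA_inv (i : Fin 2) :
    par (A q) (((kA q i)⁻¹ : (A q)ˣ) : A q) = ((kA q i)⁻¹ : (A q)ˣ) := by
  refine Subtype.ext ((parity_t q i i 0).trans ?_)
  simp [← two_mul]; rfl

theorem par_kB (i : Fin 2) : par (B q) (kB q i : B q) = kB q i := by
  refine Subtype.ext ((parity_s q i i 0).trans ?_)
  simp [← two_mul]; rfl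

open GradedTensorProduct in
theorem cop_sA (i j : Fin 2) (n : ℕ) : cop (A q) (sA q i j n) =
    ∑ k : Fin 2, (-1 : ℂ) ^ (((i : ℕ) + k) * ((k : ℕ) + j)) •
      ∑ p ∈ Finset.HasAntidiagonal.antidiagonal n, sA q i k p.1 ⊗ₜ sA q k j p.2 := by
  rw [cop_eq_iff]
  simp only [map_sum, map_smul, tensorIncl_tmul]
  exact (lift_s (isRTT_comul q) i j n).symm

open GradedTensorProduct in
theorem cop_tB (i j : Fin 2) (n : ℕ) : cop (B q) (tB q i j n) =
    ∑ k : Fin 2, (-1 : ℂ) ^ (((i : ℕ) + k) * ((k : ℕ) + j)) •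
      ∑ p ∈ Finset.HasAntidiagonal.antidiagonal n, tB q i k p.1 ⊗ₜ tB q k j p.2 := by
  rw [cop_eq_iff]
  simp only [map_sum, map_smul, tensorIncl_tmul]
  exact (lift_t (isRTT_comul q) i j n).symm

theorem comulFam_s_diag (i : Fin 2) :
    comulFam q (s q) i i 0 = GradedTensorProduct.tmul ℂ (s q i i 0) (s q i i 0) := by
  fin_cases i <;> norm_num [comulFam, tmul_zero', zero_tmul', (isRTT q).s_zero]

theorem comulFam_t_diag (i : Fin 2) :
    comulFam q (t q) i i 0 = GradedTensorProduct.tmul ℂ (t q i i 0) (t q i i 0) := by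
  fin_cases i <;> norm_num [comulFam, tmul_zero', zero_tmul', (isRTT q).t_zero]

theorem cop_kA_inv (i : Fin 2) : cop (A q) (((kA q i)⁻¹ : (A q)ˣ) : A q) =
    (((kA q i)⁻¹ : (A q)ˣ) : A q) ⊗ₜ (((kA q i)⁻¹ : (A q)ˣ) : A q) := by
  rw [cop_eq_iff]
  exact ((lift_t (isRTT_comul q) i i 0).trans (comulFam_t_diag q i)).symm

theorem cop_kB (i : Fin 2) : cop (B q) (kB q i : B q) = (kB q i : B q) ⊗ₜ (kB q i : B q) := by
  rw [cop_eq_iff]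
  exact ((lift_s (isRTT_comul q) i i 0).trans (comulFam_s_diag q i)).symm

theorem eps_sA (i j : Fin 2) (n : ℕ) :
    eps (A q) (sA q i j n) = if i = j ∧ n = 0 then 1 else 0 := lift_s _ i j n

theorem eps_tB (i j : Fin 2) (n : ℕ) :
    eps (B q) (tB q i j n) = if i = j ∧ n = 0 then 1 else 0 := lift_t _ i j n

theorem eps_kB (i : Fin 2) : eps (B q) (kB q i : B q) = 1 := (lift_s _ i i 0).trans (by simp)

variable {q}

/-- The subalgebra generated by `G` is spanned by the elements with a property `p` which is
inherited from `w` to `g * w`. Unlike `Algebra.adjoin_induction` this applies to properties which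
are not linear, such as being homogeneous. -/
theorem mem_span_words {R : Type*} [Ring R] [Algebra ℂ R] {G : Set R} {p : Algebra.adjoin ℂ G → Prop}
    (one : p 1)
    (mul : ∀ (g : R) (hg : g ∈ G) (w), p w → p (⟨g, Algebra.subset_adjoin hg⟩ * w))
    (x : Algebra.adjoin ℂ G) : x ∈ Submodule.span ℂ {w | p w} := by
  suffices h : ∀ w ∈ Submodule.span ℂ {w | p w}, x * w ∈ Submodule.span ℂ {w | p w} by
    simpa using h 1 (Submodule.subset_span one)
  obtain ⟨x, hx⟩ := x
  induction hx using Algebra.adjoin_induction with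
  | mem g hg =>
    intro w hw
    induction hw using Submodule.span_induction with
    | mem w hw => exact Submodule.subset_span (mul g hg w hw)
    | zero => rw [mul_zero]; exact zero_mem _
    | add u v _ _ hu hv => rw [mul_add]; exact add_mem hu hv
    | smul r u _ hu => rw [mul_smul_comm]; exact Submodule.smul_mem _ _ hu
  | algebraMap r =>
    intro w hw
    have : (⟨algebraMap ℂ R r, Subalgebra.algebraMap_mem _ r⟩ : Algebra.adjoin ℂ G) * w = r • w :=
      (Algebra.smul_def r w).symm
    rw [this]
    exact Submodule.smul_mem _ _ hw
  | add x y hx' hy' hx hy =>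
    intro w hw
    have : (⟨x + y, add_mem hx' hy'⟩ : Algebra.adjoin ℂ G) * w = ⟨x, hx'⟩ * w + ⟨y, hy'⟩ * w :=
      add_mul (⟨x, hx'⟩ : Algebra.adjoin ℂ G) ⟨y, hy'⟩ w
    rw [this]
    exact add_mem (hx w hw) (hy w hw)
  | mul x y hx' hy' hx hy =>
    intro w hw
    have : (⟨x * y, mul_mem hx' hy'⟩ : Algebra.adjoin ℂ G) * w = ⟨x, hx'⟩ * (⟨y, hy'⟩ * w) :=
      mul_assoc (⟨x, hx'⟩ : Algebra.adjoin ℂ G) ⟨y, hy'⟩ w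
    rw [this]
    exact hx _ (hy w hw)

/-- `A` is spanned by the words in its generators. -/
theorem A_mem_span_words {p : A q → Prop} (one : p 1)
    (s : ∀ i j n w, p w → p (sA q i j n * w))
    (k : ∀ i w, p w → p (((kA q i)⁻¹ : (A q)ˣ) * w)) (a : A q) :
    a ∈ Submodule.span ℂ {w | p w} := by
  refine mem_span_words one ?_ a
  rintro g (⟨i, j, n, rfl⟩ | ⟨i, rfl⟩) w hw
  · exact s i j n w hw
  · exact k i w hw

/-- `B` is spanned by the words in its generators. -/
theorem B_mem_span_words {p : B q → Prop} (one : p 1)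
    (t : ∀ i j n w, p w → p (tB q i j n * w))
    (k : ∀ i w, p w → p (kB q i * w)) (b : B q) :
    b ∈ Submodule.span ℂ {w | p w} := by
  refine mem_span_words one ?_ b
  rintro g (⟨i, j, n, rfl⟩ | ⟨i, rfl⟩) w hw
  · exact t i j n w hw
  · exact k i w hw

theorem A_induction {N : Submodule ℂ (A q)} (one : 1 ∈ N)
    (s : ∀ i j n, ∀ w ∈ N, sA q i j n * w ∈ N)
    (k : ∀ i, ∀ w ∈ N, (((kA q i)⁻¹ : (A q)ˣ) : A q) * w ∈ N) (a : A q) : a ∈ N := by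
  have := A_mem_span_words (p := (· ∈ N)) one s k a
  rwa [show {w | w ∈ N} = (N : Set (A q)) from rfl, Submodule.span_eq] at this

theorem B_induction {N : Submodule ℂ (B q)} (one : 1 ∈ N)
    (t : ∀ i j n, ∀ w ∈ N, tB q i j n * w ∈ N)
    (k : ∀ i, ∀ w ∈ N, (kB q i : B q) * w ∈ N) (b : B q) : b ∈ N := by
  have := B_mem_span_words (p := (· ∈ N)) one t k b
  rwa [show {w | w ∈ N} = (N : Set (B q)) from rfl, Submodule.span_eq] at this

variable (q)

/-- `Δ(s_{ij}(z) w)`; the parity automorphism in the first factor carries the sign of the super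
tensor product. -/
theorem cop_sA_mul (i j : Fin 2) (n : ℕ) (w : A q) : cop (A q) (sA q i j n * w) =
    ∑ k : Fin 2, (-1 : ℂ) ^ (((i : ℕ) + k) * ((k : ℕ) + j)) •
      ∑ p ∈ Finset.HasAntidiagonal.antidiagonal n, TensorProduct.map
        (LinearMap.mulLeft ℂ (sA q i k p.1) ∘ₗ (par (A q) ^ ((k : ℕ) + j)).toLinearMap)
        (LinearMap.mulLeft ℂ (sA q k j p.2)) (cop (A q) w) := by
  rw [cop_mul, cop_sA]
  generalize cop (A q) w = τ
  induction τ with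
  | zero => simp
  | add a b ha hb => simp only [map_add, ha, hb, Finset.sum_add_distrib, smul_add]
  | tmul x y =>
    simp only [map_sum, map_smul, LinearMap.sum_apply, LinearMap.smul_apply]
    refine Finset.sum_congr rfl fun k _ => congrArg _ (Finset.sum_congr rfl fun p _ => ?_)
    rw [superTensorMul_tmul_of_homog _ (par_sA q k j p.2)]
    rfl

theorem cop_tB_mul (i j : Fin 2) (n : ℕ) (w : B q) : cop (B q) (tB q i j n * w) =
    ∑ k : Fin 2, (-1 : ℂ) ^ (((i : ℕ) + k) * ((k : ℕ) + j)) •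
      ∑ p ∈ Finset.HasAntidiagonal.antidiagonal n, TensorProduct.map
        (LinearMap.mulLeft ℂ (tB q i k p.1) ∘ₗ (par (B q) ^ ((k : ℕ) + j)).toLinearMap)
        (LinearMap.mulLeft ℂ (tB q k j p.2)) (cop (B q) w) := by
  rw [cop_mul, cop_tB]
  generalize cop (B q) w = τ
  induction τ with
  | zero => simp
  | add a b ha hb => simp only [map_add, ha, hb, Finset.sum_add_distrib, smul_add]
  | tmul x y =>
    simp only [map_sum, map_smul, LinearMap.sum_apply, LinearMap.smul_apply]
    refine Finset.sum_congr rfl fun k _ => congrArg _ (Finset.sum_congr rfl fun p _ => ?_)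
    rw [superTensorMul_tmul_of_homog _ (par_tB q k j p.2)]
    rfl

theorem cop_mul_of_grouplike {S : Subalgebra ℂ (Uq q)} [IsSubBialgebra S] {k : S}
    (hk : cop S k = k ⊗ₜ k) (hp : par S k = k) (w : S) : cop S (k * w) =
    TensorProduct.map (LinearMap.mulLeft ℂ k) (LinearMap.mulLeft ℂ k) (cop S w) := by
  rw [cop_mul, hk]
  generalize cop S w = τ
  induction τ with
  | zero => simp
  | add a b ha hb => simp only [map_add, ha, hb]
  | tmul x y =>
    rw [superTensorMul_tmul_of_homog S (p := 0) (by simpa using hp)]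
    rfl

variable {q} in
theorem map_par_superTensorMul (S : Subalgebra ℂ (Uq q)) [IsSubBialgebra S] (a b : S ⊗[ℂ] S) :
    TensorProduct.map (par S).toLinearMap (par S).toLinearMap (superTensorMul S a b) =
      superTensorMul S (TensorProduct.map (par S).toLinearMap (par S).toLinearMap a)
        (TensorProduct.map (par S).toLinearMap (par S).toLinearMap b) := by
  induction a with
  | zero => simp
  | add a a' ha ha' => simp only [map_add, LinearMap.add_apply, ha, ha']
  | tmul x y =>
    induction b with
    | zero => simp
    | add b b' hb hb' => simp only [map_add, hb, hb']
    | tmul x' y' => simp [superTensorMul_tmul]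

/-- The coproduct is even. -/
theorem cop_par_B (x : B q) : cop (B q) (par (B q) x) =
    TensorProduct.map (par (B q)).toLinearMap (par (B q)).toLinearMap (cop (B q) x) := by
  refine B_induction (N := LinearMap.eqLocus (cop (B q) ∘ₗ (par (B q)).toLinearMap)
    (TensorProduct.map (par (B q)).toLinearMap (par (B q)).toLinearMap ∘ₗ cop (B q))) ?_ ?_ ?_ x
  · simp [cop_one]
  · intro i j n w hw
    have hw : cop (B q) (par (B q) w) = TensorProduct.map _ _ (cop (B q) w) := hw
    change cop (B q) (par (B q) _) = TensorProduct.map _ _ (cop (B q) _)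
    rw [map_mul, cop_mul, cop_mul, map_par_superTensorMul, hw, par_tB, map_smul, cop_tB]
    congr 2
    simp only [map_sum, map_smul, Finset.smul_sum, TensorProduct.map_tmul, AlgHom.toLinearMap_apply,
      par_tB, TensorProduct.smul_tmul_smul, smul_smul, ← pow_add]
    refine Finset.sum_congr rfl fun k _ => Finset.sum_congr rfl fun p _ => ?_
    congr 1
    apply sign_congr
    simp only [Nat.even_add, Nat.even_mul]
    grind
  · intro i w hw
    have hw : cop (B q) (par (B q) w) = TensorProduct.map _ _ (cop (B q) w) := hw
    change cop (B q) (par (B q) _) = TensorProduct.map _ _ (cop (B q) _)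
    rw [map_mul, cop_mul, cop_mul, map_par_superTensorMul, hw, par_kB, cop_kB,
      TensorProduct.map_tmul, AlgHom.toLinearMap_apply, par_kB]

end Generators

/-! ### Coassociativity and counit of `B` -/

section Coassoc

variable (q : ℂ)

theorem cop_par_pow_B (n : ℕ) (x : B q) : cop (B q) ((par (B q) ^ n) x) =
    TensorProduct.map (par (B q) ^ n).toLinearMap (par (B q) ^ n).toLinearMap (cop (B q) x) := by
  induction n generalizing x with
  | zero =>
    simp only [pow_zero]
    exact (congrFun (congrArg DFunLike.coe (TensorProduct.map_id (R := ℂ) (M := B q) (N := B q)))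
      (cop (B q) x)).symm
  | succ n ih =>
    rw [pow_succ, AlgHom.mul_apply, ih, cop_par_B]
    exact (congrFun (congrArg DFunLike.coe (TensorProduct.map_comp (par (B q) ^ n).toLinearMap
      (par (B q) ^ n).toLinearMap (par (B q)).toLinearMap (par (B q)).toLinearMap)) _).symm

theorem lTensor_cop_map_mulLeft (f : B q →ₗ[ℂ] B q) (k j : Fin 2) (n : ℕ) (τ : B q ⊗[ℂ] B q) :
    LinearMap.lTensor (B q) (cop (B q))
      (TensorProduct.map f (LinearMap.mulLeft ℂ (tB q k j n)) τ) =
    ∑ l : Fin 2, (-1 : ℂ) ^ (((k : ℕ) + l) * ((l : ℕ) + j)) • ∑ r ∈ antidiagonal n,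
      TensorProduct.map f (TensorProduct.map
        (LinearMap.mulLeft ℂ (tB q k l r.1) ∘ₗ (par (B q) ^ ((l : ℕ) + j)).toLinearMap)
        (LinearMap.mulLeft ℂ (tB q l j r.2))) (LinearMap.lTensor (B q) (cop (B q)) τ) := by
  induction τ with
  | zero => simp
  | add a b ha hb => simp only [map_add, ha, hb, Finset.sum_add_distrib, smul_add]
  | tmul x z =>
    rw [TensorProduct.map_tmul, LinearMap.lTensor_tmul, LinearMap.mulLeft_apply, cop_tB_mul]
    simp only [TensorProduct.tmul_sum, TensorProduct.tmul_smul]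
    rfl

theorem assoc_tmul_eq_lTensor {V : Type*} [AddCommGroup V] [Module ℂ V] (ξ : V ⊗[ℂ] V) (y : V) :
    TensorProduct.assoc ℂ V V V (ξ ⊗ₜ y) =
      LinearMap.lTensor V ((TensorProduct.mk ℂ V V).flip y) ξ := by
  induction ξ with
  | zero => simp
  | add a b ha hb => simp only [TensorProduct.add_tmul, map_add, ha, hb]
  | tmul u v => simp

/-- The map `(Δ ⊗ 1)` on `B ⊗ B`, with values in `B ⊗ (B ⊗ B)`. -/
def copLeft : B q ⊗[ℂ] B q →ₗ[ℂ] B q ⊗[ℂ] (B q ⊗[ℂ] B q) :=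
  (TensorProduct.assoc ℂ (B q) (B q) (B q)).toLinearMap ∘ₗ LinearMap.rTensor (B q) (cop (B q))

/-- The map `x ⊗ y ↦ x₁ ⊗ (x₂ ⊗ y)`, for fixed `y`. -/
def assocTmul (y : B q) : B q ⊗[ℂ] B q →ₗ[ℂ] B q ⊗[ℂ] (B q ⊗[ℂ] B q) :=
  LinearMap.lTensor (B q) ((TensorProduct.mk ℂ (B q) (B q)).flip y)

theorem copLeft_tmul (x y : B q) : copLeft q (x ⊗ₜ y) = assocTmul q y (cop (B q) x) := by
  exact assoc_tmul_eq_lTensor (cop (B q) x) y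

theorem copLeft_map_mulLeft (g : B q →ₗ[ℂ] B q) (i l : Fin 2) (m n : ℕ)
    (τ : B q ⊗[ℂ] B q) :
    copLeft q (TensorProduct.map
        (LinearMap.mulLeft ℂ (tB q i l n) ∘ₗ (par (B q) ^ m).toLinearMap) g τ) =
    ∑ k : Fin 2, (-1 : ℂ) ^ (((i : ℕ) + k) * ((k : ℕ) + l)) • ∑ r ∈ antidiagonal n,
      TensorProduct.map
        (LinearMap.mulLeft ℂ (tB q i k r.1) ∘ₗ (par (B q) ^ ((k : ℕ) + l + m)).toLinearMap)
        (TensorProduct.map (LinearMap.mulLeft ℂ (tB q k l r.2) ∘ₗ (par (B q) ^ m).toLinearMap) g)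
        (copLeft q τ) := by
  induction τ with
  | zero => simp
  | add a b ha hb => simp only [map_add, ha, hb, Finset.sum_add_distrib, smul_add]
  | tmul x z =>
    rw [TensorProduct.map_tmul, copLeft_tmul, copLeft_tmul, LinearMap.comp_apply,
      LinearMap.mulLeft_apply, AlgHom.toLinearMap_apply, cop_tB_mul, cop_par_pow_B]
    generalize cop (B q) x = ξ
    induction ξ with
    | zero => simp
    | add a b ha hb =>
      simp only [map_add, Finset.sum_add_distrib, smul_add] at ha hb ⊢
      rw [ha, hb]
    | tmul u v =>
      simp only [TensorProduct.map_tmul, map_sum, map_smul, pow_add, AlgHom.mul_apply,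
        LinearMap.comp_apply, AlgHom.toLinearMap_apply]
      rfl

/-- Coassociativity. The coproduct with values in the plain tensor product is not multiplicative,
but the two iterated coproducts of `t_{ij}^{(n)} w` are given by the same formula, in terms of those
of `w`. -/
theorem coassoc_B (b : B q) : LinearMap.lTensor (B q) (cop (B q)) (cop (B q) b) =
    copLeft q (cop (B q) b) := by
  refine B_induction (N := LinearMap.eqLocus (LinearMap.lTensor (B q) (cop (B q)) ∘ₗ cop (B q))
    (copLeft q ∘ₗ cop (B q))) ?_ ?_ ?_ b
  · change LinearMap.lTensor (B q) (cop (B q)) (cop (B q) 1) = copLeft q (cop (B q) 1)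
    rw [cop_one, copLeft_tmul, LinearMap.lTensor_tmul, cop_one]
    rfl
  · intro i j n w hw
    have hw : LinearMap.lTensor (B q) (cop (B q)) (cop (B q) w) = copLeft q (cop (B q) w) := hw
    change LinearMap.lTensor (B q) (cop (B q)) (cop (B q) _) = copLeft q (cop (B q) _)
    rw [cop_tB_mul]
    simp only [map_sum, map_smul, lTensor_cop_map_mulLeft, copLeft_map_mulLeft, hw]
    generalize (copLeft q (cop (B q) w)) = τ
    simp only [Finset.smul_sum, smul_smul, ← pow_add]
    simp only [Finset.sum_comm (s := antidiagonal n) (t := Finset.univ)]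
    conv_rhs => rw [Finset.sum_comm]
    refine Finset.sum_congr rfl fun k _ => Finset.sum_congr rfl fun l _ => ?_
    rw [sum_antidiagonal_assoc (fun a b c => (-1 : ℂ) ^ (((i : ℕ) + k) * ((k : ℕ) + j) +
      ((k : ℕ) + l) * ((l : ℕ) + j)) • TensorProduct.map
        (LinearMap.mulLeft ℂ (tB q i k a) ∘ₗ (par (B q) ^ ((k : ℕ) + j)).toLinearMap)
        (TensorProduct.map (LinearMap.mulLeft ℂ (tB q k l b) ∘ₗ
          (par (B q) ^ ((l : ℕ) + j)).toLinearMap) (LinearMap.mulLeft ℂ (tB q l j c))) τ) n]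
    refine Finset.sum_congr rfl fun p _ => Finset.sum_congr rfl fun r _ => ?_
    have hpar : par (B q) ^ ((k : ℕ) + l + (l + j)) = par (B q) ^ ((k : ℕ) + j) := by
      have h2 : par (B q) ^ 2 = 1 := by
        ext x; exact congrArg _ (par_par (B q) x)
      rw [show (k : ℕ) + l + (l + j) = 2 * l + (k + j) by ring, pow_add, pow_mul, h2, one_pow, one_mul]
    rw [hpar]
    congr 1
    apply sign_congr
    simp only [Nat.even_add, Nat.even_mul]
    grind
  · intro i w hw
    have hw : LinearMap.lTensor (B q) (cop (B q)) (cop (B q) w) = copLeft q (cop (B q) w) := hw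
    change LinearMap.lTensor (B q) (cop (B q)) (cop (B q) _) = copLeft q (cop (B q) _)
    have hk := cop_mul_of_grouplike q (cop_kB q i) (par_kB q i)
    rw [hk]
    have h1 : ∀ τ : B q ⊗[ℂ] B q, LinearMap.lTensor (B q) (cop (B q))
        (TensorProduct.map (LinearMap.mulLeft ℂ (kB q i : B q)) (LinearMap.mulLeft ℂ (kB q i : B q)) τ)
        = TensorProduct.map (LinearMap.mulLeft ℂ (kB q i : B q)) (TensorProduct.map
          (LinearMap.mulLeft ℂ (kB q i : B q)) (LinearMap.mulLeft ℂ (kB q i : B q)))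
          (LinearMap.lTensor (B q) (cop (B q)) τ) := by
      intro τ
      induction τ with
      | zero => simp
      | add a b ha hb => simp only [map_add, ha, hb]
      | tmul x z =>
        rw [TensorProduct.map_tmul, LinearMap.lTensor_tmul, LinearMap.mulLeft_apply,
          LinearMap.mulLeft_apply, hk]
        rfl
    have h2 : ∀ τ : B q ⊗[ℂ] B q, copLeft q (TensorProduct.map (LinearMap.mulLeft ℂ (kB q i : B q))
          (LinearMap.mulLeft ℂ (kB q i : B q)) τ)
        = TensorProduct.map (LinearMap.mulLeft ℂ (kB q i : B q)) (TensorProduct.map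
          (LinearMap.mulLeft ℂ (kB q i : B q)) (LinearMap.mulLeft ℂ (kB q i : B q)))
          (copLeft q τ) := by
      intro τ
      induction τ with
      | zero => simp
      | add a b ha hb => simp only [map_add, ha, hb]
      | tmul x z =>
        rw [TensorProduct.map_tmul, copLeft_tmul, LinearMap.mulLeft_apply,
          LinearMap.mulLeft_apply, hk, copLeft_tmul]
        generalize cop (B q) x = ξ
        induction ξ with
        | zero => simp
        | add a b ha hb => simp only [map_add, ha, hb]
        | tmul u v => rfl
    rw [h1, h2, hw]

/-- The counit axiom `ε(b₁) b₂ = b`. -/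
theorem lid_rTensor_eps_cop (b : B q) :
    TensorProduct.lid ℂ (B q) (LinearMap.rTensor (B q) (eps (B q)).toLinearMap (cop (B q) b)) =
      b := by
  refine B_induction (N := LinearMap.eqLocus ((TensorProduct.lid ℂ (B q)).toLinearMap ∘ₗ
    LinearMap.rTensor (B q) (eps (B q)).toLinearMap ∘ₗ cop (B q)) LinearMap.id) ?_ ?_ ?_ b
  · simp [cop_one]
  · intro i j n w hw
    have hw : TensorProduct.lid ℂ (B q) (LinearMap.rTensor (B q) (eps (B q)).toLinearMap
      (cop (B q) w)) = w := hw
    change TensorProduct.lid ℂ (B q) (LinearMap.rTensor (B q) (eps (B q)).toLinearMap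
      (cop (B q) _)) = tB q i j n * w
    conv_rhs => rw [← hw]
    rw [cop_tB_mul]
    generalize cop (B q) w = τ
    induction τ with
    | zero => simp
    | add a b ha hb =>
      simp only [map_add, Finset.sum_add_distrib, smul_add, mul_add] at ha hb ⊢
      rw [ha, hb]
    | tmul x z =>
      have hp : ∀ n x, eps (B q) ((par (B q) ^ n) x) = eps (B q) x := by
        intro n
        induction n with
        | zero => intro x; rfl
        | succ n ih => intro x; rw [pow_succ, AlgHom.mul_apply, ih, eps_par]
      simp only [map_sum, map_smul, TensorProduct.map_tmul, LinearMap.rTensor_tmul,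
        TensorProduct.lid_tmul, LinearMap.comp_apply, AlgHom.toLinearMap_apply,
        LinearMap.mulLeft_apply, map_mul, hp, eps_tB]
      rw [Finset.sum_eq_single i, Finset.sum_eq_single (0, n)]
      · simp [← two_mul, mul_assoc, pow_mul]
      · rintro ⟨a, b⟩ hp hne
        rw [Finset.HasAntidiagonal.mem_antidiagonal] at hp
        have : a ≠ 0 := by rintro rfl; apply hne; simpa using hp
        simp [this]
      · intro h; exact absurd (by simp) h
      · intro k _ hk
        simp [hk.symm]
      · simp
  · intro i w hw
    have hw : TensorProduct.lid ℂ (B q) (LinearMap.rTensor (B q) (eps (B q)).toLinearMap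
      (cop (B q) w)) = w := hw
    change TensorProduct.lid ℂ (B q) (LinearMap.rTensor (B q) (eps (B q)).toLinearMap
      (cop (B q) _)) = kB q i * w
    conv_rhs => rw [← hw]
    rw [cop_mul_of_grouplike q (cop_kB q i) (par_kB q i)]
    generalize cop (B q) w = τ
    induction τ with
    | zero => simp
    | add a b ha hb =>
      simp only [map_add, mul_add] at ha hb ⊢
      rw [ha, hb]
    | tmul x z => simp [eps_kB]

end Coassoc

/-! ### The Yang-Baxter equation -/

section YangBaxter

variable {S : Type*} [CommRing S] [Algebra ℂ S]

/-- The coefficients `∑ᵢⱼ R^{ab}_{ij} E_{ij}` of `E_{ab}` in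
`R(α₀, α₁) = ∑ R^{ab}_{ij} E_{ab} ⊗ E_{ij}`, as matrices on the second tensor factor; the spectral
parameters are ring elements. -/
def blockL (q : ℂ) (α₀ α₁ : S) (a b : Fin 2) : Matrix (Fin 2) (Fin 2) S :=
  .of fun i j => rZ q a b i j • α₀ + rW q a b i j • α₁

/-- The super transposes of the coefficients `∑ R^{ab}_{ij} E_{ab}` of `E_{ij}` in `R(α₀, α₁)`, as
matrices on the first tensor factor. The transposition turns the opposite relations into the
relations of `U`. -/
def blockR (q : ℂ) (α₀ α₁ : S) (i j : Fin 2) : Matrix (Fin 2) (Fin 2) S :=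
  .of fun b a => (-1 : ℂ) ^ ((a : ℕ) * (a + b)) • (rZ q a b i j • α₀ + rW q a b i j • α₁)

theorem rho_scalar (q : ℂ) (x y : S) (a b c d : Fin 2) :
    rho q (Matrix.scalar (Fin 2) x) (Matrix.scalar (Fin 2) y) a b c d =
      Matrix.scalar (Fin 2) (rho q x y a b c d) := by
  ext u v
  by_cases h : u = v <;> simp [rho, h]

theorem rttLeft_scalar_apply (q : ℂ) (x y : S) (X Y : Fin 2 → Fin 2 → Matrix (Fin 2) (Fin 2) S)
    (a j c l u v : Fin 2) :
    rttLeft q (Matrix.scalar (Fin 2) x) (Matrix.scalar (Fin 2) y) X Y a j c l u v =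
      ∑ b : Fin 2, ∑ d : Fin 2, (-1 : ℂ) ^ (((b : ℕ) + j) * ((c : ℕ) + l)) •
        (rho q x y a b c d * ∑ w : Fin 2, X b j u w * Y d l w v) := by
  simp only [rttLeft, rho_scalar]
  simp only [Matrix.sum_apply, Matrix.smul_apply, Matrix.scalar_apply, Matrix.diagonal_mul]
  simp only [Matrix.mul_apply]

theorem rttRight_scalar_apply (q : ℂ) (x y : S) (X Y : Fin 2 → Fin 2 → Matrix (Fin 2) (Fin 2) S)
    (a j c l u v : Fin 2) :
    rttRight q (Matrix.scalar (Fin 2) x) (Matrix.scalar (Fin 2) y) X Y a j c l u v =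
      ∑ e : Fin 2, ∑ f : Fin 2, (-1 : ℂ) ^ (((c : ℕ) + f) * ((e : ℕ) + j)) •
        ((∑ w : Fin 2, Y c f u w * X a e w v) * rho q x y e j f l) := by
  simp only [rttRight, rho_scalar]
  simp only [Matrix.sum_apply, Matrix.smul_apply, Matrix.scalar_apply, Matrix.mul_diagonal]
  simp only [Matrix.mul_apply]

set_option maxHeartbeats 1000000 in
/-- The Yang-Baxter equation: the blocks of `R` satisfy the RTT relation. Only the ratio of the two
spectral parameters matters, whence the products `α₀ β₁` and `α₁ β₀`. -/
theorem rttLeft_blockL (q : ℂ) (hq : q ≠ 0) (α₀ α₁ β₀ β₁ : S) :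
    rttLeft q (Matrix.scalar (Fin 2) (α₀ * β₁)) (Matrix.scalar (Fin 2) (α₁ * β₀))
      (blockL q α₀ α₁) (blockL q β₀ β₁) =
    rttRight q (Matrix.scalar (Fin 2) (α₀ * β₁)) (Matrix.scalar (Fin 2) (α₁ * β₀))
      (blockL q α₀ α₁) (blockL q β₀ β₁) := by
  have h : algebraMap ℂ S q * algebraMap ℂ S q⁻¹ = 1 := by
    rw [← map_mul, mul_inv_cancel₀ hq, map_one]
  funext a j c l
  ext u v
  rw [rttLeft_scalar_apply, rttRight_scalar_apply]
  generalize hQ : algebraMap ℂ S q = Q at h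
  generalize hQ' : algebraMap ℂ S q⁻¹ = Q' at h
  revert a j c l u v
  simp only [Fin.forall_fin_two, Fin.sum_univ_two]
  simp only [rho, rZ, rW, blockL, Matrix.of_apply]
  simp [Algebra.smul_def, hQ, hQ', -map_inv₀]
  clear hQ hQ' hq
  constructorm* _ ∧ _ <;> grind

set_option maxHeartbeats 1000000 in
/-- The super transposed Yang-Baxter equation; the spectral parameters are interchanged. -/
theorem rttLeft_blockR (q : ℂ) (hq : q ≠ 0) (α₀ α₁ β₀ β₁ : S) :
    rttLeft q (Matrix.scalar (Fin 2) (α₁ * β₀)) (Matrix.scalar (Fin 2) (α₀ * β₁))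
      (blockR q α₀ α₁) (blockR q β₀ β₁) =
    rttRight q (Matrix.scalar (Fin 2) (α₁ * β₀)) (Matrix.scalar (Fin 2) (α₀ * β₁))
      (blockR q α₀ α₁) (blockR q β₀ β₁) := by
  have h : algebraMap ℂ S q * algebraMap ℂ S q⁻¹ = 1 := by
    rw [← map_mul, mul_inv_cancel₀ hq, map_one]
  funext a j c l
  ext u v
  rw [rttLeft_scalar_apply, rttRight_scalar_apply]
  generalize hQ : algebraMap ℂ S q = Q at h
  generalize hQ' : algebraMap ℂ S q⁻¹ = Q' at h
  revert a j c l u v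
  simp only [Fin.forall_fin_two, Fin.sum_univ_two]
  simp only [rho, rZ, rW, blockR, Matrix.of_apply]
  simp [Algebra.smul_def, hQ, hQ', -map_inv₀]
  clear hQ hQ' hq
  constructorm* _ ∧ _ <;> grind

end YangBaxter

/-! ### Evaluation representations -/

/-- The coefficients of `R(z,w) / (zq - wq⁻¹)`, expanded in `w/z`. -/
def rCoeff (q : ℂ) (a b i j : Fin 2) (n : ℕ) : ℂ :=
  PowerSeries.coeff n
    ((PowerSeries.C (rZ q a b i j) + PowerSeries.C (rW q a b i j) * PowerSeries.X) *
      (PowerSeries.C q - PowerSeries.C q⁻¹ * PowerSeries.X)⁻¹)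

/-- The coefficients of `R(z,w) / (zq - wq⁻¹)`, expanded in `z/w`. -/
def rCoeff' (q : ℂ) (a b i j : Fin 2) (n : ℕ) : ℂ :=
  PowerSeries.coeff n
    ((PowerSeries.C (rZ q a b i j) * PowerSeries.X + PowerSeries.C (rW q a b i j)) *
      (PowerSeries.C q * PowerSeries.X - PowerSeries.C q⁻¹)⁻¹)

section Evaluation

/-- The comparison map from `Mat(S⟦X⟧)` to `Mat(S)⟦X⟧`. -/
def matSeries (S : Type*) [CommRing S] [Algebra ℂ S] :
    Matrix (Fin 2) (Fin 2) S⟦X⟧ →ₐ[ℂ] (Matrix (Fin 2) (Fin 2) S)⟦X⟧ where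
  toFun M := .mk fun n => M.map (PowerSeries.coeff n)
  map_one' := by
    ext n i j
    by_cases hn : n = 0 <;> by_cases h : i = j <;> simp [PowerSeries.coeff_one, hn, h]
  map_mul' M N := by
    ext n i j
    simp only [PowerSeries.coeff_mk, Matrix.map_apply, Matrix.mul_apply, map_sum,
      PowerSeries.coeff_mul, Matrix.sum_apply]
    rw [Finset.sum_comm]
  map_zero' := by ext n i j; simp
  map_add' M N := by ext n i j; simp
  commutes' r := by
    ext n i j
    by_cases hn : n = 0 <;> by_cases h : i = j <;>
      simp [PowerSeries.algebraMap_apply, PowerSeries.coeff_C, Matrix.algebraMap_matrix_apply, hn,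
        h]

variable {K : Type*} [CommRing K] [Algebra ℂ K]

/-- The comparison map from `Mat(K⟦X⟧⟦X⟧)` to `Mat(K)⟦X⟧⟦X⟧`. -/
def matSeries₂ : Matrix (Fin 2) (Fin 2) K⟦X⟧⟦X⟧ →ₐ[ℂ] (Matrix (Fin 2) (Fin 2) K)⟦X⟧⟦X⟧ :=
  (PowerSeries.mapAlgHom (matSeries K)).comp (matSeries K⟦X⟧)

theorem coeff_matSeries₂ (M : Matrix (Fin 2) (Fin 2) K⟦X⟧⟦X⟧) (m n : ℕ) (i j : Fin 2) :
    (PowerSeries.coeff m (PowerSeries.coeff n (matSeries₂ M)) : Matrix (Fin 2) (Fin 2) K) i j =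
      PowerSeries.coeff m (PowerSeries.coeff n (M i j)) := by
  simp [matSeries₂, matSeries, PowerSeries.mapAlgHom_apply]

theorem matSeries₂_inFst (f : Fin 2 → Fin 2 → ℕ → K) :
    matSeries₂ (.of fun i j => inFst (.mk (f i j))) =
      inFst (.mk fun n => (.of fun i j => f i j n : Matrix (Fin 2) (Fin 2) K)) := by
  ext n m i j
  rw [coeff_matSeries₂]
  by_cases hn : n = 0 <;> simp [inFst, PowerSeries.coeff_C, hn]

theorem matSeries₂_inSnd (f : Fin 2 → Fin 2 → ℕ → K) :
    matSeries₂ (.of fun i j => inSnd (.mk (f i j))) =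
      inSnd (.mk fun n => (.of fun i j => f i j n : Matrix (Fin 2) (Fin 2) K)) := by
  ext n m i j
  rw [coeff_matSeries₂]
  by_cases hn : m = 0 <;> simp [inSnd, PowerSeries.coeff_C, hn]

theorem matSeries₂_var₁ : matSeries₂ (Matrix.scalar (Fin 2) (var₁ : K⟦X⟧⟦X⟧)) = var₁ := by
  ext n m i j
  rw [coeff_matSeries₂]
  by_cases hn : n = 0 <;> by_cases hm : m = 1 <;> by_cases h : i = j <;>
    simp [var₁, PowerSeries.coeff_C, PowerSeries.coeff_X, hn, hm, h]

theorem matSeries₂_var₂ : matSeries₂ (Matrix.scalar (Fin 2) (var₂ : K⟦X⟧⟦X⟧)) = var₂ := by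
  ext n m i j
  rw [coeff_matSeries₂]
  by_cases hn : n = 1 <;> by_cases hm : m = 0 <;> by_cases h : i = j <;>
    simp [var₂, PowerSeries.coeff_one, PowerSeries.coeff_X, hn, hm, h]

theorem rttLeft_mul_left {M : Type*} [Ring M] [Algebra ℂ M] (q : ℂ) (c α β : M)
    (X Y : Fin 2 → Fin 2 → M) (a j k l : Fin 2) :
    rttLeft q (c * α) (c * β) X Y a j k l = c * rttLeft q α β X Y a j k l := by
  simp only [rttLeft, Finset.mul_sum, mul_smul_comm, ← mul_assoc, mul_add, rho]

theorem rttRight_mul_left {M : Type*} [Ring M] [Algebra ℂ M] (q : ℂ) (c α β : M)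
    (hc : ∀ x, c * x = x * c) (X Y : Fin 2 → Fin 2 → M) (a j k l : Fin 2) :
    rttRight q (c * α) (c * β) X Y a j k l = c * rttRight q α β X Y a j k l := by
  have : ∀ a b d e, rho q (c * α) (c * β) a b d e = c * rho q α β a b d e := by
    intro a b d e
    simp only [rho, mul_add, mul_smul_comm]
  simp only [rttRight, Finset.mul_sum, mul_smul_comm, this]
  refine Finset.sum_congr rfl fun e _ => Finset.sum_congr rfl fun f _ => ?_
  rw [← mul_assoc, ← hc, mul_assoc]

/-- A Yang-Baxter type relation in `Mat(K⟦X⟧⟦X⟧)`, transferred to `Mat(K)⟦X⟧⟦X⟧` after division by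
a common factor of the spectral parameters. -/
theorem rtt_of_matSeries (q : ℂ) (x y c α β : K⟦X⟧⟦X⟧) (hc : IsUnit c) (hx : x = c * α)
    (hy : y = c * β)
    (X Y : Fin 2 → Fin 2 → Matrix (Fin 2) (Fin 2) K⟦X⟧⟦X⟧)
    (h : rttLeft q (Matrix.scalar (Fin 2) x) (Matrix.scalar (Fin 2) y) X Y =
      rttRight q (Matrix.scalar (Fin 2) x) (Matrix.scalar (Fin 2) y) X Y) :
    rttLeft q (matSeries₂ (Matrix.scalar (Fin 2) α)) (matSeries₂ (Matrix.scalar (Fin 2) β))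
        (fun i j => matSeries₂ (X i j)) (fun i j => matSeries₂ (Y i j)) =
      rttRight q (matSeries₂ (Matrix.scalar (Fin 2) α)) (matSeries₂ (Matrix.scalar (Fin 2) β))
        (fun i j => matSeries₂ (X i j)) (fun i j => matSeries₂ (Y i j)) := by
  funext a j k l
  have := congrFun (congrFun (congrFun (congrFun h a) j) k) l
  rw [hx, hy, map_mul, map_mul, rttLeft_mul_left, rttRight_mul_left _ _ _ _
    (fun M => (Matrix.scalar_commute c (fun r => Commute.all _ _) M).eq)] at this
  have hu : IsUnit (Matrix.scalar (Fin 2) c) := hc.map _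
  rw [← map_rttLeft, ← map_rttRight, hu.mul_left_cancel this]

/-- Both expansions of `(r + r' z) / D`, with `τ z` for `z`, are combinations of a unit `δ` and
`τ z δ`, with the coefficients `r`, `r'`. The unit `δ` is the factor that is later cancelled from
the Yang-Baxter equation. -/
theorem exists_evalSeries (τ : K) (D : ℂ⟦X⟧) (hD : PowerSeries.constantCoeff D ≠ 0) :
    ∃ δ : K⟦X⟧, IsUnit δ ∧ ∀ r r' : ℂ,
      (PowerSeries.mk fun n => algebraMap ℂ K (PowerSeries.coeff n ((PowerSeries.C r +
        PowerSeries.C r' * PowerSeries.X) * D⁻¹)) * τ ^ n) =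
      r • δ + r' • (PowerSeries.C τ * PowerSeries.X * δ) ∧
      (PowerSeries.mk fun n => algebraMap ℂ K (PowerSeries.coeff n ((PowerSeries.C r *
        PowerSeries.X + PowerSeries.C r') * D⁻¹)) * τ ^ n) =
      r • (PowerSeries.C τ * PowerSeries.X * δ) + r' • δ := by
  have key : ∀ f : ℂ⟦X⟧, (PowerSeries.mk fun n => algebraMap ℂ K (PowerSeries.coeff n f) * τ ^ n) =
      PowerSeries.rescale τ (PowerSeries.map (algebraMap ℂ K) f) := by
    intro f; ext n; simp [mul_comm]
  refine ⟨PowerSeries.rescale τ (PowerSeries.map (algebraMap ℂ K) D⁻¹), ?_, fun r r' => ?_⟩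
  · have : IsUnit D⁻¹ := by
      rw [PowerSeries.isUnit_iff_constantCoeff]
      simpa using hD
    exact (this.map _).map _
  · have hC : ∀ r : ℂ, ∀ f : K⟦X⟧, PowerSeries.rescale τ (PowerSeries.C (algebraMap ℂ K r)) * f =
        r • f := by
      intro r f
      have : PowerSeries.rescale τ (PowerSeries.C (algebraMap ℂ K r)) = algebraMap ℂ K⟦X⟧ r := by
        ext n
        by_cases hn : n = 0 <;> simp [PowerSeries.coeff_C, hn, PowerSeries.algebraMap_apply]
      rw [this, Algebra.smul_def]
    have hX : PowerSeries.rescale τ (PowerSeries.X : K⟦X⟧) = PowerSeries.C τ * PowerSeries.X := by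
      ext n
      by_cases hn : n = 1 <;> simp [PowerSeries.coeff_X, hn]
    rw [key, key]
    simp only [map_mul, map_add, PowerSeries.map_C, PowerSeries.map_X, hX, add_mul, mul_assoc, hC]
    exact ⟨trivial, trivial⟩

end Evaluation

section EvaluationRep

variable {K : Type*} [CommRing K] [Algebra ℂ K]

theorem inFst_add' (x y : K⟦X⟧) : inFst (x + y) = inFst x + inFst y := map_add PowerSeries.C x y

theorem inSnd_add' (x y : K⟦X⟧) : inSnd (x + y) = inSnd x + inSnd y :=
  map_add (PowerSeries.map PowerSeries.C) x y

theorem inFst_mul' (x y : K⟦X⟧) : inFst (x * y) = inFst x * inFst y := map_mul PowerSeries.C x y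

theorem inSnd_mul' (x y : K⟦X⟧) : inSnd (x * y) = inSnd x * inSnd y :=
  map_mul (PowerSeries.map PowerSeries.C) x y

theorem inFst_scalar (τ : K) : inFst (PowerSeries.C τ) = PowerSeries.C (PowerSeries.C τ) := rfl

theorem inSnd_scalar (τ : K) : inSnd (PowerSeries.C τ) = PowerSeries.C (PowerSeries.C τ) :=
  PowerSeries.map_C _ _

theorem inFst_X : inFst (PowerSeries.X : K⟦X⟧) = var₁ := rfl

theorem inSnd_X : inSnd (PowerSeries.X : K⟦X⟧) = var₂ := PowerSeries.map_X _

variable (q : ℂ) (τ : K)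

/-- The coefficients of the blocks of `R(z,w) / (zq - wq⁻¹)` in the second factor; here `w = τ`. -/
def famL (a b : Fin 2) (n : ℕ) : Matrix (Fin 2) (Fin 2) K :=
  .of fun i j => algebraMap ℂ K (rCoeff q a b i j n) * τ ^ n

/-- The same blocks, expanded in the other direction; here `w⁻¹ = τ`. -/
def famL' (a b : Fin 2) (n : ℕ) : Matrix (Fin 2) (Fin 2) K :=
  .of fun i j => algebraMap ℂ K (rCoeff' q a b i j n) * τ ^ n

/-- The coefficients of the super transposed blocks of `R(z,w) / (zq - wq⁻¹)` in the first factor;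
here `z⁻¹ = τ`. -/
def famR (i j : Fin 2) (n : ℕ) : Matrix (Fin 2) (Fin 2) K :=
  .of fun b a => (-1 : ℂ) ^ ((a : ℕ) * (a + b)) • (algebraMap ℂ K (rCoeff q a b i j n) * τ ^ n)

/-- The same blocks, expanded in the other direction; here `z = τ`. -/
def famR' (i j : Fin 2) (n : ℕ) : Matrix (Fin 2) (Fin 2) K :=
  .of fun b a => (-1 : ℂ) ^ ((a : ℕ) * (a + b)) • (algebraMap ℂ K (rCoeff' q a b i j n) * τ ^ n)

theorem mk_smul_mul (r : ℂ) (f : ℕ → K) :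
    (PowerSeries.mk fun n => r • f n) = r • PowerSeries.mk f := by
  ext n; simp

/-- The generating series of the families `famL`, `famR` are blocks of `R`, up to the common factor
`δ`. -/
theorem exists_series (hq : q ≠ 0) : ∃ δ : K⟦X⟧, IsUnit δ ∧
    (∀ a b, inFst (.mk (famL q τ a b)) =
      matSeries₂ (blockL q (inFst δ) (PowerSeries.C (PowerSeries.C τ) * var₁ * inFst δ) a b)) ∧
    (∀ a b, inSnd (.mk (famL q τ a b)) =
      matSeries₂ (blockL q (inSnd δ) (PowerSeries.C (PowerSeries.C τ) * var₂ * inSnd δ) a b)) ∧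
    (∀ a b, inFst (.mk (famR q τ a b)) =
      matSeries₂ (blockR q (inFst δ) (PowerSeries.C (PowerSeries.C τ) * var₁ * inFst δ) a b)) ∧
    (∀ a b, inSnd (.mk (famR q τ a b)) =
      matSeries₂ (blockR q (inSnd δ) (PowerSeries.C (PowerSeries.C τ) * var₂ * inSnd δ) a b)) := by
  obtain ⟨δ, hδ, h⟩ := exists_evalSeries τ (PowerSeries.C q - PowerSeries.C q⁻¹ * PowerSeries.X)
    (by simpa using hq)
  have h' := fun r r' => (h r r').1
  refine ⟨δ, hδ, fun a b => ?_, fun a b => ?_, fun a b => ?_, fun a b => ?_⟩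
  · refine (matSeries₂_inFst _).symm.trans (congrArg _ ?_)
    ext1 i j
    simp only [Matrix.of_apply, rCoeff, h', blockL, inFst_add', inFst_smul, inFst_mul',
      inFst_scalar,
      inFst_X]
  · refine (matSeries₂_inSnd _).symm.trans (congrArg _ ?_)
    ext1 i j
    simp only [Matrix.of_apply, rCoeff, h', blockL, inSnd_add', inSnd_smul, inSnd_mul',
      inSnd_scalar,
      inSnd_X]
  · refine (matSeries₂_inFst _).symm.trans (congrArg _ ?_)
    ext1 i j
    simp only [Matrix.of_apply, rCoeff, mk_smul_mul, h', blockR, inFst_add', inFst_smul, inFst_mul',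
      inFst_scalar, inFst_X]
  · refine (matSeries₂_inSnd _).symm.trans (congrArg _ ?_)
    ext1 i j
    simp only [Matrix.of_apply, rCoeff, mk_smul_mul, h', blockR, inSnd_add', inSnd_smul, inSnd_mul',
      inSnd_scalar, inSnd_X]

/-- The generating series of the families `famL'`, `famR'` are blocks of `R`, up to the common
factor `δ`. -/
theorem exists_series' (hq : q ≠ 0) : ∃ δ : K⟦X⟧, IsUnit δ ∧
    (∀ a b, inFst (.mk (famL' q τ a b)) =
      matSeries₂ (blockL q (PowerSeries.C (PowerSeries.C τ) * var₁ * inFst δ) (inFst δ) a b)) ∧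
    (∀ a b, inSnd (.mk (famL' q τ a b)) =
      matSeries₂ (blockL q (PowerSeries.C (PowerSeries.C τ) * var₂ * inSnd δ) (inSnd δ) a b)) ∧
    (∀ a b, inFst (.mk (famR' q τ a b)) =
      matSeries₂ (blockR q (PowerSeries.C (PowerSeries.C τ) * var₁ * inFst δ) (inFst δ) a b)) ∧
    (∀ a b, inSnd (.mk (famR' q τ a b)) =
      matSeries₂ (blockR q (PowerSeries.C (PowerSeries.C τ) * var₂ * inSnd δ) (inSnd δ) a b)) := by
  obtain ⟨δ, hδ, h⟩ := exists_evalSeries τ (PowerSeries.C q * PowerSeries.X - PowerSeries.C q⁻¹)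
    (by simpa using hq)
  have h' := fun r r' => (h r r').2
  refine ⟨δ, hδ, fun a b => ?_, fun a b => ?_, fun a b => ?_, fun a b => ?_⟩
  · refine (matSeries₂_inFst _).symm.trans (congrArg _ ?_)
    ext1 i j
    simp only [Matrix.of_apply, rCoeff', h', blockL, inFst_add', inFst_smul, inFst_mul',
      inFst_scalar, inFst_X]
  · refine (matSeries₂_inSnd _).symm.trans (congrArg _ ?_)
    ext1 i j
    simp only [Matrix.of_apply, rCoeff', h', blockL, inSnd_add', inSnd_smul, inSnd_mul',
      inSnd_scalar, inSnd_X]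
  · refine (matSeries₂_inFst _).symm.trans (congrArg _ ?_)
    ext1 i j
    simp only [Matrix.of_apply, rCoeff', mk_smul_mul, h', blockR, inFst_add', inFst_smul,
      inFst_mul', inFst_scalar, inFst_X]
  · refine (matSeries₂_inSnd _).symm.trans (congrArg _ ?_)
    ext1 i j
    simp only [Matrix.of_apply, rCoeff', mk_smul_mul, h', blockR, inSnd_add', inSnd_smul,
      inSnd_mul', inSnd_scalar, inSnd_X]

theorem isUnit_inFst {δ : K⟦X⟧} (h : IsUnit δ) : IsUnit (inFst δ) := h.map PowerSeries.C

theorem isUnit_inSnd {δ : K⟦X⟧} (h : IsUnit δ) : IsUnit (inSnd δ) :=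
  h.map (PowerSeries.map PowerSeries.C)

theorem isUnit_scalar₂ {τ : K} (h : IsUnit τ) :
    IsUnit (PowerSeries.C (PowerSeries.C τ) : K⟦X⟧⟦X⟧) := (h.map PowerSeries.C).map PowerSeries.C

variable {τ} {τ' : K}

theorem matSeries₂_var₁_mul_var₂ :
    matSeries₂ (Matrix.scalar (Fin 2) (var₁ * var₂ : K⟦X⟧⟦X⟧)) = var₁ * var₂ := by
  rw [map_mul, map_mul, matSeries₂_var₁, matSeries₂_var₂]

theorem rCoeff_zero (a b i j : Fin 2) : rCoeff q a b i j 0 = rZ q a b i j * q⁻¹ := by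
  simp [rCoeff]

theorem rCoeff'_zero (a b i j : Fin 2) : rCoeff' q a b i j 0 = - (rW q a b i j * q) := by
  simp [rCoeff', PowerSeries.constantCoeff_inv, inv_neg]

theorem scalar₂_mul (hτ : τ * τ' = 1) :
    (PowerSeries.C (PowerSeries.C τ) * PowerSeries.C (PowerSeries.C τ') : K⟦X⟧⟦X⟧) = 1 := by
  rw [← map_mul, ← map_mul, hτ, map_one, map_one]

/-- The blocks in the second factor, at an invertible value `τ` of the spectral parameter, satisfy
the defining relations of `U`. -/
theorem isRTT_famL (hq : q ≠ 0) (hτ : τ * τ' = 1) : IsRTT q (famL' q τ') (famL q τ) := by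
  obtain ⟨δ, hδ, h1, h2, -⟩ := exists_series q τ hq
  obtain ⟨δ', hδ', h1', h2', -⟩ := exists_series' q τ' hq
  have hu : IsUnit τ := .of_mul_eq_one _ hτ
  have hu' : IsUnit τ' := .of_mul_eq_one _ ((mul_comm _ _).trans hτ)
  have hz : ∀ i, famL q τ i i 0 * famL' q τ' i i 0 = 1 ∧ famL' q τ' i i 0 * famL q τ i i 0 = 1 := by
    intro i
    have e1 : q⁻¹ * q⁻¹ * (q * q) = 1 := by field_simp
    have e2 : q * q * (q⁻¹ * q⁻¹) = 1 := by field_simp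
    constructor <;>
    · ext u v
      fin_cases i <;> fin_cases u <;> fin_cases v <;>
        simp [famL, famL', Matrix.mul_apply, rCoeff_zero, rCoeff'_zero, rZ, rW, ← map_mul, hq, e1,
          e2, -map_inv₀]
  constructor
  · simp only [h1, h2]
    have := rtt_of_matSeries q _ _ (PowerSeries.C (PowerSeries.C τ) * inFst δ * inSnd δ) var₂ var₁
      (((isUnit_scalar₂ hu).mul (isUnit_inFst hδ)).mul (isUnit_inSnd hδ)) (by ring) (by ring) _ _
      (rttLeft_blockL q hq (inFst δ) (PowerSeries.C (PowerSeries.C τ) * var₁ * inFst δ)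
        (inSnd δ) (PowerSeries.C (PowerSeries.C τ) * var₂ * inSnd δ))
    rwa [matSeries₂_var₁, matSeries₂_var₂] at this
  · simp only [h1', h2']
    have := rtt_of_matSeries q _ _
        (PowerSeries.C (PowerSeries.C τ') * inFst δ' * inSnd δ') var₁ var₂
      (((isUnit_scalar₂ hu').mul (isUnit_inFst hδ')).mul (isUnit_inSnd hδ')) (by ring) (by ring) _ _
      (rttLeft_blockL q hq (PowerSeries.C (PowerSeries.C τ') * var₁ * inFst δ') (inFst δ')
        (PowerSeries.C (PowerSeries.C τ') * var₂ * inSnd δ') (inSnd δ'))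
    rwa [matSeries₂_var₁, matSeries₂_var₂] at this
  · simp only [h1, h2']
    have := rtt_of_matSeries q _ _ (inFst δ * inSnd δ') 1 (var₁ * var₂)
      ((isUnit_inFst hδ).mul (isUnit_inSnd hδ')) (by ring)
      (by linear_combination (var₁ * var₂ * inFst δ * inSnd δ') * scalar₂_mul hτ) _ _
      (rttLeft_blockL q hq (inFst δ) (PowerSeries.C (PowerSeries.C τ) * var₁ * inFst δ)
        (PowerSeries.C (PowerSeries.C τ') * var₂ * inSnd δ') (inSnd δ'))
    rwa [matSeries₂_var₁_mul_var₂, map_one, map_one] at this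
  · ext u v
    simp [famL, rCoeff_zero, rZ]
  · ext u v
    simp [famL', rCoeff'_zero, rW]
  · exact fun i => (hz i).1
  · exact fun i => (hz i).2

/-- The blocks in the first factor, at an invertible value `τ` of the spectral parameter, satisfy
the defining relations of `U`. -/
theorem isRTT_famR (hq : q ≠ 0) (hτ : τ * τ' = 1) : IsRTT q (famR q τ) (famR' q τ') := by
  obtain ⟨δ, hδ, -, -, h1, h2⟩ := exists_series q τ hq
  obtain ⟨δ', hδ', -, -, h1', h2'⟩ := exists_series' q τ' hq
  have hu : IsUnit τ := .of_mul_eq_one _ hτ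
  have hu' : IsUnit τ' := .of_mul_eq_one _ ((mul_comm _ _).trans hτ)
  have hz : ∀ i, famR q τ i i 0 * famR' q τ' i i 0 = 1 ∧ famR' q τ' i i 0 * famR q τ i i 0 = 1 := by
    intro i
    have e1 : q⁻¹ * q⁻¹ * (q * q) = 1 := by field_simp
    have e2 : q * q * (q⁻¹ * q⁻¹) = 1 := by field_simp
    constructor <;>
    · ext u v
      fin_cases i <;> fin_cases u <;> fin_cases v <;>
        simp [famR, famR', Matrix.mul_apply, rCoeff_zero, rCoeff'_zero, rZ, rW, ← map_mul, hq, e1,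
          e2, -map_inv₀]
  constructor
  · simp only [h1', h2']
    have := rtt_of_matSeries q _ _
        (PowerSeries.C (PowerSeries.C τ') * inFst δ' * inSnd δ') var₂ var₁
      (((isUnit_scalar₂ hu').mul (isUnit_inFst hδ')).mul (isUnit_inSnd hδ')) (by ring) (by ring) _ _
      (rttLeft_blockR q hq (PowerSeries.C (PowerSeries.C τ') * var₁ * inFst δ') (inFst δ')
        (PowerSeries.C (PowerSeries.C τ') * var₂ * inSnd δ') (inSnd δ'))
    rwa [matSeries₂_var₁, matSeries₂_var₂] at this
  · simp only [h1, h2]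
    have := rtt_of_matSeries q _ _ (PowerSeries.C (PowerSeries.C τ) * inFst δ * inSnd δ) var₁ var₂
      (((isUnit_scalar₂ hu).mul (isUnit_inFst hδ)).mul (isUnit_inSnd hδ)) (by ring) (by ring) _ _
      (rttLeft_blockR q hq (inFst δ) (PowerSeries.C (PowerSeries.C τ) * var₁ * inFst δ)
        (inSnd δ) (PowerSeries.C (PowerSeries.C τ) * var₂ * inSnd δ))
    rwa [matSeries₂_var₁, matSeries₂_var₂] at this
  · simp only [h1', h2]
    have := rtt_of_matSeries q _ _ (inFst δ' * inSnd δ) 1 (var₁ * var₂)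
      ((isUnit_inFst hδ').mul (isUnit_inSnd hδ)) (by ring)
      (by linear_combination (var₁ * var₂ * inFst δ' * inSnd δ) * scalar₂_mul hτ) _ _
      (rttLeft_blockR q hq (PowerSeries.C (PowerSeries.C τ') * var₁ * inFst δ') (inFst δ')
        (inSnd δ) (PowerSeries.C (PowerSeries.C τ) * var₂ * inSnd δ))
    rwa [matSeries₂_var₁_mul_var₂, map_one, map_one] at this
  · ext u v
    simp [famR', rCoeff'_zero, rW]
  · ext u v
    simp [famR, rCoeff_zero, rZ]
  · exact fun i => (hz i).2
  · exact fun i => (hz i).1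

end EvaluationRep

/-! ### The linear forms of the generators -/

section Restriction

open scoped LaurentPolynomial
open LaurentPolynomial (T)

/-- Polynomial matrices, as Laurent polynomial matrices. -/
def polyMat : Matrix (Fin 2) (Fin 2) (Polynomial ℂ) →ₐ[ℂ] Matrix (Fin 2) (Fin 2) ℂ[T;T⁻¹] :=
  Polynomial.toLaurentAlg.mapMatrix

theorem polyMat_injective : Function.Injective polyMat := by
  intro M N h
  ext1 i j
  exact Polynomial.toLaurent_injective (congrFun (congrFun h i) j)

theorem polyMat_monomial (f : Fin 2 → Fin 2 → ℂ) (n : ℕ) :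
    polyMat (.of fun i j => Polynomial.monomial n (f i j)) =
      .of fun i j => algebraMap ℂ ℂ[T;T⁻¹] (f i j) * T 1 ^ n := by
  ext1 i j
  have : polyMat (.of fun i j => Polynomial.monomial n (f i j)) i j =
    Polynomial.toLaurent (Polynomial.monomial n (f i j)) := rfl
  rw [this, ← Polynomial.C_mul_X_pow_eq_monomial, Polynomial.toLaurent_C_mul_X_pow]
  simp [LaurentPolynomial.T_pow]

/-- A representation by Laurent polynomial matrices, restricted to a subalgebra on which its
values are polynomial. -/
def restrictPoly {q : ℂ} (S : Subalgebra ℂ (Uq q))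
    (ρ : Uq q →ₐ[ℂ] Matrix (Fin 2) (Fin 2) ℂ[T;T⁻¹])
    (h : ∀ x : S, ρ x ∈ polyMat.range) : S →ₐ[ℂ] Matrix (Fin 2) (Fin 2) (Polynomial ℂ) :=
  (AlgEquiv.ofInjective polyMat polyMat_injective).symm.toAlgHom.comp
    ((ρ.comp S.val).codRestrict _ h)

theorem restrictPoly_eq_iff {q : ℂ} {S : Subalgebra ℂ (Uq q)}
    {ρ : Uq q →ₐ[ℂ] Matrix (Fin 2) (Fin 2) ℂ[T;T⁻¹]} {h : ∀ x : S, ρ x ∈ polyMat.range}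
    {x : S} {M : Matrix (Fin 2) (Fin 2) (Polynomial ℂ)} :
    restrictPoly S ρ h x = M ↔ ρ x = polyMat M := by
  refine (AlgEquiv.symm_apply_eq (AlgEquiv.ofInjective polyMat polyMat_injective)).trans ?_
  rw [Subtype.ext_iff]
  rfl

theorem T_mul_T_neg : (T 1 * T (-1) : ℂ[T;T⁻¹]) = 1 := by
  rw [← LaurentPolynomial.T_add]; simp

variable (q : ℂ) [hq : NeZero q]

/-- The evaluation representation attached to the second factor of `R`, over the Laurent
polynomials in the spectral parameter. -/
def evalL : Uq q →ₐ[ℂ] Matrix (Fin 2) (Fin 2) ℂ[T;T⁻¹] := lift (isRTT_famL q hq.ne T_mul_T_neg)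

/-- The evaluation representation attached to the first factor of `R`. -/
def evalR : Uq q →ₐ[ℂ] Matrix (Fin 2) (Fin 2) ℂ[T;T⁻¹] := lift (isRTT_famR q hq.ne T_mul_T_neg)

theorem evalL_tB (a b : Fin 2) (n : ℕ) : evalL q (tB q a b n) =
    polyMat (.of fun i j => Polynomial.monomial n (rCoeff q a b i j n)) := by
  rw [polyMat_monomial]
  exact lift_t _ a b n

theorem evalL_kB (a : Fin 2) : evalL q (kB q a : B q) =
    polyMat (.of fun i j => Polynomial.monomial 0 (rCoeff' q a a i j 0)) := by
  rw [polyMat_monomial]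
  refine (lift_s _ a a 0).trans ?_
  simp [famL']

theorem evalR_sA (i j : Fin 2) (n : ℕ) : evalR q (sA q i j n) =
    polyMat (.of fun b a => Polynomial.monomial n
      ((-1 : ℂ) ^ ((a : ℕ) * (a + b)) * rCoeff q a b i j n)) := by
  rw [polyMat_monomial]
  refine (lift_s _ i j n).trans ?_
  ext1 b a
  simp [famR, Algebra.smul_def, mul_assoc]

theorem evalR_kA_inv (i : Fin 2) : evalR q (((kA q i)⁻¹ : (A q)ˣ) : A q) =
    polyMat (.of fun b a => Polynomial.monomial 0
      ((-1 : ℂ) ^ ((a : ℕ) * (a + b)) * rCoeff' q a b i i 0)) := by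
  rw [polyMat_monomial]
  refine (lift_t _ i i 0).trans ?_
  ext1 b a
  simp [famR', Algebra.smul_def]

theorem evalL_mem_range (b : B q) : evalL q b ∈ polyMat.range := by
  refine B_induction (N := Subalgebra.toSubmodule (polyMat.range.comap ((evalL q).comp (B q).val)))
    (one_mem (polyMat.range.comap ((evalL q).comp (B q).val))) (fun i j n w hw => ?_)
    (fun i w hw => ?_) b
  · exact mul_mem (S := Subalgebra ℂ (B q)) ⟨_, (evalL_tB q i j n).symm⟩ hw
  · exact mul_mem (S := Subalgebra ℂ (B q)) ⟨_, (evalL_kB q i).symm⟩ hw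

theorem evalR_mem_range (a : A q) : evalR q a ∈ polyMat.range := by
  refine A_induction (N := Subalgebra.toSubmodule (polyMat.range.comap ((evalR q).comp (A q).val)))
    (one_mem (polyMat.range.comap ((evalR q).comp (A q).val))) (fun i j n w hw => ?_)
    (fun i w hw => ?_) a
  · exact mul_mem (S := Subalgebra ℂ (A q)) ⟨_, (evalR_sA q i j n).symm⟩ hw
  · exact mul_mem (S := Subalgebra ℂ (A q)) ⟨_, (evalR_kA_inv q i).symm⟩ hw

/-- The representation `T(z) ↦ R(z,w) / (zq - wq⁻¹)` of `B` on the second factor; the entries are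
polynomials in `w`. -/
def repB : B q →ₐ[ℂ] Matrix (Fin 2) (Fin 2) (Polynomial ℂ) :=
  restrictPoly (B q) (evalL q) (evalL_mem_range q)

/-- The representation of `A` obtained from `S(w) ↦ R(z,w) / (zq - wq⁻¹)` by super transposition in
the first factor; the entries are polynomials in `z⁻¹`. -/
def repA : A q →ₐ[ℂ] Matrix (Fin 2) (Fin 2) (Polynomial ℂ) :=
  restrictPoly (A q) (evalR q) (evalR_mem_range q)

theorem repB_tB (a b : Fin 2) (n : ℕ) : repB q (tB q a b n) =
    .of fun i j => Polynomial.monomial n (rCoeff q a b i j n) :=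
  restrictPoly_eq_iff.2 (evalL_tB q a b n)

theorem repB_kB (a : Fin 2) : repB q (kB q a : B q) =
    .of fun i j => Polynomial.monomial 0 (rCoeff' q a a i j 0) :=
  restrictPoly_eq_iff.2 (evalL_kB q a)

theorem repA_sA (i j : Fin 2) (n : ℕ) : repA q (sA q i j n) =
    .of fun b a => Polynomial.monomial n ((-1 : ℂ) ^ ((a : ℕ) * (a + b)) * rCoeff q a b i j n) :=
  restrictPoly_eq_iff.2 (evalR_sA q i j n)

theorem repA_kA_inv (i : Fin 2) : repA q (((kA q i)⁻¹ : (A q)ˣ) : A q) =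
    .of fun b a => Polynomial.monomial 0 ((-1 : ℂ) ^ ((a : ℕ) * (a + b)) * rCoeff' q a b i i 0) :=
  restrictPoly_eq_iff.2 (evalR_kA_inv q i)

theorem sign_mul_self (n : ℕ) : (-1 : ℂ) ^ n * (-1 : ℂ) ^ n = 1 := by
  rw [← mul_pow]; norm_num

/-- The linear form `φ(s_{ij}^{(m)}, ·)` on `B`: the coefficient of `wᵐ` in a matrix entry of
`repB`. -/
def formB (i j : Fin 2) (m : ℕ) : B q →ₗ[ℂ] ℂ :=
  Polynomial.lcoeff ℂ m ∘ₗ Matrix.entryLinearMap ℂ _ i j ∘ₗ (repB q).toLinearMap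

/-- The linear form `φ(·, t_{ab}^{(m)})` on `A`: the coefficient of `z⁻ᵐ` in a matrix entry of
`repA`. -/
def formA (a b : Fin 2) (m : ℕ) : A q →ₗ[ℂ] ℂ :=
  (-1 : ℂ) ^ ((a : ℕ) * (a + b)) •
    (Polynomial.lcoeff ℂ m ∘ₗ Matrix.entryLinearMap ℂ _ b a ∘ₗ (repA q).toLinearMap)

theorem formB_apply (i j : Fin 2) (m : ℕ) (b : B q) :
    formB q i j m b = (repB q b i j).coeff m := rfl

theorem formA_apply (a b : Fin 2) (m : ℕ) (x : A q) :
    formA q a b m x = (-1 : ℂ) ^ ((a : ℕ) * (a + b)) * (repA q x b a).coeff m := rfl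

theorem formB_one (i j : Fin 2) (m : ℕ) : formB q i j m 1 = if i = j ∧ m = 0 then 1 else 0 := by
  rw [formB_apply, map_one]
  by_cases h : i = j <;> simp [Matrix.one_apply, h, Polynomial.coeff_one]

theorem formA_one (a b : Fin 2) (m : ℕ) : formA q a b m 1 = if a = b ∧ m = 0 then 1 else 0 := by
  rw [formA_apply, map_one]
  by_cases h : a = b
  · subst h
    have : Even ((a : ℕ) * (a + a)) := ⟨a * a, by ring⟩
    simp [Polynomial.coeff_one, this.neg_one_pow]
  · simp [Matrix.one_apply, h, Ne.symm h]

theorem formB_tB (i j a b : Fin 2) (m n : ℕ) :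
    formB q i j m (tB q a b n) = if m = n then rCoeff q a b i j n else 0 := by
  rw [formB_apply, repB_tB]
  simp [Polynomial.coeff_monomial, eq_comm]

theorem formB_kB (i j a : Fin 2) (m : ℕ) :
    formB q i j m (kB q a : B q) = if m = 0 then rCoeff' q a a i j 0 else 0 := by
  rw [formB_apply, repB_kB]
  simp only [Matrix.of_apply, Polynomial.coeff_monomial, eq_comm]

theorem formA_sA (i j a b : Fin 2) (m n : ℕ) :
    formA q a b m (sA q i j n) = if m = n then rCoeff q a b i j n else 0 := by
  rw [formA_apply, repA_sA]
  by_cases h : m = n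
  · simp only [h, Matrix.of_apply, Polynomial.coeff_monomial, if_true, ← mul_assoc, sign_mul_self,
      one_mul]
  · simp only [Matrix.of_apply, Polynomial.coeff_monomial, h, Ne.symm h, if_false, mul_zero]

theorem formA_kA_inv (i a b : Fin 2) (m : ℕ) :
    formA q a b m (((kA q i)⁻¹ : (A q)ˣ) : A q) = if m = 0 then rCoeff' q a b i i 0 else 0 := by
  rw [formA_apply, repA_kA_inv]
  by_cases h : m = 0
  · simp only [h, Matrix.of_apply, Polynomial.coeff_monomial, if_true, ← mul_assoc, sign_mul_self,
      one_mul]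
  · simp only [Matrix.of_apply, Polynomial.coeff_monomial, h, Ne.symm h, if_false, mul_zero]

/-- `φ(s_{ij}(z), ·)` is multiplicative in the sense of the coproduct of `s_{ij}(z)`, since it is a
matrix entry of a representation. -/
theorem formB_mul (i j : Fin 2) (m : ℕ) (b b' : B q) : formB q i j m (b * b') =
    ∑ k : Fin 2, ∑ p ∈ antidiagonal m, formB q i k p.1 b * formB q k j p.2 b' := by
  simp only [formB_apply, map_mul, Matrix.mul_apply, Polynomial.finset_sum_coeff,
    Polynomial.coeff_mul]

/-- `φ(·, t_{ab}(z))` is antimultiplicative in the sense of the coproduct of `t_{ab}(z)`; the sign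
comes from the super transposition. -/
theorem formA_mul (a b : Fin 2) (m : ℕ) (x x' : A q) : formA q a b m (x * x') =
    ∑ c : Fin 2, (-1 : ℂ) ^ (((a : ℕ) + c) * ((c : ℕ) + b)) *
      ∑ p ∈ antidiagonal m, formA q a c p.1 x' * formA q c b p.2 x := by
  simp only [formA_apply, map_mul, Matrix.mul_apply, Polynomial.finset_sum_coeff, Finset.mul_sum,
    Polynomial.coeff_mul]
  refine Finset.sum_congr rfl fun c _ => ?_
  rw [← Finset.Nat.sum_antidiagonal_swap]
  refine Finset.sum_congr rfl fun p _ => ?_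
  simp only [Prod.fst_swap, Prod.snd_swap]
  rw [show (-1 : ℂ) ^ ((a : ℕ) * (a + b)) = (-1 : ℂ) ^ (((a : ℕ) + c) * ((c : ℕ) + b) +
    ((a : ℕ) * (a + c) + c * (c + b))) by
      apply sign_congr; simp only [Nat.even_add, Nat.even_mul]; grind]
  rw [pow_add, pow_add]
  ring

end Restriction

/-! ### Convolution operators -/

section Contraction

variable {V W : Type*} [AddCommGroup V] [Module ℂ V] [AddCommGroup W] [Module ℂ W]

/-- The contraction `x ⊗ y ↦ f(x) y`. -/
def contr (f : V →ₗ[ℂ] ℂ) : V ⊗[ℂ] W →ₗ[ℂ] W :=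
  TensorProduct.lift (LinearMap.lsmul ℂ W ∘ₗ f)

theorem contr_tmul (f : V →ₗ[ℂ] ℂ) (x : V) (y : W) : contr f (x ⊗ₜ[ℂ] y) = f x • y := rfl

theorem contr_eps {S : Type*} [Ring S] [Algebra ℂ S] (f : S →ₗ[ℂ] ℂ) (τ : S ⊗[ℂ] S) :
    contr f τ = TensorProduct.lid ℂ S (LinearMap.rTensor S f τ) := by
  induction τ with
  | zero => simp
  | add a b ha hb => simp only [map_add, ha, hb]
  | tmul x y => simp [contr_tmul]

/-- An endomorphism with eigenvectors spanning, of nonzero eigenvalues, is injective. -/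
theorem injective_of_iSup_eigenspace (f : Module.End ℂ V)
    (h : ∀ v, v ∈ ⨆ μ : ℂ, ⨆ _ : μ ≠ 0, f.eigenspace μ) : Function.Injective f := by
  rw [← LinearMap.ker_eq_bot]
  have hd := f.eigenspaces_iSupIndep 0
  rw [show (⨆ μ : ℂ, ⨆ _ : μ ≠ 0, f.eigenspace μ) = ⊤ from eq_top_iff.2 fun v _ => h v,
    disjoint_top, Module.End.eigenspace_zero] at hd
  exact hd

/-- Left multiplication by an eigenvector of nonzero eigenvalue, under an algebra endomorphism. -/
theorem mul_mem_iSup_eigenspace {R : Type*} [Ring R] [Algebra ℂ R] (f : R →ₐ[ℂ] R) {g : R} {c : ℂ}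
    (hc : c ≠ 0) (hg : f g = c • g) {w : R}
    (hw : w ∈ ⨆ μ : ℂ, ⨆ _ : μ ≠ 0, Module.End.eigenspace f.toLinearMap μ) :
    g * w ∈ ⨆ μ : ℂ, ⨆ _ : μ ≠ 0, Module.End.eigenspace f.toLinearMap μ := by
  have : (⨆ μ : ℂ, ⨆ _ : μ ≠ 0, Module.End.eigenspace f.toLinearMap μ) ≤
      (⨆ μ : ℂ, ⨆ _ : μ ≠ 0, Module.End.eigenspace f.toLinearMap μ).comap
        (LinearMap.mulLeft ℂ g) := by
    refine iSup₂_le fun μ hμ x hx => ?_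
    rw [Module.End.mem_eigenspace_iff] at hx
    refine Submodule.mem_iSup_of_mem (c * μ) (Submodule.mem_iSup_of_mem (mul_ne_zero hc hμ) ?_)
    rw [Module.End.mem_eigenspace_iff]
    change f (g * x) = _
    change f x = _ at hx
    rw [map_mul, hg, hx, smul_mul_smul_comm]
    rfl
  exact this hw

theorem one_mem_iSup_eigenspace {R : Type*} [Ring R] [Algebra ℂ R] (f : R →ₐ[ℂ] R) :
    1 ∈ ⨆ μ : ℂ, ⨆ _ : μ ≠ 0, Module.End.eigenspace f.toLinearMap μ := by
  refine Submodule.mem_iSup_of_mem 1 (Submodule.mem_iSup_of_mem one_ne_zero ?_)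
  rw [Module.End.mem_eigenspace_iff]
  simp

end Contraction

section Action

variable {q : ℂ} (S : Subalgebra ℂ (Uq q)) [IsSubBialgebra S]

/-- The operator `x ↦ f(x₁) x₂`. -/
def act (f : S →ₗ[ℂ] ℂ) : S →ₗ[ℂ] S := contr f ∘ₗ cop S

theorem act_apply (f : S →ₗ[ℂ] ℂ) (x : S) : act S f x = contr f (cop S x) := rfl

/-- The algebra endomorphism `x ↦ χ(x₁) x₂`, for a character `χ` vanishing on odd elements. -/
def actHom (χ : S →ₐ[ℂ] ℂ) (hχ : ∀ x, χ (par S x) = χ x) : S →ₐ[ℂ] S :=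
  AlgHom.ofLinearMap (act S χ.toLinearMap)
    (by rw [act_apply, cop_one, contr_tmul]; simp)
    (fun x y => by
      rw [act_apply, act_apply, act_apply, cop_mul]
      generalize cop S x = a
      generalize cop S y = b
      induction a with
      | zero => simp
      | add a a' ha ha' => simp only [map_add, LinearMap.add_apply, add_mul, ha, ha']
      | tmul x y =>
        induction b with
        | zero => simp
        | add b b' hb hb' => simp only [map_add, mul_add, hb, hb']
        | tmul x' y' =>
          rw [superTensorMul_tmul]
          simp only [map_smul, map_add, contr_tmul, AlgHom.toLinearMap_apply, map_mul, hχ, add_mul,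
            sub_mul, smul_mul_smul_comm]
          module)

theorem actHom_apply (χ : S →ₐ[ℂ] ℂ) (hχ : ∀ x, χ (par S x) = χ x) (x : S) :
    actHom S χ hχ x = act S χ.toLinearMap x := rfl

end Action

/-! ### The characters of the group-like generators -/

section Forms

variable (q : ℂ)

theorem rCoeff_of_odd (a b i j : Fin 2) (n : ℕ) (h : ¬ Even ((a : ℕ) + b + i + j)) :
    rCoeff q a b i j n = 0 := by
  have : rZ q a b i j = 0 ∧ rW q a b i j = 0 := by
    revert h
    fin_cases a <;> fin_cases b <;> fin_cases i <;> fin_cases j <;> simp +decide [rZ, rW]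
  simp [rCoeff, this]

theorem sign_mul_rCoeff (a b i j : Fin 2) (n : ℕ) {m m' : ℕ}
    (h : Even ((a : ℕ) + b + i + j) → (Even m ↔ Even m')) :
    (-1 : ℂ) ^ m * rCoeff q a b i j n = (-1 : ℂ) ^ m' * rCoeff q a b i j n := by
  by_cases he : Even ((a : ℕ) + b + i + j)
  · rw [sign_congr (h he)]
  · rw [rCoeff_of_odd q a b i j n he, mul_zero, mul_zero]

theorem rCoeff_diag_zero_of_ne (a i j : Fin 2) (h : i ≠ j) : rCoeff q a a i j 0 = 0 := by
  rw [rCoeff_zero]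
  fin_cases a <;> fin_cases i <;> fin_cases j <;> simp_all [rZ]

theorem rCoeff_diag_zero_of_ne' (a b i : Fin 2) (h : a ≠ b) (n : ℕ) : rCoeff q a b i i n = 0 := by
  apply rCoeff_of_odd
  fin_cases a <;> fin_cases b <;> fin_cases i <;> simp_all +decide

variable [hq : NeZero q]

theorem rCoeff_diag_ne_zero (a i : Fin 2) : rCoeff q a a i i 0 ≠ 0 := by
  have := hq.ne
  rw [rCoeff_zero]
  fin_cases a <;> fin_cases i <;> simp [rZ, this]

theorem rCoeff'_diag (a i : Fin 2) : rCoeff' q a a i i 0 = (rCoeff q a a i i 0)⁻¹ := by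
  have := hq.ne
  rw [rCoeff_zero, rCoeff'_zero]
  fin_cases a <;> fin_cases i <;> simp [rZ, rW, this]

theorem rCoeff'_diag_of_ne (a i j : Fin 2) (h : i ≠ j) : rCoeff' q a a i j 0 = 0 := by
  rw [rCoeff'_zero]
  fin_cases a <;> fin_cases i <;> fin_cases j <;> simp_all [rW]

theorem formB_par (i j : Fin 2) (m : ℕ) (b : B q) :
    formB q i j m (par (B q) b) = (-1 : ℂ) ^ ((i : ℕ) + j) * formB q i j m b := by
  suffices h : ∀ i j m, formB q i j m (par (B q) b) =
    (-1 : ℂ) ^ ((i : ℕ) + j) * formB q i j m b from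
    h i j m
  clear i j m
  refine B_induction (N := ⨅ i : Fin 2, ⨅ j : Fin 2, ⨅ m : ℕ, LinearMap.eqLocus
    (formB q i j m ∘ₗ (par (B q)).toLinearMap)
      ((-1 : ℂ) ^ ((i : ℕ) + j) • formB q i j m)) ?_ ?_ ?_ b
    |> fun h => by simpa using h
  · simp only [Submodule.mem_iInf, LinearMap.mem_eqLocus, LinearMap.comp_apply,
      AlgHom.toLinearMap_apply, map_one, LinearMap.smul_apply, formB_one, smul_eq_mul]
    intro i j m
    split_ifs with h
    · simp [h.1, ← two_mul]
    · simp
  · intro a b n w hw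
    simp only [Submodule.mem_iInf, LinearMap.mem_eqLocus, LinearMap.comp_apply,
      AlgHom.toLinearMap_apply, LinearMap.smul_apply, smul_eq_mul] at hw ⊢
    intro i j m
    rw [map_mul, formB_mul, formB_mul, Finset.mul_sum]
    refine Finset.sum_congr rfl fun k _ => ?_
    rw [Finset.mul_sum]
    refine Finset.sum_congr rfl fun p _ => ?_
    rw [hw, par_tB, map_smul, formB_tB, smul_eq_mul]
    split_ifs with h
    · rw [mul_mul_mul_comm, ← pow_add, ← mul_assoc, sign_mul_rCoeff (m' := i + j)]
      · ring
      · simp only [Nat.even_add]; grind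
    · simp
  · intro a w hw
    simp only [Submodule.mem_iInf, LinearMap.mem_eqLocus, LinearMap.comp_apply,
      AlgHom.toLinearMap_apply, LinearMap.smul_apply, smul_eq_mul] at hw ⊢
    intro i j m
    rw [map_mul, formB_mul, formB_mul, Finset.mul_sum]
    refine Finset.sum_congr rfl fun k _ => ?_
    rw [Finset.mul_sum]
    refine Finset.sum_congr rfl fun p _ => ?_
    rw [hw, par_kB, formB_kB]
    by_cases hik : i = k
    · subst hik; ring
    · rw [rCoeff'_diag_of_ne q a i k hik]; simp

/-- `s₂₁⁽⁰⁾ = 0` pairs to zero with `B`. -/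
theorem formB_one_zero_zero (b : B q) : formB q 1 0 0 b = 0 := by
  refine B_induction (N := LinearMap.ker (formB q 1 0 0)) ?_ ?_ ?_ b
  · simp [formB_one]
  · intro a b n w hw
    have hw : formB q 1 0 0 w = 0 := hw
    change formB q 1 0 0 _ = 0
    rw [formB_mul, Fin.sum_univ_two]
    have : (if 0 = n then rCoeff q a b 1 0 n else 0) = 0 := by
      split_ifs with h
      · subst h; simp [rCoeff_zero, rZ]
      · rfl
    have hp : antidiagonal 0 = {(0, 0)} := rfl
    simp only [hp, Finset.sum_singleton, hw, formB_tB, this, mul_zero, zero_mul, add_zero]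
  · intro a w hw
    have hw : formB q 1 0 0 w = 0 := hw
    change formB q 1 0 0 _ = 0
    rw [formB_mul, Fin.sum_univ_two]
    simp [hw, formB_kB, rCoeff'_diag_of_ne]

/-- `t₁₂⁽⁰⁾ = 0` pairs to zero with `A`. -/
theorem formA_zero_one_zero (x : A q) : formA q 0 1 0 x = 0 := by
  refine A_induction (N := LinearMap.ker (formA q 0 1 0)) ?_ ?_ ?_ x
  · simp [formA_one]
  · intro a b n w hw
    have hw : formA q 0 1 0 w = 0 := hw
    change formA q 0 1 0 _ = 0
    rw [formA_mul, Fin.sum_univ_two]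
    have : (if 0 = n then rCoeff q 0 1 a b n else 0) = 0 := by
      split_ifs with h
      · subst h; simp [rCoeff_zero, rZ]
      · rfl
    have hp : antidiagonal 0 = {(0, 0)} := rfl
    simp only [hp, Finset.sum_singleton, hw, formA_sA, this, mul_zero, zero_mul, add_zero]
  · intro a w hw
    have hw : formA q 0 1 0 w = 0 := hw
    change formA q 0 1 0 _ = 0
    rw [formA_mul, Fin.sum_univ_two]
    have : rCoeff' q 0 1 a a 0 = 0 := by
      rw [rCoeff'_zero]
      fin_cases a <;> simp [rW]
    simp [hw, formA_kA_inv, this]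

/-- The character `φ(s_{ii}^{(0)}, ·)` of `B`. -/
def charB (i : Fin 2) : B q →ₐ[ℂ] ℂ :=
  AlgHom.ofLinearMap (formB q i i 0) (by simp [formB_one]) fun b b' => by
    rw [formB_mul, Fin.sum_univ_two]
    fin_cases i <;> simp [formB_one_zero_zero]

/-- The character `φ(·, t_{ii}^{(0)})` of `A`. -/
def charA (a : Fin 2) : A q →ₐ[ℂ] ℂ :=
  AlgHom.ofLinearMap (formA q a a 0) (by simp [formA_one]) fun b b' => by
    rw [formA_mul, Fin.sum_univ_two]
    fin_cases a <;> simp [formA_zero_one_zero] <;> ring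

theorem charB_apply (i : Fin 2) (b : B q) : charB q i b = formB q i i 0 b := rfl

theorem charA_apply (i : Fin 2) (b : A q) : charA q i b = formA q i i 0 b := rfl

theorem charB_par (i : Fin 2) (b : B q) : charB q i (par (B q) b) = charB q i b := by
  rw [charB_apply, formB_par, ← two_mul, pow_mul]
  simp [charB_apply]

theorem charA_par (i : Fin 2) (x : A q) : charA q i (par (A q) x) = charA q i x := by
  refine A_induction (N := LinearMap.eqLocus ((charA q i).comp (par (A q))).toLinearMap
    (charA q i).toLinearMap) ?_ ?_ ?_ x
  · simp
  · intro a b n w hw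
    have hw : charA q i (par (A q) w) = charA q i w := hw
    change charA q i (par (A q) _) = charA q i _
    rw [map_mul, map_mul, map_mul, hw, par_sA, map_smul, charA_apply, formA_sA, smul_eq_mul]
    by_cases hab : a = b
    · simp [hab, ← two_mul]
    · rw [rCoeff_of_odd]
      · simp
      · fin_cases a <;> fin_cases b <;> fin_cases i <;> simp_all +decide
  · intro a w hw
    have hw : charA q i (par (A q) w) = charA q i w := hw
    change charA q i (par (A q) _) = charA q i _
    rw [map_mul, map_mul, map_mul, hw, par_kA_inv]

end Forms

/-! ### The operators of the generators of `A` on `B` -/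

section Operators

theorem par_pow_two_mul {q : ℂ} (S : Subalgebra ℂ (Uq q)) [IsSubBialgebra S] (n : ℕ) :
    par S ^ (2 * n) = 1 := by
  have h2 : par S ^ 2 = 1 := by
    ext x; exact congrArg _ (par_par S x)
  rw [pow_mul, h2, one_pow]

theorem par_pow_congr {q : ℂ} (S : Subalgebra ℂ (Uq q)) [IsSubBialgebra S] {m n : ℕ}
    (h : Even m ↔ Even n) : par S ^ m = par S ^ n := by
  by_cases hm : Even m
  · obtain ⟨k, rfl⟩ := hm
    obtain ⟨l, rfl⟩ := h.1 ⟨k, rfl⟩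
    rw [← two_mul, ← two_mul, par_pow_two_mul, par_pow_two_mul]
  · obtain ⟨k, rfl⟩ := Nat.not_even_iff_odd.1 hm
    obtain ⟨l, rfl⟩ := Nat.not_even_iff_odd.1 fun hn => hm (h.2 hn)
    rw [pow_add, pow_add, par_pow_two_mul, par_pow_two_mul]

variable (q : ℂ) [hq : NeZero q]

/-- The operator `b ↦ φ(s_{ij}^{(m)}, b₁) b₂` on `B`. -/
def opB (i j : Fin 2) (m : ℕ) : B q →ₗ[ℂ] B q := act (B q) (formB q i j m)

theorem contr_copLeft (f : B q →ₗ[ℂ] ℂ) (τ : B q ⊗[ℂ] B q) :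
    contr f (copLeft q τ) = LinearMap.rTensor (B q) (act (B q) f) τ := by
  induction τ with
  | zero => simp
  | add a b ha hb => simp only [map_add, ha, hb]
  | tmul x y =>
    rw [copLeft_tmul, LinearMap.rTensor_tmul, act_apply]
    generalize cop (B q) x = ξ
    induction ξ with
    | zero => simp
    | add a b ha hb => simp only [map_add, ha, hb, TensorProduct.add_tmul]
    | tmul u v => rw [contr_tmul]; rfl

/-- The operators `b ↦ f(b₁) b₂` are comodule maps, by coassociativity. -/
theorem cop_act (f : B q →ₗ[ℂ] ℂ) (b : B q) :
    cop (B q) (act (B q) f b) = LinearMap.rTensor (B q) (act (B q) f) (cop (B q) b) := by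
  rw [← contr_copLeft, ← coassoc_B, act_apply]
  generalize cop (B q) b = τ
  induction τ with
  | zero => simp
  | add a b ha hb => simp only [map_add, ha, hb]
  | tmul x y => rw [contr_tmul, map_smul]; rfl

theorem act_eps (b : B q) : act (B q) (eps (B q)).toLinearMap b = b := by
  rw [act_apply, contr_eps, lid_rTensor_eps_cop]

theorem contr_formB_superTensorMul (i j : Fin 2) (m : ℕ) (a b : B q ⊗[ℂ] B q) :
    contr (formB q i j m) (superTensorMul (B q) a b) =
      ∑ k : Fin 2, (-1 : ℂ) ^ (((i : ℕ) + k) * ((k : ℕ) + j)) • ∑ p ∈ antidiagonal m,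
        contr (formB q i k p.1) (TensorProduct.map (par (B q) ^ ((k : ℕ) + j)).toLinearMap
          (par (B q) ^ ((k : ℕ) + j)).toLinearMap a) * contr (formB q k j p.2) b := by
  induction a with
  | zero => simp
  | add a a' ha ha' =>
    simp only [map_add, LinearMap.add_apply, add_mul, ha, ha', Finset.sum_add_distrib, smul_add]
  | tmul x y =>
    induction b with
    | zero => simp
    | add b b' hb hb' =>
      simp only [map_add, mul_add, hb, hb', Finset.sum_add_distrib, smul_add]
    | tmul x' y' =>
      have hx : ∀ (i j : Fin 2) (m n : ℕ) (x : B q), formB q i j m ((par (B q) ^ n) x) =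
          (-1 : ℂ) ^ (n * (i + j)) * formB q i j m x := by
        intro i j m n x
        induction n with
        | zero => simp
        | succ n ih =>
          rw [pow_succ', AlgHom.mul_apply, formB_par, ih, ← mul_assoc, ← pow_add]
          congr 2; ring
      rw [superTensorMul_tmul]
      simp only [map_smul, map_add, contr_tmul, formB_mul, formB_par, TensorProduct.map_tmul,
        AlgHom.toLinearMap_apply, hx, add_mul, sub_mul, smul_mul_smul_comm, smul_add, smul_sub,
        Finset.sum_smul, Finset.smul_sum, smul_smul, ← Finset.sum_add_distrib,
        ← Finset.sum_sub_distrib]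
      refine Finset.sum_congr rfl fun k _ => Finset.sum_congr rfl fun p _ => ?_
      have e1 : (-1 : ℂ) ^ ((i : ℕ) * (k + j) + (k : ℕ) * (k + j)) *
          ((-1) ^ ((k : ℕ) * (i + k) + (j : ℕ) * (i + k)) *
          formB q i k p.1 x * formB q k j p.2 x') = formB q i k p.1 x * formB q k j p.2 x' := by
        rw [← add_mul, ← add_mul, mul_comm ((k : ℕ) + j), ← mul_assoc, ← mul_assoc, sign_mul_self,
          one_mul]
      rw [e1]
      by_cases h : Even ((k : ℕ) + j)
      · rw [par_pow_congr (B q) (n := 0) (by simpa using h), h.neg_one_pow]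
        simp only [pow_zero, AlgHom.one_apply, one_mul]
        module
      · have h' : Odd ((k : ℕ) + j) := Nat.not_even_iff_odd.1 h
        rw [par_pow_congr (B q) (n := 1) (by simpa using h'), h'.neg_one_pow]
        simp only [pow_one, neg_mul, one_mul]
        module

/-- The twisted Leibniz rule of the operators `opB`. -/
theorem opB_mul (i j : Fin 2) (m : ℕ) (b b' : B q) : opB q i j m (b * b') =
    ∑ k : Fin 2, (-1 : ℂ) ^ (((i : ℕ) + k) * ((k : ℕ) + j)) • ∑ p ∈ antidiagonal m,
      opB q i k p.1 ((par (B q) ^ ((k : ℕ) + j)) b) * opB q k j p.2 b' := by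
  rw [opB, act_apply, cop_mul, contr_formB_superTensorMul]
  simp only [opB, act_apply, cop_par_pow_B]

theorem opB_par (i j : Fin 2) (m : ℕ) (b : B q) : opB q i j m (par (B q) b) =
    (-1 : ℂ) ^ ((i : ℕ) + j) • par (B q) (opB q i j m b) := by
  rw [opB, act_apply, act_apply, cop_par_B]
  generalize cop (B q) b = τ
  induction τ with
  | zero => simp
  | add a b ha hb => simp only [map_add, ha, hb, smul_add]
  | tmul x y =>
    simp only [TensorProduct.map_tmul, contr_tmul, AlgHom.toLinearMap_apply, formB_par, map_smul,
      smul_smul]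

theorem opB_tB (i j : Fin 2) (m : ℕ) (a b : Fin 2) (n : ℕ) : opB q i j m (tB q a b n) =
    ∑ c : Fin 2, (-1 : ℂ) ^ (((a : ℕ) + c) * ((c : ℕ) + b)) • ∑ p ∈ antidiagonal n,
      formB q i j m (tB q a c p.1) • tB q c b p.2 := by
  rw [opB, act_apply, cop_tB]
  simp only [map_sum, map_smul, contr_tmul]

theorem opB_kB (i j : Fin 2) (m : ℕ) (a : Fin 2) :
    opB q i j m (kB q a) = formB q i j m (kB q a) • (kB q a : B q) := by
  rw [opB, act_apply, cop_kB, contr_tmul]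

theorem opB_diag (i : Fin 2) :
    opB q i i 0 = (actHom (B q) (charB q i) (charB_par q i)).toLinearMap := rfl

theorem opB_diag_tB (i a b : Fin 2) (n : ℕ) :
    opB q i i 0 (tB q a b n) = rCoeff q a a i i 0 • tB q a b n := by
  rw [opB_tB, Finset.sum_eq_single a]
  · rw [Finset.sum_eq_single (0, n)]
    · simp [formB_tB, ← two_mul, mul_assoc, pow_mul]
    · rintro ⟨u, v⟩ h hne
      rw [Finset.HasAntidiagonal.mem_antidiagonal] at h
      have : u ≠ 0 := by rintro rfl; apply hne; simpa using h
      simp [formB_tB, this.symm]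
    · intro h; exact absurd (by simp) h
  · intro c _ hc
    simp only [formB_tB, rCoeff_diag_zero_of_ne' q a c i hc.symm]
    simp
  · simp

/-- The group-like generators act diagonalizably, with nonzero eigenvalues. -/
theorem opB_diag_injective (i : Fin 2) : Function.Injective (opB q i i 0) := by
  rw [opB_diag]
  apply injective_of_iSup_eigenspace
  refine B_induction (one_mem_iSup_eigenspace _) (fun a b n w hw => ?_) fun a w hw => ?_
  · exact mul_mem_iSup_eigenspace _ (rCoeff_diag_ne_zero q a i) (opB_diag_tB q i a b n) hw
  · refine mul_mem_iSup_eigenspace _ (c := rCoeff' q a a i i 0) ?_ ?_ hw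
    · rw [rCoeff'_diag]; exact inv_ne_zero (rCoeff_diag_ne_zero q a i)
    · refine (opB_kB q i i 0 a).trans ?_
      rw [formB_kB, if_pos rfl]

/-- The algebra endomorphism `x ↦ φ(x₁, t_{aa}^{(0)}) x₂` of `A`. -/
def etaA (a : Fin 2) : A q →ₐ[ℂ] A q := actHom (A q) (charA q a) (charA_par q a)

theorem etaA_sA (a i j : Fin 2) (m : ℕ) : etaA q a (sA q i j m) =
    rCoeff q a a i i 0 • sA q i j m := by
  rw [etaA, actHom_apply, act_apply, cop_sA]
  simp only [map_sum, map_smul, contr_tmul, AlgHom.toLinearMap_apply, charA_apply, formA_sA]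
  rw [Finset.sum_eq_single i]
  · rw [Finset.sum_eq_single (0, m)]
    · simp [← two_mul, mul_assoc, pow_mul]
    · rintro ⟨u, v⟩ h hne
      rw [Finset.HasAntidiagonal.mem_antidiagonal] at h
      have : u ≠ 0 := by rintro rfl; apply hne; simpa using h
      simp [this.symm]
    · intro h; exact absurd (by simp) h
  · intro k _ hk
    rw [Finset.sum_eq_zero]
    · simp
    · intro p _
      split_ifs with h
      · rw [← h, rCoeff_diag_zero_of_ne q a i k hk.symm, zero_smul]
      · simp
  · simp

theorem etaA_kA_inv (a i : Fin 2) : etaA q a (((kA q i)⁻¹ : (A q)ˣ) : A q) =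
    rCoeff' q a a i i 0 • (((kA q i)⁻¹ : (A q)ˣ) : A q) := by
  rw [etaA, actHom_apply, act_apply, cop_kA_inv, contr_tmul, AlgHom.toLinearMap_apply, charA_apply,
    formA_kA_inv, if_pos rfl]

theorem etaA_injective (a : Fin 2) : Function.Injective (etaA q a) := by
  apply injective_of_iSup_eigenspace (etaA q a).toLinearMap
  refine A_induction (one_mem_iSup_eigenspace _) (fun i j n w hw => ?_) fun i w hw => ?_
  · exact mul_mem_iSup_eigenspace _ (rCoeff_diag_ne_zero q a i) (etaA_sA q a i j n) hw
  · refine mul_mem_iSup_eigenspace _ (c := rCoeff' q a a i i 0) ?_ (etaA_kA_inv q a i) hw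
    rw [rCoeff'_diag]; exact inv_ne_zero (rCoeff_diag_ne_zero q a i)

theorem etaA_surjective (a : Fin 2) : Function.Surjective (etaA q a) := by
  intro x
  refine A_induction (N := Subalgebra.toSubmodule (etaA q a).range) (one_mem (etaA q a).range)
    (fun i j n w hw => ?_) (fun i w hw => ?_) x
  · refine mul_mem (S := Subalgebra ℂ (A q)) ⟨(rCoeff q a a i i 0)⁻¹ • sA q i j n, ?_⟩ hw
    refine (map_smul (etaA q a) _ _).trans ?_
    rw [etaA_sA, smul_smul, inv_mul_cancel₀ (rCoeff_diag_ne_zero q a i), one_smul]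
  · refine mul_mem (S := Subalgebra ℂ (A q))
      ⟨rCoeff q a a i i 0 • (((kA q i)⁻¹ : (A q)ˣ) : A q), ?_⟩ hw
    refine (map_smul (etaA q a) _ _).trans ?_
    rw [etaA_kA_inv, smul_smul, rCoeff'_diag, mul_inv_cancel₀ (rCoeff_diag_ne_zero q a i), one_smul]

/-- The convolution inverse of the character `φ(·, t_{aa}^{(0)})`, that is the character
`φ(·, s_{aa}^{(0)})`. -/
def charAInv (a : Fin 2) : A q →ₐ[ℂ] ℂ :=
  (eps (A q)).comp (AlgEquiv.ofBijective (etaA q a) ⟨etaA_injective q a, etaA_surjective q a⟩).symm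

theorem charAInv_sA (a i j : Fin 2) (m : ℕ) :
    charAInv q a (sA q i j m) = formB q i j m (kB q a : B q) := by
  have h : (AlgEquiv.ofBijective (etaA q a) ⟨etaA_injective q a, etaA_surjective q a⟩).symm
      (sA q i j m) = (rCoeff q a a i i 0)⁻¹ • sA q i j m := by
    rw [AlgEquiv.symm_apply_eq]
    refine Eq.trans ?_ (map_smul (etaA q a) _ _).symm
    rw [etaA_sA, smul_smul, inv_mul_cancel₀ (rCoeff_diag_ne_zero q a i), one_smul]
  refine (congrArg (eps (A q)) h).trans ?_
  rw [map_smul, eps_sA, formB_kB]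
  by_cases hij : i = j
  · subst hij
    by_cases hm : m = 0 <;> simp [hm, rCoeff'_diag]
  · simp [hij, rCoeff'_diag_of_ne]

end Operators

/-! ### The action of `A` on `B` -/

section Orbit

variable (q : ℂ) [hq : NeZero q]

/-- A linear map `Θ : A → B` with `Θ(1) = b` which intertwines left multiplication by
`s_{ij}^{(m)}` with the operator `opB`. There is exactly one for every `b`, namely `a ↦ a · b` for
the action of `A` on `B`. -/
structure IsOrbitMap (b : B q) (Θ : A q →ₗ[ℂ] B q) : Prop where
  one : Θ 1 = b
  op : ∀ i j m a, opB q i j m (Θ a) = Θ (sA q i j m * a)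

variable {q}

/-- Uniqueness holds because `s_{ii}^{(0)}` acts injectively, so that the action of its inverse is
forced. -/
theorem IsOrbitMap.unique {b : B q} {Θ Θ' : A q →ₗ[ℂ] B q} (h : IsOrbitMap q b Θ)
    (h' : IsOrbitMap q b Θ') : Θ = Θ' := by
  ext1 a
  refine A_induction (N := LinearMap.eqLocus Θ Θ') (h.one.trans h'.one.symm)
    (fun i j m w hw => ?_) (fun i w hw => ?_) a
  · have hw : Θ w = Θ' w := hw
    change Θ _ = Θ' _
    rw [← h.op, ← h'.op, hw]
  · have hw : Θ w = Θ' w := hw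
    change Θ _ = Θ' _
    apply opB_diag_injective q i
    have e : sA q i i 0 * ((((kA q i)⁻¹ : (A q)ˣ) : A q) * w) = w := by
      rw [← mul_assoc]; exact (congrArg (· * w) (kA q i).mul_inv).trans (one_mul w)
    rw [h.op, h'.op, e, hw]

theorem IsOrbitMap.par {b : B q} {Θ : A q →ₗ[ℂ] B q} (h : IsOrbitMap q b Θ) :
    IsOrbitMap q (par (B q) b)
      ((par (B q)).toLinearMap ∘ₗ Θ ∘ₗ (QAffineGL11.par (A q)).toLinearMap) where
  one := by simp [h.one]
  op i j m a := by
    simp only [LinearMap.comp_apply, AlgHom.toLinearMap_apply, map_mul, par_sA, smul_mul_assoc,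
      map_smul]
    rw [opB_par, h.op]

theorem IsOrbitMap.smul {b : B q} {Θ : A q →ₗ[ℂ] B q} (h : IsOrbitMap q b Θ) (r : ℂ) :
    IsOrbitMap q (r • b) (r • Θ) where
  one := by simp [h.one]
  op i j m a := by simp [h.op]

theorem IsOrbitMap.add {b b' : B q} {Θ Θ' : A q →ₗ[ℂ] B q} (h : IsOrbitMap q b Θ)
    (h' : IsOrbitMap q b' Θ') : IsOrbitMap q (b + b') (Θ + Θ') where
  one := by simp [h.one, h'.one]
  op i j m a := by simp [h.op, h'.op]

theorem IsOrbitMap.par_apply {b : B q} {Θ : A q →ₗ[ℂ] B q} (h : IsOrbitMap q b Θ) {p : ℕ}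
    (hb : QAffineGL11.par (B q) b = (-1 : ℂ) ^ p • b) (a : A q) :
    QAffineGL11.par (B q) (Θ a) = (-1 : ℂ) ^ p • Θ (QAffineGL11.par (A q) a) := by
  have h1 := h.par
  rw [hb] at h1
  have := congrArg (fun f => f (QAffineGL11.par (A q) a)) (h1.unique (h.smul _))
  simpa [par_par] using this

theorem IsOrbitMap.par_pow_apply {b : B q} {Θ : A q →ₗ[ℂ] B q} (h : IsOrbitMap q b Θ) {p : ℕ}
    (hb : QAffineGL11.par (B q) b = (-1 : ℂ) ^ p • b) (n : ℕ) (a : A q) :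
    (QAffineGL11.par (B q) ^ n) (Θ a) = (-1 : ℂ) ^ (n * p) • Θ ((QAffineGL11.par (A q) ^ n) a) := by
  induction n with
  | zero => simp
  | succ n ih =>
    rw [pow_succ', AlgHom.mul_apply, ih, map_smul, h.par_apply hb, smul_smul, ← pow_add, pow_succ',
      AlgHom.mul_apply]
    congr 2; ring

/-- The product of orbit maps, reflecting the Leibniz rule `a · (bb') = ± (a₁ · b) (a₂ · b')`. -/
def orbitMul (Θ Θ' : A q →ₗ[ℂ] B q) (p : ℕ) : A q →ₗ[ℂ] B q :=
  LinearMap.mul' ℂ (B q) ∘ₗ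
    TensorProduct.map Θ (Θ' ∘ₗ (par (A q) ^ p).toLinearMap) ∘ₗ cop (A q)

theorem orbitMul_apply (Θ Θ' : A q →ₗ[ℂ] B q) (p : ℕ) (a : A q) : orbitMul Θ Θ' p a =
    LinearMap.mul' ℂ (B q) (TensorProduct.map Θ (Θ' ∘ₗ (par (A q) ^ p).toLinearMap)
      (cop (A q) a)) := rfl

theorem IsOrbitMap.mul {b b' : B q} {Θ Θ' : A q →ₗ[ℂ] B q} (h : IsOrbitMap q b Θ)
    (h' : IsOrbitMap q b' Θ') {p : ℕ} (hb : QAffineGL11.par (B q) b = (-1 : ℂ) ^ p • b) :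
    IsOrbitMap q (b * b') (orbitMul Θ Θ' p) where
  one := by
    rw [orbitMul_apply, cop_one]
    simp [h.one, h'.one]
  op i j m a := by
    rw [orbitMul_apply, orbitMul_apply, cop_sA_mul]
    generalize cop (A q) a = τ
    induction τ with
    | zero => simp
    | add a b ha hb => simp only [map_add, ha, hb, Finset.sum_add_distrib, smul_add]
    | tmul x y =>
      simp only [map_sum, map_smul, TensorProduct.map_tmul, LinearMap.mul'_apply, opB_mul,
        LinearMap.comp_apply, AlgHom.toLinearMap_apply, LinearMap.mulLeft_apply, map_mul]
      refine Finset.sum_congr rfl fun k _ => congrArg _ (Finset.sum_congr rfl fun r _ => ?_)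
      rw [h.par_pow_apply hb, map_smul, h.op, h'.op, QAffineGL11.par_pow_apply (par_sA q k j r.2),
        smul_mul_assoc, smul_mul_assoc, map_smul, mul_smul_comm, mul_comm p]

theorem isOrbitMap_one : IsOrbitMap q 1
    ((Algebra.linearMap ℂ (B q)) ∘ₗ (eps (A q)).toLinearMap) where
  one := by simp
  op i j m a := by
    simp only [LinearMap.comp_apply, AlgHom.toLinearMap_apply, Algebra.linearMap_apply,
      Algebra.algebraMap_eq_smul_one, map_smul, map_mul, eps_sA]
    rw [opB, act_apply, cop_one, contr_tmul, formB_one, smul_mul_smul_comm, one_mul,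
      smul_smul, mul_comm]

/-- The orbit map of `s_{aa}^{(0)}`: the generators of `A` act on it through the convolution inverse
of `φ(·, t_{aa}^{(0)})`. -/
theorem isOrbitMap_kB (a : Fin 2) :
    IsOrbitMap q (kB q a) ((charAInv q a).toLinearMap.smulRight (kB q a : B q)) where
  one := by simp
  op i j m x := by
    simp only [LinearMap.smulRight_apply, AlgHom.toLinearMap_apply, map_smul, map_mul, charAInv_sA,
      opB_kB]
    rw [mul_smul, smul_comm]

/-- The orbit map of `t_{ab}^{(n)}` is `a ↦ φ(a, (t_{ab}^{(n)})₁) (t_{ab}^{(n)})₂`. -/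
theorem isOrbitMap_tB (a b : Fin 2) (n : ℕ) :
    IsOrbitMap q (tB q a b n) (∑ c : Fin 2, (-1 : ℂ) ^ (((a : ℕ) + c) * ((c : ℕ) + b)) •
      ∑ p ∈ antidiagonal n, (formA q a c p.1).smulRight (tB q c b p.2)) where
  one := by
    simp only [LinearMap.sum_apply, LinearMap.smul_apply, LinearMap.smulRight_apply, formA_one]
    rw [Finset.sum_eq_single a]
    · rw [Finset.sum_eq_single (0, n)]
      · simp [← two_mul, mul_assoc, pow_mul]
      · rintro ⟨u, v⟩ h hne
        rw [Finset.HasAntidiagonal.mem_antidiagonal] at h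
        have : u ≠ 0 := by rintro rfl; apply hne; simpa using h
        simp [this]
      · intro h; exact absurd (by simp) h
    · intro c _ hc
      simp [hc.symm]
    · simp
  op i j m x := by
    simp only [LinearMap.sum_apply, LinearMap.smul_apply, LinearMap.smulRight_apply, map_sum,
      map_smul, opB_tB, formA_mul, Finset.smul_sum, Finset.sum_smul, smul_smul, Finset.mul_sum,
      formB_tB, formA_sA]
    have e : ∀ (c d : Fin 2), ∑ p ∈ antidiagonal n, ∑ r ∈ antidiagonal p.2,
        ((-1 : ℂ) ^ (((a : ℕ) + c) * ((c : ℕ) + b)) * (formA q a c p.1 x *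
          ((-1 : ℂ) ^ (((c : ℕ) + d) * ((d : ℕ) + b)) *
            if m = r.1 then rCoeff q c d i j r.1 else 0))) • tB q d b r.2 =
      ∑ p ∈ antidiagonal n, ∑ r ∈ antidiagonal p.1,
        ((-1 : ℂ) ^ (((a : ℕ) + d) * ((d : ℕ) + b)) * ((-1 : ℂ) ^ (((a : ℕ) + c) * ((c : ℕ) + d)) *
          (formA q a c r.1 x * if r.2 = m then rCoeff q c d i j m else 0))) • tB q d b p.2 := by
      intro c d
      rw [sum_antidiagonal_assoc (fun u v w => ((-1 : ℂ) ^ (((a : ℕ) + c) * ((c : ℕ) + b)) *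
        (formA q a c u x * ((-1 : ℂ) ^ (((c : ℕ) + d) * ((d : ℕ) + b)) *
            if m = v then rCoeff q c d i j v else 0))) • tB q d b w)]
      refine Finset.sum_congr rfl fun p _ => Finset.sum_congr rfl fun r _ => ?_
      congr 1
      by_cases hm : m = r.2
      · subst hm
        have : (-1 : ℂ) ^ (((a : ℕ) + c) * ((c : ℕ) + b)) * (-1 : ℂ) ^
            (((c : ℕ) + d) * ((d : ℕ) + b))
          = (-1 : ℂ) ^ (((a : ℕ) + d) * ((d : ℕ) + b)) * (-1 : ℂ) ^
            (((a : ℕ) + c) * ((c : ℕ) + d)) := by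
          rw [← pow_add, ← pow_add]
          apply sign_congr
          simp only [Nat.even_add, Nat.even_mul]
          grind
        simp only [if_true]
        linear_combination (formA q a c r.1 x * rCoeff q c d i j r.2) * this
      · simp [hm, Ne.symm hm]
    simp only [Finset.sum_comm (s := antidiagonal n) (t := Finset.univ), mul_assoc]
    rw [Finset.sum_comm]
    exact Finset.sum_congr rfl fun d _ => Finset.sum_congr rfl fun c _ => e c d

/-- Orbit maps exist for the generators of `B` and are multiplicative on homogeneous elements, so
they exist for all words. In particular the operators `opB` satisfy the relations of the
`s_{ij}^{(m)}`. -/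
theorem exists_isOrbitMap (b : B q) : ∃ Θ, IsOrbitMap q b Θ := by
  have hmem := B_mem_span_words (p := fun w => (∃ n : ℕ, par (B q) w = (-1 : ℂ) ^ n • w) ∧
    ∃ Θ, IsOrbitMap q w Θ) ⟨⟨0, by simp⟩, _, isOrbitMap_one⟩ ?_ ?_ b
  · induction hmem using Submodule.span_induction with
    | mem w hw => exact hw.2
    | zero =>
      obtain h := (isOrbitMap_one (q := q)).smul 0
      rw [zero_smul] at h
      exact ⟨_, h⟩
    | add u v _ _ hu hv => exact ⟨_, hu.choose_spec.add hv.choose_spec⟩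
    | smul r u _ hu => exact ⟨_, hu.choose_spec.smul r⟩
  · rintro i j n w ⟨⟨e, he⟩, Θ, hΘ⟩
    refine ⟨⟨i + j + e, ?_⟩, _, (isOrbitMap_tB i j n).mul hΘ (par_tB q i j n)⟩
    rw [map_mul, par_tB, he, smul_mul_smul_comm, pow_add _ (_ + _)]
  · rintro i w ⟨⟨e, he⟩, Θ, hΘ⟩
    refine ⟨⟨e, ?_⟩, _, (isOrbitMap_kB i).mul hΘ (p := 0) (by rw [par_kB]; simp)⟩
    rw [map_mul, par_kB, he, mul_smul_comm]

/-- The orbit map `a ↦ a · b` of `b ∈ B`. -/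
def orbitMap (b : B q) : A q →ₗ[ℂ] B q := (exists_isOrbitMap b).choose

theorem isOrbitMap (b : B q) : IsOrbitMap q b (orbitMap b) := (exists_isOrbitMap b).choose_spec

variable (q) in
/-- The action of the algebra `A` on `B` by `a · b = φ(a, b₁) b₂`; it is constructed before `φ`. -/
def opAct : A q →ₐ[ℂ] Module.End ℂ (B q) where
  toFun a :=
    { toFun := fun b => orbitMap b a
      map_add' := fun b b' => congrArg (fun f => f a)
        ((isOrbitMap (b + b')).unique ((isOrbitMap b).add (isOrbitMap b')))
      map_smul' := fun r b => congrArg (fun f => f a)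
        ((isOrbitMap (r • b)).unique ((isOrbitMap b).smul r)) }
  map_one' := by
    ext1 b
    exact (isOrbitMap b).one
  map_mul' a a' := by
    ext1 b
    have h : IsOrbitMap q (orbitMap b a') (orbitMap b ∘ₗ (LinearMap.mulRight ℂ a')) :=
      ⟨by simp, fun i j m a => by simp [(isOrbitMap b).op, mul_assoc]⟩
    exact (congrArg (fun f => f a) ((isOrbitMap (orbitMap b a')).unique h)).symm
  map_zero' := by
    ext1 b
    exact map_zero (orbitMap b)
  map_add' a a' := by
    ext1 b
    exact map_add (orbitMap b) a a'
  commutes' r := by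
    ext1 b
    change orbitMap b _ = r • b
    rw [Algebra.algebraMap_eq_smul_one, map_smul, (isOrbitMap b).one]

theorem opAct_apply (a : A q) (b : B q) : opAct q a b = orbitMap b a := rfl

theorem opAct_sA (i j : Fin 2) (m : ℕ) : opAct q (sA q i j m) = opB q i j m := by
  ext1 b
  rw [opAct_apply, ← mul_one (sA q i j m), ← (isOrbitMap b).op, (isOrbitMap b).one]

theorem par_opAct (a : A q) (b : B q) :
    par (B q) (opAct q a b) = opAct q (par (A q) a) (par (B q) b) := by
  rw [opAct_apply, opAct_apply, (isOrbitMap (par (B q) b)).unique (isOrbitMap b).par]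
  simp [par_par]

/-- The Leibniz rule `a · (bb') = (-1)^{|a₂||b|} (a₁ · b) (a₂ · b')`, for `b` of parity `p`. -/
theorem opAct_mul (a : A q) {b : B q} (b' : B q) {p : ℕ} (hb : par (B q) b = (-1 : ℂ) ^ p • b) :
    opAct q a (b * b') = orbitMul (orbitMap b) (orbitMap b') p a := by
  rw [opAct_apply, (isOrbitMap (b * b')).unique ((isOrbitMap b).mul (isOrbitMap b') hb)]

theorem opAct_one (a : A q) : opAct q a 1 = eps (A q) a • 1 := by
  rw [opAct_apply, (isOrbitMap 1).unique isOrbitMap_one]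
  simp [Algebra.algebraMap_eq_smul_one]

/-- The action of `A` commutes with the right coaction of `B` on itself. -/
theorem cop_opAct (a : A q) (b : B q) :
    cop (B q) (opAct q a b) = LinearMap.rTensor (B q) (opAct q a) (cop (B q) b) := by
  suffices h : ∀ b, cop (B q) (opAct q a b) = LinearMap.rTensor (B q) (opAct q a) (cop (B q) b) from
    h b
  clear b
  have hlin : ∀ b : B q, ∀ τ : B q ⊗[ℂ] B q, ∃ f : A q →ₗ[ℂ] B q ⊗[ℂ] B q,
      ∀ a, f a = LinearMap.rTensor (B q) (opAct q a) τ := fun b τ =>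
    ⟨(LinearMap.applyₗ τ) ∘ₗ LinearMap.rTensorHom (B q) ∘ₗ (opAct q).toLinearMap, fun a => rfl⟩
  choose f hf using fun b : B q => hlin b (cop (B q) b)
  intro b
  rw [← hf]
  refine A_induction (N := LinearMap.eqLocus (cop (B q) ∘ₗ orbitMap b) (f b)) ?_ ?_ ?_ a
  · change cop (B q) (orbitMap b 1) = f b 1
    rw [(isOrbitMap b).one, hf, map_one]
    exact (LinearMap.rTensor_id_apply _ _ _).symm
  · intro i j m w hw
    have hw : cop (B q) (opAct q w b) = f b w := hw
    change cop (B q) (opAct q _ b) = f b _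
    rw [hf] at hw ⊢
    rw [map_mul, Module.End.mul_apply, opAct_sA, opB, cop_act, hw, Module.End.mul_eq_comp,
      LinearMap.rTensor_comp_apply]
  · intro i w hw
    have hw : cop (B q) (opAct q w b) = f b w := hw
    change cop (B q) (opAct q _ b) = f b _
    rw [hf] at hw ⊢
    apply Module.Flat.rTensor_preserves_injective_linearMap (M := B q) _ (opB_diag_injective q i)
    have hk : opAct q (sA q i i 0) * opAct q ((((kA q i)⁻¹ : (A q)ˣ) : A q) * w) = opAct q w := by
      rw [← map_mul, ← mul_assoc]
      exact congrArg _ ((congrArg (· * w) (kA q i).mul_inv).trans (one_mul w))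
    rw [← LinearMap.rTensor_comp_apply, opB, ← cop_act, ← opB, ← opAct_sA,
      ← Module.End.mul_eq_comp, hk, ← Module.End.mul_apply, hk, hw]

end Orbit

/-! ### Existence and uniqueness of the pairing -/

section Pairing

variable (q : ℂ)

theorem mem_homog_iff {S : Subalgebra ℂ (Uq q)} [IsSubBialgebra S] {x : S} {i : ZMod 2} :
    (x : Uq q) ∈ homog q i ↔ par S x = (-1 : ℂ) ^ i.val • x := by
  rw [mem_homog, Subtype.ext_iff]
  rfl

theorem eq_cop {S : Subalgebra ℂ (Uq q)} [IsSubBialgebra S] {x : S} {τ : S ⊗[ℂ] S}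
    (h : tensorIncl q S τ = comul q x) : τ = cop S x := ((cop_eq_iff S).2 h).symm

variable [hq : NeZero q]

/-- The Hopf pairing `φ(a, b) = ε(a · b)`. -/
def pairing : A q →ₗ[ℂ] B q →ₗ[ℂ] ℂ :=
  (LinearMap.compRight ℂ (eps (B q)).toLinearMap) ∘ₗ (opAct q).toLinearMap

variable {q}

theorem pairing_apply (a : A q) (b : B q) : pairing q a b = eps (B q) (opAct q a b) := rfl

theorem opAct_eq_act (a : A q) (b : B q) : opAct q a b = act (B q) (pairing q a) b := by
  rw [← act_eps q (opAct q a b), act_apply, act_apply, cop_opAct]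
  generalize cop (B q) b = τ
  induction τ with
  | zero => simp
  | add a b ha hb => simp only [map_add, ha, hb]
  | tmul x y => rfl

theorem pairing_par (a : A q) (b : B q) : pairing q (par (A q) a) (par (B q) b) =
    pairing q a b := by
  rw [pairing_apply, ← par_opAct, eps_par, pairing_apply]

theorem pairing_mul (a a' : A q) (b : B q) : pairing q (a * a') b = pairing q a (opAct q a' b) := by
  rw [pairing_apply, map_mul, Module.End.mul_apply, pairing_apply]

theorem pairing_sA_tB (i j a b : Fin 2) (m n : ℕ) :
    pairing q (sA q i j m) (tB q a b n) = if m = n then rCoeff q a b i j n else 0 := by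
  rw [pairing_apply, opAct_sA, opB_tB]
  simp only [map_sum, map_smul, eps_tB]
  rw [Finset.sum_eq_single b]
  · rw [Finset.sum_eq_single (n, 0)]
    · simp only [true_and, if_true, smul_eq_mul, mul_one, formB_tB]
      rw [← two_mul (b : ℕ), mul_left_comm, pow_mul]
      simp
    · rintro ⟨u, v⟩ h hne
      rw [Finset.HasAntidiagonal.mem_antidiagonal] at h
      have : v ≠ 0 := by rintro rfl; apply hne; simpa using h
      simp [this]
    · intro h; exact absurd (by simp) h
  · intro c _ hc
    simp [hc]
  · simp

theorem isHopfPairing_pairing : IsHopfPairing q (pairing q) where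
  even i j a b ha hb hij := by
    rw [mem_homog_iff] at ha hb
    have h := pairing_par a b
    rw [ha, hb, map_smul, map_smul, LinearMap.smul_apply, smul_smul, smul_eq_mul] at h
    have : (-1 : ℂ) ^ j.val * (-1 : ℂ) ^ i.val = -1 := by
      revert hij; clear ha hb h; fin_cases i <;> fin_cases j <;> intro hij <;>
        first | exact absurd rfl hij | simp [ZMod.val]
    rw [this] at h
    linear_combination (-1 / 2 : ℂ) * h
  apply_mul i j a b b' hb hb' τ hτ := by
    rw [mem_homog_iff] at hb hb'
    rw [pairing_apply, opAct_mul a b' hb, orbitMul_apply, eq_cop q hτ]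
    generalize cop (A q) a = τ
    induction τ with
    | zero => simp
    | add a b ha hb => simp only [map_add, ha, hb, mul_add]
    | tmul x y =>
      simp only [TensorProduct.map_tmul, LinearMap.mul'_apply, map_mul, LinearMap.comp_apply,
        AlgHom.toLinearMap_apply, tensorEval, LinearMap.flip_apply]
      have h : ∀ n, pairing q ((par (A q) ^ n) y) b' = (-1 : ℂ) ^ (n * j.val) * pairing q y b' := by
        intro n
        induction n with
        | zero => simp
        | succ n ih =>
          have h := pairing_par ((par (A q) ^ n) y) b'
          rw [hb', map_smul, ih, smul_eq_mul] at h
          rw [pow_succ', AlgHom.mul_apply, add_mul, pow_add, mul_comm (_ ^ _) (_ ^ _), mul_assoc,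
            ← h, ← mul_assoc, one_mul, sign_mul_self, one_mul]
      have h' := h i.val
      simp only [pairing_apply, opAct_apply] at h' ⊢
      rw [h']
      ring
  apply_one a := by
    rw [pairing_apply, opAct_one, map_smul, map_one, smul_eq_mul, mul_one]
    rfl
  mul_apply a a' b τ hτ := by
    rw [pairing_mul, opAct_eq_act, act_apply, eq_cop q hτ]
    generalize cop (B q) b = τ
    induction τ with
    | zero => simp
    | add a b ha hb => simp only [map_add, ha, hb]
    | tmul x y => simp [contr_tmul, tensorEval]
  one_apply b := by
    rw [pairing_apply, map_one]; rfl
  normalization i j a b m n := pairing_sA_tB i j a b m n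

section Uniqueness

variable {φ ψ : A q →ₗ[ℂ] B q →ₗ[ℂ] ℂ}

theorem IsHopfPairing.apply_mul' (h : IsHopfPairing q φ) (a : A q) {b b' : B q} {e e' : ℕ}
    (hb : par (B q) b = (-1 : ℂ) ^ e • b) (hb' : par (B q) b' = (-1 : ℂ) ^ e' • b') :
    φ a (b * b') = (-1 : ℂ) ^ (e * e') * tensorEval (φ.flip b) (φ.flip b') (cop (A q) a) := by
  have hm : ∀ {x : B q} {n : ℕ}, par (B q) x = (-1 : ℂ) ^ n • x →
      (x : Uq q) ∈ homog q (n : ZMod 2) := by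
    intro x n hx
    rw [mem_homog_iff, ZMod.val_natCast, ← neg_one_pow_eq_pow_mod_two, hx]
  rw [h.apply_mul _ _ a b b' (hm hb) (hm hb') _ (tensorIncl_cop (A q) a)]
  congr 1
  apply sign_congr
  rw [ZMod.val_natCast, ZMod.val_natCast, Nat.even_iff, Nat.even_iff, ← Nat.mul_mod]

theorem IsHopfPairing.mul_apply' (h : IsHopfPairing q φ) (a a' : A q) (b : B q) :
    φ (a * a') b = tensorEval (φ a') (φ a) (cop (B q) b) :=
  h.mul_apply a a' b _ (tensorIncl_cop (B q) b)

theorem IsHopfPairing.sA_tB (h : IsHopfPairing q φ) (i j a b : Fin 2) (m n : ℕ) :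
    φ (sA q i j m) (tB q a b n) = if m = n then rCoeff q a b i j n else 0 :=
  h.normalization i j a b m n

theorem tensorEval_tmul {V : Type*} [AddCommGroup V] [Module ℂ V] (f g : V →ₗ[ℂ] ℂ) (x y : V) :
    tensorEval f g (x ⊗ₜ y) = f x * g y := by
  simp [tensorEval]

theorem IsHopfPairing.sA_kB (h : IsHopfPairing q φ) (i j a : Fin 2) (m : ℕ) :
    φ (sA q i j m) (kB q a : B q) = if i = j ∧ m = 0 then (rCoeff q a a i i 0)⁻¹ else 0 := by
  have h1 := h.apply_one (sA q i j m)
  rw [show (1 : B q) = tB q a a 0 * kB q a from (kB q a).inv_mul.symm,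
    h.apply_mul' (e := 0) (e' := 0) _ (by rw [par_tB]; simp [← two_mul]) (by rw [par_kB]; simp),
    cop_sA] at h1
  simp only [map_sum, map_smul, tensorEval_tmul, LinearMap.flip_apply, h.sA_tB] at h1
  rw [Finset.sum_eq_single i, Finset.sum_eq_single (0, m)] at h1
  · have e : counit q (sA q i j m : Uq q) = _ := eps_sA q i j m
    rw [e] at h1
    have hne := rCoeff_diag_ne_zero q a i
    simp [← two_mul, mul_assoc, pow_mul] at h1
    split_ifs at h1 ⊢ with hc
    · field_simp; linear_combination h1
    · simpa [hne] using h1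
  · rintro ⟨u, v⟩ hp hne
    rw [Finset.HasAntidiagonal.mem_antidiagonal] at hp
    have : u ≠ 0 := by rintro rfl; apply hne; simpa using hp
    simp [this]
  · intro h; exact absurd (by simp) h
  · intro k _ hk
    rw [Finset.sum_eq_zero]
    · simp
    · intro p _
      split_ifs with hc
      · rw [rCoeff_diag_zero_of_ne q a i k hk.symm, zero_mul]
      · simp
  · simp

theorem IsHopfPairing.kA_inv_tB (h : IsHopfPairing q φ) (i a b : Fin 2) (n : ℕ) :
    φ (((kA q i)⁻¹ : (A q)ˣ) : A q) (tB q a b n) =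
      if a = b ∧ n = 0 then (rCoeff q a a i i 0)⁻¹ else 0 := by
  have h1 := h.one_apply (tB q a b n)
  rw [show (1 : A q) = (((kA q i)⁻¹ : (A q)ˣ) : A q) * sA q i i 0 from (kA q i).inv_mul.symm,
    h.mul_apply', cop_tB] at h1
  simp only [map_sum, map_smul, tensorEval_tmul, h.sA_tB] at h1
  rw [Finset.sum_eq_single a, Finset.sum_eq_single (0, n)] at h1
  · have e : counit q (tB q a b n : Uq q) = _ := eps_tB q a b n
    rw [e] at h1
    have hne := rCoeff_diag_ne_zero q a i
    simp [← two_mul, mul_assoc, pow_mul] at h1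
    split_ifs at h1 ⊢ with hc
    · field_simp; linear_combination h1
    · simpa [hne] using h1
  · rintro ⟨u, v⟩ hp hne
    rw [Finset.HasAntidiagonal.mem_antidiagonal] at hp
    have : u ≠ 0 := by rintro rfl; apply hne; simpa using hp
    simp [Ne.symm this]
  · intro h; exact absurd (by simp) h
  · intro k _ hk
    rw [Finset.sum_eq_zero]
    · simp
    · intro p _
      split_ifs with hc
      · rw [rCoeff_diag_zero_of_ne' q a k i hk.symm, zero_mul]
      · simp
  · simp

theorem IsHopfPairing.kA_inv_mul (h : IsHopfPairing q φ) (i : Fin 2) {b b' : B q} {e e' : ℕ}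
    (hb : par (B q) b = (-1 : ℂ) ^ e • b) (hb' : par (B q) b' = (-1 : ℂ) ^ e' • b') :
    φ (((kA q i)⁻¹ : (A q)ˣ) : A q) (b * b') = (-1 : ℂ) ^ (e * e') *
      (φ (((kA q i)⁻¹ : (A q)ˣ) : A q) b * φ (((kA q i)⁻¹ : (A q)ˣ) : A q) b') := by
  rw [h.apply_mul' _ hb hb', cop_kA_inv, tensorEval_tmul]; rfl

theorem IsHopfPairing.kA_inv_kB (h : IsHopfPairing q φ) (i a : Fin 2) :
    φ (((kA q i)⁻¹ : (A q)ˣ) : A q) (kB q a : B q) = rCoeff q a a i i 0 := by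
  have h1 := h.apply_one (((kA q i)⁻¹ : (A q)ˣ) : A q)
  have e : counit q ((((kA q i)⁻¹ : (A q)ˣ) : A q) : Uq q) = 1 := (lift_t _ i i 0).trans (by simp)
  rw [show (1 : B q) = tB q a a 0 * kB q a from (kB q a).inv_mul.symm,
    h.kA_inv_mul i (e := 0) (e' := 0) (by rw [par_tB]; simp [← two_mul]) (by rw [par_kB]; simp),
    h.kA_inv_tB, e] at h1
  have hne := rCoeff_diag_ne_zero q a i
  simp at h1
  field_simp at h1
  exact h1

/-- A Hopf pairing is determined by its values on generators: on the generators of `A` by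
multiplicativity in `B`, then on `A` by multiplicativity in `A`. The values on the inverses of the
`s_{ii}^{(0)}` are forced. -/
theorem IsHopfPairing.unique (h : IsHopfPairing q φ) (h' : IsHopfPairing q ψ) : φ = ψ := by
  have hs : ∀ b i j m, φ (sA q i j m) b = ψ (sA q i j m) b := by
    intro b
    have hmem := B_mem_span_words (p := fun w => (∃ n : ℕ, par (B q) w = (-1 : ℂ) ^ n • w) ∧
      ∀ i j m, φ (sA q i j m) w = ψ (sA q i j m) w) ⟨⟨0, by simp⟩, ?_⟩ ?_ ?_ b
    · induction hmem using Submodule.span_induction with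
      | mem w hw => exact hw.2
      | zero => simp
      | add u v _ _ hu hv => simp [hu, hv]
      | smul r u _ hu => simp [hu]
    · intro i j m
      rw [h.apply_one, h'.apply_one]
    · rintro a b n w ⟨⟨e, he⟩, hw⟩
      refine ⟨⟨a + b + e, by rw [map_mul, par_tB, he, smul_mul_smul_comm, pow_add _ (_ + _)]⟩, ?_⟩
      intro i j m
      rw [h.apply_mul' _ (par_tB q a b n) he, h'.apply_mul' _ (par_tB q a b n) he, cop_sA]
      simp only [map_sum, map_smul, tensorEval_tmul, LinearMap.flip_apply, h.sA_tB, h'.sA_tB, hw]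
    · rintro a w ⟨⟨e, he⟩, hw⟩
      refine ⟨⟨e, by rw [map_mul, par_kB, he, mul_smul_comm]⟩, fun i j m => ?_⟩
      have hk : par (B q) (kB q a : B q) = (-1 : ℂ) ^ 0 • (kB q a : B q) := by rw [par_kB]; simp
      rw [h.apply_mul' _ hk he, h'.apply_mul' _ hk he, cop_sA]
      simp only [map_sum, map_smul, tensorEval_tmul, LinearMap.flip_apply, h.sA_kB, h'.sA_kB, hw]
  have hk : ∀ b i, φ (((kA q i)⁻¹ : (A q)ˣ) : A q) b = ψ (((kA q i)⁻¹ : (A q)ˣ) : A q) b := by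
    intro b
    have hmem := B_mem_span_words (p := fun w => (∃ n : ℕ, par (B q) w = (-1 : ℂ) ^ n • w) ∧
      ∀ i, φ (((kA q i)⁻¹ : (A q)ˣ) : A q) w = ψ (((kA q i)⁻¹ : (A q)ˣ) : A q) w)
      ⟨⟨0, by simp⟩, ?_⟩ ?_ ?_ b
    · induction hmem using Submodule.span_induction with
      | mem w hw => exact hw.2
      | zero => simp
      | add u v _ _ hu hv => simp [hu, hv]
      | smul r u _ hu => simp [hu]
    · intro i
      rw [h.apply_one, h'.apply_one]
    · rintro a b n w ⟨⟨e, he⟩, hw⟩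
      refine ⟨⟨a + b + e, by rw [map_mul, par_tB, he, smul_mul_smul_comm, pow_add _ (_ + _)]⟩, ?_⟩
      intro i
      rw [h.kA_inv_mul i (par_tB q a b n) he, h'.kA_inv_mul i (par_tB q a b n) he, h.kA_inv_tB,
        h'.kA_inv_tB, hw]
    · rintro a w ⟨⟨e, he⟩, hw⟩
      refine ⟨⟨e, by rw [map_mul, par_kB, he, mul_smul_comm]⟩, fun i => ?_⟩
      have hk : par (B q) (kB q a : B q) = (-1 : ℂ) ^ 0 • (kB q a : B q) := by rw [par_kB]; simp
      rw [h.kA_inv_mul i hk he, h'.kA_inv_mul i hk he, h.kA_inv_kB, h'.kA_inv_kB, hw]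
  ext1 a
  refine A_induction (N := LinearMap.eqLocus φ ψ) ?_ (fun i j m w hw => ?_) (fun i w hw => ?_) a
  · change φ 1 = ψ 1
    ext1 b
    rw [h.one_apply, h'.one_apply]
  · have hw : φ w = ψ w := hw
    change φ _ = ψ _
    ext1 b
    rw [h.mul_apply', h'.mul_apply', hw, show φ (sA q i j m) = ψ (sA q i j m) from
      LinearMap.ext fun b => hs b i j m]
  · have hw : φ w = ψ w := hw
    change φ _ = ψ _
    ext1 b
    rw [h.mul_apply', h'.mul_apply', hw, show φ (((kA q i)⁻¹ : (A q)ˣ) : A q) = ψ _ from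
      LinearMap.ext fun b => hk b i]

end Uniqueness

theorem existsUnique_isHopfPairing : ∃! φ : A q →ₗ[ℂ] B q →ₗ[ℂ] ℂ, IsHopfPairing q φ :=
  ⟨pairing q, isHopfPairing_pairing, fun _ h => h.unique isHopfPairing_pairing⟩

end Pairing

/-! ### Logarithms of power series -/

section Logarithm

theorem sum_antidiagonal_four {M : Type*} [AddCommMonoid M] (n : ℕ) (f : ℕ → ℕ → ℕ → ℕ → M) :
    ∑ p ∈ antidiagonal n, ∑ r ∈ antidiagonal p.2, ∑ s ∈ antidiagonal p.1, f s.1 s.2 r.1 r.2 =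
      ∑ p ∈ antidiagonal n, ∑ r ∈ antidiagonal p.2, ∑ s ∈ antidiagonal p.1,
        f s.1 r.1 s.2 r.2 := by
  simp only [Finset.sum_sigma']
  refine Finset.sum_nbij'
    (fun x => ⟨(x.2.2.1 + x.2.1.1, x.2.2.2 + x.2.1.2), (x.2.2.2, x.2.1.2), (x.2.2.1, x.2.1.1)⟩)
    (fun x => ⟨(x.2.2.1 + x.2.1.1, x.2.2.2 + x.2.1.2), (x.2.2.2, x.2.1.2), (x.2.2.1, x.2.1.1)⟩)
    ?_ ?_ ?_ ?_ ?_
  all_goals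
    rintro ⟨⟨a, b⟩, ⟨c, d⟩, ⟨e, g⟩⟩ h
    simp only [Finset.mem_sigma, Finset.HasAntidiagonal.mem_antidiagonal] at h ⊢
  · obtain ⟨h1, h2, h3⟩ := h
    exact ⟨by omega, trivial, trivial⟩
  · obtain ⟨h1, h2, h3⟩ := h
    exact ⟨by omega, trivial, trivial⟩
  · obtain ⟨h1, h2, h3⟩ := h
    subst h1 h2 h3
    rfl
  · obtain ⟨h1, h2, h3⟩ := h
    subst h1 h2 h3
    rfl

/-- Weights `λ_t`, for `0 ≤ t ≤ M`, such that `p'(0) = ∑ λ_t p(t)` for polynomials of degree at most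
`M`. They express the logarithm, the derivative of `t ↦ fᵗ` at `0`, by powers of `f` with natural
exponents, to which multiplicativity applies directly. -/
def derivWeight (M t : ℕ) : ℂ :=
  (Polynomial.derivative (Lagrange.basis (Finset.range (M + 1)) (fun i : ℕ => (i : ℂ)) t)).eval 0

theorem sum_derivWeight (M : ℕ) (p : Polynomial ℂ) (hp : p.natDegree ≤ M) :
    ∑ t ∈ Finset.range (M + 1), derivWeight M t * p.eval (t : ℂ) =
      (Polynomial.derivative p).eval 0 := by
  have h := Lagrange.eq_interpolate (s := Finset.range (M + 1)) (v := fun i : ℕ => (i : ℂ)) (f := p)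
    (fun _ _ _ _ h => Nat.cast_injective h) ?_
  · conv_rhs => rw [h]
    simp only [Lagrange.interpolate_apply, Polynomial.derivative_sum, Polynomial.eval_finset_sum,
      Polynomial.derivative_C_mul, Polynomial.eval_mul, Polynomial.eval_C, derivWeight]
    exact Finset.sum_congr rfl fun _ _ => mul_comm _ _
  · rw [Finset.card_range]
    exact (Polynomial.degree_le_natDegree).trans_lt (by exact_mod_cast Nat.lt_succ_of_le hp)

/-- The polynomial `t ↦ t choose k`. -/
def choosePoly (k : ℕ) : Polynomial ℂ := Polynomial.C ((k.factorial : ℂ)⁻¹) * descPochhammer ℂ k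

theorem choosePoly_eval (k t : ℕ) : (choosePoly k).eval (t : ℂ) = (t.choose k : ℂ) := by
  rw [choosePoly, Polynomial.eval_mul, Polynomial.eval_C, descPochhammer_eval_eq_descFactorial,
    Nat.descFactorial_eq_factorial_mul_choose, Nat.cast_mul, inv_mul_cancel_left₀]
  exact_mod_cast k.factorial_ne_zero

theorem choosePoly_natDegree (k : ℕ) : (choosePoly k).natDegree ≤ k :=
  (Polynomial.natDegree_C_mul_le _ _).trans (descPochhammer_natDegree ℂ k).le

theorem choosePoly_eval_zero (k : ℕ) : (choosePoly k).eval 0 = if k = 0 then 1 else 0 := by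
  have := choosePoly_eval k 0
  rw [Nat.cast_zero] at this
  rw [this]
  cases k <;> simp

theorem descPochhammer_eval_neg_one (k : ℕ) :
    (descPochhammer ℂ k).eval (-1) = (-1 : ℂ) ^ k * k.factorial := by
  induction k with
  | zero => simp
  | succ k ih =>
    rw [descPochhammer_succ_right, Polynomial.eval_mul, ih]
    simp only [Polynomial.eval_sub, Polynomial.eval_X, Polynomial.eval_natCast, Nat.factorial_succ]
    push_cast
    ring

theorem choosePoly_derivative (k : ℕ) (hk : 1 ≤ k) :
    (Polynomial.derivative (choosePoly k)).eval 0 = (-1 : ℂ) ^ (k + 1) / k := by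
  obtain ⟨k, rfl⟩ := Nat.exists_eq_add_of_le' hk
  rw [choosePoly, Polynomial.derivative_C_mul, descPochhammer_succ_left, Polynomial.derivative_mul]
  simp only [Polynomial.derivative_X, one_mul, Polynomial.eval_mul, Polynomial.eval_C,
    Polynomial.eval_add, Polynomial.eval_X, zero_mul, add_zero, Polynomial.eval_comp,
    Polynomial.eval_sub, Polynomial.eval_one, zero_sub, descPochhammer_eval_neg_one,
    Nat.factorial_succ]
  have : (k.factorial : ℂ) ≠ 0 := by exact_mod_cast k.factorial_ne_zero
  have : ((k : ℂ) + 1) ≠ 0 := by exact_mod_cast k.succ_ne_zero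
  push_cast
  field_simp
  ring

theorem sum_derivWeight_choose {M k : ℕ} (hM : k ≤ M) :
    ∑ t ∈ Finset.range (M + 1), derivWeight M t * (t.choose k : ℂ) =
      if k = 0 then 0 else (-1 : ℂ) ^ (k + 1) / k := by
  have := sum_derivWeight M (choosePoly k) ((choosePoly_natDegree k).trans hM)
  simp only [choosePoly_eval] at this
  rw [this]
  split_ifs with h
  · subst h; simp [choosePoly]
  · exact choosePoly_derivative k (Nat.one_le_iff_ne_zero.2 h)

/-- The Leibniz rule for the derivative at `0`, on products of binomial coefficients. -/
theorem sum_derivWeight_choose_mul {M k l : ℕ} (hM : k + l ≤ M) :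
    ∑ t ∈ Finset.range (M + 1), derivWeight M t * ((t.choose k : ℂ) * (t.choose l : ℂ)) =
      (if l = 0 then (∑ t ∈ Finset.range (M + 1), derivWeight M t * (t.choose k : ℂ)) else 0) +
      (if k = 0 then (∑ t ∈ Finset.range (M + 1), derivWeight M t * (t.choose l : ℂ)) else 0) := by
  have := sum_derivWeight M (choosePoly k * choosePoly l)
    (Polynomial.natDegree_mul_le.trans
      ((add_le_add (choosePoly_natDegree k) (choosePoly_natDegree l)).trans hM))
  simp only [Polynomial.eval_mul, choosePoly_eval] at this
  rw [this, Polynomial.derivative_mul]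
  have h1 := sum_derivWeight M (choosePoly k) ((choosePoly_natDegree k).trans (by omega))
  have h2 := sum_derivWeight M (choosePoly l) ((choosePoly_natDegree l).trans (by omega))
  simp only [choosePoly_eval] at h1 h2
  rw [h1, h2]
  simp only [Polynomial.eval_add, Polynomial.eval_mul, choosePoly_eval_zero]
  split_ifs <;> simp

variable {R : Type*} [Ring R]

theorem coeff_sub_one_pow_eq_zero {f : R⟦X⟧} (hf : PowerSeries.constantCoeff f = 1) {n k : ℕ}
    (h : n < k) : PowerSeries.coeff n ((f - 1) ^ k) = 0 := by
  have hX : PowerSeries.X ∣ f - 1 := by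
    rw [PowerSeries.X_dvd_iff, map_sub, hf, map_one, sub_self]
  obtain ⟨g, hg⟩ := hX
  have hc : Commute (PowerSeries.X : R⟦X⟧) g := PowerSeries.commute_X g |>.symm
  rw [hg, hc.mul_pow, PowerSeries.coeff_X_pow_mul', if_neg (by omega)]

variable [Algebra ℂ R]

/-- The coefficients of the powers of `f` are polynomials in the exponent. -/
theorem coeff_pow_eq_sum {f : R⟦X⟧} (hf : PowerSeries.constantCoeff f = 1) {n N : ℕ} (hN : n ≤ N)
    (t : ℕ) : PowerSeries.coeff n (f ^ t) =
      ∑ k ∈ Finset.range (N + 1), (t.choose k : ℂ) • PowerSeries.coeff n ((f - 1) ^ k) := by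
  have h1 : f ^ t = ∑ k ∈ Finset.range (t + 1), (t.choose k : ℂ) • (f - 1) ^ k := by
    conv_lhs => rw [← sub_add_cancel f 1, (Commute.one_right (f - 1)).add_pow]
    refine Finset.sum_congr rfl fun k _ => ?_
    rw [one_pow, mul_one, ← nsmul_eq_mul', Nat.cast_smul_eq_nsmul]
  have h2 : ∀ K, t ≤ K → f ^ t = ∑ k ∈ Finset.range (K + 1), (t.choose k : ℂ) • (f - 1) ^ k := by
    intro K hK
    rw [h1]
    refine Finset.sum_subset (Finset.range_mono (by omega)) fun k _ hk => ?_
    rw [Nat.choose_eq_zero_of_lt (by simpa using hk), Nat.cast_zero, zero_smul]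
  rw [h2 (max t N) (le_max_left _ _), map_sum]
  simp only [map_smul, PowerSeries.coeff_smul]
  symm
  refine Finset.sum_subset (Finset.range_mono (by omega)) fun k _ hk => ?_
  rw [coeff_sub_one_pow_eq_zero hf (by simp at hk; omega), smul_zero]

theorem logCoeff_eq_sum_range {f : R⟦X⟧} {n N : ℕ} (hf : PowerSeries.constantCoeff f = 1)
    (hN : n ≤ N) : logCoeff f n = ∑ k ∈ Finset.range (N + 1),
      (if k = 0 then 0 else (-1 : ℂ) ^ (k + 1) / k) • PowerSeries.coeff n ((f - 1) ^ k) := by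
  rw [logCoeff]
  have : Finset.Icc 1 n ⊆ Finset.range (N + 1) := fun k hk => by
    simp only [Finset.mem_Icc, Finset.mem_range] at hk ⊢; omega
  rw [← Finset.sum_subset this]
  · refine Finset.sum_congr rfl fun k hk => ?_
    rw [Finset.mem_Icc] at hk
    rw [if_neg (by omega)]
  · intro k _ hk
    rw [Finset.mem_Icc] at hk
    by_cases h : k = 0
    · rw [if_pos h, zero_smul]
    · rw [coeff_sub_one_pow_eq_zero hf (by omega), smul_zero]

/-- The coefficients of `log f` are the derivatives at `t = 0` of the coefficients of `f ^ t`,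
written as linear combinations of values at natural numbers `t`. -/
theorem logCoeff_eq_sum_pow {f : R⟦X⟧} (hf : PowerSeries.constantCoeff f = 1) {n M : ℕ}
    (hM : n ≤ M) : logCoeff f n =
      ∑ t ∈ Finset.range (M + 1), derivWeight M t • PowerSeries.coeff n (f ^ t) := by
  rw [logCoeff_eq_sum_range hf hM]
  simp only [coeff_pow_eq_sum hf hM, Finset.smul_sum, smul_smul]
  rw [Finset.sum_comm]
  refine Finset.sum_congr rfl fun k hk => ?_
  rw [← Finset.sum_smul, sum_derivWeight_choose (by simp at hk; omega)]

/-- The derivative at `t = 0` of a product `β(f ^ t, g ^ t)`, for a bilinear map `β`. -/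
theorem sum_derivWeight_bilin {R' W : Type*} [Ring R'] [Algebra ℂ R'] [AddCommGroup W] [Module ℂ W]
    (β : R →ₗ[ℂ] R' →ₗ[ℂ] W) {f : R⟦X⟧} {g : R'⟦X⟧} (hf : PowerSeries.constantCoeff f = 1)
    (hg : PowerSeries.constantCoeff g = 1) (n : ℕ) :
    ∑ t ∈ Finset.range (2 * n + 1), derivWeight (2 * n) t • ∑ p ∈ antidiagonal n,
      β (PowerSeries.coeff p.1 (f ^ t)) (PowerSeries.coeff p.2 (g ^ t)) =
    β (logCoeff f n) 1 + β 1 (logCoeff g n) := by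
  have key : ∀ p ∈ antidiagonal n, ∑ t ∈ Finset.range (2 * n + 1), derivWeight (2 * n) t •
      β (PowerSeries.coeff p.1 (f ^ t)) (PowerSeries.coeff p.2 (g ^ t)) =
      β (logCoeff f p.1) (PowerSeries.coeff p.2 1) +
        β (PowerSeries.coeff p.1 1) (logCoeff g p.2) := by
    intro p hp
    rw [Finset.HasAntidiagonal.mem_antidiagonal] at hp
    have e : ∀ t, derivWeight (2 * n) t •
        β (PowerSeries.coeff p.1 (f ^ t)) (PowerSeries.coeff p.2 (g ^ t)) =
        ∑ k ∈ Finset.range (n + 1), ∑ l ∈ Finset.range (n + 1),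
          (derivWeight (2 * n) t * ((t.choose k : ℂ) * (t.choose l : ℂ))) •
          β (PowerSeries.coeff p.1 ((f - 1) ^ k)) (PowerSeries.coeff p.2 ((g - 1) ^ l)) := by
      intro t
      rw [coeff_pow_eq_sum hf (N := n) (by omega), coeff_pow_eq_sum hg (N := n) (by omega)]
      simp only [map_sum, map_smul, LinearMap.sum_apply, LinearMap.smul_apply, Finset.smul_sum,
        smul_smul]
      rw [Finset.sum_comm]
      refine Finset.sum_congr rfl fun k _ => Finset.sum_congr rfl fun l _ => ?_
      congr 1; ring
    simp only [e]
    rw [Finset.sum_comm]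
    simp only [Finset.sum_comm (s := Finset.range (2 * n + 1)) (t := Finset.range (n + 1)),
      ← Finset.sum_smul]
    have e2 : ∀ k ∈ Finset.range (n + 1), ∀ l ∈ Finset.range (n + 1),
        (∑ t ∈ Finset.range (2 * n + 1), derivWeight (2 * n) t * ((t.choose k : ℂ) *
          (t.choose l : ℂ))) • β (PowerSeries.coeff p.1 ((f - 1) ^ k))
            (PowerSeries.coeff p.2 ((g - 1) ^ l)) =
        (if l = 0 then (if k = 0 then 0 else (-1 : ℂ) ^ (k + 1) / k) •
          β (PowerSeries.coeff p.1 ((f - 1) ^ k)) (PowerSeries.coeff p.2 1) else 0) +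
        (if k = 0 then (if l = 0 then 0 else (-1 : ℂ) ^ (l + 1) / l) •
          β (PowerSeries.coeff p.1 1) (PowerSeries.coeff p.2 ((g - 1) ^ l)) else 0) := by
      intro k hk l hl
      rw [Finset.mem_range] at hk hl
      rw [sum_derivWeight_choose_mul (by omega), sum_derivWeight_choose (by omega),
        sum_derivWeight_choose (by omega), add_smul]
      congr 1
      · by_cases h : l = 0 <;> simp [h]
      · by_cases h : k = 0 <;> simp [h]
    rw [Finset.sum_congr rfl fun k hk => Finset.sum_congr rfl fun l hl => e2 k hk l hl]
    simp only [Finset.sum_add_distrib, Finset.sum_ite_eq', Finset.mem_range, Nat.succ_pos, if_true]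
    rw [Finset.sum_comm (f := fun k l => if k = 0 then _ else _)]
    simp only [Finset.sum_ite_eq', Finset.mem_range, Nat.succ_pos, if_true]
    rw [logCoeff_eq_sum_range hf (N := n) (by omega), logCoeff_eq_sum_range hg (N := n) (by omega)]
    simp only [map_sum, map_smul, LinearMap.sum_apply, LinearMap.smul_apply]
  simp only [Finset.smul_sum]
  rw [Finset.sum_comm, Finset.sum_congr rfl key, Finset.sum_add_distrib]
  congr 1
  · rw [Finset.sum_eq_single (n, 0)]
    · simp
    · rintro ⟨u, v⟩ h hne
      rw [Finset.HasAntidiagonal.mem_antidiagonal] at h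
      have : v ≠ 0 := by rintro rfl; apply hne; simpa using h
      simp [PowerSeries.coeff_one, this]
    · intro h; exact absurd (by simp) h
  · rw [Finset.sum_eq_single (0, n)]
    · simp
    · rintro ⟨u, v⟩ h hne
      rw [Finset.HasAntidiagonal.mem_antidiagonal] at h
      have : u ≠ 0 := by rintro rfl; apply hne; simpa using h
      simp [PowerSeries.coeff_one, this]
    · intro h; exact absurd (by simp) h

theorem logCoeff_map {R' : Type*} [Ring R'] [Algebra ℂ R'] (φ : R →ₐ[ℂ] R') (f : R⟦X⟧) (n : ℕ) :
    logCoeff (PowerSeries.map (φ : R →+* R') f) n = φ (logCoeff f n) := by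
  simp only [logCoeff, map_sum, map_smul]
  refine Finset.sum_congr rfl fun k _ => ?_
  rw [← map_one (PowerSeries.map (φ : R →+* R')), ← map_sub, ← map_pow, PowerSeries.coeff_map]
  rfl

/-- If a series `D` of operators is multiplicative on a stable subalgebra `N`, its logarithm is a
derivation of `N`. -/
theorem logCoeff_derivation {B : Type*} [Ring B] [Algebra ℂ B] (N : Subalgebra ℂ B)
    {D : (Module.End ℂ B)⟦X⟧} (hD : PowerSeries.constantCoeff D = 1)
    (hN : ∀ n, ∀ b ∈ N, (PowerSeries.coeff n D : Module.End ℂ B) b ∈ N)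
    (hmul : ∀ n, ∀ b ∈ N, ∀ b' ∈ N, (PowerSeries.coeff n D : Module.End ℂ B) (b * b') =
      ∑ p ∈ antidiagonal n, (PowerSeries.coeff p.1 D : Module.End ℂ B) b *
        (PowerSeries.coeff p.2 D : Module.End ℂ B) b')
    (n : ℕ) {b b' : B} (hb : b ∈ N) (hb' : b' ∈ N) :
    logCoeff D n (b * b') = logCoeff D n b * b' + b * logCoeff D n b' := by
  have hpow : ∀ t, (∀ n, ∀ b ∈ N, (PowerSeries.coeff n (D ^ t) : Module.End ℂ B) b ∈ N) ∧
      ∀ n, ∀ b ∈ N, ∀ b' ∈ N,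
      (PowerSeries.coeff n (D ^ t) : Module.End ℂ B) (b * b') = ∑ p ∈ antidiagonal n,
        (PowerSeries.coeff p.1 (D ^ t) : Module.End ℂ B) b *
          (PowerSeries.coeff p.2 (D ^ t) : Module.End ℂ B) b' := by
    intro t
    induction t with
    | zero =>
      refine ⟨fun n b hb => ?_, fun n b hb b' hb' => ?_⟩
      · rw [pow_zero, PowerSeries.coeff_one]
        split_ifs
        · exact hb
        · exact zero_mem _
      · rw [pow_zero]
        by_cases hn : n = 0
        · subst hn; simp
        · rw [Finset.sum_eq_zero]
          · simp [PowerSeries.coeff_one, hn]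
          · rintro ⟨u, v⟩ hp
            rw [Finset.HasAntidiagonal.mem_antidiagonal] at hp
            by_cases hu : u = 0
            · have : v ≠ 0 := by rintro rfl; simp_all
              simp [PowerSeries.coeff_one, this]
            · simp [PowerSeries.coeff_one, hu]
    | succ t ih =>
      obtain ⟨ih1, ih2⟩ := ih
      refine ⟨fun n b hb => ?_, fun n b hb b' hb' => ?_⟩
      · rw [pow_succ', PowerSeries.coeff_mul, LinearMap.sum_apply]
        exact sum_mem fun p _ => hN _ _ (ih1 _ _ hb)
      · rw [pow_succ']
        simp only [PowerSeries.coeff_mul, LinearMap.sum_apply, Module.End.mul_apply]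
        rw [Finset.sum_congr rfl fun p _ => by
          rw [ih2 p.2 b hb b' hb', map_sum, Finset.sum_congr rfl fun r _ =>
            hmul p.1 _ (ih1 r.1 b hb) _ (ih1 r.2 b' hb')]]
        simp only [Finset.sum_mul, Finset.mul_sum]
        exact sum_antidiagonal_four n fun i j k l =>
          (PowerSeries.coeff i D : Module.End ℂ B)
            ((PowerSeries.coeff k (D ^ t) : Module.End ℂ B) b) *
            (PowerSeries.coeff j D : Module.End ℂ B)
              ((PowerSeries.coeff l (D ^ t) : Module.End ℂ B) b')
  conv_lhs => rw [logCoeff_eq_sum_pow hD (M := 2 * n) (by omega)]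
  simp only [LinearMap.sum_apply, LinearMap.smul_apply]
  rw [Finset.sum_congr rfl fun t _ => congrArg _ ((hpow t).2 n b hb b' hb')]
  have := sum_derivWeight_bilin ((LinearMap.mul ℂ B).compl₁₂ (LinearMap.applyₗ b : Module.End ℂ B →ₗ[ℂ] B)
    (LinearMap.applyₗ b' : Module.End ℂ B →ₗ[ℂ] B)) hD hD n
  simpa using this

end Logarithm

/-! ### Operators on series in two variables -/

section SeriesOperators

variable {R : Type*} [Ring R] [Algebra ℂ R]

theorem map_algebraMap_commute (c : ℂ⟦X⟧) (f : R⟦X⟧) :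
    PowerSeries.map (algebraMap ℂ R) c * f = f * PowerSeries.map (algebraMap ℂ R) c := by
  ext n
  rw [PowerSeries.coeff_mul, PowerSeries.coeff_mul, ← Finset.Nat.sum_antidiagonal_swap]
  simp [Algebra.commutes]

/-- The two-variable series over `R` form an algebra over the two-variable series over `ℂ`. -/
instance seriesAlgebra : Algebra ℂ⟦X⟧⟦X⟧ R⟦X⟧⟦X⟧ :=
  RingHom.toAlgebra' (PowerSeries.map (PowerSeries.map (algebraMap ℂ R))) fun c f => by
    ext n : 1
    rw [PowerSeries.coeff_mul, PowerSeries.coeff_mul, ← Finset.Nat.sum_antidiagonal_swap]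
    simp [map_algebraMap_commute]

theorem series_smul_def (c : ℂ⟦X⟧⟦X⟧) (v : R⟦X⟧⟦X⟧) :
    c • v = PowerSeries.map (PowerSeries.map (algebraMap ℂ R)) c * v := rfl

theorem var₁_smul (v : R⟦X⟧⟦X⟧) : (var₁ : ℂ⟦X⟧⟦X⟧) • v = var₁ * v := by
  rw [series_smul_def]
  simp [var₁]

theorem var₂_smul (v : R⟦X⟧⟦X⟧) : (var₂ : ℂ⟦X⟧⟦X⟧) • v = var₂ * v := by
  rw [series_smul_def]
  simp [var₂]

/-- An element of `R`, as a constant series in two variables. -/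
def const₂ (r : R) : R⟦X⟧⟦X⟧ := PowerSeries.C (PowerSeries.C r)

theorem coeff_const₂ (m n : ℕ) (r : R) : PowerSeries.coeff n (PowerSeries.coeff m (const₂ r)) =
    if m = 0 ∧ n = 0 then r else 0 := by
  rw [const₂, PowerSeries.coeff_C]
  by_cases hm : m = 0 <;> by_cases hn : n = 0 <;> simp [hm, hn, PowerSeries.coeff_C]

theorem const₂_mul (r r' : R) : const₂ (r * r') = const₂ r * const₂ r' := by simp [const₂]

theorem const₂_one : const₂ (1 : R) = 1 := by simp [const₂]

/-- A series in `var₁` is its constant term plus a multiple of `var₁`; this and `eq_shift` are the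
induction steps by which linear maps over the two-variable series are determined coefficientwise. -/
theorem C_eq_shift (f : R⟦X⟧) : (PowerSeries.C f : R⟦X⟧⟦X⟧) = (var₁ : ℂ⟦X⟧⟦X⟧) •
    PowerSeries.C (PowerSeries.mk fun p => PowerSeries.coeff (p + 1) f) +
      const₂ (PowerSeries.constantCoeff f) := by
  conv_lhs => rw [PowerSeries.eq_X_mul_shift_add_const f, map_add, map_mul]
  rw [var₁_smul, var₁, const₂]

theorem eq_shift (v : R⟦X⟧⟦X⟧) : v = (var₂ : ℂ⟦X⟧⟦X⟧) •
    (PowerSeries.mk fun p => PowerSeries.coeff (p + 1) v) +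
      PowerSeries.C (PowerSeries.constantCoeff v) := by
  rw [var₂_smul]
  exact PowerSeries.eq_X_mul_shift_add_const v

theorem coeff_zero_var₁_smul (v : R⟦X⟧⟦X⟧) (m : ℕ) :
    PowerSeries.coeff 0 (PowerSeries.coeff m ((var₁ : ℂ⟦X⟧⟦X⟧) • v)) = 0 := by
  rw [var₁_smul, var₁, PowerSeries.coeff_C_mul]
  simp

theorem coeff_succ_var₁_smul (v : R⟦X⟧⟦X⟧) (m n : ℕ) :
    PowerSeries.coeff (n + 1) (PowerSeries.coeff m ((var₁ : ℂ⟦X⟧⟦X⟧) • v)) =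
      PowerSeries.coeff n (PowerSeries.coeff m v) := by
  rw [var₁_smul, var₁, PowerSeries.coeff_C_mul, PowerSeries.coeff_succ_X_mul]

theorem coeff_zero_var₂_smul (v : R⟦X⟧⟦X⟧) :
    PowerSeries.coeff 0 ((var₂ : ℂ⟦X⟧⟦X⟧) • v) = 0 := by
  rw [var₂_smul, var₂]
  simp

theorem coeff_succ_var₂_smul (v : R⟦X⟧⟦X⟧) (m : ℕ) :
    PowerSeries.coeff (m + 1) ((var₂ : ℂ⟦X⟧⟦X⟧) • v) = PowerSeries.coeff m v := by
  rw [var₂_smul, var₂, PowerSeries.coeff_succ_X_mul]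

/-- A linear map over the two-variable series is determined by its values on `R`. -/
theorem series_linearMap_ext {T T' : Module.End ℂ⟦X⟧⟦X⟧ R⟦X⟧⟦X⟧}
    (h : ∀ r, T (const₂ r) = T' (const₂ r)) : T = T' := by
  have h1 : ∀ n m (f : R⟦X⟧), PowerSeries.coeff n (PowerSeries.coeff m (T (PowerSeries.C f))) =
      PowerSeries.coeff n (PowerSeries.coeff m (T' (PowerSeries.C f))) := by
    intro n m f
    rw [C_eq_shift f]
    simp only [map_add, map_smul, h]
    congr 1
    induction n generalizing f with
    | zero => rw [coeff_zero_var₁_smul, coeff_zero_var₁_smul]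
    | succ n ih =>
      rw [coeff_succ_var₁_smul, coeff_succ_var₁_smul, C_eq_shift]
      simp only [map_add, map_smul, h]
      congr 1
      exact ih _
  have h2 : ∀ m (v : R⟦X⟧⟦X⟧), PowerSeries.coeff m (T v) = PowerSeries.coeff m (T' v) := by
    intro m v
    have h3 : ∀ f, T (PowerSeries.C f) = T' (PowerSeries.C f) := fun f => by
      ext m n; exact h1 n m f
    rw [eq_shift v]
    simp only [map_add, map_smul, h3]
    congr 1
    induction m generalizing v with
    | zero => rw [coeff_zero_var₂_smul, coeff_zero_var₂_smul]
    | succ m ih =>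
      rw [coeff_succ_var₂_smul, coeff_succ_var₂_smul, eq_shift (PowerSeries.mk _)]
      simp only [map_add, map_smul, h3]
      congr 1
      exact ih _
  ext v m : 2
  exact h2 m v

/-- A bilinear map over the two-variable series is determined by its values on `R`. -/
theorem series_bilin_ext {T T' : R⟦X⟧⟦X⟧ →ₗ[ℂ⟦X⟧⟦X⟧] R⟦X⟧⟦X⟧ →ₗ[ℂ⟦X⟧⟦X⟧] R⟦X⟧⟦X⟧}
    (h : ∀ r r', T (const₂ r) (const₂ r') = T' (const₂ r) (const₂ r')) : T = T' := by
  have h1 : ∀ r, T (const₂ r) = T' (const₂ r) := fun r => series_linearMap_ext (h r)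
  ext v v' : 2
  have := series_linearMap_ext (T := T.flip v') (T' := T'.flip v') fun r => by
    simp [h1]
  exact congrArg (fun f => f v) this

/-- The series in `var₂` alone. -/
def sndSubring : Subring R⟦X⟧⟦X⟧ := (PowerSeries.map (PowerSeries.C : R →+* R⟦X⟧)).range

theorem mem_sndSubring {v : R⟦X⟧⟦X⟧} : v ∈ sndSubring (R := R) ↔
    ∀ m n, n ≠ 0 → PowerSeries.coeff n (PowerSeries.coeff m v) = 0 := by
  constructor
  · rintro ⟨f, rfl⟩ m n hn
    simp [PowerSeries.coeff_C, hn]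
  · intro h
    refine ⟨.mk fun m => PowerSeries.coeff 0 (PowerSeries.coeff m v), ?_⟩
    ext m n
    by_cases hn : n = 0
    · simp [hn]
    · simp [PowerSeries.coeff_C, hn, h m n hn]

theorem const₂_mem (r : R) : const₂ r ∈ sndSubring (R := R) := ⟨PowerSeries.C r, by simp [const₂]⟩

/-- If `T` maps `R` to series in `var₂`, its value on a series in `var₁` is computed on
coefficients. -/
theorem coeff_apply_C {T : Module.End ℂ⟦X⟧⟦X⟧ R⟦X⟧⟦X⟧}
    (hT : ∀ r, T (const₂ r) ∈ sndSubring (R := R))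
    (f : R⟦X⟧) (m n : ℕ) : PowerSeries.coeff n (PowerSeries.coeff m (T (PowerSeries.C f))) =
      PowerSeries.coeff 0 (PowerSeries.coeff m (T (const₂ (PowerSeries.coeff n f)))) := by
  induction n generalizing f with
  | zero =>
    conv_lhs => rw [C_eq_shift f]
    simp only [map_add, map_smul, coeff_zero_var₁_smul, zero_add]
    simp
  | succ n ih =>
    conv_lhs => rw [C_eq_shift f]
    simp only [map_add, map_smul, coeff_succ_var₁_smul, ih, PowerSeries.coeff_mk]
    rw [mem_sndSubring.1 (hT _) m (n + 1) (by omega), add_zero]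

theorem apply_const₂_eq_zero {T : Module.End ℂ⟦X⟧⟦X⟧ R⟦X⟧⟦X⟧}
    (hT : ∀ r, T (const₂ r) ∈ sndSubring (R := R)) {f : R⟦X⟧} (h : T (PowerSeries.C f) = 0)
      (n : ℕ) :
    T (const₂ (PowerSeries.coeff n f)) = 0 := by
  ext m k
  by_cases hk : k = 0
  · subst hk
    rw [← coeff_apply_C hT, h]
    simp
  · rw [mem_sndSubring.1 (hT _) m k hk]
    simp

/-- An operator, applied to the coefficients of a series. -/
def mapCoeff (T : Module.End ℂ R) : R⟦X⟧ →+ R⟦X⟧ where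
  toFun f := .mk fun n => T (PowerSeries.coeff n f)
  map_zero' := by ext; simp
  map_add' f g := by ext; simp

theorem coeff_mapCoeff (T : Module.End ℂ R) (f : R⟦X⟧) (n : ℕ) :
    PowerSeries.coeff n (mapCoeff T f) = T (PowerSeries.coeff n f) :=
  PowerSeries.coeff_mk n fun n => T (PowerSeries.coeff n f)

theorem mapCoeff_smul (T : Module.End ℂ R) (c : ℂ⟦X⟧) (f : R⟦X⟧) :
    mapCoeff T (PowerSeries.map (algebraMap ℂ R) c * f) =
      PowerSeries.map (algebraMap ℂ R) c * mapCoeff T f := by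
  ext n
  simp [coeff_mapCoeff, PowerSeries.coeff_mul, ← Algebra.smul_def]

theorem sum_antidiagonal_left_comm {M : Type*} [AddCommMonoid M] (f : ℕ → ℕ → ℕ → M) (n : ℕ) :
    ∑ p ∈ antidiagonal n, ∑ r ∈ antidiagonal p.2, f p.1 r.1 r.2 =
      ∑ p ∈ antidiagonal n, ∑ r ∈ antidiagonal p.2, f r.1 p.1 r.2 := by
  rw [sum_antidiagonal_assoc, sum_antidiagonal_assoc fun i j k => f j i k]
  refine Finset.sum_congr rfl fun p _ => ?_
  rw [← Finset.Nat.sum_antidiagonal_swap]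
  rfl

/-- The action of a series `D` of operators on series in two variables: the variable of `D` becomes
`var₂`, and the operators act on coefficients. -/
def ser (D : (Module.End ℂ R)⟦X⟧) : Module.End ℂ⟦X⟧⟦X⟧ R⟦X⟧⟦X⟧ where
  toFun v := .mk fun m => ∑ p ∈ antidiagonal m,
    mapCoeff (PowerSeries.coeff p.1 D) (PowerSeries.coeff p.2 v)
  map_add' v v' := by
    ext m : 1
    simp [Finset.sum_add_distrib]
  map_smul' c v := by
    ext m : 1
    simp only [series_smul_def, PowerSeries.coeff_mk, RingHom.id_apply, PowerSeries.coeff_mul,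
      map_sum, Finset.mul_sum, PowerSeries.coeff_map, mapCoeff_smul]
    exact sum_antidiagonal_left_comm (fun i j k => PowerSeries.map (algebraMap ℂ R)
      (PowerSeries.coeff j c) * mapCoeff (PowerSeries.coeff i D) (PowerSeries.coeff k v)) m

theorem coeff_ser (D : (Module.End ℂ R)⟦X⟧) (v : R⟦X⟧⟦X⟧) (m n : ℕ) :
    PowerSeries.coeff n (PowerSeries.coeff m (ser D v)) = ∑ p ∈ antidiagonal m,
      (PowerSeries.coeff p.1 D : Module.End ℂ R)
        (PowerSeries.coeff n (PowerSeries.coeff p.2 v)) := by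
  simp [ser, coeff_mapCoeff]

theorem coeff_ser_C (D : (Module.End ℂ R)⟦X⟧) (f : R⟦X⟧) (m n : ℕ) :
    PowerSeries.coeff n (PowerSeries.coeff m (ser D (PowerSeries.C f))) =
      (PowerSeries.coeff m D : Module.End ℂ R) (PowerSeries.coeff n f) := by
  rw [coeff_ser, Finset.sum_eq_single (m, 0)]
  · simp
  · rintro ⟨u, v⟩ h hne
    rw [Finset.HasAntidiagonal.mem_antidiagonal] at h
    have : v ≠ 0 := by rintro rfl; apply hne; simpa using h
    simp [PowerSeries.coeff_C, this]
  · intro h; exact absurd (by simp) h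

theorem ser_const₂ (D : (Module.End ℂ R)⟦X⟧) (r : R) : ser D (const₂ r) =
    PowerSeries.map PowerSeries.C (.mk fun m => (PowerSeries.coeff m D : Module.End ℂ R) r) := by
  ext m n
  rw [const₂, coeff_ser_C]
  by_cases hn : n = 0 <;> simp [hn, PowerSeries.coeff_C]

theorem ser_mem (D : (Module.End ℂ R)⟦X⟧) {v : R⟦X⟧⟦X⟧} (hv : v ∈ sndSubring (R := R)) :
    ser D v ∈ sndSubring (R := R) := by
  rw [mem_sndSubring] at hv ⊢
  intro m n hn
  rw [coeff_ser]
  exact Finset.sum_eq_zero fun p _ => by rw [hv _ _ hn, map_zero]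

variable (R) in
/-- `ser` as a homomorphism of rings. -/
def serHom : (Module.End ℂ R)⟦X⟧ →+* Module.End ℂ⟦X⟧⟦X⟧ R⟦X⟧⟦X⟧ where
  toFun := ser
  map_one' := by
    refine series_linearMap_ext fun r => ?_
    ext m n
    rw [const₂, coeff_ser_C, Module.End.one_apply, PowerSeries.coeff_one]
    by_cases hm : m = 0 <;> simp [hm, PowerSeries.coeff_C]
  map_zero' := by
    refine series_linearMap_ext fun r => ?_
    ext m n
    simp [const₂, coeff_ser_C]
  map_add' D D' := by
    refine series_linearMap_ext fun r => ?_
    ext m n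
    simp [const₂, coeff_ser_C]
  map_mul' D D' := by
    refine series_linearMap_ext fun r => ?_
    ext m n
    rw [Module.End.mul_apply, const₂, coeff_ser_C, PowerSeries.coeff_mul, LinearMap.sum_apply,
      coeff_ser]
    simp [coeff_ser_C]

/-- An algebra endomorphism, applied to the coefficients of a series in two variables. -/
def mapAlg (P : R →ₐ[ℂ] R) : R⟦X⟧⟦X⟧ →ₐ[ℂ⟦X⟧⟦X⟧] R⟦X⟧⟦X⟧ where
  __ := PowerSeries.map (PowerSeries.map (P : R →+* R))
  commutes' c := by
    rw [Algebra.algebraMap_eq_smul_one, series_smul_def, mul_one]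
    ext m n
    simp

theorem coeff_mapAlg (P : R →ₐ[ℂ] R) (v : R⟦X⟧⟦X⟧) (m n : ℕ) :
    PowerSeries.coeff n (PowerSeries.coeff m (mapAlg P v)) =
      P (PowerSeries.coeff n (PowerSeries.coeff m v)) := rfl

theorem mapAlg_const₂ (P : R →ₐ[ℂ] R) (r : R) : mapAlg P (const₂ r) = const₂ (P r) := by
  ext m n
  rw [coeff_mapAlg, coeff_const₂, coeff_const₂]
  split_ifs <;> simp

theorem mapAlg_mem (P : R →ₐ[ℂ] R) {v : R⟦X⟧⟦X⟧} (hv : v ∈ sndSubring (R := R)) :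
    mapAlg P v ∈ sndSubring (R := R) := by
  rw [mem_sndSubring] at hv ⊢
  intro m n hn
  rw [coeff_mapAlg, hv _ _ hn, map_zero]

/-- `f(var₁ * var₂)`. -/
def diagScalar : ℂ⟦X⟧ →+* ℂ⟦X⟧⟦X⟧ where
  toFun f := .mk fun n => PowerSeries.monomial n (PowerSeries.coeff n f)
  map_one' := by
    ext m n
    rw [PowerSeries.coeff_mk, PowerSeries.coeff_monomial, PowerSeries.coeff_one,
      PowerSeries.coeff_one]
    split_ifs <;> simp_all [PowerSeries.coeff_one]
  map_zero' := by ext; simp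
  map_add' f g := by ext; simp
  map_mul' f g := by
    ext m : 1
    rw [PowerSeries.coeff_mul, PowerSeries.coeff_mk, PowerSeries.coeff_mul, map_sum]
    refine Finset.sum_congr rfl fun p hp => ?_
    rw [PowerSeries.coeff_mk, PowerSeries.coeff_mk, PowerSeries.monomial_mul_monomial,
      (Finset.HasAntidiagonal.mem_antidiagonal.1 hp)]

theorem coeff_diagScalar_smul_C (c : ℂ⟦X⟧) (f : R⟦X⟧) (m n : ℕ) :
    PowerSeries.coeff n (PowerSeries.coeff m (diagScalar c • (PowerSeries.C f : R⟦X⟧⟦X⟧))) =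
      if m ≤ n then PowerSeries.coeff m c • PowerSeries.coeff (n - m) f else 0 := by
  rw [series_smul_def, PowerSeries.coeff_mul_C, PowerSeries.coeff_map]
  have : PowerSeries.coeff m (diagScalar c) =
      PowerSeries.C (PowerSeries.coeff m c) * PowerSeries.X ^ m := by
    simp only [diagScalar, RingHom.coe_mk, MonoidHom.coe_mk, OneHom.coe_mk, PowerSeries.coeff_mk]
    exact PowerSeries.monomial_eq_C_mul_X_pow _ _
  rw [this, (PowerSeries.map (algebraMap ℂ R)).map_mul, (PowerSeries.map (algebraMap ℂ R)).map_pow,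
    PowerSeries.map_X, PowerSeries.map_C, mul_assoc,
    PowerSeries.coeff_C_mul, PowerSeries.coeff_X_pow_mul']
  split_ifs
  · rw [Algebra.smul_def]
  · simp

end SeriesOperators

/-! ### Gauss decomposition of a matrix of operators -/

section GaussAction

variable {Λ W : Type*} [CommRing Λ] [Ring W] [Algebra Λ W]

/-- Operators `S i j` on an algebra `W` with a parity automorphism `P`, which satisfy the Leibniz
rules given by the coproduct of `s_{ij}(z)`, and the operators `E`, `F`, `Φ` obtained from them
by the Gauss decomposition. -/
structure GaussAction (P : W →ₐ[Λ] W) (S : Fin 2 → Fin 2 → Module.End Λ W)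
    (E F Φ : Module.End Λ W) : Prop where
  injective : Function.Injective (S 0 0)
  surjective : Function.Surjective (S 0 0)
  S_E : ∀ v, S 0 0 (E v) = S 0 1 v
  F_S : ∀ v, F (S 0 0 v) = S 1 0 v
  S_Φ : ∀ v, S 0 0 (Φ v) = S 1 1 v + S 1 0 (E v)
  F_F : ∀ v, F (F v) = 0
  S_one : ∀ i j, S i j 1 = if i = j then 1 else 0
  P_P : ∀ v, P (P v) = v
  S_P : ∀ i j v, S i j (P v) = if i = j then P (S i j v) else -P (S i j v)
  mul₀₀ : ∀ v v', S 0 0 (v * v') = S 0 0 v * S 0 0 v' - S 0 1 (P v) * S 1 0 v'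
  mul₀₁ : ∀ v v', S 0 1 (v * v') = S 0 0 (P v) * S 0 1 v' + S 0 1 v * S 1 1 v'
  mul₁₀ : ∀ v v', S 1 0 (v * v') = S 1 0 v * S 0 0 v' + S 1 1 (P v) * S 1 0 v'
  mul₁₁ : ∀ v v', S 1 1 (v * v') = S 1 1 v * S 1 1 v' - S 1 0 (P v) * S 0 1 v'

namespace GaussAction

variable {P : W →ₐ[Λ] W} {S : Fin 2 → Fin 2 → Module.End Λ W} {E F Φ : Module.End Λ W}

section

variable (h : GaussAction P S E F Φ)
include h

theorem E_P (v : W) : E (P v) = -P (E v) := by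
  apply h.injective
  rw [h.S_E, h.S_P, if_neg (by decide), map_neg, h.S_P, if_pos rfl, h.S_E]

theorem Φ_P (v : W) : Φ (P v) = P (Φ v) := by
  apply h.injective
  rw [h.S_Φ, h.S_P, if_pos rfl, h.E_P, map_neg, h.S_P, if_neg (by decide), neg_neg, h.S_P,
    if_pos rfl, h.S_Φ, map_add]

theorem E_one : E 1 = 0 := by
  apply h.injective
  rw [h.S_E, h.S_one, map_zero, if_neg (by decide)]

theorem F_one : F 1 = 0 := by
  have := h.F_S 1
  rwa [h.S_one, h.S_one, if_pos rfl, if_neg (by decide)] at this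

theorem Φ_one : Φ 1 = 1 := by
  apply h.injective
  rw [h.S_Φ, h.E_one, map_zero, add_zero, h.S_one, h.S_one]
  simp

/-- The Leibniz rule for `E` with a first factor `g` such that `E (E g) = 0`. Generators have this
property, and an induction on words then removes the condition. -/
theorem E_mul_of {g : W} (hg : E (E g) = 0) (v : W) : E (g * v) = P g * E v + E g * Φ v := by
  apply h.injective
  have h1 : S 0 1 (P (E g)) = 0 := by rw [h.S_P, if_neg (by decide), ← h.S_E, hg]; simp
  rw [h.S_E, h.mul₀₁, map_add, h.mul₀₀, h.mul₀₀, h.P_P, h1, zero_mul, sub_zero, h.S_E, h.S_E, h.S_Φ,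
    mul_add]
  abel

/-- `Φ` is multiplicative for a first factor `g` with `E (E g) = 0` and `Φ (E g) = E (Φ g)`. -/
theorem Φ_mul_of {g : W} (hg : E (E g) = 0) (hg' : Φ (E g) = E (Φ g)) (v : W) :
    Φ (g * v) = Φ g * Φ v := by
  apply h.injective
  have h1 : S 0 1 (Φ (P g)) = S 1 1 (E (P g)) := by
    have h2 : E (E (P g)) = 0 := by rw [h.E_P, map_neg, h.E_P, hg]; simp
    have h3 : E (Φ (P g)) = Φ (E (P g)) := by
      rw [h.Φ_P, h.E_P, ← hg', h.E_P, map_neg, h.Φ_P]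
    rw [← h.S_E, h3, h.S_Φ, h2, map_zero, add_zero]
  rw [h.S_Φ, h.mul₁₁, h.E_mul_of hg, map_add, h.mul₁₀, h.mul₁₀, h.P_P, h.mul₀₀, ← h.Φ_P, h1, h.S_Φ,
    h.S_Φ, h.S_E, h.E_P, map_neg]
  simp only [mul_add, add_mul, h.S_E, neg_mul]
  abel

/-- The Leibniz rule for `F`, with a first factor in the image of `S 0 0`. -/
theorem F_mul_of {v : W} (h1 : ∀ y, F (S 0 1 (P v) * y) = F (S 0 1 (P v)) * y +
      Φ (P (S 0 1 (P v))) * F y)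
    (h2 : S 1 1 (P v) + F (S 0 1 (P v)) = Φ (S 0 0 (P v))) (v' : W) :
    F (S 0 0 v * v') = F (S 0 0 v) * v' + Φ (P (S 0 0 v)) * F v' := by
  obtain ⟨u, rfl⟩ := h.surjective v'
  have h3 : S 0 0 v * S 0 0 u = S 0 0 (v * u) + S 0 1 (P v) * S 1 0 u := by
    rw [h.mul₀₀, sub_add_cancel]
  rw [h3, map_add, h.F_S, h1, ← h.F_S u, h.F_F, mul_zero, add_zero, h.F_S, h.F_S, h.mul₁₀]
  have h4 := h.S_P 0 0 v
  rw [if_pos rfl] at h4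
  rw [← h4, ← h2, add_mul]
  abel

end

/-- The action of the operators `S i j` on the entries `t a b` of a matrix, as given by a matrix `R`
of Perk-Schultz type: `β`, `γ` are its diagonal entries, `η`, `θ` the off-diagonal ones, the entry
at `00,00` being normalized to `1`, and `β'` is the inverse of `β`. -/
structure HasTable (P : W →ₐ[Λ] W) (S : Fin 2 → Fin 2 → Module.End Λ W) (t : Fin 2 → Fin 2 → W)
    (β β' γ η θ : Λ) : Prop where
  inv : β' * β = 1
  rel : γ - η * θ = β * β
  P_t : ∀ i j, P (t i j) = if i = j then t i j else -t i j
  S₀₀_t : ∀ i j, S 0 0 (t i j) = if i = 0 then t i j else β • t i j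
  S₁₁_t : ∀ i j, S 1 1 (t i j) = if i = 0 then β • t i j else γ • t i j
  S₀₁_t : ∀ j, S 0 1 (t 0 j) = 0
  S₀₁_t₁₀ : S 0 1 (t 1 0) = η • t 0 0
  S₀₁_t₁₁ : S 0 1 (t 1 1) = -η • t 0 1
  S₁₀_t : ∀ j, S 1 0 (t 1 j) = 0
  S₁₀_t₀₀ : S 1 0 (t 0 0) = -θ • t 1 0
  S₁₀_t₀₁ : S 1 0 (t 0 1) = θ • t 1 1

section

variable (h : GaussAction P S E F Φ) {t : Fin 2 → Fin 2 → W} {β β' γ η θ : Λ}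
  (ht : HasTable P S t β β' γ η θ)
include h ht

theorem E_t (j : Fin 2) : E (t 0 j) = 0 := by
  apply h.injective
  rw [h.S_E, ht.S₀₁_t, map_zero]

theorem E_t₁₀ : E (t 1 0) = η • t 0 0 := by
  apply h.injective
  rw [h.S_E, ht.S₀₁_t₁₀, map_smul, ht.S₀₀_t, if_pos rfl]

theorem E_t₁₁ : E (t 1 1) = -η • t 0 1 := by
  apply h.injective
  rw [h.S_E, ht.S₀₁_t₁₁, map_smul, ht.S₀₀_t, if_pos rfl]

theorem F_t (j : Fin 2) : F (t 1 j) = 0 := by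
  have h1 := h.F_S (t 1 j)
  rw [ht.S₀₀_t, if_neg (by decide), ht.S₁₀_t, map_smul] at h1
  rw [← one_smul Λ (F (t 1 j)), ← ht.inv, mul_smul, h1, smul_zero]

theorem F_t₀₀ : F (t 0 0) = -θ • t 1 0 := by
  have h1 := h.F_S (t 0 0)
  rwa [ht.S₀₀_t, if_pos rfl, ht.S₁₀_t₀₀] at h1

theorem F_t₀₁ : F (t 0 1) = θ • t 1 1 := by
  have h1 := h.F_S (t 0 1)
  rwa [ht.S₀₀_t, if_pos rfl, ht.S₁₀_t₀₁] at h1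

theorem Φ_t (i j : Fin 2) : Φ (t i j) = β • t i j := by
  apply h.injective
  rw [h.S_Φ, map_smul, ht.S₀₀_t, ht.S₁₁_t]
  fin_cases i
  · simp [h.E_t ht]
  · have hrel : γ = β * β + η * θ := by rw [← ht.rel]; ring
    fin_cases j
    · simp only [Fin.mk_one, one_ne_zero, if_false, Fin.zero_eta, h.E_t₁₀ ht, map_smul,
        ht.S₁₀_t₀₀, hrel]
      module
    · simp only [Fin.mk_one, one_ne_zero, if_false, h.E_t₁₁ ht, map_smul,
        ht.S₁₀_t₀₁, hrel]
      module

theorem E_E_t (i j : Fin 2) : E (E (t i j)) = 0 := by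
  fin_cases i
  · simp [h.E_t ht]
  · fin_cases j
    · simp [h.E_t₁₀ ht, h.E_t ht]
    · simp [h.E_t₁₁ ht, h.E_t ht]

theorem Φ_E_t (i j : Fin 2) : Φ (E (t i j)) = E (Φ (t i j)) := by
  rw [h.Φ_t ht, map_smul]
  fin_cases i
  · simp [h.E_t ht]
  · fin_cases j
    · simp only [Fin.mk_one, Fin.zero_eta, h.E_t₁₀ ht, map_smul, h.Φ_t ht]
      module
    · simp only [Fin.mk_one, h.E_t₁₁ ht, map_smul, h.Φ_t ht]
      module

/-- The Leibniz rule for `F` with first factor `t i j`. The row `i = 0` is annihilated by `S 0 1`,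
and `S 0 1` maps the row `i = 1` to multiples of the row `i = 0`, so `F_mul_of` applies to the two
rows in turn. -/
theorem F_t_mul (i j : Fin 2) (v : W) :
    F (t i j * v) = F (t i j) * v + Φ (P (t i j)) * F v := by
  have h0 : ∀ j v, F (t 0 j * v) = F (t 0 j) * v + Φ (P (t 0 j)) * F v := by
    intro j v
    have hP : P (t 0 j) = (if 0 = j then 1 else -1 : Λ) • t 0 j := by
      rw [ht.P_t]; split_ifs <;> simp
    have hS : S 0 1 (P (t 0 j)) = 0 := by rw [hP, map_smul, ht.S₀₁_t, smul_zero]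
    have := h.F_mul_of (v := t 0 j) (fun y => by simp [hS])
      (by rw [hS, map_zero, add_zero, hP, map_smul, map_smul, map_smul, ht.S₁₁_t, ht.S₀₀_t,
        if_pos rfl, if_pos rfl, h.Φ_t ht]) v
    rwa [ht.S₀₀_t, if_pos rfl] at this
  fin_cases i
  · exact h0 j v
  · change F (t 1 j * v) = F (t 1 j) * v + Φ (P (t 1 j)) * F v
    obtain ⟨ε, hP⟩ : ∃ ε : Λ, P (t 1 j) = ε • t 1 j :=
      ⟨if 1 = j then 1 else -1, by rw [ht.P_t]; split_ifs <;> simp⟩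
    obtain ⟨c, hc⟩ : ∃ c : Λ, S 0 1 (P (t 1 j)) = c • t 0 j := by
      rw [hP, map_smul]
      fin_cases j
      · exact ⟨ε * η, by simp [ht.S₀₁_t₁₀, mul_smul]⟩
      · exact ⟨-(ε * η), by simp [ht.S₀₁_t₁₁, mul_smul]⟩
    have hrel : γ = β * β + η * θ := by rw [← ht.rel]; ring
    have key := h.F_mul_of (v := t 1 j)
      (fun y => by
        rw [hc, smul_mul_assoc, map_smul, h0]
        simp only [map_smul, smul_mul_assoc, smul_add])
      (by
        rw [hP]
        simp only [map_smul]
        rw [ht.S₁₁_t, ht.S₀₀_t, if_neg one_ne_zero, if_neg one_ne_zero, map_smul, h.Φ_t ht]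
        rw [← smul_add]
        congr 1
        fin_cases j
        · simp only [Fin.zero_eta, ht.S₀₁_t₁₀, map_smul, h.F_t₀₀ ht, hrel]
          module
        · simp only [Fin.mk_one, ht.S₀₁_t₁₁, map_smul, h.F_t₀₁ ht, hrel]
          module) v
    rw [ht.S₀₀_t, if_neg (by decide)] at key
    simp only [smul_mul_assoc, map_smul, ← smul_add] at key
    have := congrArg (fun x => β' • x) key
    simpa only [smul_smul, ht.inv, one_smul] using this

end

end GaussAction

end GaussAction

/-! ### Action on the Gauss coordinates -/

section GaussLeibniz

variable {Λ W : Type*} [CommRing Λ] [Ring W] [Algebra Λ W]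

/-- The Leibniz rules for the operators in the Gauss decomposition. -/
structure GaussLeibniz (P : W →ₐ[Λ] W) (E F Φ : Module.End Λ W) : Prop where
  E_mul : ∀ v v', E (v * v') = P v * E v' + E v * Φ v'
  F_mul : ∀ v v', F (v * v') = F v * v' + Φ (P v) * F v'
  Φ_mul : ∀ v v', Φ (v * v') = Φ v * Φ v'

/-- An inverse of the upper left entry of the matrix `t`, and the resulting condition
`(t₁₀ t₀₀⁻¹)² = 0`. -/
structure GaussInverse (t : Fin 2 → Fin 2 → W) (u : W) : Prop where
  mul_inv : t 0 0 * u = 1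
  inv_mul : u * t 0 0 = 1
  sq : t 1 0 * u * (t 1 0 * u) = 0

-- In the following names `e = t₀₀⁻¹ t₀₁`, `f = t₁₀ t₀₀⁻¹` and `φ = t₀₀⁻¹ (t₁₁ + t₁₀ t₀₀⁻¹ t₀₁)` are
-- the Gauss coordinates of the matrix `t`, and `u = t₀₀⁻¹`.
namespace GaussAction

variable {P : W →ₐ[Λ] W} {S : Fin 2 → Fin 2 → Module.End Λ W} {E F Φ : Module.End Λ W}
  {t : Fin 2 → Fin 2 → W} {β β' γ η θ : Λ} {u : W}
  (h : GaussAction P S E F Φ) (ht : HasTable P S t β β' γ η θ) (hl : GaussLeibniz P E F Φ)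
  (hu : GaussInverse t u)

include hu in
theorem eq_of_t_mul_eq {v v' : W} (hv : t 0 0 * v = t 0 0 * v') : v = v' := by
  rw [← one_mul v, ← hu.inv_mul, mul_assoc, hv, ← mul_assoc, hu.inv_mul, one_mul]

include h in
theorem S_mul_of_E_eq_zero {v : W} (hv : E v = 0) (v' : W) :
    S 0 0 (v * v') = S 0 0 v * S 0 0 v' := by
  rw [h.mul₀₀, ← h.S_E, h.E_P, hv]
  simp

include h in
theorem S_mul_of_F_eq_zero {v' : W} {c : Λ} (hv : S 0 0 v' = c • v') (hF : F v' = 0) (v : W) :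
    S 0 0 (v * v') = c • (S 0 0 v * v') := by
  rw [h.mul₀₀, ← h.F_S v', hv, map_smul, hF, smul_zero, mul_zero, sub_zero, mul_smul_comm]

include ht hu in
theorem P_u : P u = u := by
  apply eq_of_t_mul_eq hu
  have h1 : P (t 0 0 * u) = 1 := by rw [hu.mul_inv, map_one]
  rw [map_mul, ht.P_t, if_pos rfl] at h1
  rw [h1, hu.mul_inv]

include h ht hl hu

theorem E_u : E u = 0 := by
  apply eq_of_t_mul_eq hu
  have h1 := hl.E_mul (t 0 0) u
  rw [hu.mul_inv, h.E_one, h.E_t ht, zero_mul, add_zero, ht.P_t, if_pos rfl] at h1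
  rw [← h1, mul_zero]

theorem Φ_u : Φ u = β' • u := by
  apply eq_of_t_mul_eq hu
  have h1 := hl.Φ_mul (t 0 0) u
  rw [hu.mul_inv, h.Φ_one, h.Φ_t ht, smul_mul_assoc] at h1
  rw [mul_smul_comm, hu.mul_inv, h1, smul_smul, ht.inv, one_smul]

theorem S_u : S 0 0 u = u := by
  apply eq_of_t_mul_eq hu
  have h1 := h.S_mul_of_E_eq_zero (h.E_t ht 0) u
  rw [hu.mul_inv, h.S_one, if_pos rfl, ht.S₀₀_t, if_pos rfl] at h1
  rw [← h1, hu.mul_inv]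

theorem F_u : F u = (θ * β') • (u * (t 1 0 * u)) := by
  apply eq_of_t_mul_eq hu
  have h1 := hl.F_mul (t 0 0) u
  rw [hu.mul_inv, h.F_one, h.F_t₀₀ ht, ht.P_t, if_pos rfl, h.Φ_t ht, smul_mul_assoc,
    smul_mul_assoc] at h1
  have h2 : β • (t 0 0 * F u) = θ • (t 1 0 * u) := by
    rw [neg_smul] at h1
    exact (neg_add_eq_zero.1 h1.symm).symm
  rw [mul_smul_comm, ← mul_assoc, hu.mul_inv, one_mul, mul_comm, mul_smul, ← h2, smul_smul, ht.inv,
    one_smul]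

theorem E_e : E (u * t 0 1) = 0 := by
  rw [hl.E_mul, h.E_t ht, h.E_u ht hl hu]
  simp

theorem E_f : E (t 1 0 * u) = (η * β') • (1 : W) := by
  rw [hl.E_mul, h.E_u ht hl hu, h.E_t₁₀ ht, h.Φ_u ht hl hu, mul_zero, zero_add, smul_mul_smul_comm,
    hu.mul_inv]

theorem E_φ : E (u * (t 1 1 + t 1 0 * u * t 0 1)) = 0 := by
  have h1 : E (t 1 1 + t 1 0 * u * t 0 1) = 0 := by
    rw [map_add, hl.E_mul (t 1 0 * u), h.E_t₁₁ ht, h.E_t ht, h.E_f ht hl hu, h.Φ_t ht]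
    simp only [smul_mul_smul_comm, one_mul, mul_zero, zero_add, mul_assoc, ht.inv, mul_one]
    module
  rw [hl.E_mul, h1, h.E_u ht hl hu]
  simp

theorem Φ_e : Φ (u * t 0 1) = u * t 0 1 := by
  rw [hl.Φ_mul, h.Φ_u ht hl hu, h.Φ_t ht, smul_mul_smul_comm, ht.inv, one_smul]

theorem Φ_f : Φ (t 1 0 * u) = t 1 0 * u := by
  rw [hl.Φ_mul, h.Φ_u ht hl hu, h.Φ_t ht, smul_mul_smul_comm, mul_comm, ht.inv, one_smul]

theorem Φ_φ : Φ (u * (t 1 1 + t 1 0 * u * t 0 1)) = u * (t 1 1 + t 1 0 * u * t 0 1) := by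
  rw [hl.Φ_mul, map_add, hl.Φ_mul (t 1 0 * u), h.Φ_f ht hl hu, h.Φ_t ht, h.Φ_t ht, h.Φ_u ht hl hu,
    mul_smul_comm, ← smul_add, smul_mul_smul_comm, ht.inv, one_smul]

theorem F_f : F (t 1 0 * u) = 0 := by
  have hP : P (t 1 0) = -t 1 0 := by rw [ht.P_t, if_neg one_ne_zero]
  rw [hl.F_mul, h.F_t ht, h.F_u ht hl hu, hP, map_neg, h.Φ_t ht, zero_mul, zero_add, neg_mul,
    smul_mul_smul_comm, ← mul_assoc (t 1 0) u, hu.sq, smul_zero, neg_zero]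

theorem F_e : F (u * t 0 1) = (θ * β') • (u * (t 1 1 + t 1 0 * u * t 0 1)) := by
  rw [hl.F_mul, h.F_u ht hl hu, P_u ht hu, h.Φ_u ht hl hu, h.F_t₀₁ ht, smul_mul_smul_comm, mul_add,
    smul_add, smul_mul_assoc, mul_comm β', add_comm]
  simp only [mul_assoc]

theorem F_φ : F (u * (t 1 1 + t 1 0 * u * t 0 1)) = 0 := by
  have hP : P (t 1 0 * u) = -(t 1 0 * u) := by
    rw [map_mul, P_u ht hu, ht.P_t, if_neg one_ne_zero, neg_mul]
  have h2 : t 1 0 * (u * (t 1 0 * (u * t 0 1))) = 0 := by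
    simp only [← mul_assoc]
    rw [mul_assoc (t 1 0 * u), hu.sq, zero_mul]
  rw [hl.F_mul, map_add, h.F_t ht, hl.F_mul (t 1 0 * u), h.F_f ht hl hu, hP, map_neg,
    h.Φ_f ht hl hu, h.F_u ht hl hu, h.F_t₀₁ ht, P_u ht hu, h.Φ_u ht hl hu]
  simp only [zero_mul, zero_add, mul_add, neg_mul, smul_mul_assoc, mul_smul_comm, mul_assoc, h2,
    mul_neg, mul_zero, smul_zero, add_zero]
  module

theorem S_e : S 0 0 (u * t 0 1) = u * t 0 1 := by
  rw [h.S_mul_of_E_eq_zero (h.E_u ht hl hu), h.S_u ht hl hu, ht.S₀₀_t, if_pos rfl]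

theorem S_f : S 0 0 (t 1 0 * u) = (γ * β') • (t 1 0 * u) := by
  have hP : P (t 1 0) = -t 1 0 := by rw [ht.P_t, if_neg one_ne_zero]
  have hc : γ * β' = β + η * θ * β' := by linear_combination β * ht.inv + β' * ht.rel
  rw [h.mul₀₀, ← h.F_S u, h.S_u ht hl hu, h.F_u ht hl hu, hP, map_neg, ht.S₀₁_t₁₀, ht.S₀₀_t,
    if_neg one_ne_zero, neg_mul, smul_mul_smul_comm, ← mul_assoc (t 0 0), hu.mul_inv, one_mul, hc,
      smul_mul_assoc]
  module

theorem S_φ : S 0 0 (u * (t 1 1 + t 1 0 * u * t 0 1)) =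
    (γ * β') • (u * (t 1 1 + t 1 0 * u * t 0 1)) := by
  have hP : P (t 1 0 * u) = -(t 1 0 * u) := by
    rw [map_mul, P_u ht hu, ht.P_t, if_neg one_ne_zero, neg_mul]
  have hc : γ * β' = β + η * θ * β' := by linear_combination β * ht.inv + β' * ht.rel
  rw [h.S_mul_of_E_eq_zero (h.E_u ht hl hu), h.S_u ht hl hu, map_add, h.mul₀₀ (t 1 0 * u),
    h.S_f ht hl hu, hP, map_neg, ← h.S_E (t 1 0 * u), h.E_f ht hl hu, map_smul, h.S_one,
    ht.S₀₀_t, ht.S₀₀_t, ht.S₁₀_t₀₁]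
  simp only [if_true, one_ne_zero, if_false, neg_mul, smul_mul_smul_comm, one_mul, sub_neg_eq_add]
  rw [hc]
  simp only [smul_mul_assoc, add_mul, mul_add, mul_smul_comm, smul_add, add_smul]
  module

end GaussAction

end GaussLeibniz

/-! ### Nilpotency of the odd currents -/

section Specialization

/-- The relations for `x₁₀`, `x₀₀` obtained from the RTT relation at a point where the coefficient
`q α - q⁻¹ β` of the Perk-Schultz matrix vanishes. -/
theorem rtt_specialize {M M' : Type*} [Ring M] [Algebra ℂ M] [Ring M'] [Algebra ℂ M'] {q : ℂ}
    (hq0 : q ≠ 0) (hq2 : q ^ 2 ≠ 1) (hq4 : q ^ 4 ≠ 1) {α β : M} (hα : ∀ x, α * x = x * α)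
      (hβ : ∀ x, β * x = x * β)
    {X Y : Fin 2 → Fin 2 → M} (h : rttLeft q α β X Y = rttRight q α β X Y) (ev : M →ₗ[ℂ] M')
    {x y : Fin 2 → Fin 2 → M'} {Z : M'} (hZ : ∀ v, Z * v = 0 → v = 0)
    (evα : ∀ v, ev (α * v) = Z * ev v) (evβ : ∀ v, ev (β * v) = q ^ 2 • (Z * ev v))
    (evXY : ∀ i j k l, ev (X i j * Y k l) = x i j * y k l) :
    x 1 0 * y 1 0 = 0 ∧ x 0 0 * y 1 0 = q • (x 1 0 * y 0 0) := by
  have h1 := congrArg ev (congrFun (congrFun (congrFun (congrFun h 1) 0) 1) 0)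
  have h2 := congrArg ev (congrFun (congrFun (congrFun (congrFun h 1) 0) 0) 0)
  simp only [rttLeft, rttRight, Fin.sum_univ_two, rho, mul_add, ← smul_mul_assoc, ← mul_smul_comm,
    ← hα, ← hβ] at h1 h2
  simp [rZ, rW, evα, evβ, evXY, add_mul, smul_smul] at h1 h2
  rw [← hα, ← hβ] at h1 h2
  simp only [evα, evβ, smul_smul] at h1 h2
  have e1 : q⁻¹ * q ^ 2 = q := by field_simp
  have e2 : q⁻¹ * (q ^ 4 - 1) ≠ 0 := mul_ne_zero (inv_ne_zero hq0) (sub_ne_zero.2 hq4)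
  have e3 : q - q⁻¹ ≠ 0 := by
    intro h
    apply hq2
    field_simp at h
    linear_combination h
  rw [e1, add_neg_cancel] at h1 h2
  constructor
  · apply hZ
    rw [← sub_eq_zero, sub_zero]
    refine (smul_eq_zero_iff_right e2).1 ?_
    rw [← h1]
    match_scalars
    field_simp
    ring
  · rw [← sub_eq_zero]
    apply hZ
    refine (smul_eq_zero_iff_right e3).1 ?_
    rw [← h2, mul_sub, mul_smul_comm]
    match_scalars
    · ring
    · field_simp
      ring

variable {M : Type*} [Ring M] [Algebra ℂ M]

/-- The specialization `var₁ ↦ c X`, `var₂ ↦ c' X`. -/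
def evalDiag (c c' : ℂ) : M⟦X⟧⟦X⟧ →ₗ[ℂ] M⟦X⟧ where
  toFun v := .mk fun n => ∑ p ∈ antidiagonal n,
    (c ^ p.1 * c' ^ p.2) • PowerSeries.coeff p.1 (PowerSeries.coeff p.2 v)
  map_add' v v' := by ext; simp [Finset.sum_add_distrib]
  map_smul' r v := by
    ext n
    simp [Finset.smul_sum, smul_comm r]

theorem coeff_evalDiag (c c' : ℂ) (v : M⟦X⟧⟦X⟧) (n : ℕ) : PowerSeries.coeff n (evalDiag c c' v) =
    ∑ p ∈ antidiagonal n, (c ^ p.1 * c' ^ p.2) • PowerSeries.coeff p.1 (PowerSeries.coeff p.2 v) :=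
  PowerSeries.coeff_mk n fun n => ∑ p ∈ antidiagonal n,
    (c ^ p.1 * c' ^ p.2) • PowerSeries.coeff p.1 (PowerSeries.coeff p.2 v)

/-- The substitution `X ↦ c X`. -/
def scaleVar (c : ℂ) (f : M⟦X⟧) : M⟦X⟧ := .mk fun n => c ^ n • PowerSeries.coeff n f

theorem scaleVar_mul (c : ℂ) (f g : M⟦X⟧) : scaleVar c (f * g) = scaleVar c f * scaleVar c g := by
  ext n
  simp only [scaleVar, PowerSeries.coeff_mul, PowerSeries.coeff_mk, Finset.smul_sum]
  refine Finset.sum_congr rfl fun p hp => ?_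
  rw [smul_mul_smul_comm, ← pow_add, Finset.HasAntidiagonal.mem_antidiagonal.1 hp]

theorem scaleVar_one_left (f : M⟦X⟧) : scaleVar 1 f = f := by
  ext n
  simp [scaleVar]

theorem scaleVar_one (c : ℂ) : scaleVar c (1 : M⟦X⟧) = 1 := by
  ext n
  by_cases h : n = 0 <;> simp [scaleVar, PowerSeries.coeff_one, h]

theorem evalDiag_inFst_mul_inSnd (c c' : ℂ) (f g : M⟦X⟧) :
    evalDiag c c' (inFst f * inSnd g) = scaleVar c f * scaleVar c' g := by
  ext n
  rw [coeff_evalDiag, PowerSeries.coeff_mul]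
  refine Finset.sum_congr rfl fun p _ => ?_
  rw [coeff_inFst_mul_inSnd, scaleVar, scaleVar, PowerSeries.coeff_mk, PowerSeries.coeff_mk,
    smul_mul_smul_comm]

theorem evalDiag_var₁_mul (c c' : ℂ) (v : M⟦X⟧⟦X⟧) :
    evalDiag c c' (var₁ * v) = c • (PowerSeries.X * evalDiag c c' v) := by
  ext n
  rw [PowerSeries.coeff_smul]
  cases n with
  | zero => simp [coeff_evalDiag, var₁]
  | succ n =>
    rw [coeff_evalDiag, PowerSeries.coeff_succ_X_mul, coeff_evalDiag,
      Finset.Nat.antidiagonal_succ, Finset.sum_cons, Finset.sum_map, Finset.smul_sum]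
    simp only [var₁, PowerSeries.coeff_C_mul, Function.Embedding.prodMap,
      Function.Embedding.coeFn_mk,
      Prod.map_fst, Prod.map_snd, Nat.succ_eq_add_one, Function.Embedding.refl_apply,
      PowerSeries.coeff_succ_X_mul, PowerSeries.coeff_zero_X_mul, smul_zero, zero_add, smul_smul]
    refine Finset.sum_congr rfl fun p _ => ?_
    congr 1; ring

theorem evalDiag_var₂_mul (c c' : ℂ) (v : M⟦X⟧⟦X⟧) :
    evalDiag c c' (var₂ * v) = c' • (PowerSeries.X * evalDiag c c' v) := by
  ext n
  rw [PowerSeries.coeff_smul]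
  cases n with
  | zero => simp [coeff_evalDiag, var₂]
  | succ n =>
    rw [coeff_evalDiag, PowerSeries.coeff_succ_X_mul, coeff_evalDiag,
      Finset.Nat.antidiagonal_succ', Finset.sum_cons, Finset.sum_map, Finset.smul_sum]
    simp only [var₂, Function.Embedding.prodMap, Function.Embedding.coeFn_mk,
      Prod.map_fst, Prod.map_snd, Nat.succ_eq_add_one, Function.Embedding.refl_apply,
      PowerSeries.coeff_succ_X_mul, PowerSeries.coeff_zero_X_mul, map_zero, smul_zero, zero_add,
      smul_smul]
    refine Finset.sum_congr rfl fun p _ => ?_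
    congr 1; ring

theorem X_mul_eq_zero (v : M⟦X⟧) (h : PowerSeries.X * v = 0) : v = 0 := by
  ext n
  rw [← PowerSeries.coeff_succ_X_mul, h]
  simp

theorem map₂_injective {M' : Type*} [Ring M'] [Algebra ℂ M'] (f : M →ₐ[ℂ] M')
    (hf : Function.Injective f) : Function.Injective (map₂ f) := by
  intro v v' h
  ext n m
  apply hf
  rw [← coeff_map₂, ← coeff_map₂, h]

variable (q : ℂ) (hq0 : q ≠ 0) (hq2 : q ^ 2 ≠ 1) (hq4 : q ^ 4 ≠ 1)

include hq0 hq2 hq4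

/-- `F⁻(z)² = 0`, from the RTT relation at `z = q² w`, where `R(z,w)` degenerates. -/
theorem tSeries_sq {u : (B q)⟦X⟧} (hu : tSeries q 0 0 * u = 1) (hu' : u * tSeries q 0 0 = 1) :
    tSeries q 1 0 * u * (tSeries q 1 0 * u) = 0 := by
  have h : rttLeft q var₂ var₁ (fun i j => inFst (tSeries q i j))
      (fun i j => inSnd (tSeries q i j)) =
      rttRight q var₂ var₁ (fun i j => inFst (tSeries q i j))
        (fun i j => inSnd (tSeries q i j)) := by
    funext a j c l
    apply map₂_injective (B q).val Subtype.val_injective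
    rw [map_rttLeft, map_rttRight]
    simp only [tSeries, map₂_inFst, map₂_inSnd, map₂_var₁, map₂_var₂]
    exact congrFun (congrFun (congrFun (congrFun (isRTT q).tt a) j) c) l
  obtain ⟨h1, h2⟩ := rtt_specialize hq0 hq2 hq4 var₂_mul var₁_mul h (evalDiag (q ^ 2) 1)
    (x := fun i j => scaleVar (q ^ 2) (tSeries q i j)) (y := tSeries q) X_mul_eq_zero
    (fun v => by rw [evalDiag_var₂_mul, one_smul]) (fun v => evalDiag_var₁_mul _ _ v)
    (fun i j k l => by rw [evalDiag_inFst_mul_inSnd, scaleVar_one_left])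
  have h3 : scaleVar (q ^ 2) u * scaleVar (q ^ 2) (tSeries q 0 0) = 1 := by
    rw [← scaleVar_mul, hu', scaleVar_one]
  have h4 : tSeries q 1 0 * u = q • (scaleVar (q ^ 2) u * scaleVar (q ^ 2) (tSeries q 1 0)) := by
    have := congrArg (fun v => scaleVar (q ^ 2) u * v * u) h2
    simp only [mul_smul_comm, smul_mul_assoc, mul_assoc, hu, mul_one] at this
    rw [← this, ← mul_assoc, h3, one_mul]
  refine (congrArg (· * (tSeries q 1 0 * u)) h4).trans ?_
  rw [smul_mul_assoc, mul_assoc, ← mul_assoc (scaleVar (q ^ 2) (tSeries q 1 0)), h1]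
  simp

/-- `F⁺(z)² = 0`. -/
theorem sSeries_sq {u : (A q)⟦X⟧} (hu : sSeries q 0 0 * u = 1) (hu' : u * sSeries q 0 0 = 1) :
    sSeries q 1 0 * u * (sSeries q 1 0 * u) = 0 := by
  have h : rttLeft q var₁ var₂ (fun i j => inFst (sSeries q i j))
      (fun i j => inSnd (sSeries q i j)) =
      rttRight q var₁ var₂ (fun i j => inFst (sSeries q i j))
        (fun i j => inSnd (sSeries q i j)) := by
    funext a j c l
    apply map₂_injective (A q).val Subtype.val_injective
    rw [map_rttLeft, map_rttRight]
    simp only [sSeries, map₂_inFst, map₂_inSnd, map₂_var₁, map₂_var₂]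
    exact congrFun (congrFun (congrFun (congrFun (isRTT q).ss a) j) c) l
  obtain ⟨h1, h2⟩ := rtt_specialize hq0 hq2 hq4 var₁_mul var₂_mul h (evalDiag 1 (q ^ 2))
    (x := sSeries q) (y := fun i j => scaleVar (q ^ 2) (sSeries q i j)) X_mul_eq_zero
    (fun v => by rw [evalDiag_var₁_mul, one_smul]) (fun v => evalDiag_var₂_mul _ _ v)
    (fun i j k l => by rw [evalDiag_inFst_mul_inSnd, scaleVar_one_left])
  have h3 : scaleVar (q ^ 2) (sSeries q 0 0) * scaleVar (q ^ 2) u = 1 := by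
    rw [← scaleVar_mul, hu, scaleVar_one]
  have h4 : u * sSeries q 1 0 = q⁻¹ • (scaleVar (q ^ 2) (sSeries q 1 0) * scaleVar (q ^ 2) u) := by
    have := congrArg (fun v => q⁻¹ • (u * v * scaleVar (q ^ 2) u)) h2
    simp only [mul_smul_comm, smul_mul_assoc, mul_assoc, h3, mul_one, smul_smul,
      inv_mul_cancel₀ hq0, one_smul] at this
    rw [← this, ← mul_assoc u, hu', one_mul]
  rw [mul_assoc, ← mul_assoc u, h4, smul_mul_assoc, mul_smul_comm, ← mul_assoc, ← mul_assoc, h1]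
  simp

end Specialization

/-! ### The action of `A` on two-variable series over `B` -/

section ConcreteAction

/-- The Leibniz rule for series of operators, from the Leibniz rule for the operators. -/
theorem ser_mul {R : Type*} [Ring R] [Algebra ℂ R] {D X Y X' Y' : (Module.End ℂ R)⟦X⟧}
    {T T' : R →ₐ[ℂ] R} {ε : ℤ}
    (h : ∀ m b b', (PowerSeries.coeff m D : Module.End ℂ R) (b * b') =
      (∑ p ∈ antidiagonal m, (PowerSeries.coeff p.1 X : Module.End ℂ R) (T b) *
        (PowerSeries.coeff p.2 Y : Module.End ℂ R) b') +
      ε • ∑ p ∈ antidiagonal m, (PowerSeries.coeff p.1 X' : Module.End ℂ R) (T' b) *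
        (PowerSeries.coeff p.2 Y' : Module.End ℂ R) b') (v v' : R⟦X⟧⟦X⟧) :
    ser D (v * v') = ser X (mapAlg T v) * ser Y v' + ε • (ser X' (mapAlg T' v) * ser Y' v') := by
  have := series_bilin_ext (T := (LinearMap.mul ℂ⟦X⟧⟦X⟧ R⟦X⟧⟦X⟧).compr₂ (ser D))
    (T' := (LinearMap.mul ℂ⟦X⟧⟦X⟧ R⟦X⟧⟦X⟧).compl₁₂ (ser X ∘ₗ (mapAlg T).toLinearMap) (ser Y) +
      ε • (LinearMap.mul ℂ⟦X⟧⟦X⟧ R⟦X⟧⟦X⟧).compl₁₂ (ser X' ∘ₗ (mapAlg T').toLinearMap) (ser Y'))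
    fun r r' => by
      change ser D (const₂ r * const₂ r') = ser X (mapAlg T (const₂ r)) * ser Y (const₂ r') +
        ε • (ser X' (mapAlg T' (const₂ r)) * ser Y' (const₂ r'))
      rw [mapAlg_const₂, mapAlg_const₂, ← const₂_mul, ser_const₂, ser_const₂, ser_const₂,
        ser_const₂,
        ser_const₂, ← (PowerSeries.map PowerSeries.C).map_mul,
        ← (PowerSeries.map PowerSeries.C).map_mul, ← map_zsmul, ← map_add]
      congr 1
      ext m
      simp only [PowerSeries.coeff_mk, h, map_add, map_zsmul, PowerSeries.coeff_mul]
  exact congrArg (fun f => f v v') this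

variable (q : ℂ) [hq : NeZero q]

/-- The action of series `x(z)` over `A` on two-variable series over `B`; the variable `z` of `x`
becomes the outer variable. -/
def actSer : (A q)⟦X⟧ →+* Module.End ℂ⟦X⟧⟦X⟧ (B q)⟦X⟧⟦X⟧ :=
  (serHom (B q)).comp (PowerSeries.map (opAct q : A q →+* Module.End ℂ (B q)))

theorem actSer_apply (x : (A q)⟦X⟧) :
    actSer q x = ser (PowerSeries.map (opAct q : A q →+* Module.End ℂ (B q)) x) := rfl

theorem coeff_actSer_C (x : (A q)⟦X⟧) (f : (B q)⟦X⟧) (m n : ℕ) :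
    PowerSeries.coeff n (PowerSeries.coeff m (actSer q x (PowerSeries.C f))) =
      opAct q (PowerSeries.coeff m x) (PowerSeries.coeff n f) := by
  rw [actSer_apply, coeff_ser_C, PowerSeries.coeff_map]
  rfl

theorem actSer_mem (x : (A q)⟦X⟧) {v : (B q)⟦X⟧⟦X⟧} (hv : v ∈ sndSubring (R := B q)) :
    actSer q x v ∈ sndSubring (R := B q) := ser_mem _ hv

/-- The inverse of `s₁₁(z)`. -/
def sInv : (A q)⟦X⟧ := PowerSeries.invOfUnit (sSeries q 0 0) (kA q 0)

/-- The inverse of `t₁₁(z)`. -/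
def tInv : (B q)⟦X⟧ := PowerSeries.invOfUnit (tSeries q 0 0) (kB q 0)⁻¹

theorem constantCoeff_sSeries : PowerSeries.constantCoeff (sSeries q 0 0) = kA q 0 :=
  (PowerSeries.coeff_zero_eq_constantCoeff_apply _).symm.trans (PowerSeries.coeff_mk 0 (sA q 0 0))

theorem constantCoeff_tSeries :
    PowerSeries.constantCoeff (tSeries q 0 0) = ((kB q 0)⁻¹ : (B q)ˣ) :=
  (PowerSeries.coeff_zero_eq_constantCoeff_apply _).symm.trans (PowerSeries.coeff_mk 0 (tB q 0 0))

theorem s_mul_sInv : sSeries q 0 0 * sInv q = 1 :=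
  PowerSeries.mul_invOfUnit _ _ (constantCoeff_sSeries q)

theorem sInv_mul_s : sInv q * sSeries q 0 0 = 1 :=
  PowerSeries.invOfUnit_mul _ _ (constantCoeff_sSeries q)

theorem t_mul_tInv : tSeries q 0 0 * tInv q = 1 :=
  PowerSeries.mul_invOfUnit _ _ (constantCoeff_tSeries q)

theorem tInv_mul_t : tInv q * tSeries q 0 0 = 1 :=
  PowerSeries.invOfUnit_mul _ _ (constantCoeff_tSeries q)

theorem coeff_actSer_s (i j : Fin 2) (f : (B q)⟦X⟧) (m n : ℕ) :
    PowerSeries.coeff n (PowerSeries.coeff m (actSer q (sSeries q i j) (PowerSeries.C f))) =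
      opB q i j m (PowerSeries.coeff n f) := by
  rw [coeff_actSer_C, sSeries, PowerSeries.coeff_mk, opAct_sA]

theorem coeff_map_opAct_s (i j : Fin 2) (m : ℕ) :
    PowerSeries.coeff m (PowerSeries.map (opAct q : A q →+* Module.End ℂ (B q)) (sSeries q i j)) =
      opB q i j m := by
  rw [PowerSeries.coeff_map, sSeries, PowerSeries.coeff_mk]
  exact opAct_sA i j m

theorem actSer_s_par (i j : Fin 2) (v : (B q)⟦X⟧⟦X⟧) :
    actSer q (sSeries q i j) (mapAlg (par (B q)) v) =
    if i = j then mapAlg (par (B q)) (actSer q (sSeries q i j) v)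
    else -mapAlg (par (B q)) (actSer q (sSeries q i j) v) := by
  have h1 : ∀ f m n, PowerSeries.coeff n (PowerSeries.coeff m (actSer q (sSeries q i j)
      (mapAlg (par (B q)) (PowerSeries.C f)))) = (-1 : ℂ) ^ ((i : ℕ) + j) •
      par (B q) (opB q i j m (PowerSeries.coeff n f)) := by
    intro f m n
    have : mapAlg (par (B q)) (PowerSeries.C f) =
        PowerSeries.C (PowerSeries.map (par (B q) : B q →+* B q) f) :=
      PowerSeries.map_C _ _
    rw [this, coeff_actSer_s, PowerSeries.coeff_map]
    exact opB_par q i j m _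
  have h2 := series_linearMap_ext (T := actSer q (sSeries q i j) ∘ₗ (mapAlg (par (B q))).toLinearMap)
    (T' := ((-1) ^ ((i : ℕ) + j) : ℤ) • ((mapAlg (par (B q))).toLinearMap ∘ₗ actSer q (sSeries q i j)))
    fun r => by
      ext m n
      rw [LinearMap.comp_apply, AlgHom.toLinearMap_apply, const₂, h1]
      simp only [LinearMap.smul_apply, LinearMap.comp_apply, AlgHom.toLinearMap_apply, map_zsmul,
        coeff_mapAlg, coeff_actSer_s]
      rw [← Int.cast_smul_eq_zsmul ℂ]
      push_cast
      rfl
  have h3 := congrArg (fun f => f v) h2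
  simp only [LinearMap.comp_apply, LinearMap.smul_apply, AlgHom.toLinearMap_apply] at h3
  rw [h3]
  fin_cases i <;> fin_cases j <;> simp

theorem actSer_s_mul₀₀ (v v' : (B q)⟦X⟧⟦X⟧) : actSer q (sSeries q 0 0) (v * v') =
    actSer q (sSeries q 0 0) v * actSer q (sSeries q 0 0) v' -
      actSer q (sSeries q 0 1) (mapAlg (par (B q)) v) * actSer q (sSeries q 1 0) v' := by
  have := ser_mul (D := PowerSeries.map (opAct q : A q →+* Module.End ℂ (B q)) (sSeries q 0 0))
    (X := PowerSeries.map (opAct q : A q →+* Module.End ℂ (B q)) (sSeries q 0 0))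
    (Y := PowerSeries.map (opAct q : A q →+* Module.End ℂ (B q)) (sSeries q 0 0))
    (X' := PowerSeries.map (opAct q : A q →+* Module.End ℂ (B q)) (sSeries q 0 1))
    (Y' := PowerSeries.map (opAct q : A q →+* Module.End ℂ (B q)) (sSeries q 1 0))
    (T := AlgHom.id ℂ (B q)) (T' := par (B q)) (ε := -1) (fun m b b' => by
      simp only [coeff_map_opAct_s, opB_mul q 0 0 m b b', Fin.sum_univ_two]
      simp [AlgHom.one_apply]) v v'
  rw [neg_one_smul, ← sub_eq_add_neg] at this
  exact this

theorem actSer_s_mul₀₁ (v v' : (B q)⟦X⟧⟦X⟧) : actSer q (sSeries q 0 1) (v * v') =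
    actSer q (sSeries q 0 0) (mapAlg (par (B q)) v) * actSer q (sSeries q 0 1) v' +
      actSer q (sSeries q 0 1) v * actSer q (sSeries q 1 1) v' := by
  have := ser_mul (D := PowerSeries.map (opAct q : A q →+* Module.End ℂ (B q)) (sSeries q 0 1))
    (X := PowerSeries.map (opAct q : A q →+* Module.End ℂ (B q)) (sSeries q 0 0))
    (Y := PowerSeries.map (opAct q : A q →+* Module.End ℂ (B q)) (sSeries q 0 1))
    (X' := PowerSeries.map (opAct q : A q →+* Module.End ℂ (B q)) (sSeries q 0 1))
    (Y' := PowerSeries.map (opAct q : A q →+* Module.End ℂ (B q)) (sSeries q 1 1))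
    (T := par (B q)) (T' := AlgHom.id ℂ (B q)) (ε := 1) (fun m b b' => by
      simp only [coeff_map_opAct_s, opB_mul q 0 1 m b b', Fin.sum_univ_two]
      simp [par_par, pow_two, AlgHom.mul_apply]) v v'
  rw [one_smul] at this
  exact this

theorem actSer_s_mul₁₀ (v v' : (B q)⟦X⟧⟦X⟧) : actSer q (sSeries q 1 0) (v * v') =
    actSer q (sSeries q 1 0) v * actSer q (sSeries q 0 0) v' +
      actSer q (sSeries q 1 1) (mapAlg (par (B q)) v) * actSer q (sSeries q 1 0) v' := by
  have := ser_mul (D := PowerSeries.map (opAct q : A q →+* Module.End ℂ (B q)) (sSeries q 1 0))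
    (X := PowerSeries.map (opAct q : A q →+* Module.End ℂ (B q)) (sSeries q 1 0))
    (Y := PowerSeries.map (opAct q : A q →+* Module.End ℂ (B q)) (sSeries q 0 0))
    (X' := PowerSeries.map (opAct q : A q →+* Module.End ℂ (B q)) (sSeries q 1 1))
    (Y' := PowerSeries.map (opAct q : A q →+* Module.End ℂ (B q)) (sSeries q 1 0))
    (T := AlgHom.id ℂ (B q)) (T' := par (B q)) (ε := 1) (fun m b b' => by
      simp only [coeff_map_opAct_s, opB_mul q 1 0 m b b', Fin.sum_univ_two]
      simp [AlgHom.one_apply]) v v'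
  rw [one_smul] at this
  exact this

theorem actSer_s_mul₁₁ (v v' : (B q)⟦X⟧⟦X⟧) : actSer q (sSeries q 1 1) (v * v') =
    actSer q (sSeries q 1 1) v * actSer q (sSeries q 1 1) v' -
      actSer q (sSeries q 1 0) (mapAlg (par (B q)) v) * actSer q (sSeries q 0 1) v' := by
  have := ser_mul (D := PowerSeries.map (opAct q : A q →+* Module.End ℂ (B q)) (sSeries q 1 1))
    (X := PowerSeries.map (opAct q : A q →+* Module.End ℂ (B q)) (sSeries q 1 1))
    (Y := PowerSeries.map (opAct q : A q →+* Module.End ℂ (B q)) (sSeries q 1 1))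
    (X' := PowerSeries.map (opAct q : A q →+* Module.End ℂ (B q)) (sSeries q 1 0))
    (Y' := PowerSeries.map (opAct q : A q →+* Module.End ℂ (B q)) (sSeries q 0 1))
    (T := AlgHom.id ℂ (B q)) (T' := par (B q)) (ε := -1) (fun m b b' => by
      have h1 : opB q 1 1 m (b * b') =
          (-1 : ℂ) ^ 1 • ∑ p ∈ antidiagonal m, opB q 1 0 p.1
            ((par (B q) ^ 1) b) * opB q 0 1 p.2 b' +
          (-1 : ℂ) ^ 4 • ∑ p ∈ antidiagonal m, opB q 1 1 p.1
            ((par (B q) ^ 2) b) * opB q 1 1 p.2 b' :=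
        (opB_mul q 1 1 m b b').trans (Fin.sum_univ_two _)
      have h2 : (par (B q) ^ 2) b = b := by rw [pow_two]; exact par_par _ b
      have h3 : (par (B q) ^ 1) b = par (B q) b := rfl
      rw [h2, h3, show (-1 : ℂ) ^ 1 = -1 by norm_num, show (-1 : ℂ) ^ 4 = 1 by norm_num, one_smul,
        neg_one_smul, add_comm] at h1
      rw [neg_one_smul ℤ]
      simp only [coeff_map_opAct_s]
      exact h1) v v'
  rw [neg_one_smul, ← sub_eq_add_neg] at this
  exact this

/-- The action of `s_{ij}(z)`, `E⁺(z)`, `F⁺(z)`, `φ⁺(z)` on two-variable series over `B`. The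
operator of `s₁₁(z)` is invertible because the series `s₁₁(z)` is, and `F⁺(z)² = 0` by
`sSeries_sq`. -/
theorem gaussAction (hq : ∀ n : ℕ, 0 < n → q ^ n ≠ 1) :
    GaussAction (mapAlg (par (B q))) (fun i j => actSer q (sSeries q i j))
      (actSer q (gaussE (sSeries q) (kA q 0))) (actSer q (gaussF (sSeries q) (kA q 0)))
      (actSer q (gaussPhi (sSeries q) (kA q 0))) where
  injective := by
    refine Function.LeftInverse.injective (g := actSer q (sInv q)) fun v => ?_
    rw [← Module.End.mul_apply, ← map_mul, sInv_mul_s, map_one, Module.End.one_apply]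
  surjective := by
    refine Function.RightInverse.surjective (g := actSer q (sInv q)) fun v => ?_
    rw [← Module.End.mul_apply, ← map_mul, s_mul_sInv, map_one, Module.End.one_apply]
  S_E v := by
    rw [← Module.End.mul_apply, ← map_mul, gaussE, ← mul_assoc, ← sInv, s_mul_sInv, one_mul]
  F_S v := by
    rw [← Module.End.mul_apply, ← map_mul, gaussF, mul_assoc, ← sInv, sInv_mul_s, mul_one]
  S_Φ v := by
    rw [← Module.End.mul_apply, ← Module.End.mul_apply, ← map_mul, ← map_mul, ← LinearMap.add_apply,
      ← map_add, gaussPhi, ← mul_assoc, ← sInv, s_mul_sInv, one_mul, gaussK₂, gaussE, ← mul_assoc]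
  F_F v := by
    rw [← Module.End.mul_apply, ← map_mul, gaussF, ← sInv, sSeries_sq q (NeZero.ne q)
      (hq 2 (by norm_num)) (hq 4 (by norm_num)) (s_mul_sInv q) (sInv_mul_s q), map_zero,
      LinearMap.zero_apply]
  S_one i j := by
    rw [← const₂_one]
    ext m n
    rw [const₂, coeff_actSer_C, sSeries, PowerSeries.coeff_mk, PowerSeries.coeff_C]
    by_cases hn : n = 0
    · rw [if_pos hn, opAct_one, eps_sA]
      by_cases hij : i = j <;> by_cases hm : m = 0 <;>
        simp [hij, hm, hn, PowerSeries.coeff_C]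
    · rw [if_neg hn, map_zero]
      by_cases hij : i = j <;> by_cases hm : m = 0 <;>
        simp [hij, hm, hn, PowerSeries.coeff_C]
  P_P v := by
    ext m n
    rw [coeff_mapAlg, coeff_mapAlg, par_par]
  S_P := actSer_s_par q
  mul₀₀ := actSer_s_mul₀₀ q
  mul₀₁ := actSer_s_mul₀₁ q
  mul₁₀ := actSer_s_mul₁₀ q
  mul₁₁ := actSer_s_mul₁₁ q

end ConcreteAction

/-! ### The action on the generators of `B` -/

section Table

theorem const₂_smul {R : Type*} [Ring R] [Algebra ℂ R] (c : ℂ) (r : R) :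
    const₂ (c • r) = (const₂ c : ℂ⟦X⟧⟦X⟧) • const₂ r := by
  rw [series_smul_def, const₂, const₂, const₂, PowerSeries.map_C, PowerSeries.map_C, ← map_mul,
    ← map_mul, Algebra.smul_def]

/-- The entries of `R(z,w) / (zq - wq⁻¹)`, as series in `X = w/z`. -/
def rSeries (q : ℂ) (a b i j : Fin 2) : ℂ⟦X⟧ :=
  (PowerSeries.C (rZ q a b i j) + PowerSeries.C (rW q a b i j) * PowerSeries.X) *
    (PowerSeries.C q - PowerSeries.C q⁻¹ * PowerSeries.X)⁻¹

variable (q : ℂ) [hq : NeZero q]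

theorem rDenom_mul_inv : (PowerSeries.C q - PowerSeries.C q⁻¹ * PowerSeries.X) *
    (PowerSeries.C q - PowerSeries.C q⁻¹ * PowerSeries.X)⁻¹ = 1 := by
  apply PowerSeries.mul_inv_cancel
  simpa using hq.ne

theorem C_mul_C_inv : (PowerSeries.C q : ℂ⟦X⟧) * PowerSeries.C q⁻¹ = 1 := by
  rw [← map_mul, mul_inv_cancel₀ hq.ne, map_one]

theorem rSeries_00 : rSeries q 0 0 0 0 = 1 := by
  rw [← rDenom_mul_inv q]
  simp [rSeries, rZ, rW, sub_eq_add_neg]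

theorem rSeries_eq_zero {a b i j : Fin 2} (h : ¬ (a = b ∧ i = j) ∧ ¬ (a = j ∧ b = i)) :
    rSeries q a b i j = 0 := by
  have h1 : rZ q a b i j = 0 ∧ rW q a b i j = 0 := by
    revert h
    fin_cases a <;> fin_cases b <;> fin_cases i <;> fin_cases j <;> simp [rZ, rW]
  rw [rSeries, h1.1, h1.2]
  simp

theorem rSeries_eq_zero' {a b : Fin 2} (h : a ≠ b) : rSeries q a b a b = 0 := by
  have h1 : rZ q a b a b = 0 ∧ rW q a b a b = 0 := by
    revert h
    fin_cases a <;> fin_cases b <;> simp [rZ, rW]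
  rw [rSeries, h1.1, h1.2]
  simp

theorem rSeries_symm : rSeries q 0 0 1 1 = rSeries q 1 1 0 0 := by
  simp [rSeries, rZ, rW]

/-- The inverse of the series `(1 - X) / (q - q⁻¹ X)`. -/
def betaInv : ℂ⟦X⟧ := (rSeries q 1 1 0 0)⁻¹

theorem betaInv_mul : betaInv q * rSeries q 1 1 0 0 = 1 := by
  apply PowerSeries.inv_mul_cancel
  simpa [rSeries, rZ, rW] using hq.ne

/-- A determinant identity for `R`: it makes the Gauss coordinate `φ⁺(z)` act on all `t_{ij}(w)` by
one and the same scalar series. -/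
theorem rSeries_rel : rSeries q 1 1 1 1 - rSeries q 1 0 0 1 * rSeries q 0 1 1 0 =
    rSeries q 1 1 0 0 * rSeries q 1 1 0 0 := by
  have h1 := rDenom_mul_inv q
  have h2 := C_mul_C_inv q
  simp [rSeries, rZ, rW]
  set d := (PowerSeries.C q - PowerSeries.C q⁻¹ * PowerSeries.X)⁻¹
  generalize (PowerSeries.C q⁻¹ : ℂ⟦X⟧) = c' at *
  generalize (PowerSeries.C q : ℂ⟦X⟧) = c at *
  generalize (PowerSeries.X : ℂ⟦X⟧) = x at *
  linear_combination (-(c' - c * x) * d) * h1 + ((1 + x ^ 2 - 2 * x) * d ^ 2) * h2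

theorem smul_C_zsmul {ε : ℤ} {c : ℂ⟦X⟧} (f : (B q)⟦X⟧) (m n : ℕ) :
    PowerSeries.coeff n (PowerSeries.coeff m (ε • diagScalar c • (PowerSeries.C f : (B q)⟦X⟧⟦X⟧))) =
      ε • if m ≤ n then PowerSeries.coeff m c • PowerSeries.coeff (n - m) f else 0 := by
  rw [map_zsmul, map_zsmul, coeff_diagScalar_smul_C]

/-- The action of `s_{ij}(z)` on `t_{ab}(w)`. -/
theorem actSer_s_tSeries (i j a b : Fin 2) :
    actSer q (sSeries q i j) (PowerSeries.C (tSeries q a b)) =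
      ∑ c : Fin 2, (-1 : ℤ) ^ (((a : ℕ) + c) * ((c : ℕ) + b)) •
        diagScalar (rSeries q a c i j) • (PowerSeries.C (tSeries q c b) : (B q)⟦X⟧⟦X⟧) := by
  ext m n
  rw [coeff_actSer_s, tSeries, PowerSeries.coeff_mk, opB_tB, map_sum, map_sum]
  simp only [smul_C_zsmul]
  refine congrArg Subtype.val (Finset.sum_congr rfl fun c _ => ?_)
  rw [← Int.cast_smul_eq_zsmul ℂ]
  push_cast
  congr 1
  by_cases hmn : m ≤ n
  · rw [if_pos hmn, Finset.sum_eq_single (m, n - m)]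
    · rw [formB_tB, if_pos rfl, tSeries, PowerSeries.coeff_mk]
      rfl
    · rintro ⟨u, v⟩ h hne
      rw [Finset.HasAntidiagonal.mem_antidiagonal] at h
      rw [formB_tB, if_neg, zero_smul]
      rintro rfl
      apply hne
      simp only [Prod.mk.injEq, true_and]
      simp only at h
      omega
    · intro h
      exact absurd (by simp; omega) h
  · rw [if_neg hmn]
    refine Finset.sum_eq_zero fun p hp => ?_
    rw [Finset.HasAntidiagonal.mem_antidiagonal] at hp
    rw [formB_tB, if_neg (by omega), zero_smul]

/-- The entries of `R` give the action of the `s_{ij}(z)` on the `t_{ab}(w)`. -/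
theorem hasTable : GaussAction.HasTable (mapAlg (par (B q))) (fun i j => actSer q (sSeries q i j))
    (fun i j => (PowerSeries.C (tSeries q i j) : (B q)⟦X⟧⟦X⟧))
    (diagScalar (rSeries q 1 1 0 0)) (diagScalar (betaInv q)) (diagScalar (rSeries q 1 1 1 1))
    (diagScalar (rSeries q 1 0 0 1)) (diagScalar (rSeries q 0 1 1 0)) where
  inv := by rw [← map_mul, betaInv_mul, map_one]
  rel := by rw [← map_mul, ← map_sub, rSeries_rel, map_mul]
  P_t i j := by
    have h : mapAlg (par (B q)) (PowerSeries.C (tSeries q i j)) =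
        PowerSeries.C (PowerSeries.map (par (B q) : B q →+* B q) (tSeries q i j)) :=
      PowerSeries.map_C _ _
    have h2 : PowerSeries.map (par (B q) : B q →+* B q) (tSeries q i j) =
        if i = j then tSeries q i j else - tSeries q i j := by
      ext n
      rw [PowerSeries.coeff_map, tSeries, PowerSeries.coeff_mk]
      refine congrArg Subtype.val ((par_tB q i j n).trans ?_)
      fin_cases i <;> fin_cases j <;> simp [tSeries]
    rw [h, h2]
    split_ifs <;> simp
  S₀₀_t i j := by
    rw [actSer_s_tSeries, Fin.sum_univ_two]
    fin_cases i
    · rw [rSeries_eq_zero q (b := 1) (by decide)]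
      fin_cases j <;> simp [rSeries_00]
    · rw [rSeries_eq_zero q (b := 0) (by decide)]
      fin_cases j <;> simp
  S₁₁_t i j := by
    rw [actSer_s_tSeries, Fin.sum_univ_two]
    fin_cases i
    · rw [rSeries_eq_zero q (b := 1) (by decide)]
      fin_cases j <;> simp [rSeries_symm]
    · rw [rSeries_eq_zero q (b := 0) (by decide)]
      fin_cases j <;> simp
  S₀₁_t j := by
    rw [actSer_s_tSeries, Fin.sum_univ_two, rSeries_eq_zero q (b := 0) (by decide),
      rSeries_eq_zero' q (by decide)]
    simp
  S₀₁_t₁₀ := by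
    rw [actSer_s_tSeries, Fin.sum_univ_two, rSeries_eq_zero q (b := 1) (by decide)]
    simp
  S₀₁_t₁₁ := by
    rw [actSer_s_tSeries, Fin.sum_univ_two, rSeries_eq_zero q (b := 1) (by decide)]
    simp
  S₁₀_t j := by
    rw [actSer_s_tSeries, Fin.sum_univ_two, rSeries_eq_zero q (b := 1) (by decide),
      rSeries_eq_zero' q (by decide)]
    simp
  S₁₀_t₀₀ := by
    rw [actSer_s_tSeries, Fin.sum_univ_two, rSeries_eq_zero q (b := 0) (by decide)]
    simp
  S₁₀_t₀₁ := by
    rw [actSer_s_tSeries, Fin.sum_univ_two, rSeries_eq_zero q (b := 0) (by decide)]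
    simp

/-- The action of `s_{ij}(z)` on the group-like elements of `B`. -/
theorem actSer_s_kB (i j a : Fin 2) : actSer q (sSeries q i j) (const₂ (kB q a : B q)) =
    if i = j then const₂ (rCoeff' q a a i i 0) • const₂ (kB q a : B q) else 0 := by
  have h : (if i = j then const₂ (rCoeff' q a a i i 0) • const₂ (kB q a : B q) else 0) =
      const₂ (if i = j then rCoeff' q a a i i 0 • (kB q a : B q) else 0) := by
    split_ifs
    · rw [const₂_smul]
    · simp [const₂]
  rw [h]
  ext m n
  rw [coeff_const₂, const₂, coeff_actSer_s, PowerSeries.coeff_C]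
  by_cases hn : n = 0
  · rw [if_pos hn, opB_kB, formB_kB]
    by_cases hm : m = 0
    · rw [if_pos hm, if_pos ⟨hm, hn⟩]
      by_cases hij : i = j
      · rw [if_pos hij, hij]
      · rw [if_neg hij, rCoeff'_diag_of_ne q a i j hij, zero_smul]
    · rw [if_neg hm, zero_smul, if_neg fun h => hm h.1]
  · rw [if_neg hn, map_zero, if_neg fun h => hn h.2]

/-- Two-variable series over `B` are generated by the `t_{ij}(w)` and the group-like elements. -/
theorem series_induction {Q : (B q)⟦X⟧⟦X⟧ →ₗ[ℂ⟦X⟧⟦X⟧] Module.End ℂ⟦X⟧⟦X⟧ (B q)⟦X⟧⟦X⟧}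
    (hQ : ∀ b b', Q (const₂ b) (const₂ b') ∈ sndSubring (R := B q)) (one : Q 1 = 0)
    (t : ∀ i j v, Q v = 0 → Q (PowerSeries.C (tSeries q i j) * v) = 0)
    (k : ∀ a v, Q v = 0 → Q (const₂ (kB q a : B q) * v) = 0) : Q = 0 := by
  have h : ∀ b, Q (const₂ b) = 0 := by
    intro b
    refine B_induction (N := { carrier := {b | Q (const₂ b) = 0}
                               add_mem' := ?_
                               zero_mem' := ?_
                               smul_mem' := ?_ }) ?_ ?_ ?_ b
    · intro b b' hb hb'
      have e : const₂ (b + b') = const₂ b + const₂ b' := by simp [const₂]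
      change Q _ = 0
      rw [e, map_add, show Q (const₂ b) = 0 from hb, show Q (const₂ b') = 0 from hb', add_zero]
    · change Q (const₂ 0) = 0
      simp [const₂]
    · intro r b hb
      change Q _ = 0
      rw [const₂_smul, map_smul, show Q (const₂ b) = 0 from hb, smul_zero]
    · change Q (const₂ 1) = 0
      rw [const₂_one, one]
    · intro i j n b hb
      have h1 := t i j (const₂ b) hb
      change Q (const₂ (tB q i j n * b)) = 0
      refine series_linearMap_ext fun b' => ?_
      have h2 : PowerSeries.C (tSeries q i j) * const₂ b =
          PowerSeries.C (tSeries q i j * PowerSeries.C b) := by rw [map_mul, const₂]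
      have h3 := apply_const₂_eq_zero (T := Q.flip (const₂ b')) (fun r => hQ r b')
        (f := tSeries q i j * PowerSeries.C b) (by
          rw [← h2, LinearMap.flip_apply, h1, LinearMap.zero_apply]) n
      rwa [PowerSeries.coeff_mul_C, tSeries, PowerSeries.coeff_mk] at h3
    · intro a b hb
      change Q (const₂ (kB q a * b)) = 0
      rw [const₂_mul]
      exact k a _ hb
  refine LinearMap.ext fun v => ?_
  have h4 := series_bilin_ext (T := Q) (T' := 0) fun r r' => by rw [h]; rfl
  rw [h4]

theorem mapAlg_par_kB (a : Fin 2) :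
    mapAlg (par (B q)) (const₂ (kB q a : B q)) = const₂ (kB q a : B q) := by
  rw [mapAlg_const₂, par_kB]

section

variable {q} (hq' : ∀ n : ℕ, 0 < n → q ^ n ≠ 1)
include hq'

theorem actE_kB (a : Fin 2) :
    actSer q (gaussE (sSeries q) (kA q 0)) (const₂ (kB q a : B q)) = 0 := by
  apply (gaussAction q hq').injective
  rw [(gaussAction q hq').S_E, actSer_s_kB, if_neg (by decide), map_zero]

theorem const₂_mul_inv {c : ℂ} (hc : c ≠ 0) :
    (const₂ c : ℂ⟦X⟧⟦X⟧) * const₂ c⁻¹ = 1 := by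
  rw [← const₂_mul, mul_inv_cancel₀ hc, const₂_one]

theorem rCoeff'_ne_zero (a i : Fin 2) : rCoeff' q a a i i 0 ≠ 0 := by
  rw [rCoeff'_diag]
  exact inv_ne_zero (rCoeff_diag_ne_zero q a i)

theorem actPhi_kB (a : Fin 2) :
    actSer q (gaussPhi (sSeries q) (kA q 0)) (const₂ (kB q a : B q)) =
      const₂ (rCoeff' q a a 1 1 0 * (rCoeff' q a a 0 0 0)⁻¹) • const₂ (kB q a : B q) := by
  apply (gaussAction q hq').injective
  rw [(gaussAction q hq').S_Φ, actE_kB hq', map_zero, add_zero, map_smul, actSer_s_kB, actSer_s_kB,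
    if_pos rfl, if_pos rfl, smul_smul, const₂_mul, mul_assoc, mul_comm (const₂ (_)⁻¹),
    const₂_mul_inv hq' (rCoeff'_ne_zero hq' a 0), mul_one]

theorem actF_kB (a : Fin 2) :
    actSer q (gaussF (sSeries q) (kA q 0)) (const₂ (kB q a : B q)) = 0 := by
  have h1 := (gaussAction q hq').F_S (const₂ (kB q a : B q))
  rw [actSer_s_kB, actSer_s_kB, if_pos rfl, if_neg (by decide), map_smul] at h1
  have h2 := congrArg (fun v => (const₂ (rCoeff' q a a 0 0 0)⁻¹ : ℂ⟦X⟧⟦X⟧) • v) h1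
  simpa only [smul_smul, mul_comm (const₂ (_)⁻¹ : ℂ⟦X⟧⟦X⟧),
    const₂_mul_inv hq' (rCoeff'_ne_zero hq' a 0), one_smul, smul_zero] using h2

/-- The Leibniz rule for `F⁺(z)` with a group-like first factor. -/
theorem actF_kB_mul (a : Fin 2) (v : (B q)⟦X⟧⟦X⟧) :
    actSer q (gaussF (sSeries q) (kA q 0)) (const₂ (kB q a : B q) * v) =
      actSer q (gaussPhi (sSeries q) (kA q 0)) (const₂ (kB q a : B q)) *
        actSer q (gaussF (sSeries q) (kA q 0)) v := by
  have h := gaussAction q hq'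
  have h0 : actSer q (sSeries q 0 1) (mapAlg (par (B q)) (const₂ (kB q a : B q))) = 0 := by
    rw [mapAlg_par_kB, actSer_s_kB, if_neg (by decide)]
  have hP : mapAlg (par (B q)) (actSer q (sSeries q 0 0) (const₂ (kB q a : B q))) =
      actSer q (sSeries q 0 0) (const₂ (kB q a : B q)) := by
    rw [actSer_s_kB, if_pos rfl, map_smul, mapAlg_par_kB]
  have h1 := h.F_mul_of (v := const₂ (kB q a : B q))
    (fun y => by rw [h0, zero_mul, map_zero, map_zero, map_zero, zero_mul, zero_mul, add_zero])
    (by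
      rw [h0, map_zero, add_zero, mapAlg_par_kB, actSer_s_kB, actSer_s_kB, if_pos rfl, if_pos rfl,
        map_smul, actPhi_kB hq', smul_smul, ← const₂_mul, mul_comm, mul_assoc,
        inv_mul_cancel₀ (rCoeff'_ne_zero hq' a 0), mul_one]) v
  rw [hP, h.F_S, actSer_s_kB, actSer_s_kB, if_pos rfl, if_neg (by decide), zero_mul, zero_add,
    smul_mul_assoc, map_smul, map_smul, smul_mul_assoc] at h1
  have h2 := congrArg (fun v => (const₂ (rCoeff' q a a 0 0 0)⁻¹ : ℂ⟦X⟧⟦X⟧) • v) h1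
  simpa only [smul_smul, mul_comm (const₂ (_)⁻¹ : ℂ⟦X⟧⟦X⟧),
    const₂_mul_inv hq' (rCoeff'_ne_zero hq' a 0), one_smul] using h2

/-- The Leibniz rules for the action of `E⁺(z)`, `F⁺(z)`, `φ⁺(z)`, by induction on the word in the
generators which is the first factor. The rule for `φ⁺(z)` enters the two others. -/
theorem gaussLeibniz : GaussLeibniz (mapAlg (par (B q)))
    (actSer q (gaussE (sSeries q) (kA q 0))) (actSer q (gaussF (sSeries q) (kA q 0)))
    (actSer q (gaussPhi (sSeries q) (kA q 0))) := by
  have h := gaussAction q hq'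
  have ht := hasTable q
  set E := actSer q (gaussE (sSeries q) (kA q 0)) with hE
  set F := actSer q (gaussF (sSeries q) (kA q 0)) with hF
  set Φ := actSer q (gaussPhi (sSeries q) (kA q 0)) with hΦ
  set P := mapAlg (par (B q)) with hP
  have memP : ∀ {v}, v ∈ sndSubring (R := B q) → P v ∈ sndSubring (R := B q) :=
      fun hv => mapAlg_mem _ hv
  have memE : ∀ {v}, v ∈ sndSubring (R := B q) → E v ∈ sndSubring (R := B q) :=
      fun hv => actSer_mem q _ hv
  have memF : ∀ {v}, v ∈ sndSubring (R := B q) → F v ∈ sndSubring (R := B q) :=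
      fun hv => actSer_mem q _ hv
  have memΦ : ∀ {v}, v ∈ sndSubring (R := B q) → Φ v ∈ sndSubring (R := B q) :=
      fun hv => actSer_mem q _ hv
  have memC : ∀ b : B q, const₂ b ∈ sndSubring (R := B q) := const₂_mem
  let M := LinearMap.mul ℂ⟦X⟧⟦X⟧ (B q)⟦X⟧⟦X⟧
  have EEk : ∀ a, E (E (const₂ (kB q a : B q))) = 0 := fun a => by
    rw [hE, actE_kB hq', map_zero]
  have ΦEk : ∀ a, Φ (E (const₂ (kB q a : B q))) = E (Φ (const₂ (kB q a : B q))) := fun a => by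
    rw [hE, hΦ, actE_kB hq', map_zero, actPhi_kB hq', map_smul, actE_kB hq', smul_zero]
  have hΦm : ∀ v v', Φ (v * v') = Φ v * Φ v' := by
    have key := series_induction q (Q := M.compr₂ Φ - M.compl₁₂ Φ Φ)
      (fun b b' => sub_mem (memΦ (mul_mem (memC b) (memC b'))) (mul_mem (memΦ (memC b)) (memΦ (memC b'))))
      (LinearMap.ext fun v => by
        change Φ (1 * v) - Φ 1 * Φ v = 0
        rw [h.Φ_one, one_mul, one_mul, sub_self])
      (fun i j v hv => LinearMap.ext fun v' => by
        have hv' : Φ (v * v') - Φ v * Φ v' = 0 := congrArg (fun f => f v') hv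
        change Φ (_ * v * v') - Φ (_ * v) * Φ v' = 0
        rw [mul_assoc, h.Φ_mul_of (h.E_E_t ht i j) (h.Φ_E_t ht i j),
          h.Φ_mul_of (h.E_E_t ht i j) (h.Φ_E_t ht i j), sub_eq_zero.1 hv', mul_assoc, sub_self])
      (fun a v hv => LinearMap.ext fun v' => by
        have hv' : Φ (v * v') - Φ v * Φ v' = 0 := congrArg (fun f => f v') hv
        change Φ (_ * v * v') - Φ (_ * v) * Φ v' = 0
        rw [mul_assoc, h.Φ_mul_of (EEk a) (ΦEk a),
          h.Φ_mul_of (EEk a) (ΦEk a), sub_eq_zero.1 hv', mul_assoc, sub_self])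
    intro v v'
    exact sub_eq_zero.1 (congrArg (fun f => f v v') key)
  refine ⟨fun v v' => ?_, fun v v' => ?_, hΦm⟩
  · have key := series_induction q (Q := M.compr₂ E - (M.compl₁₂ P.toLinearMap E + M.compl₁₂ E Φ))
      (fun b b' => sub_mem (memE (mul_mem (memC b) (memC b'))) (add_mem
        (mul_mem (memP (memC b)) (memE (memC b'))) (mul_mem (memE (memC b)) (memΦ (memC b')))))
      (LinearMap.ext fun v => by
        change E (1 * v) - (P 1 * E v + E 1 * Φ v) = 0
        rw [h.E_one, map_one, zero_mul, add_zero, one_mul, one_mul, sub_self])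
      (fun i j v hv => LinearMap.ext fun v' => by
        have hv' : E (v * v') - (P v * E v' + E v * Φ v') = 0 := congrArg (fun f => f v') hv
        change E (_ * v * v') - (P (_ * v) * E v' + E (_ * v) * Φ v') = 0
        rw [mul_assoc, h.E_mul_of (h.E_E_t ht i j), h.E_mul_of (h.E_E_t ht i j), sub_eq_zero.1 hv',
          hΦm, map_mul]
        noncomm_ring)
      (fun a v hv => LinearMap.ext fun v' => by
        have hv' : E (v * v') - (P v * E v' + E v * Φ v') = 0 := congrArg (fun f => f v') hv
        change E (_ * v * v') - (P (_ * v) * E v' + E (_ * v) * Φ v') = 0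
        rw [mul_assoc, h.E_mul_of (EEk a), h.E_mul_of (EEk a), sub_eq_zero.1 hv',
          hΦm, map_mul]
        noncomm_ring)
    exact sub_eq_zero.1 (congrArg (fun f => f v v') key)
  · have key := series_induction q (Q := M.compr₂ F - (M.compl₁₂ F LinearMap.id +
        M.compl₁₂ (Φ ∘ₗ P.toLinearMap) F))
      (fun b b' => sub_mem (memF (mul_mem (memC b) (memC b'))) (add_mem
        (mul_mem (memF (memC b)) (memC b')) (mul_mem (memΦ (memP (memC b))) (memF (memC b')))))
      (LinearMap.ext fun v => by
        change F (1 * v) - (F 1 * v + Φ (P 1) * F v) = 0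
        rw [h.F_one, map_one, h.Φ_one, zero_mul, zero_add, one_mul, one_mul, sub_self])
      (fun i j v hv => LinearMap.ext fun v' => by
        have hv' : F (v * v') - (F v * v' + Φ (P v) * F v') = 0 := congrArg (fun f => f v') hv
        change F (_ * v * v') - (F (_ * v) * v' + Φ (P (_ * v)) * F v') = 0
        rw [mul_assoc, h.F_t_mul ht, h.F_t_mul ht, sub_eq_zero.1 hv', map_mul P, hΦm]
        noncomm_ring)
      (fun a v hv => LinearMap.ext fun v' => by
        have hv' : F (v * v') - (F v * v' + Φ (P v) * F v') = 0 := congrArg (fun f => f v') hv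
        change F (_ * v * v') - (F (_ * v) * v' + Φ (P (_ * v)) * F v') = 0
        rw [mul_assoc, hF, actF_kB_mul hq', actF_kB_mul hq', ← hF, ← hΦ, sub_eq_zero.1 hv',
          map_mul P,
          hΦm, mapAlg_par_kB]
        noncomm_ring)
    exact sub_eq_zero.1 (congrArg (fun f => f v v') key)

end

end Table

/-! ### Ordered products and skew derivations -/

section OrderedProducts

variable {R : Type*} [Monoid R] (x : Idx → R)

theorem orderedProd_zero : orderedProd x 0 = 1 := by simp [orderedProd]

theorem orderedProd_single_add {c : Idx} {f : Idx →₀ ℕ} (h : ∀ c' ∈ f.support, c < c') (n : ℕ) :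
    orderedProd x (Finsupp.single c n + f) = x c ^ n * orderedProd x f := by
  by_cases hn : n = 0
  · simp [hn]
  have hc : c ∉ f.support := fun hc => (h c hc).false
  have hs : (Finsupp.single c n + f).support = insert c f.support := by
    rw [Finsupp.support_add_eq, Finsupp.support_single_ne_zero _ hn]
    · rfl
    · rw [Finsupp.support_single_ne_zero _ hn]
      simpa using hc
  rw [orderedProd, hs, Finset.sort_insert (· ≤ ·) (fun b hb => (h b hb).le) hc, List.map_cons,
    List.prod_cons]
  congr 1
  · simp [Finsupp.notMem_support_iff.1 hc]
  · rw [orderedProd]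
    congr 1
    refine List.map_congr_left fun b hb => ?_
    have hb' : b ≠ c := fun e => hc (e ▸ (Finset.mem_sort _).1 hb)
    simp [Finsupp.single_apply, hb'.symm]

theorem orderedProd_add_single {c : Idx} {f : Idx →₀ ℕ} (h : ∀ c' ∈ f.support, c' < c) (n : ℕ) :
    orderedProd x (f + Finsupp.single c n) = orderedProd x f * x c ^ n := by
  induction f using Finsupp.induction_on_min with
  | zero =>
    have := orderedProd_single_add x (c := c) (f := 0) (by simp) n
    rwa [add_zero, orderedProd_zero, mul_one, ← zero_add (Finsupp.single c n),
      ← one_mul (x c ^ n), ← orderedProd_zero x] at this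
  | single_add a m f ha hm ih =>
    have hsub : ∀ b ∈ f.support, b ∈ (Finsupp.single a m + f).support := by
      intro b hb
      rw [Finsupp.mem_support_iff] at hb ⊢
      simp [hb]
    have hac : a < c := h a (by simp [hm])
    rw [add_assoc, orderedProd_single_add, ih fun b hb => h b (hsub b hb),
      orderedProd_single_add x ha,
      mul_assoc]
    intro b hb
    rcases Finset.mem_union.1 (Finsupp.support_add hb) with hb | hb
    · exact ha b hb
    · rw [Finset.mem_singleton.1 (Finsupp.support_single_subset hb)]
      exact hac

/-- Removing one factor at the end. -/
theorem orderedProd_add_single_one {b : Idx} {f : Idx →₀ ℕ} (h : ∀ c ∈ f.support, c ≤ b) :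
    orderedProd x (f + Finsupp.single b 1) = orderedProd x f * x b := by
  have h1 : ∀ c ∈ (f.erase b).support, c < b := fun c hc => by
    rw [Finsupp.support_erase, Finset.mem_erase] at hc
    exact lt_of_le_of_ne (h c hc.2) hc.1
  conv_lhs => rw [← Finsupp.erase_add_single b f]
  conv_rhs => rw [← Finsupp.erase_add_single b f]
  rw [add_assoc, ← Finsupp.single_add, orderedProd_add_single x h1, orderedProd_add_single x h1,
    pow_succ, mul_assoc]

/-- The number of odd factors before `b`. -/
def oddBefore (b : Idx) (g : Idx →₀ ℕ) : ℕ := ∑ c ∈ g.support with c < b, g c * c.par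

theorem oddBefore_single_add {b c : Idx} {n : ℕ} (hn : n ≠ 0) {f : Idx →₀ ℕ}
    (h : ∀ c' ∈ f.support, c < c') :
    oddBefore b (Finsupp.single c n + f) = (if c < b then n * c.par else 0) + oddBefore b f := by
  have hc : c ∉ f.support := fun hc => (h c hc).false
  have hs : (Finsupp.single c n + f).support = insert c f.support := by
    rw [Finsupp.support_add_eq, Finsupp.support_single_ne_zero _ hn]
    · rfl
    · rw [Finsupp.support_single_ne_zero _ hn]
      simpa using hc
  rw [oddBefore, oddBefore, Finset.sum_filter, Finset.sum_filter, hs, Finset.sum_insert hc]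
  congr 1
  · simp [Finsupp.notMem_support_iff.1 hc]
  · refine Finset.sum_congr rfl fun b hb => ?_
    have hb' : b ≠ c := fun e => hc (e ▸ hb)
    simp [Finsupp.single_apply, hb'.symm]

/-- A skew derivation `D`, modulo a subspace `I`, applied to an ordered product, when `D` maps the
factor `x b` to the scalar `d` and annihilates the other factors. If `D` is odd, `b` may occur at
most once when `x b` is odd; otherwise the multiplicity `g b` appears as a factor. The Leibniz rule
is required only for ordered products of factors indexed by `T`. -/
theorem skewDerivation_orderedProd {R : Type*} [Ring R] [Algebra ℂ R] (x : Idx → R)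
    (D : R →ₗ[ℂ] R) (I : Submodule ℂ R) (p : ℕ) (b : Idx) (d : ℂ) (T : Set Idx)
    (hI : ∀ c ∈ T, ∀ v ∈ I, x c * v ∈ I) (hD1 : D 1 ∈ I)
    (hD : ∀ c ∈ T, ∀ g : Idx →₀ ℕ, (∀ c' ∈ g.support, c ≤ c' ∧ c' ∈ T) →
      D (x c * orderedProd x g) - ((-1 : ℂ) ^ (p * c.par) • (x c * D (orderedProd x g)) +
        (if c = b then d else 0) • orderedProd x g) ∈ I)
    (g : Idx →₀ ℕ) (hg : ∀ c ∈ g.support, c ∈ T) (hgb : g b ≤ 1 ∨ Even (p * b.par)) :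
    D (orderedProd x g) - ((-1 : ℂ) ^ (p * oddBefore b g) * g b * d) •
      orderedProd x (g - Finsupp.single b 1) ∈ I := by
  induction g using Finsupp.induction_on_min with
  | zero => simpa [orderedProd_zero] using hD1
  | single_add c n f hc hn ih =>
    have hsub : ∀ a ∈ f.support, a ∈ (Finsupp.single c n + f).support := by
      intro a ha
      rw [Finsupp.mem_support_iff] at ha ⊢
      simp [ha]
    have hcT : c ∈ T := hg c (by simp [hn])
    have hcf : f c = 0 := Finsupp.notMem_support_iff.1 fun h => (hc c h).false
    have ih := ih (fun a ha => hg a (hsub a ha))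
      (hgb.imp_left fun h => le_trans (by simp) h)
    have hIpow : ∀ m, ∀ v ∈ I, x c ^ m * v ∈ I := by
      intro m v hv
      induction m with
      | zero => simpa using hv
      | succ m ihm => rw [pow_succ', mul_assoc]; exact hI c hcT _ ihm
    have hpow : ∀ m, D (x c ^ m * orderedProd x f) -
        ((-1 : ℂ) ^ (p * (m * c.par)) • (x c ^ m * D (orderedProd x f)) +
          (if c = b then (∑ i ∈ Finset.range m, (-1 : ℂ) ^ (p * c.par * i)) * d else 0) •
            (x c ^ (m - 1) * orderedProd x f)) ∈ I := by
      intro m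
      induction m with
      | zero => simp
      | succ m ihm =>
        have h1 := hD c hcT (Finsupp.single c m + f) (fun c' hc' => by
          rcases Finset.mem_union.1 (Finsupp.support_add hc') with h | h
          · rw [Finset.mem_singleton.1 (Finsupp.support_single_subset h)]
            exact ⟨le_rfl, hcT⟩
          · exact ⟨(hc c' h).le, hg c' (hsub c' h)⟩)
        rw [orderedProd_single_add x hc] at h1
        have h2 := I.smul_mem ((-1 : ℂ) ^ (p * c.par)) (hI c hcT _ ihm)
        have h3 := I.add_mem h1 h2
        convert h3 using 1
        have e1 : (-1 : ℂ) ^ (p * ((m + 1) * c.par)) =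
            (-1 : ℂ) ^ (p * c.par) * (-1 : ℂ) ^ (p * (m * c.par)) := by rw [← pow_add]; ring_nf
        have e2 : x c * (x c ^ m * D (orderedProd x f)) = x c ^ (m + 1) * D (orderedProd x f) := by
          rw [pow_succ', mul_assoc]
        have e3 : (if c = b then (∑ i ∈ Finset.range m, (-1 : ℂ) ^ (p * c.par * i)) * d else 0) •
            (x c * (x c ^ (m - 1) * orderedProd x f)) =
            (if c = b then (∑ i ∈ Finset.range m, (-1 : ℂ) ^ (p * c.par * i)) * d else 0) •
            (x c ^ m * orderedProd x f) := by
          rcases m with _ | m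
          · simp
          · rw [Nat.add_sub_cancel, pow_succ' (x c) m, mul_assoc]
        rw [mul_sub, mul_add, mul_smul_comm, mul_smul_comm, e2, e3, e1, Nat.add_sub_cancel,
          pow_succ' (x c) m, mul_assoc (x c) (x c ^ m) (orderedProd x f)]
        by_cases hcb : c = b
        · simp only [if_pos hcb]
          have e4 : ∑ i ∈ Finset.range (m + 1), (-1 : ℂ) ^ (p * c.par * i) =
              (-1 : ℂ) ^ (p * c.par) * (∑ i ∈ Finset.range m, (-1 : ℂ) ^ (p * c.par * i)) + 1 := by
            rw [Finset.sum_range_succ', Finset.mul_sum]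
            simp only [mul_add, pow_add, mul_one, mul_zero, pow_zero]
            congr 1
            exact Finset.sum_congr rfl fun i _ => mul_comm _ _
          rw [e4]
          module
        · simp only [if_neg hcb]
          module
    have hn' := hpow n
    rw [← orderedProd_single_add x hc] at hn'
    by_cases hcb : c = b
    · subst hcb
      have hDv : D (orderedProd x f) ∈ I := by
        rw [hcf] at ih
        simpa using ih
      have e1 : oddBefore c (Finsupp.single c n + f) = 0 := by
        rw [oddBefore_single_add hn hc, if_neg (lt_irrefl c), zero_add, oddBefore]
        refine Finset.sum_eq_zero fun a ha => ?_
        rw [Finset.mem_filter] at ha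
        exact absurd (hc a ha.1) ha.2.asymm
      have e2 : Finsupp.single c n + f - Finsupp.single c 1 = Finsupp.single c (n - 1) + f := by
        ext a
        by_cases ha : a = c
        · subst ha; simp [hcf]
        · simp [Finsupp.single_apply, Ne.symm ha]
      have e3 : ∑ i ∈ Finset.range n, (-1 : ℂ) ^ (p * c.par * i) = n := by
        rcases hgb with h | h
        · have : n = 1 := by
            simp [hcf] at h
            omega
          subst this
          simp
        · rw [Finset.sum_congr rfl fun i _ => (h.mul_right i).neg_one_pow]
          simp
      rw [e1, e2, orderedProd_single_add x hc (n - 1)]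
      have h4 := I.add_mem hn' (I.smul_mem ((-1 : ℂ) ^ (p * (n * c.par))) (hIpow n _ hDv))
      convert h4 using 1
      rw [if_pos rfl, e3]
      simp only [Finsupp.add_apply, Finsupp.single_eq_same, hcf, mul_zero, pow_zero, one_mul,
        add_zero]
      abel
    · simp only [if_neg hcb, zero_smul, add_zero] at hn'
      have egb : (Finsupp.single c n + f) b = f b := by simp [Finsupp.single_apply, hcb]
      rw [egb]
      by_cases hfb : f b = 0
      · rw [hfb] at ih ⊢
        simp only [Nat.cast_zero, mul_zero, zero_mul, zero_smul, sub_zero] at ih ⊢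
        have h4 := I.add_mem hn' (I.smul_mem ((-1 : ℂ) ^ (p * (n * c.par))) (hIpow n _ ih))
        rwa [sub_add_cancel] at h4
      · have hlt : c < b := hc b (Finsupp.mem_support_iff.2 hfb)
        have e2 : Finsupp.single c n + f - Finsupp.single b 1 =
            Finsupp.single c n + (f - Finsupp.single b 1) := by
          ext a
          by_cases ha : a = b
          · subst ha
            simp [Finsupp.single_apply, hcb]
          · simp [Finsupp.single_apply, Ne.symm ha]
        rw [e2, orderedProd_single_add x (f := f - Finsupp.single b 1), oddBefore_single_add hn hc,
          if_pos hlt]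
        · have h4 := I.add_mem hn' (I.smul_mem ((-1 : ℂ) ^ (p * (n * c.par))) (hIpow n _ ih))
          convert h4 using 1
          have e3 : (-1 : ℂ) ^ (p * (n * c.par + oddBefore b f)) =
              (-1 : ℂ) ^ (p * (n * c.par)) * (-1 : ℂ) ^ (p * oddBefore b f) := by
            rw [mul_add, pow_add]
          rw [e3, mul_sub, mul_smul_comm]
          module
        · intro a ha
          refine hc a ?_
          rw [Finsupp.mem_support_iff] at ha ⊢
          intro h0
          apply ha
          simp [h0]

end OrderedProducts

/-! ### Leibniz rules for the Drinfeld generators -/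

section Coefficients

variable {q : ℂ} [hq : NeZero q]

theorem coeff_actSer_const₂ (x : (A q)⟦X⟧) (b : B q) (m n : ℕ) :
    PowerSeries.coeff n (PowerSeries.coeff m (actSer q x (const₂ b))) =
      if n = 0 then opAct q (PowerSeries.coeff m x) b else 0 := by
  rw [const₂, coeff_actSer_C, PowerSeries.coeff_C]
  split_ifs <;> simp

theorem coeff_mul_const₂ (x y : (A q)⟦X⟧) (b b' : B q) (m : ℕ) :
    PowerSeries.coeff 0 (PowerSeries.coeff m (actSer q x (const₂ b) * actSer q y (const₂ b'))) =
      ∑ p ∈ antidiagonal m,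
        opAct q (PowerSeries.coeff p.1 x) b * opAct q (PowerSeries.coeff p.2 y) b' := by
  rw [PowerSeries.coeff_mul, map_sum]
  refine Finset.sum_congr rfl fun p _ => ?_
  rw [PowerSeries.coeff_mul]
  simp [coeff_actSer_const₂]

theorem coeff_const₂_mul (y : (A q)⟦X⟧) (b b' : B q) (m : ℕ) :
    PowerSeries.coeff 0 (PowerSeries.coeff m (const₂ b * actSer q y (const₂ b'))) =
      b * opAct q (PowerSeries.coeff m y) b' := by
  rw [const₂, PowerSeries.coeff_C_mul, PowerSeries.coeff_C_mul, coeff_actSer_const₂, if_pos rfl]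

theorem coeff_mul_const₂' (x : (A q)⟦X⟧) (b b' : B q) (m : ℕ) :
    PowerSeries.coeff 0 (PowerSeries.coeff m (actSer q x (const₂ b) * const₂ b')) =
      opAct q (PowerSeries.coeff m x) b * b' := by
  rw [const₂, const₂, PowerSeries.coeff_mul_C, PowerSeries.coeff_mul_C, ← const₂,
    coeff_actSer_const₂, if_pos rfl]

theorem actSer_const₂_eq_zero {x : (A q)⟦X⟧} {b : B q}
    (h : ∀ m, opAct q (PowerSeries.coeff m x) b = 0) : actSer q x (const₂ b) = 0 := by
  ext m n
  rw [coeff_actSer_const₂, h]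
  simp

theorem opAct_of_eq_diag {x : (A q)⟦X⟧} {f g : (B q)⟦X⟧} {c : ℂ⟦X⟧}
    (h : actSer q x (PowerSeries.C f) = diagScalar c • PowerSeries.C g) (m n : ℕ) :
    opAct q (PowerSeries.coeff m x) (PowerSeries.coeff n f) =
      if m ≤ n then PowerSeries.coeff m c • PowerSeries.coeff (n - m) g else 0 := by
  rw [← coeff_actSer_C, h, coeff_diagScalar_smul_C]

theorem opAct_of_eq_self {x : (A q)⟦X⟧} {f : (B q)⟦X⟧}
    (h : actSer q x (PowerSeries.C f) = PowerSeries.C f) (m n : ℕ) :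
    opAct q (PowerSeries.coeff m x) (PowerSeries.coeff n f) =
      if m = 0 then PowerSeries.coeff n f else 0 := by
  rw [← coeff_actSer_C, h, PowerSeries.coeff_C]
  split_ifs <;> simp

theorem opAct_of_eq_zero {x : (A q)⟦X⟧} {f : (B q)⟦X⟧}
    (h : actSer q x (PowerSeries.C f) = 0) (m n : ℕ) :
    opAct q (PowerSeries.coeff m x) (PowerSeries.coeff n f) = 0 := by
  rw [← coeff_actSer_C, h]
  simp

variable (hq' : ∀ n : ℕ, 0 < n → q ^ n ≠ 1)
include hq'

theorem gaussInverse : GaussInverse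
    (fun i j => (PowerSeries.C (tSeries q i j) : (B q)⟦X⟧⟦X⟧)) (PowerSeries.C (tInv q)) where
  mul_inv := by rw [← map_mul, t_mul_tInv, map_one]
  inv_mul := by rw [← map_mul, tInv_mul_t, map_one]
  sq := by
    rw [← map_mul, ← map_mul, tSeries_sq q hq.ne (hq' 2 (by norm_num)) (hq' 4 (by norm_num))
      (t_mul_tInv q) (tInv_mul_t q), map_zero]

/-- The Leibniz rule `E⁺(z) (bb') = P(b) E⁺(z) b' + E⁺(z) b · φ⁺(z) b'`, with `P` the parity
automorphism. -/
theorem opE_mul (m : ℕ) (b b' : B q) :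
    opAct q (ePos q m) (b * b') = par (B q) b * opAct q (ePos q m) b' +
      ∑ p ∈ antidiagonal m, opAct q (ePos q p.1) b *
        opAct q (PowerSeries.coeff p.2 (gaussPhi (sSeries q) (kA q 0))) b' := by
  have h := congrArg (fun v => PowerSeries.coeff 0 (PowerSeries.coeff m v))
    ((gaussLeibniz hq').E_mul (const₂ b) (const₂ b'))
  simpa only [← const₂_mul, mapAlg_const₂, map_add, coeff_mul_const₂, coeff_const₂_mul,
    coeff_actSer_const₂, if_true, ePos] using h

/-- `φ⁺(z)` acts by algebra homomorphisms. -/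
theorem opPhi_mul (m : ℕ) (b b' : B q) :
    opAct q (PowerSeries.coeff m (gaussPhi (sSeries q) (kA q 0))) (b * b') =
      ∑ p ∈ antidiagonal m,
        opAct q (PowerSeries.coeff p.1 (gaussPhi (sSeries q) (kA q 0))) b *
        opAct q (PowerSeries.coeff p.2 (gaussPhi (sSeries q) (kA q 0))) b' := by
  have h := congrArg (fun v => PowerSeries.coeff 0 (PowerSeries.coeff m v))
    ((gaussLeibniz hq').Φ_mul (const₂ b) (const₂ b'))
  simpa only [← const₂_mul, coeff_mul_const₂, coeff_actSer_const₂, if_true] using h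

/-- The Leibniz rule `F⁺(z) (bb') = F⁺(z) b · b' + φ⁺(z) P(b) · F⁺(z) b'`, with `P` the parity
automorphism. -/
theorem opF_mul (m : ℕ) (b b' : B q) :
    opAct q (PowerSeries.coeff m (gaussF (sSeries q) (kA q 0))) (b * b') =
      opAct q (PowerSeries.coeff m (gaussF (sSeries q) (kA q 0))) b * b' +
      ∑ p ∈ antidiagonal m,
        opAct q (PowerSeries.coeff p.1 (gaussPhi (sSeries q) (kA q 0))) (par (B q) b) *
        opAct q (PowerSeries.coeff p.2 (gaussF (sSeries q) (kA q 0))) b' := by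
  have h := congrArg (fun v => PowerSeries.coeff 0 (PowerSeries.coeff m v))
    ((gaussLeibniz hq').F_mul (const₂ b) (const₂ b'))
  simpa only [← const₂_mul, mapAlg_const₂, map_add, coeff_mul_const₂, coeff_mul_const₂',
    coeff_actSer_const₂, if_true] using h

/-- `s₁₁(z) (bb') = s₁₁(z) b · s₁₁(z) b'` if `b` is annihilated by all `E_n`. -/
theorem opS_mul {b : B q} (hb : ∀ n, opAct q (ePos q n) b = 0) (m : ℕ) (b' : B q) :
    opAct q (sA q 0 0 m) (b * b') = ∑ p ∈ antidiagonal m,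
      opAct q (sA q 0 0 p.1) b * opAct q (sA q 0 0 p.2) b' := by
  have h := congrArg (fun v => PowerSeries.coeff 0 (PowerSeries.coeff m v))
    ((gaussAction q hq').S_mul_of_E_eq_zero (actSer_const₂_eq_zero hb) (const₂ b'))
  simpa only [← const₂_mul, coeff_mul_const₂, coeff_actSer_const₂, if_true, sSeries,
    PowerSeries.coeff_mk] using h

end Coefficients

/-! ### Normalized currents -/

section Normalized

variable (q : ℂ) [hq : NeZero q]

/-- `(s₁₁⁽⁰⁾)⁻¹ K₁⁺(z)`. -/
def hSer : (A q)⟦X⟧ := PowerSeries.C (((kA q 0)⁻¹ : (A q)ˣ) : A q) * sSeries q 0 0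

/-- `(φ₀⁺)⁻¹ φ⁺(z)`. -/
def cSer : (A q)⟦X⟧ := PowerSeries.C (((phiPlus₀ q)⁻¹ : (A q)ˣ) : A q) *
  gaussPhi (sSeries q) (kA q 0)

/-- `(φ₀⁺)⁻¹ F⁺(z)`. -/
def fSer : (A q)⟦X⟧ := PowerSeries.C (((phiPlus₀ q)⁻¹ : (A q)ˣ) : A q) *
  gaussF (sSeries q) (kA q 0)

/-- `s₁₁⁽⁰⁾ K₁⁻(z)`. -/
def hSerB : (B q)⟦X⟧ := PowerSeries.C (kB q 0 : B q) * tSeries q 0 0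

/-- `s₁₁⁽⁰⁾ t₂₁(z)`. -/
def gSerB : (B q)⟦X⟧ := PowerSeries.C (kB q 0 : B q) * tSeries q 1 0

/-- `(φ₀⁻)⁻¹ φ⁻(z)`. -/
def cSerB : (B q)⟦X⟧ := PowerSeries.C (((phiMinus₀ q)⁻¹ : (B q)ˣ) : B q) *
  gaussPhi (tSeries q) (kB q 0)⁻¹

/-- `(φ₀⁻)⁻¹ E⁻(z)`. -/
def eSerB : (B q)⟦X⟧ := PowerSeries.C (((phiMinus₀ q)⁻¹ : (B q)ˣ) : B q) *
  gaussE (tSeries q) (kB q 0)⁻¹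

/-- `F⁻(z)`. -/
def fSerB : (B q)⟦X⟧ := gaussF (tSeries q) (kB q 0)⁻¹

theorem constantCoeff_gaussPhi_s :
    PowerSeries.constantCoeff (gaussPhi (sSeries q) (kA q 0)) = phiPlus₀ q := by
  have h : PowerSeries.constantCoeff (sSeries q 1 0) = 0 :=
    (PowerSeries.coeff_zero_eq_constantCoeff_apply _).symm.trans
      ((PowerSeries.coeff_mk 0 (sA q 1 0)).trans (Subtype.ext (isRTT q).s_zero))
  have h' : PowerSeries.constantCoeff (sSeries q 1 1) = kA q 1 :=
    (PowerSeries.coeff_zero_eq_constantCoeff_apply _).symm.trans (PowerSeries.coeff_mk 0 (sA q 1 1))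
  rw [gaussPhi, gaussK₂, map_mul, map_add, map_mul, map_mul, PowerSeries.constantCoeff_invOfUnit, h,
    h', zero_mul, zero_mul, add_zero, phiPlus₀, Units.val_mul]

/-- The group-like generators commute: a coefficient of an entry of the RTT relation. -/
theorem kB_commute : (kB q 0 : B q) * kB q 1 = kB q 1 * kB q 0 := by
  apply Subtype.ext
  change s q 0 0 0 * s q 1 1 0 = s q 1 1 0 * s q 0 0 0
  have h := congrFun (congrFun (congrFun (congrFun (isRTT q).ss 0) 0) 1) 1
  have h1 := congrArg (fun v => PowerSeries.coeff 1 (PowerSeries.coeff 0 v)) h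
  have h0 := (isRTT q).s_zero
  simp [rttLeft, rttRight, rho, rZ, rW, var₁, var₂, inFst, inSnd, h0, PowerSeries.coeff_mul,
    PowerSeries.coeff_X, PowerSeries.coeff_C, Finset.Nat.antidiagonal_succ] at h1
  have e : ∀ i j, PowerSeries.constantCoeff (PowerSeries.constantCoeff
      ((PowerSeries.map PowerSeries.C) (PowerSeries.mk (s q i j)))) = s q i j 0 := by
    intro i j
    rw [← PowerSeries.coeff_zero_eq_constantCoeff_apply,
      ← PowerSeries.coeff_zero_eq_constantCoeff_apply, PowerSeries.coeff_map, PowerSeries.coeff_C,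
      PowerSeries.coeff_mk, if_pos rfl]
  rwa [e, e, h0, zero_mul, smul_zero, neg_zero, add_zero] at h1

theorem constantCoeff_gaussPhi_t :
    PowerSeries.constantCoeff (gaussPhi (tSeries q) (kB q 0)⁻¹) = phiMinus₀ q := by
  have h : PowerSeries.constantCoeff (tSeries q 0 1) = 0 :=
    (PowerSeries.coeff_zero_eq_constantCoeff_apply _).symm.trans
      ((PowerSeries.coeff_mk 0 (tB q 0 1)).trans (Subtype.ext (isRTT q).t_zero))
  have h' : PowerSeries.constantCoeff (tSeries q 1 1) = ((kB q 1)⁻¹ : (B q)ˣ) :=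
    (PowerSeries.coeff_zero_eq_constantCoeff_apply _).symm.trans (PowerSeries.coeff_mk 0 (tB q 1 1))
  have hc : kB q 0 * (kB q 1)⁻¹ = (kB q 1)⁻¹ * kB q 0 :=
    (Commute.inv_right (Units.ext (kB_commute q))).eq
  rw [gaussPhi, gaussK₂, map_mul, map_add, map_mul, map_mul, PowerSeries.constantCoeff_invOfUnit, h,
    h', mul_zero, add_zero, inv_inv, phiMinus₀, mul_inv_rev, inv_inv, ← hc, Units.val_mul]

theorem constantCoeff_hSer : PowerSeries.constantCoeff (hSer q) = 1 := by
  rw [hSer, map_mul, constantCoeff_sSeries, PowerSeries.constantCoeff_C, Units.inv_mul]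

theorem constantCoeff_cSer : PowerSeries.constantCoeff (cSer q) = 1 := by
  rw [cSer, map_mul, constantCoeff_gaussPhi_s, PowerSeries.constantCoeff_C, Units.inv_mul]

theorem constantCoeff_hSerB : PowerSeries.constantCoeff (hSerB q) = 1 := by
  rw [hSerB, map_mul, constantCoeff_tSeries, PowerSeries.constantCoeff_C, Units.mul_inv]

theorem constantCoeff_cSerB : PowerSeries.constantCoeff (cSerB q) = 1 := by
  rw [cSerB, map_mul, constantCoeff_gaussPhi_t, PowerSeries.constantCoeff_C, Units.inv_mul]

variable {q}

theorem phiPlus₀_mem : phiPlus₀ q ∈ Subgroup.closure (Set.range (kA q)) :=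
  mul_mem (inv_mem (Subgroup.subset_closure ⟨0, rfl⟩)) (Subgroup.subset_closure ⟨1, rfl⟩)

theorem phiMinus₀_mem : phiMinus₀ q ∈ Subgroup.closure (Set.range (kB q)) :=
  inv_mem (mul_mem (inv_mem (Subgroup.subset_closure ⟨0, rfl⟩)) (Subgroup.subset_closure ⟨1, rfl⟩))

theorem opAct_inv_apply (k : (A q)ˣ) (b : B q) :
    opAct q ((k⁻¹ : (A q)ˣ) : A q) (opAct q k b) = b := by
  rw [← Module.End.mul_apply, ← map_mul, Units.inv_mul, map_one, Module.End.one_apply]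

theorem opAct_apply_inv (k : (A q)ˣ) (b : B q) :
    opAct q k (opAct q ((k⁻¹ : (A q)ˣ) : A q) b) = b := by
  rw [← Module.End.mul_apply, ← map_mul, Units.mul_inv, map_one, Module.End.one_apply]

/-- Group-like elements act by algebra automorphisms. -/
theorem opAct_grp_mul {k : (A q)ˣ} (hk : k ∈ Subgroup.closure (Set.range (kA q))) (b b' : B q) :
    opAct q k (b * b') = opAct q k b * opAct q k b' := by
  induction hk using Subgroup.closure_induction generalizing b b' with
  | mem x hx =>
    obtain ⟨i, rfl⟩ := hx
    change opAct q (sA q i i 0) _ = opAct q (sA q i i 0) _ * opAct q (sA q i i 0) _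
    rw [opAct_sA, opB_diag]
    exact map_mul (actHom (B q) (charB q i) (charB_par q i)) b b'
  | one => simp
  | mul x y _ _ hx hy =>
    have h : ∀ v, opAct q ((x * y : (A q)ˣ) : A q) v = opAct q x (opAct q y v) := fun v => by
      rw [Units.val_mul, map_mul, Module.End.mul_apply]
    rw [h, h, h, hy, hx]
  | inv x _ hx =>
    have h : Function.Injective (opAct q x) := Function.LeftInverse.injective (opAct_inv_apply x)
    apply h
    rw [hx, opAct_apply_inv, opAct_apply_inv, opAct_apply_inv]

theorem eps_grp {k : (A q)ˣ} (hk : k ∈ Subgroup.closure (Set.range (kA q))) :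
    eps (A q) k = 1 := by
  induction hk using Subgroup.closure_induction with
  | mem x hx =>
    obtain ⟨i, rfl⟩ := hx
    have := (lift_s (isRTT_counit q) i i 0)
    exact this.trans (by simp)
  | one => simp
  | mul x y _ _ hx hy => rw [Units.val_mul, map_mul, hx, hy, one_mul]
  | inv x _ hx =>
    have := congrArg (eps (A q)) x.mul_inv
    rwa [map_mul, hx, one_mul, map_one] at this

theorem opAct_grp_one {k : (A q)ˣ} (hk : k ∈ Subgroup.closure (Set.range (kA q))) :
    opAct q k 1 = 1 := by
  rw [opAct_one, eps_grp hk, one_smul]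

/-- The elements of `A` whose action commutes with the left multiplications by group-like elements
of `B`. All factors of the monomials `E(f)` are of this kind, which separates `k'` from `F(g)`. -/
def commuting (q : ℂ) [NeZero q] : Subalgebra ℂ (A q) :=
  (Subalgebra.centralizer ℂ (Set.range fun i =>
    LinearMap.mulLeft ℂ (kB q i : B q))).comap (opAct q)

theorem mem_commuting {a : A q} : a ∈ commuting q ↔
    ∀ i v, opAct q a (kB q i * v) = kB q i * opAct q a v := by
  rw [commuting, Subalgebra.mem_comap, Subalgebra.mem_centralizer_iff]
  constructor
  · intro h i v
    exact (LinearMap.congr_fun (h _ ⟨i, rfl⟩) v).symm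
  · rintro h _ ⟨i, rfl⟩
    exact LinearMap.ext fun v => (h i v).symm

theorem commuting_apply {a : A q} (ha : a ∈ commuting q) {κ : (B q)ˣ}
    (hκ : κ ∈ Subgroup.closure (Set.range (kB q))) (v : B q) :
    opAct q a (κ * v) = κ * opAct q a v := by
  induction hκ using Subgroup.closure_induction generalizing v with
  | mem x hx =>
    obtain ⟨i, rfl⟩ := hx
    exact mem_commuting.1 ha i v
  | one => simp
  | mul x y _ _ hx hy => rw [Units.val_mul, mul_assoc, hx, hy, mul_assoc]
  | inv x _ hx =>
    have h1 := hx (((x⁻¹ : (B q)ˣ) : B q) * v)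
    rw [Units.mul_inv_cancel_left] at h1
    rw [h1, Units.inv_mul_cancel_left]

theorem coeff_hSer (n : ℕ) : PowerSeries.coeff n (hSer q) =
    (((kA q 0)⁻¹ : (A q)ˣ) : A q) * sA q 0 0 n := by
  rw [hSer, PowerSeries.coeff_C_mul, sSeries, PowerSeries.coeff_mk]

variable (hq' : ∀ n : ℕ, 0 < n → q ^ n ≠ 1)
include hq'

theorem opE_kB (n : ℕ) (a : Fin 2) : opAct q (ePos q n) (kB q a) = 0 := by
  have h := congrArg (fun v => PowerSeries.coeff 0 (PowerSeries.coeff n v)) (actE_kB hq' a)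
  simpa only [coeff_actSer_const₂, if_true, map_zero, ePos] using h

theorem ePos_mem_commuting (n : ℕ) : ePos q n ∈ commuting q := by
  rw [mem_commuting]
  intro i v
  rw [opE_mul hq', par_kB]
  simp [opE_kB hq']

theorem exists_opPhi_kB (a : Fin 2) : ∃ c : ℂ, ∀ n,
    opAct q (PowerSeries.coeff n (gaussPhi (sSeries q) (kA q 0))) (kB q a) =
      if n = 0 then c • (kB q a : B q) else 0 := by
  refine ⟨rCoeff' q a a 1 1 0 * (rCoeff' q a a 0 0 0)⁻¹, fun n => ?_⟩
  have h := congrArg (fun v => PowerSeries.coeff 0 (PowerSeries.coeff n v)) (actPhi_kB hq' a)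
  rw [← const₂_smul] at h
  simpa only [coeff_actSer_const₂, if_true, coeff_const₂, and_true] using h

theorem opF_kB (n : ℕ) (a : Fin 2) :
    opAct q (PowerSeries.coeff n (gaussF (sSeries q) (kA q 0))) (kB q a) = 0 := by
  have h := congrArg (fun v => PowerSeries.coeff 0 (PowerSeries.coeff n v)) (actF_kB hq' a)
  simpa only [coeff_actSer_const₂, if_true, map_zero] using h

theorem opAct_cSer (n : ℕ) (v : B q) : opAct q (PowerSeries.coeff n (cSer q)) v =
    opAct q (((phiPlus₀ q)⁻¹ : (A q)ˣ) : A q)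
      (opAct q (PowerSeries.coeff n (gaussPhi (sSeries q) (kA q 0))) v) := by
  rw [cSer, PowerSeries.coeff_C_mul, map_mul, Module.End.mul_apply]

theorem opAct_fSer (n : ℕ) (v : B q) : opAct q (PowerSeries.coeff n (fSer q)) v =
    opAct q (((phiPlus₀ q)⁻¹ : (A q)ˣ) : A q)
      (opAct q (PowerSeries.coeff n (gaussF (sSeries q) (kA q 0))) v) := by
  rw [fSer, PowerSeries.coeff_C_mul, map_mul, Module.End.mul_apply]

theorem opAct_hSer (n : ℕ) (v : B q) : opAct q (PowerSeries.coeff n (hSer q)) v =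
    opAct q (((kA q 0)⁻¹ : (A q)ˣ) : A q) (opAct q (sA q 0 0 n) v) := by
  rw [coeff_hSer, map_mul, Module.End.mul_apply]

theorem opAct_cSer_zero (v : B q) : opAct q (PowerSeries.coeff 0 (cSer q)) v = v := by
  rw [PowerSeries.coeff_zero_eq_constantCoeff_apply, constantCoeff_cSer, map_one]
  rfl

theorem opAct_hSer_zero (v : B q) : opAct q (PowerSeries.coeff 0 (hSer q)) v = v := by
  rw [PowerSeries.coeff_zero_eq_constantCoeff_apply, constantCoeff_hSer, map_one]
  rfl

theorem opC_mul (m : ℕ) (b b' : B q) : opAct q (PowerSeries.coeff m (cSer q)) (b * b') =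
    ∑ p ∈ antidiagonal m, opAct q (PowerSeries.coeff p.1 (cSer q)) b *
      opAct q (PowerSeries.coeff p.2 (cSer q)) b' := by
  simp only [opAct_cSer hq', opPhi_mul hq', map_sum, opAct_grp_mul (inv_mem phiPlus₀_mem)]

theorem opH_mul {b : B q} (hb : ∀ n, opAct q (ePos q n) b = 0) (m : ℕ) (b' : B q) :
    opAct q (PowerSeries.coeff m (hSer q)) (b * b') =
    ∑ p ∈ antidiagonal m, opAct q (PowerSeries.coeff p.1 (hSer q)) b *
      opAct q (PowerSeries.coeff p.2 (hSer q)) b' := by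
  simp only [opAct_hSer hq', opS_mul hq' hb, map_sum,
    opAct_grp_mul (inv_mem (Subgroup.subset_closure ⟨0, rfl⟩))]

/-- The Leibniz rule for `(φ₀⁺)⁻¹ F⁺(z)`. The group-like factor `(φ₀⁺)⁻¹` would act on `b'`, so `b'`
is taken to be fixed by it. -/
theorem opFn_mul (m : ℕ) (b : B q) {b' : B q}
    (hb' : opAct q (((phiPlus₀ q)⁻¹ : (A q)ˣ) : A q) b' = b') :
    opAct q (PowerSeries.coeff m (fSer q)) (b * b') =
    opAct q (PowerSeries.coeff m (fSer q)) b * b' + ∑ p ∈ antidiagonal m,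
      opAct q (PowerSeries.coeff p.1 (cSer q)) (par (B q) b) *
        opAct q (PowerSeries.coeff p.2 (fSer q)) b' := by
  simp only [opAct_cSer hq', opAct_fSer hq', opF_mul hq', map_add, map_sum,
    opAct_grp_mul (inv_mem phiPlus₀_mem), hb']

/-- Normalization removes the scalar by which `φ⁺(z)` acts on group-like elements. -/
theorem coeff_cSer_kB (n : ℕ) (a : Fin 2) : opAct q (PowerSeries.coeff n (cSer q)) (kB q a) =
    if n = 0 then (kB q a : B q) else 0 := by
  by_cases hn : n = 0
  · rw [hn, opAct_cSer_zero hq', if_pos rfl]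
  · obtain ⟨c, hc⟩ := exists_opPhi_kB hq' a
    rw [opAct_cSer hq', hc, if_neg hn, if_neg hn, map_zero]

theorem coeff_hSer_kB (n : ℕ) (a : Fin 2) : opAct q (PowerSeries.coeff n (hSer q)) (kB q a) =
    if n = 0 then (kB q a : B q) else 0 := by
  by_cases hn : n = 0
  · rw [hn, opAct_hSer_zero hq', if_pos rfl]
  · rw [opAct_hSer hq', opAct_sA, opB_kB, formB_kB, if_neg hn, if_neg hn, zero_smul, map_zero]

theorem cSer_mem_commuting (n : ℕ) : PowerSeries.coeff n (cSer q) ∈ commuting q := by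
  rw [mem_commuting]
  intro i v
  rw [opC_mul hq', Finset.sum_eq_single (0, n)]
  · rw [coeff_cSer_kB hq', if_pos rfl]
  · rintro ⟨a, b⟩ hp h0
    rw [coeff_cSer_kB hq', if_neg, zero_mul]
    rintro rfl
    exact h0 (by simpa using hp)
  · simp

theorem hSer_mem_commuting (n : ℕ) : PowerSeries.coeff n (hSer q) ∈ commuting q := by
  rw [mem_commuting]
  intro i v
  rw [opH_mul hq' fun n => opE_kB hq' n i, Finset.sum_eq_single (0, n)]
  · rw [coeff_hSer_kB hq', if_pos rfl]
  · rintro ⟨a, b⟩ hp h0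
    rw [coeff_hSer_kB hq', if_neg, zero_mul]
    rintro rfl
    exact h0 (by simpa using hp)
  · simp

theorem fSer_mem_commuting (n : ℕ) : PowerSeries.coeff n (fSer q) ∈ commuting q := by
  rw [mem_commuting]
  intro i v
  have h1 : ∀ p : ℕ × ℕ, opAct q (((phiPlus₀ q)⁻¹ : (A q)ˣ) : A q)
      (opAct q (PowerSeries.coeff p.1 (gaussPhi (sSeries q) (kA q 0))) (kB q i)) =
      if p.1 = 0 then (kB q i : B q) else 0 := fun p => by
    rw [← opAct_cSer hq', coeff_cSer_kB hq']
  rw [opAct_fSer hq', opF_mul hq', opF_kB hq', zero_mul, zero_add, par_kB, map_sum]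
  simp only [opAct_grp_mul (inv_mem phiPlus₀_mem), h1]
  rw [Finset.sum_eq_single (0, n)]
  · rw [if_pos rfl, ← opAct_fSer hq']
  · rintro ⟨a, b⟩ hp h0
    rw [if_neg, zero_mul]
    rintro rfl
    exact h0 (by simpa using hp)
  · simp

end Normalized

/-! ### The action on the Drinfeld generators of `B` -/

section Values

/-- The action of the coefficients of `x` on those of `f` is `x(z) f(w) = c(zw) g(w)`. -/
def ActsDiag {q : ℂ} [NeZero q] (x : (A q)⟦X⟧) (f g : (B q)⟦X⟧) (c : ℂ⟦X⟧) : Prop :=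
  ∀ m n, opAct q (PowerSeries.coeff m x) (PowerSeries.coeff n f) =
    if m ≤ n then PowerSeries.coeff m c • PowerSeries.coeff (n - m) g else 0

/-- The coefficients of `x - 1` annihilate those of `f`. -/
def ActsTrivially {q : ℂ} [NeZero q] (x : (A q)⟦X⟧) (f : (B q)⟦X⟧) : Prop :=
  ∀ m n, opAct q (PowerSeries.coeff m x) (PowerSeries.coeff n f) =
    if m = 0 then PowerSeries.coeff n f else 0

/-- The coefficients of `x` annihilate those of `f`. -/
def Annihilates {q : ℂ} [NeZero q] (x : (A q)⟦X⟧) (f : (B q)⟦X⟧) : Prop :=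
  ∀ m n, opAct q (PowerSeries.coeff m x) (PowerSeries.coeff n f) = 0

variable {q : ℂ} [hq : NeZero q] {x : (A q)⟦X⟧} {f g : (B q)⟦X⟧} {c : ℂ⟦X⟧}

theorem ActsDiag.C_mul (hx : ∀ m, PowerSeries.coeff m x ∈ commuting q) {κ : (B q)ˣ}
    (hκ : κ ∈ Subgroup.closure (Set.range (kB q))) (h : ActsDiag x f g c) :
    ActsDiag x (PowerSeries.C (κ : B q) * f) (PowerSeries.C (κ : B q) * g) c := by
  intro m n
  rw [PowerSeries.coeff_C_mul, commuting_apply (hx m) hκ, h]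
  split_ifs
  · rw [mul_smul_comm, PowerSeries.coeff_C_mul]
  · rw [mul_zero]

theorem ActsTrivially.C_mul (hx : ∀ m, PowerSeries.coeff m x ∈ commuting q) {κ : (B q)ˣ}
    (hκ : κ ∈ Subgroup.closure (Set.range (kB q))) (h : ActsTrivially x f) :
    ActsTrivially x (PowerSeries.C (κ : B q) * f) := by
  intro m n
  rw [PowerSeries.coeff_C_mul, commuting_apply (hx m) hκ, h, mul_ite, mul_zero]

theorem Annihilates.C_mul (hx : ∀ m, PowerSeries.coeff m x ∈ commuting q) {κ : (B q)ˣ}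
    (hκ : κ ∈ Subgroup.closure (Set.range (kB q))) (h : Annihilates x f) :
    Annihilates x (PowerSeries.C (κ : B q) * f) := by
  intro m n
  rw [PowerSeries.coeff_C_mul, commuting_apply (hx m) hκ, h, mul_zero]

theorem opAct_inv_of_eq_smul {k : (A q)ˣ} {v : B q} {c : ℂ} (h : opAct q k v = c • v) :
    opAct q ((k⁻¹ : (A q)ˣ) : A q) v = c⁻¹ • v := by
  have h2 := congrArg (opAct q ((k⁻¹ : (A q)ˣ) : A q)) h
  rw [opAct_inv_apply, map_smul] at h2
  by_cases hc : c = 0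
  · rw [h2, hc]
    simp
  · rw [h2, inv_smul_smul₀ hc, ← h2]

/-- If `x(z)` acts by a scalar series, `x(0)⁻¹ x(z)` acts by a scalar series. -/
theorem ActsDiag.normalize {k : (A q)ˣ} (hk : PowerSeries.constantCoeff x = k)
    (h : ActsDiag x f f c) :
    ActsDiag (PowerSeries.C ((k⁻¹ : (A q)ˣ) : A q) * x) f f
      (PowerSeries.C (PowerSeries.constantCoeff c)⁻¹ * c) := by
  have h0 : ∀ n, opAct q k (PowerSeries.coeff n f) =
      PowerSeries.constantCoeff c • PowerSeries.coeff n f := by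
    intro n
    have := h 0 n
    rwa [PowerSeries.coeff_zero_eq_constantCoeff_apply, hk, if_pos (Nat.zero_le n), Nat.sub_zero,
      PowerSeries.coeff_zero_eq_constantCoeff_apply] at this
  have h1 : ∀ n, opAct q ((k⁻¹ : (A q)ˣ) : A q) (PowerSeries.coeff n f) =
      (PowerSeries.constantCoeff c)⁻¹ • PowerSeries.coeff n f :=
    fun n => opAct_inv_of_eq_smul (h0 n)
  intro m n
  rw [PowerSeries.coeff_C_mul, map_mul, Module.End.mul_apply, h]
  split_ifs
  · rw [map_smul, h1, PowerSeries.coeff_C_mul, smul_smul, mul_comm]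
  · rw [map_zero]

theorem ActsTrivially.normalize {k : (A q)ˣ} (hk : PowerSeries.constantCoeff x = k)
    (h : ActsTrivially x f) : ActsTrivially (PowerSeries.C ((k⁻¹ : (A q)ˣ) : A q) * x) f := by
  have h0 : ∀ n, opAct q ((k⁻¹ : (A q)ˣ) : A q) (PowerSeries.coeff n f) =
      PowerSeries.coeff n f := by
    intro n
    have := congrArg (opAct q ((k⁻¹ : (A q)ˣ) : A q)) (h 0 n)
    rw [PowerSeries.coeff_zero_eq_constantCoeff_apply, hk, opAct_inv_apply, if_pos rfl] at this
    exact this.symm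
  intro m n
  rw [PowerSeries.coeff_C_mul, map_mul, Module.End.mul_apply, h]
  split_ifs
  · exact h0 n
  · rw [map_zero]

theorem kB_mem (i : Fin 2) : kB q i ∈ Subgroup.closure (Set.range (kB q)) :=
  Subgroup.subset_closure ⟨i, rfl⟩

theorem phiMinus₀_inv_mem : (phiMinus₀ q)⁻¹ ∈ Subgroup.closure (Set.range (kB q)) :=
  inv_mem phiMinus₀_mem

theorem C_gaussPhi_t : (PowerSeries.C (gaussPhi (tSeries q) (kB q 0)⁻¹) : (B q)⟦X⟧⟦X⟧) =
    PowerSeries.C (tInv q) * (PowerSeries.C (tSeries q 1 1) +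
      PowerSeries.C (tSeries q 1 0) * PowerSeries.C (tInv q) * PowerSeries.C (tSeries q 0 1)) := by
  simp only [← map_mul, ← map_add]
  rfl

theorem C_gaussE_t : (PowerSeries.C (gaussE (tSeries q) (kB q 0)⁻¹) : (B q)⟦X⟧⟦X⟧) =
    PowerSeries.C (tInv q) * PowerSeries.C (tSeries q 0 1) := by
  simp only [← map_mul]
  rfl

theorem C_gaussF_t : (PowerSeries.C (gaussF (tSeries q) (kB q 0)⁻¹) : (B q)⟦X⟧⟦X⟧) =
    PowerSeries.C (tSeries q 1 0) * PowerSeries.C (tInv q) := by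
  simp only [← map_mul]
  rfl

variable (q) in
/-- The generating series of the `E_n`. -/
def eSer : (A q)⟦X⟧ := gaussE (sSeries q) (kA q 0)

theorem coeff_eSer (n : ℕ) : PowerSeries.coeff n (eSer q) = ePos q n := rfl

variable (hq' : ∀ n : ℕ, 0 < n → q ^ n ≠ 1)
include hq'

theorem eSer_hSerB : Annihilates (eSer q) (hSerB q) := by
  have h : Annihilates (eSer q) (tSeries q 0 0) :=
    opAct_of_eq_zero ((gaussAction q hq').E_t (hasTable q) 0)
  exact h.C_mul (ePos_mem_commuting hq') (kB_mem 0)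

theorem actE_gaussE : actSer q (eSer q) (PowerSeries.C (gaussE (tSeries q) (kB q 0)⁻¹)) =
    0 := by
  have h := (gaussAction q hq').E_e (hasTable q) (gaussLeibniz hq') (gaussInverse hq')
  rw [eSer, C_gaussE_t]
  exact h

theorem actE_gaussPhi : actSer q (eSer q) (PowerSeries.C (gaussPhi (tSeries q) (kB q 0)⁻¹)) =
    0 := by
  have h := (gaussAction q hq').E_φ (hasTable q) (gaussLeibniz hq') (gaussInverse hq')
  rw [eSer, C_gaussPhi_t]
  exact h

theorem actE_gaussF : actSer q (eSer q) (PowerSeries.C (gaussF (tSeries q) (kB q 0)⁻¹)) =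
    diagScalar (rSeries q 1 0 0 1 * betaInv q) • PowerSeries.C 1 := by
  have h := (gaussAction q hq').E_f (hasTable q) (gaussLeibniz hq') (gaussInverse hq')
  rw [eSer, C_gaussF_t, RingHom.map_mul diagScalar, RingHom.map_one]
  exact h

theorem actPhi_gaussE : actSer q (gaussPhi (sSeries q) (kA q 0))
    (PowerSeries.C (gaussE (tSeries q) (kB q 0)⁻¹)) =
    PowerSeries.C (gaussE (tSeries q) (kB q 0)⁻¹) := by
  have h := (gaussAction q hq').Φ_e (hasTable q) (gaussLeibniz hq') (gaussInverse hq')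
  rw [C_gaussE_t]
  exact h

theorem actPhi_gaussPhi :
    actSer q (gaussPhi (sSeries q) (kA q 0)) (PowerSeries.C (gaussPhi (tSeries q) (kB q 0)⁻¹)) =
    PowerSeries.C (gaussPhi (tSeries q) (kB q 0)⁻¹) := by
  have h := (gaussAction q hq').Φ_φ (hasTable q) (gaussLeibniz hq') (gaussInverse hq')
  rw [C_gaussPhi_t]
  exact h

theorem actPhi_gaussF : actSer q (gaussPhi (sSeries q) (kA q 0))
    (PowerSeries.C (gaussF (tSeries q) (kB q 0)⁻¹)) =
    PowerSeries.C (gaussF (tSeries q) (kB q 0)⁻¹) := by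
  have h := (gaussAction q hq').Φ_f (hasTable q) (gaussLeibniz hq') (gaussInverse hq')
  rw [C_gaussF_t]
  exact h

theorem actS_gaussE : actSer q (sSeries q 0 0) (PowerSeries.C (gaussE (tSeries q) (kB q 0)⁻¹)) =
    PowerSeries.C (gaussE (tSeries q) (kB q 0)⁻¹) := by
  have h := (gaussAction q hq').S_e (hasTable q) (gaussLeibniz hq') (gaussInverse hq')
  rw [C_gaussE_t]
  exact h

theorem actS_gaussPhi : actSer q (sSeries q 0 0) (PowerSeries.C (gaussPhi (tSeries q) (kB q 0)⁻¹)) =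
    diagScalar (rSeries q 1 1 1 1 * betaInv q) • PowerSeries.C
      (gaussPhi (tSeries q) (kB q 0)⁻¹) := by
  have h := (gaussAction q hq').S_φ (hasTable q) (gaussLeibniz hq') (gaussInverse hq')
  rw [C_gaussPhi_t, RingHom.map_mul diagScalar]
  exact h

theorem actF_gaussE : actSer q (gaussF (sSeries q) (kA q 0))
    (PowerSeries.C (gaussE (tSeries q) (kB q 0)⁻¹)) =
    diagScalar (rSeries q 0 1 1 0 * betaInv q) • PowerSeries.C
      (gaussPhi (tSeries q) (kB q 0)⁻¹) := by
  have h := (gaussAction q hq').F_e (hasTable q) (gaussLeibniz hq') (gaussInverse hq')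
  rw [C_gaussE_t, C_gaussPhi_t, RingHom.map_mul diagScalar]
  exact h

theorem actF_gaussPhi : actSer q (gaussF (sSeries q) (kA q 0))
    (PowerSeries.C (gaussPhi (tSeries q) (kB q 0)⁻¹)) =
    0 := by
  have h := (gaussAction q hq').F_φ (hasTable q) (gaussLeibniz hq') (gaussInverse hq')
  rw [C_gaussPhi_t]
  exact h

theorem actF_gaussF : actSer q (gaussF (sSeries q) (kA q 0))
    (PowerSeries.C (gaussF (tSeries q) (kB q 0)⁻¹)) =
    0 := by
  have h := (gaussAction q hq').F_f (hasTable q) (gaussLeibniz hq') (gaussInverse hq')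
  rw [C_gaussF_t]
  exact h

theorem eSer_eSerB : Annihilates (eSer q) (eSerB q) := by
  have h : Annihilates (eSer q) (gaussE (tSeries q) (kB q 0)⁻¹) :=
      opAct_of_eq_zero (actE_gaussE hq')
  exact h.C_mul (ePos_mem_commuting hq') phiMinus₀_inv_mem

theorem eSer_cSerB : Annihilates (eSer q) (cSerB q) := by
  have h : Annihilates (eSer q) (gaussPhi (tSeries q) (kB q 0)⁻¹) :=
      opAct_of_eq_zero (actE_gaussPhi hq')
  exact h.C_mul (ePos_mem_commuting hq') phiMinus₀_inv_mem

theorem exists_eSer_fSerB : ∃ c, ActsDiag (eSer q) (fSerB q) 1 c :=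
  ⟨_, opAct_of_eq_diag (actE_gaussF hq')⟩

theorem gaussPhi_gaussE :
    ActsTrivially (gaussPhi (sSeries q) (kA q 0)) (gaussE (tSeries q) (kB q 0)⁻¹) :=
  opAct_of_eq_self (actPhi_gaussE hq')

theorem gaussPhi_gaussPhi :
    ActsTrivially (gaussPhi (sSeries q) (kA q 0)) (gaussPhi (tSeries q) (kB q 0)⁻¹) :=
  opAct_of_eq_self (actPhi_gaussPhi hq')

theorem gaussPhi_fSerB : ActsTrivially (gaussPhi (sSeries q) (kA q 0)) (fSerB q) :=
  opAct_of_eq_self (actPhi_gaussF hq')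

theorem cSer_fSerB : ActsTrivially (cSer q) (fSerB q) :=
  (gaussPhi_fSerB hq').normalize (constantCoeff_gaussPhi_s q)

theorem cSer_eSerB : ActsTrivially (cSer q) (eSerB q) := by
  have h := (gaussPhi_gaussE hq').normalize (constantCoeff_gaussPhi_s q)
  exact h.C_mul (cSer_mem_commuting hq') phiMinus₀_inv_mem

theorem cSer_cSerB : ActsTrivially (cSer q) (cSerB q) := by
  have h := (gaussPhi_gaussPhi hq').normalize (constantCoeff_gaussPhi_s q)
  exact h.C_mul (cSer_mem_commuting hq') phiMinus₀_inv_mem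

theorem gaussPhi_tSeries (i j : Fin 2) :
    ActsDiag (gaussPhi (sSeries q) (kA q 0)) (tSeries q i j) (tSeries q i j)
    (rSeries q 1 1 0 0) :=
  opAct_of_eq_diag ((gaussAction q hq').Φ_t (hasTable q) i j)

/-- `(φ₀⁺)⁻¹ φ⁺(z)` acts on the first column `s₁₁⁽⁰⁾ t_{i1}(w)` by a scalar series. -/
theorem exists_cSer_t : ∃ c, ∀ i, ActsDiag (cSer q) (PowerSeries.C (kB q 0 : B q) * tSeries q i 0)
    (PowerSeries.C (kB q 0 : B q) * tSeries q i 0) c := by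
  refine ⟨PowerSeries.C (PowerSeries.constantCoeff (rSeries q 1 1 0 0))⁻¹ * rSeries q 1 1 0 0,
    fun i => ?_⟩
  have h := (gaussPhi_tSeries hq' i 0).normalize (constantCoeff_gaussPhi_s q)
  exact h.C_mul (cSer_mem_commuting hq') (kB_mem 0)

theorem hSer_hSerB : ActsTrivially (hSer q) (hSerB q) := by
  have h0 : ActsTrivially (sSeries q 0 0) (tSeries q 0 0) :=
    opAct_of_eq_self (((hasTable q).S₀₀_t 0 0).trans (if_pos rfl))
  have h := h0.normalize (constantCoeff_sSeries q)
  exact h.C_mul (hSer_mem_commuting hq') (kB_mem 0)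

theorem hSer_eSerB : ActsTrivially (hSer q) (eSerB q) := by
  have h0 : ActsTrivially (sSeries q 0 0) (gaussE (tSeries q) (kB q 0)⁻¹) :=
      opAct_of_eq_self (actS_gaussE hq')
  have h := h0.normalize (constantCoeff_sSeries q)
  exact h.C_mul (hSer_mem_commuting hq') phiMinus₀_inv_mem

theorem exists_hSer_cSerB : ∃ c, ActsDiag (hSer q) (cSerB q) (cSerB q) c := by
  have h0 : ActsDiag (sSeries q 0 0) (gaussPhi (tSeries q) (kB q 0)⁻¹)
      (gaussPhi (tSeries q) (kB q 0)⁻¹) (rSeries q 1 1 1 1 * betaInv q) :=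
    opAct_of_eq_diag (actS_gaussPhi hq')
  have h := h0.normalize (constantCoeff_sSeries q)
  exact ⟨_, h.C_mul (hSer_mem_commuting hq') phiMinus₀_inv_mem⟩

/-- `φ₀⁺` fixes the series fixed by `φ⁺(z)`. -/
theorem phiPlus₀_inv_fix (h : ActsTrivially (gaussPhi (sSeries q) (kA q 0)) f) (n : ℕ) :
    opAct q (((phiPlus₀ q)⁻¹ : (A q)ˣ) : A q) (PowerSeries.coeff n f) = PowerSeries.coeff n f := by
  have := congrArg (opAct q (((phiPlus₀ q)⁻¹ : (A q)ˣ) : A q)) (h 0 n)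
  rw [PowerSeries.coeff_zero_eq_constantCoeff_apply, constantCoeff_gaussPhi_s, opAct_inv_apply,
    if_pos rfl] at this
  exact this.symm

theorem fSer_of_annihilates (h : Annihilates (gaussF (sSeries q) (kA q 0)) f) :
    Annihilates (fSer q) f := by
  intro m n
  rw [opAct_fSer hq', h, map_zero]

theorem fSer_fSerB : Annihilates (fSer q) (fSerB q) :=
  fSer_of_annihilates hq' (opAct_of_eq_zero (actF_gaussF hq'))

theorem fSer_cSerB : Annihilates (fSer q) (cSerB q) := by
  have h := fSer_of_annihilates hq' (opAct_of_eq_zero (actF_gaussPhi hq'))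
  exact h.C_mul (fSer_mem_commuting hq') phiMinus₀_inv_mem

theorem fSer_gSerB : Annihilates (fSer q) (gSerB q) := by
  have h := fSer_of_annihilates hq' (opAct_of_eq_zero
    ((gaussAction q hq').F_t (hasTable q) 0))
  exact h.C_mul (fSer_mem_commuting hq') (kB_mem 0)

theorem exists_fSer_eSerB : ∃ c, ActsDiag (fSer q) (eSerB q) (cSerB q) c := by
  have h0 : ActsDiag (gaussF (sSeries q) (kA q 0)) (gaussE (tSeries q) (kB q 0)⁻¹)
      (gaussPhi (tSeries q) (kB q 0)⁻¹) (rSeries q 0 1 1 0 * betaInv q) :=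
    opAct_of_eq_diag (actF_gaussE hq')
  have h : ActsDiag (fSer q) (gaussE (tSeries q) (kB q 0)⁻¹)
      (gaussPhi (tSeries q) (kB q 0)⁻¹) (rSeries q 0 1 1 0 * betaInv q) := by
    intro m n
    rw [opAct_fSer hq', h0]
    split_ifs
    · rw [map_smul, phiPlus₀_inv_fix hq' (gaussPhi_gaussPhi hq')]
    · rw [map_zero]
  exact ⟨_, h.C_mul (fSer_mem_commuting hq') phiMinus₀_inv_mem⟩

/-- `φ₀⁺` fixes `s_{aa}^{(0)} t_{ij}^{(n)}`, since it multiplies all `t_{ij}^{(n)}` by the same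
scalar and `s_{aa}^{(0)}`, the inverse of `t_{aa}^{(0)}`, by the inverse scalar. -/
theorem phiPlus₀_inv_kB_mul_tB (a i j : Fin 2) (n : ℕ) :
    opAct q (((phiPlus₀ q)⁻¹ : (A q)ˣ) : A q) (kB q a * tB q i j n) = kB q a * tB q i j n := by
  have h0 : ∃ c : ℂ, ∀ i j n, opAct q (phiPlus₀ q : A q) (tB q i j n) = c • tB q i j n := by
    refine ⟨PowerSeries.coeff 0 (rSeries q 1 1 0 0), fun i j n => ?_⟩
    have := gaussPhi_tSeries hq' i j 0 n
    rw [PowerSeries.coeff_zero_eq_constantCoeff_apply, constantCoeff_gaussPhi_s,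
      if_pos (Nat.zero_le n), Nat.sub_zero, tSeries, PowerSeries.coeff_mk] at this
    exact this
  obtain ⟨c, hc⟩ := h0
  have h1 : c • opAct q (phiPlus₀ q : A q) (kB q a : B q) = kB q a := by
    have h2 : (kB q a : B q) * tB q a a 0 = 1 := (kB q a).mul_inv
    have h3 := opAct_grp_mul phiPlus₀_mem (kB q a : B q) (tB q a a 0)
    rw [h2, opAct_grp_one phiPlus₀_mem, hc] at h3
    have h4 := congrArg (fun v => v * (kB q a : B q)) h3
    have h5 : tB q a a 0 * (kB q a : B q) = 1 := (kB q a).inv_mul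
    simp only [one_mul, mul_smul_comm, smul_mul_assoc, mul_assoc, h5, mul_one] at h4
    exact h4.symm
  have h2 : opAct q (phiPlus₀ q : A q) (kB q a * tB q i j n) = kB q a * tB q i j n := by
    rw [opAct_grp_mul phiPlus₀_mem, hc, mul_smul_comm, ← smul_mul_assoc, h1]
  conv_lhs => rw [← h2]
  exact opAct_inv_apply _ _

theorem phiPlus₀_inv_phiMinus₀_inv : opAct q (((phiPlus₀ q)⁻¹ : (A q)ˣ) : A q)
    (((phiMinus₀ q)⁻¹ : (B q)ˣ) : B q) = (((phiMinus₀ q)⁻¹ : (B q)ˣ) : B q) := by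
  have h : (((phiMinus₀ q)⁻¹ : (B q)ˣ) : B q) = kB q 1 * tB q 0 0 0 := by
    have hc : (kB q 0)⁻¹ * kB q 1 = kB q 1 * (kB q 0)⁻¹ :=
      (Commute.inv_left (Units.ext (kB_commute q))).eq
    rw [phiMinus₀, inv_inv, hc, Units.val_mul]
    rfl
  rw [h, phiPlus₀_inv_kB_mul_tB hq']

/-- `φ₀⁺` also fixes `(φ₀⁻)⁻¹ f`, if `f` is fixed by `φ⁺(z)`. -/
theorem phiPlus₀_inv_C_mul (h : ActsTrivially (gaussPhi (sSeries q) (kA q 0)) f) (n : ℕ) :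
    opAct q (((phiPlus₀ q)⁻¹ : (A q)ˣ) : A q)
      (PowerSeries.coeff n (PowerSeries.C (((phiMinus₀ q)⁻¹ : (B q)ˣ) : B q) * f)) =
      PowerSeries.coeff n (PowerSeries.C (((phiMinus₀ q)⁻¹ : (B q)ˣ) : B q) * f) := by
  rw [PowerSeries.coeff_C_mul, opAct_grp_mul (inv_mem phiPlus₀_mem),
    phiPlus₀_inv_phiMinus₀_inv hq', phiPlus₀_inv_fix hq' h]

theorem actF_t₀₀ : actSer q (gaussF (sSeries q) (kA q 0)) (PowerSeries.C (tSeries q 0 0)) =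
    diagScalar (-rSeries q 0 1 1 0) • PowerSeries.C (tSeries q 1 0) := by
  have h := (gaussAction q hq').F_t₀₀ (hasTable q)
  rw [RingHom.map_neg diagScalar]
  exact h

theorem exists_fSer_hSerB : ∃ c, ActsDiag (fSer q) (hSerB q) (gSerB q) c := by
  have h0 : ActsDiag (gaussF (sSeries q) (kA q 0)) (tSeries q 0 0) (tSeries q 1 0)
      (-rSeries q 0 1 1 0) := opAct_of_eq_diag (actF_t₀₀ hq')
  obtain ⟨c', hc'⟩ := exists_opPhi_kB hq' 0
  refine ⟨c' • -rSeries q 0 1 1 0, fun m n => ?_⟩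
  have h1 : opAct q (PowerSeries.coeff m (gaussF (sSeries q) (kA q 0)))
      (kB q 0 * PowerSeries.coeff n (tSeries q 0 0)) = c' • ((kB q 0 : B q) *
      opAct q (PowerSeries.coeff m (gaussF (sSeries q) (kA q 0)))
        (PowerSeries.coeff n (tSeries q 0 0))) := by
    rw [opF_mul hq', opF_kB hq', zero_mul, zero_add, par_kB, Finset.sum_eq_single (0, m)]
    · rw [hc', if_pos rfl, smul_mul_assoc]
    · rintro ⟨a, b⟩ hp hne
      rw [hc', if_neg, zero_mul]
      rintro rfl
      exact hne (by simpa using hp)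
    · simp
  rw [hSerB, PowerSeries.coeff_C_mul, opAct_fSer hq', h1, map_smul, h0]
  split_ifs
  · rw [mul_smul_comm, map_smul, tSeries, PowerSeries.coeff_mk, phiPlus₀_inv_kB_mul_tB hq' 0,
      smul_smul,
      gSerB, PowerSeries.coeff_C_mul, tSeries, PowerSeries.coeff_mk, PowerSeries.coeff_smul,
      smul_eq_mul]
  · rw [mul_zero, map_zero, smul_zero]

end Values

/-! ### Logarithms of currents -/

section Logarithms

variable {R : Type*} [Ring R] [Algebra ℂ R]

theorem coeff_pow_mem (N : Subalgebra ℂ R) {f : R⟦X⟧} (hf : ∀ n, PowerSeries.coeff n f ∈ N)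
    (t n : ℕ) : PowerSeries.coeff n (f ^ t) ∈ N := by
  induction t generalizing n with
  | zero =>
    rw [pow_zero, PowerSeries.coeff_one]
    split_ifs
    · exact one_mem N
    · exact zero_mem N
  | succ t ih =>
    rw [pow_succ, PowerSeries.coeff_mul]
    exact sum_mem fun p _ => mul_mem (ih _) (hf _)

theorem logCoeff_mem (N : Subalgebra ℂ R) {f : R⟦X⟧} (hf : ∀ n, PowerSeries.coeff n f ∈ N) (n : ℕ) :
    logCoeff f n ∈ N := by
  refine sum_mem fun k _ => N.smul_mem (coeff_pow_mem N (fun n => ?_) k n) _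
  rw [map_sub, PowerSeries.coeff_one]
  refine sub_mem (hf n) ?_
  split_ifs
  · exact one_mem N
  · exact zero_mem N

/-- If `D(z)` fixes `v`, its logarithm annihilates `v`. -/
theorem logCoeff_apply_eq_zero {D : (Module.End ℂ R)⟦X⟧} {v : R}
    (h : ∀ m, (PowerSeries.coeff m D : Module.End ℂ R) v = if m = 0 then v else 0) (n : ℕ) :
    logCoeff D n v = 0 := by
  have h1 : ∀ m, (PowerSeries.coeff m (D - 1) : Module.End ℂ R) v = 0 := by
    intro m
    rw [map_sub, PowerSeries.coeff_one, LinearMap.sub_apply, h]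
    split_ifs <;> simp
  rw [logCoeff, LinearMap.sum_apply]
  refine Finset.sum_eq_zero fun k hk => ?_
  obtain ⟨k, rfl⟩ := Nat.exists_eq_add_of_le' (Finset.mem_Icc.1 hk).1
  rw [pow_succ (D - 1), PowerSeries.coeff_mul, LinearMap.smul_apply, LinearMap.sum_apply]
  simp only [Module.End.mul_apply, h1, map_zero, Finset.sum_const_zero, smul_zero]

/-- If `D(z)` acts on the series `f(w)` by a scalar series in `zw`, its logarithm does too. -/
theorem exists_logCoeff_apply {D : (Module.End ℂ R)⟦X⟧} (hD : PowerSeries.constantCoeff D = 1)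
    {f : R⟦X⟧} {c : ℂ⟦X⟧} (h : ∀ m n, (PowerSeries.coeff m D : Module.End ℂ R)
      (PowerSeries.coeff n f) =
        if m ≤ n then PowerSeries.coeff m c • PowerSeries.coeff (n - m) f else 0)
    (m : ℕ) : ∃ d : ℂ, ∀ n, logCoeff D m (PowerSeries.coeff n f) =
      if m ≤ n then d • PowerSeries.coeff (n - m) f else 0 := by
  have hpow : ∀ t m n, (PowerSeries.coeff m (D ^ t) : Module.End ℂ R) (PowerSeries.coeff n f) =
      if m ≤ n then PowerSeries.coeff m (c ^ t) • PowerSeries.coeff (n - m) f else 0 := by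
    intro t
    induction t with
    | zero =>
      intro m n
      rw [pow_zero, pow_zero, PowerSeries.coeff_one, PowerSeries.coeff_one]
      by_cases hm : m = 0 <;> simp [hm]
    | succ t ih =>
      intro m n
      rw [pow_succ, pow_succ, PowerSeries.coeff_mul, PowerSeries.coeff_mul, LinearMap.sum_apply]
      have h1 : ∀ p ∈ antidiagonal m, ((PowerSeries.coeff p.1 (D ^ t) : Module.End ℂ R) *
          (PowerSeries.coeff p.2 D : Module.End ℂ R)) (PowerSeries.coeff n f) =
          if m ≤ n then (PowerSeries.coeff p.1 (c ^ t) * PowerSeries.coeff p.2 c) •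
            PowerSeries.coeff (n - m) f else 0 := by
        rintro ⟨a, b⟩ hp
        have hp' : a + b = m := by simpa using hp
        rw [Module.End.mul_apply, h]
        by_cases hb : b ≤ n
        · rw [if_pos hb, map_smul, ih]
          by_cases hm : m ≤ n
          · have e : n - b - a = n - m := by omega
            rw [if_pos hm, if_pos (by change a ≤ n - b; omega), smul_smul, mul_comm, e]
          · rw [if_neg hm, if_neg (by change ¬a ≤ n - b; omega), smul_zero]
        · rw [if_neg hb, map_zero, if_neg (by omega)]
      rw [Finset.sum_congr rfl h1]
      split_ifs
      · rw [Finset.sum_smul]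
      · simp
  refine ⟨∑ t ∈ Finset.range (m + 1), derivWeight m t * PowerSeries.coeff m (c ^ t), fun n => ?_⟩
  rw [logCoeff_eq_sum_pow hD le_rfl, LinearMap.sum_apply]
  simp only [LinearMap.smul_apply, hpow]
  split_ifs
  · simp only [Finset.sum_smul, smul_smul]
  · simp

/-- A derivation which maps the series `f(w)` to `d wˢ f(w)` maps `log f(w)` to `d wˢ`. -/
theorem derivation_logCoeff (N : Subalgebra ℂ R) {D : R →ₗ[ℂ] R}
    (hD : ∀ b ∈ N, ∀ b' ∈ N, D (b * b') = D b * b' + b * D b') {f : R⟦X⟧}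
    (hf : PowerSeries.constantCoeff f = 1) (hN : ∀ n, PowerSeries.coeff n f ∈ N) {s : ℕ} {d : ℂ}
    (h : ∀ n, D (PowerSeries.coeff n f) = if s ≤ n then d • PowerSeries.coeff (n - s) f else 0)
    (n : ℕ) : D (logCoeff f n) = (if s = n then d else 0) • (1 : R) := by
  have hD1 : D 1 = 0 := by
    have := hD 1 (one_mem N) 1 (one_mem N)
    rwa [mul_one, mul_one, one_mul, left_eq_add] at this
  have hf' : mapCoeff D f = d • (PowerSeries.X ^ s * f) := by
    ext n
    rw [coeff_mapCoeff, h, PowerSeries.coeff_smul, PowerSeries.coeff_X_pow_mul']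
    split_ifs <;> simp
  have hmul : ∀ u v : R⟦X⟧, (∀ n, PowerSeries.coeff n u ∈ N) → (∀ n, PowerSeries.coeff n v ∈ N) →
      mapCoeff D (u * v) = mapCoeff D u * v + u * mapCoeff D v := by
    intro u v hu hv
    ext n
    rw [coeff_mapCoeff, map_add, PowerSeries.coeff_mul, PowerSeries.coeff_mul,
      PowerSeries.coeff_mul,
      map_sum, ← Finset.sum_add_distrib]
    refine Finset.sum_congr rfl fun p _ => ?_
    rw [hD _ (hu _) _ (hv _), coeff_mapCoeff, coeff_mapCoeff]
  have hpow : ∀ t : ℕ, mapCoeff D (f ^ t) = ((t : ℂ) * d) • (PowerSeries.X ^ s * f ^ t) := by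
    intro t
    induction t with
    | zero =>
      ext n
      rw [coeff_mapCoeff, pow_zero, PowerSeries.coeff_one]
      split_ifs <;> simp [hD1]
    | succ t ih =>
      have e : f ^ t * (PowerSeries.X ^ s * f) = PowerSeries.X ^ s * (f ^ t * f) := by
        rw [← mul_assoc, (PowerSeries.commute_X_pow (f ^ t) s).eq, mul_assoc]
      rw [pow_succ, hmul _ _ (coeff_pow_mem N hN t) hN, ih, hf', mul_smul_comm, smul_mul_assoc,
        mul_assoc, e, ← add_smul, Nat.cast_succ, add_mul, one_mul]
  rw [logCoeff_eq_sum_pow (M := n + 1) hf (Nat.le_succ n), map_sum]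
  have h1 : ∀ t : ℕ, D (PowerSeries.coeff n (f ^ t)) = if s ≤ n then
      ((t : ℂ) * d) • PowerSeries.coeff (n - s) (f ^ t) else 0 := by
    intro t
    rw [← coeff_mapCoeff, hpow, PowerSeries.coeff_smul, PowerSeries.coeff_X_pow_mul']
    split_ifs <;> simp
  simp only [map_smul, h1]
  by_cases hs : s ≤ n
  · simp only [if_pos hs, coeff_pow_eq_sum hf (Nat.sub_le n s), Finset.smul_sum, smul_smul]
    rw [Finset.sum_comm]
    have h2 : ∀ k ∈ Finset.range (n + 1), ∑ t ∈ Finset.range (n + 1 + 1),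
        (derivWeight (n + 1) t * (t * d * (t.choose k : ℂ))) • PowerSeries.coeff (n - s)
          ((f - 1) ^ k) =
        if k = 0 then d • PowerSeries.coeff (n - s) (1 : R⟦X⟧) else 0 := by
      intro k hk
      have h3 := sum_derivWeight_choose_mul (M := n + 1) (k := k) (l := 1)
        (by have := Finset.mem_range.1 hk; omega)
      rw [sum_derivWeight_choose (M := n + 1) (k := 1) (by omega)] at h3
      simp only [Nat.choose_one_right, one_ne_zero, if_false, zero_add] at h3
      rw [← Finset.sum_smul]
      have h4 : ∑ t ∈ Finset.range (n + 1 + 1), derivWeight (n + 1) t * (t * d * (t.choose k : ℂ)) =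
          d * ∑ t ∈ Finset.range (n + 1 + 1), derivWeight (n + 1) t * ((t.choose k : ℂ) * t) := by
        rw [Finset.mul_sum]
        exact Finset.sum_congr rfl fun t _ => by ring
      rw [h4, h3]
      split_ifs with hk0
      · subst hk0
        norm_num
      · simp
    rw [Finset.sum_congr rfl h2, Finset.sum_ite_eq' , if_pos (by simp), PowerSeries.coeff_one]
    by_cases hsn : s = n
    · simp [hsn]
    · rw [if_neg (by omega), if_neg hsn, smul_zero, zero_smul]
  · simp only [if_neg hs, smul_zero, Finset.sum_const_zero]
    rw [if_neg (by omega), zero_smul]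

end Logarithms

/-! ### The derivations `h_s` and `C_s` -/

section Derivations

variable {q : ℂ} [hq : NeZero q]

theorem opAct_hPos (s : ℕ) : opAct q (hPos q s) = (q - q⁻¹)⁻¹ •
    logCoeff (PowerSeries.map (opAct q : A q →+* Module.End ℂ (B q)) (hSer q)) s := by
  rw [hPos, map_smul, ← logCoeff_map]
  rfl

theorem opAct_cPos (s : ℕ) : opAct q (cPos q s) = (q - q⁻¹)⁻¹ •
    logCoeff (PowerSeries.map (opAct q : A q →+* Module.End ℂ (B q)) (cSer q)) s := by
  rw [cPos, map_smul, ← logCoeff_map]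
  rfl

theorem constantCoeff_map_opAct {x : (A q)⟦X⟧} (hx : PowerSeries.constantCoeff x = 1) :
    PowerSeries.constantCoeff (PowerSeries.map (opAct q : A q →+* Module.End ℂ (B q)) x) = 1 := by
  rw [← PowerSeries.coeff_zero_eq_constantCoeff_apply, PowerSeries.coeff_map,
    PowerSeries.coeff_zero_eq_constantCoeff_apply, hx, map_one]

theorem coeff_map_opAct (x : (A q)⟦X⟧) (n : ℕ) (b : B q) :
    (PowerSeries.coeff n (PowerSeries.map (opAct q : A q →+* Module.End ℂ (B q)) x) :
      Module.End ℂ (B q)) b = opAct q (PowerSeries.coeff n x) b := by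
  rw [PowerSeries.coeff_map]
  rfl

theorem eltMinus_F (s : ℕ+) : Idx.eltMinus q (.F s) = -PowerSeries.coeff s (eSerB q) := by
  rw [eSerB, PowerSeries.coeff_C_mul, Idx.eltMinus, eNeg, mul_neg]

theorem eltMinus_h (s : ℕ+) : Idx.eltMinus q (.h s) = -(q - q⁻¹)⁻¹ • logCoeff (cSerB q) s := rfl

theorem eltMinus_C (s : ℕ+) : Idx.eltMinus q (.C s) = -(q - q⁻¹)⁻¹ • logCoeff (hSerB q) s := rfl

theorem eltMinus_E (n : ℕ) : Idx.eltMinus q (.E n) = PowerSeries.coeff n (fSerB q) := rfl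

/-- The subalgebra generated by the coefficients of `s₁₁⁽⁰⁾ K₁⁻`, `(φ₀⁻)⁻¹ φ⁻`, `(φ₀⁻)⁻¹ E⁻`. It is
annihilated by the `E_n` and contains all `b⁻` except the `F_{-n}`. -/
def borelB (q : ℂ) : Subalgebra ℂ (B q) :=
  Algebra.adjoin ℂ {b | ∃ n, b = PowerSeries.coeff n (hSerB q) ∨ b = PowerSeries.coeff n (cSerB q) ∨
    b = PowerSeries.coeff n (eSerB q)}

theorem hSerB_mem_borelB (n : ℕ) : PowerSeries.coeff n (hSerB q) ∈ borelB q :=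
  Algebra.subset_adjoin ⟨n, Or.inl rfl⟩

theorem cSerB_mem_borelB (n : ℕ) : PowerSeries.coeff n (cSerB q) ∈ borelB q :=
  Algebra.subset_adjoin ⟨n, Or.inr (Or.inl rfl)⟩

theorem eSerB_mem_borelB (n : ℕ) : PowerSeries.coeff n (eSerB q) ∈ borelB q :=
  Algebra.subset_adjoin ⟨n, Or.inr (Or.inr rfl)⟩

theorem eltMinus_mem_borelB {c : Idx} (hc : ∀ n, c ≠ .E n) : Idx.eltMinus q c ∈ borelB q := by
  rcases c with s | s | s | n
  · rw [eltMinus_F]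
    exact neg_mem (eSerB_mem_borelB _)
  · exact (borelB q).smul_mem (logCoeff_mem _ cSerB_mem_borelB _) _
  · exact (borelB q).smul_mem (logCoeff_mem _ hSerB_mem_borelB _) _
  · exact absurd rfl (hc n)

variable (hq' : ∀ n : ℕ, 0 < n → q ^ n ≠ 1)
include hq'

theorem opE_one (n : ℕ) : opAct q (ePos q n) 1 = 0 := by
  have h1 := mem_commuting.1 (ePos_mem_commuting hq' n) 0 1
  rw [mul_one, opE_kB hq'] at h1
  rw [← Units.mul_right_inj (kB q 0), ← h1, mul_zero]

theorem opC_one (n : ℕ) : opAct q (PowerSeries.coeff n (cSer q)) 1 = if n = 0 then 1 else 0 := by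
  have h1 := mem_commuting.1 (cSer_mem_commuting hq' n) 0 1
  rw [mul_one, coeff_cSer_kB hq'] at h1
  rw [← Units.mul_right_inj (kB q 0), ← h1]
  split_ifs <;> simp

theorem opH_one (n : ℕ) : opAct q (PowerSeries.coeff n (hSer q)) 1 = if n = 0 then 1 else 0 := by
  have h1 := mem_commuting.1 (hSer_mem_commuting hq' n) 0 1
  rw [mul_one, coeff_hSer_kB hq'] at h1
  rw [← Units.mul_right_inj (kB q 0), ← h1]
  split_ifs <;> simp

theorem opFn_one (n : ℕ) : opAct q (PowerSeries.coeff n (fSer q)) 1 = 0 := by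
  have h1 := mem_commuting.1 (fSer_mem_commuting hq' n) 0 1
  rw [mul_one, opAct_fSer hq', opF_kB hq', map_zero] at h1
  rw [← Units.mul_right_inj (kB q 0), ← h1, mul_zero]

theorem opE_borelB {b : B q} (hb : b ∈ borelB q) (n : ℕ) : opAct q (ePos q n) b = 0 := by
  induction hb using Algebra.adjoin_induction generalizing n with
  | mem x hx =>
    obtain ⟨m, rfl | rfl | rfl⟩ := hx
    · exact eSer_hSerB hq' n m
    · exact eSer_cSerB hq' n m
    · exact eSer_eSerB hq' n m
  | algebraMap r => rw [Algebra.algebraMap_eq_smul_one, map_smul, opE_one hq', smul_zero]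
  | add x y _ _ hx hy => rw [map_add, hx, hy, add_zero]
  | mul x y _ _ hx hy => simp [opE_mul hq', hx, hy]

theorem opH_borelB {b : B q} (hb : b ∈ borelB q) (n : ℕ) :
    opAct q (PowerSeries.coeff n (hSer q)) b ∈ borelB q := by
  induction hb using Algebra.adjoin_induction generalizing n with
  | mem x hx =>
    obtain ⟨m, rfl | rfl | rfl⟩ := hx
    · rw [hSer_hSerB hq']
      split_ifs
      exacts [hSerB_mem_borelB _, zero_mem _]
    · obtain ⟨c, hc⟩ := exists_hSer_cSerB hq'
      rw [hc]
      split_ifs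
      exacts [(borelB q).smul_mem (cSerB_mem_borelB _) _, zero_mem _]
    · rw [hSer_eSerB hq']
      split_ifs
      exacts [eSerB_mem_borelB _, zero_mem _]
  | algebraMap r =>
    rw [Algebra.algebraMap_eq_smul_one, map_smul, opH_one hq']
    split_ifs
    exacts [(borelB q).smul_mem (one_mem _) _, by rw [smul_zero]; exact zero_mem _]
  | add x y _ _ hx hy => rw [map_add]; exact add_mem (hx n) (hy n)
  | mul x y hx' _ hx hy =>
    rw [opH_mul hq' (opE_borelB hq' hx')]
    exact sum_mem fun p _ => mul_mem (hx _) (hy _)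

/-- `h_s` acts by a derivation of `borelB`. -/
theorem hPos_mul (s : ℕ) {b b' : B q} (hb : b ∈ borelB q) (hb' : b' ∈ borelB q) :
    opAct q (hPos q s) (b * b') = opAct q (hPos q s) b * b' + b * opAct q (hPos q s) b' := by
  have h := logCoeff_derivation (borelB q)
    (D := PowerSeries.map (opAct q : A q →+* Module.End ℂ (B q)) (hSer q))
    (constantCoeff_map_opAct (constantCoeff_hSer q))
    (fun n b hb => by rw [coeff_map_opAct]; exact opH_borelB hq' hb n)
    (fun n b hb b' _ => by
      simp only [coeff_map_opAct]
      exact opH_mul hq' (opE_borelB hq' hb) n b') s hb hb'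
  simp only [opAct_hPos, LinearMap.smul_apply, h, smul_add, smul_mul_assoc, mul_smul_comm]

/-- `C_s` acts by a derivation. -/
theorem cPos_mul (s : ℕ) (b b' : B q) :
    opAct q (cPos q s) (b * b') = opAct q (cPos q s) b * b' + b * opAct q (cPos q s) b' := by
  have h := logCoeff_derivation ⊤
    (D := PowerSeries.map (opAct q : A q →+* Module.End ℂ (B q)) (cSer q))
    (constantCoeff_map_opAct (constantCoeff_cSer q)) (fun n b _ => Algebra.mem_top)
    (fun n b _ b' _ => by
      simp only [coeff_map_opAct]
      exact opC_mul hq' n b b') s (b := b) (b' := b') Algebra.mem_top Algebra.mem_top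
  simp only [opAct_cPos, LinearMap.smul_apply, h, smul_add, smul_mul_assoc, mul_smul_comm]

theorem hPos_of_trivial {f : (B q)⟦X⟧} (h : ActsTrivially (hSer q) f) (s n : ℕ) :
    opAct q (hPos q s) (PowerSeries.coeff n f) = 0 := by
  rw [opAct_hPos, LinearMap.smul_apply, logCoeff_apply_eq_zero, smul_zero]
  intro m
  rw [coeff_map_opAct, h]

theorem cPos_of_trivial {f : (B q)⟦X⟧} (h : ActsTrivially (cSer q) f) (s n : ℕ) :
    opAct q (cPos q s) (PowerSeries.coeff n f) = 0 := by
  rw [opAct_cPos, LinearMap.smul_apply, logCoeff_apply_eq_zero, smul_zero]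
  intro m
  rw [coeff_map_opAct, h]

theorem exists_hPos_of_diag {f : (B q)⟦X⟧} {c : ℂ⟦X⟧} (h : ActsDiag (hSer q) f f c) (s : ℕ) :
    ∃ d : ℂ, ∀ n, opAct q (hPos q s) (PowerSeries.coeff n f) =
      if s ≤ n then d • PowerSeries.coeff (n - s) f else 0 := by
  obtain ⟨d, hd⟩ := exists_logCoeff_apply
    (D := PowerSeries.map (opAct q : A q →+* Module.End ℂ (B q)) (hSer q)) (f := f) (c := c)
    (constantCoeff_map_opAct (constantCoeff_hSer q))
    (fun m n => by rw [coeff_map_opAct]; exact h m n) s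
  refine ⟨(q - q⁻¹)⁻¹ * d, fun n => ?_⟩
  rw [opAct_hPos, LinearMap.smul_apply, hd, smul_ite, smul_smul, smul_zero]

theorem exists_cPos_of_diag {f : (B q)⟦X⟧} {c : ℂ⟦X⟧} (h : ActsDiag (cSer q) f f c) (s : ℕ) :
    ∃ d : ℂ, ∀ n, opAct q (cPos q s) (PowerSeries.coeff n f) =
      if s ≤ n then d • PowerSeries.coeff (n - s) f else 0 := by
  obtain ⟨d, hd⟩ := exists_logCoeff_apply
    (D := PowerSeries.map (opAct q : A q →+* Module.End ℂ (B q)) (cSer q)) (f := f) (c := c)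
    (constantCoeff_map_opAct (constantCoeff_cSer q))
    (fun m n => by rw [coeff_map_opAct]; exact h m n) s
  refine ⟨(q - q⁻¹)⁻¹ * d, fun n => ?_⟩
  rw [opAct_cPos, LinearMap.smul_apply, hd, smul_ite, smul_smul, smul_zero]

/-- Among the `b⁻` in the subalgebra `borelB`, only `(h_s)⁻ = C_{-s}` is not annihilated by
`h_s`. -/
theorem exists_hPos_eltMinus (s : ℕ+) : ∃ d : ℂ, ∀ c : Idx, (∀ n, c ≠ .E n) →
    opAct q (hPos q s) (Idx.eltMinus q c) = (if c = .h s then d else 0) • (1 : B q) := by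
  obtain ⟨c₀, hc₀⟩ := exists_hSer_cSerB hq'
  obtain ⟨d, hd⟩ := exists_hPos_of_diag hq' hc₀ s
  refine ⟨-(q - q⁻¹)⁻¹ * d, fun c hc => ?_⟩
  rcases c with m | m | m | n
  · rw [eltMinus_F, map_neg, hPos_of_trivial hq' (hSer_eSerB hq'), if_neg (by simp)]
    simp
  · rw [eltMinus_h, map_smul,
      derivation_logCoeff (borelB q) (fun b hb b' hb' => hPos_mul hq' s hb hb')
      (constantCoeff_cSerB q) cSerB_mem_borelB hd, smul_smul]
    congr 1
    by_cases h : s = m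
    · subst h; simp
    · rw [if_neg, if_neg, mul_zero]
      · simpa using Ne.symm h
      · simpa using h
  · have h0 : ∀ n, opAct q (hPos q s) (PowerSeries.coeff n (hSerB q)) =
        if (s : ℕ) ≤ n then (0 : ℂ) • PowerSeries.coeff (n - s) (hSerB q) else 0 := fun n => by
      rw [hPos_of_trivial hq' (hSer_hSerB hq')]
      simp
    rw [eltMinus_C, map_smul,
      derivation_logCoeff (borelB q) (fun b hb b' hb' => hPos_mul hq' s hb hb')
      (constantCoeff_hSerB q) hSerB_mem_borelB h0, ite_self, if_neg (by simp)]
    simp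
  · exact absurd rfl (hc n)

/-- Only `(C_s)⁻ = h_{-s}` is not annihilated by `C_s`. -/
theorem exists_cPos_eltMinus (s : ℕ+) : ∃ d : ℂ, ∀ c : Idx,
    opAct q (cPos q s) (Idx.eltMinus q c) = (if c = .C s then d else 0) • (1 : B q) := by
  obtain ⟨c₀, hc₀⟩ := exists_cSer_t hq'
  obtain ⟨d, hd⟩ := exists_cPos_of_diag hq' (hc₀ 0) s
  have hD : ∀ b ∈ (⊤ : Subalgebra ℂ (B q)), ∀ b' ∈ (⊤ : Subalgebra ℂ (B q)),
      opAct q (cPos q s) (b * b') = opAct q (cPos q s) b * b' + b * opAct q (cPos q s) b' :=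
    fun b _ b' _ => cPos_mul hq' s b b'
  refine ⟨-(q - q⁻¹)⁻¹ * d, fun c => ?_⟩
  rcases c with m | m | m | n
  · rw [eltMinus_F, map_neg, cPos_of_trivial hq' (cSer_eSerB hq'), if_neg (by simp)]
    simp
  · have h0 : ∀ n, opAct q (cPos q s) (PowerSeries.coeff n (cSerB q)) =
        if (s : ℕ) ≤ n then (0 : ℂ) • PowerSeries.coeff (n - s) (cSerB q) else 0 := fun n => by
      rw [cPos_of_trivial hq' (cSer_cSerB hq')]
      simp
    rw [eltMinus_h, map_smul, derivation_logCoeff ⊤ hD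
      (constantCoeff_cSerB q) (fun _ => Algebra.mem_top) h0, ite_self, if_neg (by simp)]
    simp
  · rw [eltMinus_C, map_smul, derivation_logCoeff (s := s) (d := d) ⊤ hD
      (constantCoeff_hSerB q) (fun _ => Algebra.mem_top) hd, smul_smul]
    congr 1
    by_cases h : s = m
    · subst h; simp
    · rw [if_neg, if_neg, mul_zero]
      · simpa using Ne.symm h
      · simpa using h
  · rw [eltMinus_E, cPos_of_trivial hq' (cSer_fSerB hq'), if_neg (by simp)]
    simp

/-- Only `(E_n)⁻ = F_{-n}` is not annihilated by `E_n`. -/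
theorem exists_ePos_eltMinus (n : ℕ) : ∃ d : ℂ, ∀ c : Idx,
    opAct q (ePos q n) (Idx.eltMinus q c) = (if c = .E n then d else 0) • (1 : B q) := by
  obtain ⟨c₀, hc₀⟩ := exists_eSer_fSerB hq'
  refine ⟨PowerSeries.coeff n c₀, fun c => ?_⟩
  by_cases hc : ∀ m, c ≠ .E m
  · rw [opE_borelB hq' (eltMinus_mem_borelB hc), if_neg (hc n), zero_smul]
  · push Not at hc
    obtain ⟨m, rfl⟩ := hc
    rw [eltMinus_E, ← coeff_eSer, hc₀, PowerSeries.coeff_one]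
    by_cases h : m = n
    · subst h; simp
    · rw [if_neg (show ¬Idx.E m = Idx.E n by simpa using h)]
      split_ifs
      · omega
      · simp
      · simp

end Derivations

/-! ### Parity of the Drinfeld generators -/

section Parity

variable (q : ℂ) [hq : NeZero q]

theorem map_par_tSeries (i j : Fin 2) :
    PowerSeries.map (par (B q) : B q →+* B q) (tSeries q i j) =
      (-1 : ℂ) ^ ((i : ℕ) + j) • tSeries q i j := by
  ext n : 1
  rw [PowerSeries.coeff_map, PowerSeries.coeff_smul, tSeries, PowerSeries.coeff_mk]
  exact par_tB q i j n

theorem map_par_tInv : PowerSeries.map (par (B q) : B q →+* B q) (tInv q) = tInv q := by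
  have h := congrArg (PowerSeries.map (par (B q) : B q →+* B q)) (t_mul_tInv q)
  rw [map_mul, map_par_tSeries, map_one] at h
  have h' : tSeries q 0 0 * PowerSeries.map (par (B q) : B q →+* B q) (tInv q) = 1 := by
    simpa using h
  exact (left_inv_eq_right_inv (tInv_mul_t q) h').symm

theorem par_phiMinus₀_inv : par (B q) (((phiMinus₀ q)⁻¹ : (B q)ˣ) : B q) =
    (((phiMinus₀ q)⁻¹ : (B q)ˣ) : B q) := by
  have h : ∀ k : (B q)ˣ, par (B q) (k : B q) = k → par (B q) ((k⁻¹ : (B q)ˣ) : B q) =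
      (k⁻¹ : (B q)ˣ) := by
    intro k hk
    rw [← Units.mul_right_inj k, Units.mul_inv]
    nth_rw 1 [← hk]
    rw [← map_mul, Units.mul_inv, map_one]
  rw [phiMinus₀, inv_inv, Units.val_mul, map_mul, h _ (par_kB q 0), par_kB]

theorem par_eSerB (n : ℕ) : par (B q) (PowerSeries.coeff n (eSerB q)) =
    -PowerSeries.coeff n (eSerB q) := by
  have h : PowerSeries.map (par (B q) : B q →+* B q) (eSerB q) = -eSerB q := by
    change PowerSeries.map _ (PowerSeries.C _ * (tInv q * tSeries q 0 1)) =
      -(PowerSeries.C _ * (tInv q * tSeries q 0 1))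
    rw [map_mul, map_mul, map_par_tInv, map_par_tSeries, PowerSeries.map_C]
    simp [par_phiMinus₀_inv]
  have := congrArg (PowerSeries.coeff n) h
  rwa [PowerSeries.coeff_map, map_neg] at this

theorem par_fSerB (n : ℕ) : par (B q) (PowerSeries.coeff n (fSerB q)) =
    -PowerSeries.coeff n (fSerB q) := by
  have h : PowerSeries.map (par (B q) : B q →+* B q) (fSerB q) = -fSerB q := by
    change PowerSeries.map _ (tSeries q 1 0 * tInv q) = -(tSeries q 1 0 * tInv q)
    rw [map_mul, map_par_tInv, map_par_tSeries]
    simp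
  have := congrArg (PowerSeries.coeff n) h
  rwa [PowerSeries.coeff_map, map_neg] at this

theorem map_par_hSerB : PowerSeries.map (par (B q) : B q →+* B q) (hSerB q) = hSerB q := by
  rw [hSerB, map_mul, map_par_tSeries, PowerSeries.map_C]
  simp [par_kB]

theorem par_gSerB (n : ℕ) : par (B q) (PowerSeries.coeff n (gSerB q)) =
    -PowerSeries.coeff n (gSerB q) := by
  rw [gSerB, PowerSeries.coeff_C_mul, tSeries, PowerSeries.coeff_mk, map_mul, par_kB, par_tB]
  simp

theorem map_par_cSerB : PowerSeries.map (par (B q) : B q →+* B q) (cSerB q) = cSerB q := by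
  change PowerSeries.map _ (PowerSeries.C _ * (tInv q * (tSeries q 1 1 +
      tSeries q 1 0 * tInv q * tSeries q 0 1))) =
    PowerSeries.C _ * (tInv q * (tSeries q 1 1 + tSeries q 1 0 * tInv q * tSeries q 0 1))
  rw [map_mul, map_mul, map_add, map_mul, map_mul, map_par_tInv, map_par_tSeries, map_par_tSeries,
    map_par_tSeries, PowerSeries.map_C]
  simp [par_phiMinus₀_inv]

theorem par_cSerB (n : ℕ) : par (B q) (PowerSeries.coeff n (cSerB q)) =
    PowerSeries.coeff n (cSerB q) := by
  have := congrArg (PowerSeries.coeff n) (map_par_cSerB q)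
  rwa [PowerSeries.coeff_map] at this

theorem par_hSerB (n : ℕ) : par (B q) (PowerSeries.coeff n (hSerB q)) =
    PowerSeries.coeff n (hSerB q) := by
  have := congrArg (PowerSeries.coeff n) (map_par_hSerB q)
  rwa [PowerSeries.coeff_map] at this

theorem par_eltMinus (c : Idx) : par (B q) (Idx.eltMinus q c) =
    (-1 : ℂ) ^ c.par • Idx.eltMinus q c := by
  rcases c with s | s | s | n
  · rw [eltMinus_F, map_neg, par_eSerB, Idx.par]
    simp
  · rw [eltMinus_h, map_smul, ← logCoeff_map, map_par_cSerB, Idx.par, pow_zero, one_smul]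
  · rw [eltMinus_C, map_smul, ← logCoeff_map, map_par_hSerB, Idx.par, pow_zero, one_smul]
  · rw [eltMinus_E, par_fSerB, Idx.par]
    simp

end Parity

/-! ### The characters of the group-like elements -/

section Characters

variable {q : ℂ} [hq : NeZero q]

/-- The character `φ(k, ·)` of `B`, for a group-like element `k` of `A`. -/
def grpChar (k : (A q)ˣ) (hk : k ∈ Subgroup.closure (Set.range (kA q))) : B q →ₐ[ℂ] ℂ :=
  AlgHom.ofLinearMap ((eps (B q)).toLinearMap ∘ₗ opAct q k)
    (by simp [opAct_grp_one hk]) (fun b b' => by simp [opAct_grp_mul hk])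

theorem grpChar_apply {k : (A q)ˣ} (hk : k ∈ Subgroup.closure (Set.range (kA q))) (b : B q) :
    grpChar k hk b = eps (B q) (opAct q k b) := rfl

/-- The group-like elements act diagonally on the matrix entries `t_{ij}(z)`. -/
theorem exists_opAct_grp_tB {k : (A q)ˣ} (hk : k ∈ Subgroup.closure (Set.range (kA q))) :
    ∃ ω : Fin 2 → ℂ, ∀ i j n, opAct q k (tB q i j n) = ω i • tB q i j n := by
  induction hk using Subgroup.closure_induction with
  | mem x hx =>
    obtain ⟨l, rfl⟩ := hx
    refine ⟨fun i => rCoeff q i i l l 0, fun i j n => ?_⟩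
    rw [← opB_diag_tB, ← opAct_sA]
    rfl
  | one => exact ⟨fun _ => 1, fun i j n => by simp⟩
  | mul x y _ _ hx hy =>
    obtain ⟨ω, hω⟩ := hx
    obtain ⟨ω', hω'⟩ := hy
    refine ⟨fun i => ω' i * ω i, fun i j n => ?_⟩
    rw [Units.val_mul, map_mul, Module.End.mul_apply, hω', map_smul, hω, smul_smul]
  | inv x _ hx =>
    obtain ⟨ω, hω⟩ := hx
    exact ⟨fun i => (ω i)⁻¹, fun i j n => opAct_inv_of_eq_smul (hω i j n)⟩

variable {k : (A q)ˣ} (hk : k ∈ Subgroup.closure (Set.range (kA q)))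

theorem exists_map_grpChar_tSeries : ∃ ω : Fin 2 → ℂ, ∀ i j,
    PowerSeries.map (grpChar k hk : B q →+* ℂ) (tSeries q i j) =
      if i = j then PowerSeries.C (ω i) else 0 := by
  obtain ⟨ω, hω⟩ := exists_opAct_grp_tB hk
  refine ⟨ω, fun i j => ?_⟩
  ext n
  rw [PowerSeries.coeff_map, tSeries, PowerSeries.coeff_mk]
  change grpChar k hk (tB q i j n) = _
  rw [grpChar_apply, hω, map_smul, eps_tB]
  by_cases hij : i = j <;> by_cases hn : n = 0 <;> simp [hij, hn, PowerSeries.coeff_C]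

theorem exists_map_grpChar_tInv : ∃ ω : ℂ,
    PowerSeries.map (grpChar k hk : B q →+* ℂ) (tInv q) = PowerSeries.C ω := by
  obtain ⟨ω, hω⟩ := exists_map_grpChar_tSeries hk
  have h := congrArg (PowerSeries.map (grpChar k hk : B q →+* ℂ)) (t_mul_tInv q)
  rw [map_mul, hω, if_pos rfl, map_one] at h
  have h0 := congrArg PowerSeries.constantCoeff h
  rw [map_mul, PowerSeries.constantCoeff_C, map_one] at h0
  refine ⟨(ω 0)⁻¹, ?_⟩
  have h1 : PowerSeries.C (ω 0)⁻¹ * (PowerSeries.C (ω 0) : ℂ⟦X⟧) = 1 := by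
    rw [← map_mul, inv_mul_cancel₀ (left_ne_zero_of_mul_eq_one h0), map_one]
  exact (left_inv_eq_right_inv h1 h).symm

theorem eq_one_of_map_eq_C {f : (B q)⟦X⟧} (hf : PowerSeries.constantCoeff f = 1) {ψ : B q →ₐ[ℂ] ℂ}
    {ω : ℂ} (h : PowerSeries.map (ψ : B q →+* ℂ) f = PowerSeries.C ω) :
    PowerSeries.map (ψ : B q →+* ℂ) f = 1 := by
  have h0 := congrArg (PowerSeries.coeff 0) h
  rw [PowerSeries.coeff_map, PowerSeries.coeff_zero_eq_constantCoeff_apply, hf, map_one,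
    PowerSeries.coeff_zero_eq_constantCoeff_apply, PowerSeries.constantCoeff_C] at h0
  rw [h, ← h0, map_one]

theorem map_grpChar_hSerB : PowerSeries.map (grpChar k hk : B q →+* ℂ) (hSerB q) = 1 := by
  obtain ⟨ω, hω⟩ := exists_map_grpChar_tSeries hk
  refine eq_one_of_map_eq_C (ω := grpChar k hk (kB q 0) * ω 0) (constantCoeff_hSerB q) ?_
  rw [hSerB, map_mul, hω, if_pos rfl, PowerSeries.map_C, map_mul]
  rfl

theorem map_grpChar_cSerB : PowerSeries.map (grpChar k hk : B q →+* ℂ) (cSerB q) = 1 := by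
  obtain ⟨ω, hω⟩ := exists_map_grpChar_tSeries hk
  obtain ⟨ω', hω'⟩ := exists_map_grpChar_tInv hk
  refine eq_one_of_map_eq_C (ω := grpChar k hk (((phiMinus₀ q)⁻¹ : (B q)ˣ) : B q) * (ω' * ω 1))
    (constantCoeff_cSerB q) ?_
  change PowerSeries.map _ (PowerSeries.C _ * (tInv q * (tSeries q 1 1 +
      tSeries q 1 0 * tInv q * tSeries q 0 1))) = _
  rw [map_mul, map_mul, map_add, map_mul, map_mul, hω', hω, hω, hω, if_pos rfl, if_neg one_ne_zero,
    zero_mul, zero_mul, add_zero, PowerSeries.map_C, map_mul, map_mul]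
  rfl

theorem grpChar_eSerB (n : ℕ) : grpChar k hk (PowerSeries.coeff n (eSerB q)) = 0 := by
  obtain ⟨ω, hω⟩ := exists_map_grpChar_tSeries hk
  have h : PowerSeries.map (grpChar k hk : B q →+* ℂ) (eSerB q) = 0 := by
    change PowerSeries.map _ (PowerSeries.C _ * (tInv q * tSeries q 0 1)) = 0
    rw [map_mul, map_mul, hω, if_neg zero_ne_one, mul_zero, mul_zero]
  have := congrArg (PowerSeries.coeff n) h
  rwa [PowerSeries.coeff_map, map_zero] at this

theorem grpChar_fSerB (n : ℕ) : grpChar k hk (PowerSeries.coeff n (fSerB q)) = 0 := by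
  obtain ⟨ω, hω⟩ := exists_map_grpChar_tSeries hk
  have h : PowerSeries.map (grpChar k hk : B q →+* ℂ) (fSerB q) = 0 := by
    change PowerSeries.map _ (tSeries q 1 0 * tInv q) = 0
    rw [map_mul, hω, if_neg one_ne_zero, zero_mul]
  have := congrArg (PowerSeries.coeff n) h
  rwa [PowerSeries.coeff_map, map_zero] at this

theorem grpChar_gSerB (n : ℕ) : grpChar k hk (PowerSeries.coeff n (gSerB q)) = 0 := by
  obtain ⟨ω, hω⟩ := exists_map_grpChar_tSeries hk
  have h : PowerSeries.map (grpChar k hk : B q →+* ℂ) (gSerB q) = 0 := by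
    rw [gSerB, map_mul, hω, if_neg one_ne_zero, mul_zero]
  have := congrArg (PowerSeries.coeff n) h
  rwa [PowerSeries.coeff_map, map_zero] at this

theorem grpChar_cSerB {n : ℕ} (hn : n ≠ 0) : grpChar k hk (PowerSeries.coeff n (cSerB q)) = 0 := by
  have := congrArg (PowerSeries.coeff n) (map_grpChar_cSerB hk)
  rwa [PowerSeries.coeff_map, PowerSeries.coeff_one, if_neg hn] at this

theorem logCoeff_one {R : Type*} [Ring R] [Algebra ℂ R] (n : ℕ) : logCoeff (1 : R⟦X⟧) n = 0 := by
  refine Finset.sum_eq_zero fun k hk => ?_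
  rw [sub_self, zero_pow (by have := (Finset.mem_Icc.1 hk).1; omega), map_zero, smul_zero]

/-- The characters `φ(k, ·)` annihilate all `b⁻`. -/
theorem grpChar_eltMinus (c : Idx) : grpChar k hk (Idx.eltMinus q c) = 0 := by
  rcases c with s | s | s | n
  · rw [eltMinus_F, map_neg, grpChar_eSerB, neg_zero]
  · rw [eltMinus_h, map_smul, ← logCoeff_map, map_grpChar_cSerB, logCoeff_one, smul_zero]
  · rw [eltMinus_C, map_smul, ← logCoeff_map, map_grpChar_hSerB, logCoeff_one, smul_zero]
  · rw [eltMinus_E, grpChar_fSerB]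

end Characters

/-! ### The subalgebra fixed by `φ⁺(z)` -/

section Fixed

variable {q : ℂ} [hq : NeZero q]

theorem orderedProd_mem {R : Type*} [Monoid R] (x : Idx → R) (N : Submonoid R) {g : Idx →₀ ℕ}
    (hg : ∀ c ∈ g.support, x c ∈ N) : orderedProd x g ∈ N := by
  refine N.list_prod_mem fun y hy => ?_
  obtain ⟨c, hc, rfl⟩ := List.mem_map.1 hy
  exact pow_mem (hg c ((Finset.mem_sort _).1 hc)) _

variable (hq' : ∀ n : ℕ, 0 < n → q ^ n ≠ 1)

/-- The elements of `B` fixed by `φ⁺(z)` and `φ₀⁺`. -/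
def phiFixed (hq' : ∀ n : ℕ, 0 < n → q ^ n ≠ 1) : Subalgebra ℂ (B q) where
  carrier := {v | (∀ n, opAct q (PowerSeries.coeff n (cSer q)) v = if n = 0 then v else 0) ∧
    opAct q (((phiPlus₀ q)⁻¹ : (A q)ˣ) : A q) v = v}
  add_mem' := by
    rintro v v' ⟨h1, h2⟩ ⟨h1', h2'⟩
    refine ⟨fun n => ?_, by rw [map_add, h2, h2']⟩
    rw [map_add, h1, h1']
    split_ifs <;> simp
  mul_mem' := by
    rintro v v' ⟨h1, h2⟩ ⟨h1', h2'⟩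
    refine ⟨fun n => ?_, by rw [opAct_grp_mul (inv_mem phiPlus₀_mem), h2, h2']⟩
    rw [opC_mul hq']
    simp only [h1, h1']
    by_cases hn : n = 0
    · subst hn; simp
    · rw [if_neg hn]
      refine Finset.sum_eq_zero fun p hp => ?_
      have hp' : p.1 + p.2 = n := by simpa using hp
      by_cases h : p.1 = 0
      · rw [if_neg (by omega : ¬p.2 = 0), mul_zero]
      · rw [if_neg h, zero_mul]
  algebraMap_mem' r := by
    refine ⟨fun n => ?_, ?_⟩
    · rw [Algebra.algebraMap_eq_smul_one, map_smul, opC_one hq']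
      split_ifs <;> simp
    · rw [Algebra.algebraMap_eq_smul_one, map_smul, opAct_grp_one (inv_mem phiPlus₀_mem)]

theorem fSerB_mem_phiFixed (n : ℕ) : PowerSeries.coeff n (fSerB q) ∈ phiFixed hq' :=
  ⟨fun m => cSer_fSerB hq' m n, phiPlus₀_inv_fix hq' (gaussPhi_fSerB hq') n⟩

theorem eSerB_mem_phiFixed (n : ℕ) : PowerSeries.coeff n (eSerB q) ∈ phiFixed hq' :=
  ⟨fun m => cSer_eSerB hq' m n, phiPlus₀_inv_C_mul hq' (gaussPhi_gaussE hq') n⟩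

theorem cSerB_mem_phiFixed (n : ℕ) : PowerSeries.coeff n (cSerB q) ∈ phiFixed hq' :=
  ⟨fun m => cSer_cSerB hq' m n, phiPlus₀_inv_C_mul hq' (gaussPhi_gaussPhi hq') n⟩

include hq' in
theorem opPhi_of_mem {v : B q} (hv : v ∈ phiFixed hq') (n : ℕ) :
    opAct q (PowerSeries.coeff n (gaussPhi (sSeries q) (kA q 0))) v = if n = 0 then v else 0 := by
  have h1 := congrArg (opAct q (phiPlus₀ q : A q)) (hv.1 n)
  rw [opAct_cSer hq', opAct_apply_inv] at h1
  rw [h1]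
  have h2 := congrArg (opAct q (phiPlus₀ q : A q)) hv.2
  rw [opAct_apply_inv] at h2
  split_ifs
  · exact h2.symm
  · rw [map_zero]

end Fixed

/-! ### The order on the basis -/

section Order

theorem Idx.le_iff_key (c c' : Idx) : c ≤ c' ↔ c.key ≤ c'.key := Iff.rfl

theorem Idx.exists_eq_E_of_le {n : ℕ} {c : Idx} (h : .E n ≤ c) : ∃ m, c = .E m := by
  rw [Idx.le_iff_key] at h
  rcases c with s | s | s | m
  · simp [Idx.key, Prod.Lex.toLex_le_toLex] at h
  · simp [Idx.key, Prod.Lex.toLex_le_toLex] at h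
  · simp [Idx.key, Prod.Lex.toLex_le_toLex] at h
  · exact ⟨m, rfl⟩

theorem Idx.exists_eq_F_of_le {s : ℕ+} {c : Idx} (h : c ≤ .F s) : ∃ m, c = .F m := by
  rw [Idx.le_iff_key] at h
  rcases c with m | m | m | m
  · exact ⟨m, rfl⟩
  · simp [Idx.key, Prod.Lex.toLex_le_toLex] at h
  · simp [Idx.key, Prod.Lex.toLex_le_toLex] at h
  · simp [Idx.key, Prod.Lex.toLex_le_toLex] at h

theorem Idx.eq_F_or_h_of_le {s : ℕ+} {c : Idx} (h : c ≤ .h s) :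
    (∃ m, c = .F m) ∨ ∃ m, c = .h m := by
  rw [Idx.le_iff_key] at h
  rcases c with m | m | m | m
  · exact Or.inl ⟨m, rfl⟩
  · exact Or.inr ⟨m, rfl⟩
  · simp [Idx.key, Prod.Lex.toLex_le_toLex] at h
  · simp [Idx.key, Prod.Lex.toLex_le_toLex] at h

/-- An ordered product with a factor `x c` ends in a factor `x c'` with `c ≤ c'`. -/
theorem exists_orderedProd_eq {R : Type*} [Monoid R] (x : Idx → R) {g : Idx →₀ ℕ} {c : Idx}
    (hc : c ∈ g.support) : ∃ c', c ≤ c' ∧ c' ∈ g.support ∧ ∃ y, orderedProd x g = y * x c' := by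
  have hne : g.support.Nonempty := ⟨c, hc⟩
  refine ⟨g.support.max' hne, Finset.le_max' _ _ hc, Finset.max'_mem _ _,
    orderedProd x (g - Finsupp.single (g.support.max' hne) 1), ?_⟩
  have h : g - Finsupp.single (g.support.max' hne) 1 + Finsupp.single (g.support.max' hne) 1 = g :=
    tsub_add_cancel_of_le (by
      rw [Finsupp.single_le_iff]
      exact Nat.one_le_iff_ne_zero.2 (Finsupp.mem_support_iff.1 (Finset.max'_mem _ _)))
  conv_lhs => rw [← h]
  refine orderedProd_add_single_one x fun c hc => Finset.le_max' _ _ ?_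
  rw [Finsupp.mem_support_iff] at hc ⊢
  intro h0
  apply hc
  simp [h0]

end Order

/-! ### Recurrences for the ordered monomials -/

section Recurrence

variable {q : ℂ} [hq : NeZero q] (hq' : ∀ n : ℕ, 0 < n → q ^ n ≠ 1)
include hq'

theorem ePos_eltMinus (n : ℕ) (c : Idx) : opAct q (ePos q n) (Idx.eltMinus q c) =
    (if c = .E n then pairing q (Idx.elt q (.E n)) (Idx.eltMinus q (.E n)) else 0) • (1 : B q) := by
  obtain ⟨d, hd⟩ := exists_ePos_eltMinus hq' n
  have h : pairing q (Idx.elt q (.E n)) (Idx.eltMinus q (.E n)) = d := by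
    rw [pairing_apply, Idx.elt, hd, if_pos rfl, map_smul, map_one, smul_eq_mul, mul_one]
  rw [h, hd]

theorem cPos_eltMinus (s : ℕ+) (c : Idx) : opAct q (cPos q s) (Idx.eltMinus q c) =
    (if c = .C s then pairing q (Idx.elt q (.C s)) (Idx.eltMinus q (.C s)) else 0) • (1 : B q) := by
  obtain ⟨d, hd⟩ := exists_cPos_eltMinus hq' s
  have h : pairing q (Idx.elt q (.C s)) (Idx.eltMinus q (.C s)) = d := by
    rw [pairing_apply, Idx.elt, hd, if_pos rfl, map_smul, map_one, smul_eq_mul, mul_one]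
  rw [h, hd]

theorem hPos_eltMinus (s : ℕ+) {c : Idx} (hc : ∀ n, c ≠ .E n) :
    opAct q (hPos q s) (Idx.eltMinus q c) =
      (if c = .h s then pairing q (Idx.elt q (.h s)) (Idx.eltMinus q (.h s)) else 0) •
        (1 : B q) := by
  obtain ⟨d, hd⟩ := exists_hPos_eltMinus hq' s
  have h : pairing q (Idx.elt q (.h s)) (Idx.eltMinus q (.h s)) = d := by
    rw [pairing_apply, Idx.elt, hd _ (by simp), if_pos rfl, map_smul, map_one, smul_eq_mul, mul_one]
  rw [h, hd c hc]

/-- `E_n` acts on the ordered monomials by a superderivation: it annihilates the factors before the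
`F_{-m}`, and the factors after an `F_{-m}` are of the same kind and thus fixed by `φ⁺(z)`. -/
theorem ePos_monF (n : ℕ) (g : Idx →₀ ℕ) (hg : g (.E n) ≤ 1) : opAct q (ePos q n) (monF q g) =
    ((-1 : ℂ) ^ (1 * oddBefore (.E n) g) * g (.E n) *
      pairing q (Idx.elt q (.E n)) (Idx.eltMinus q (.E n))) • monF q (g -
        Finsupp.single (.E n) 1) := by
  have h := skewDerivation_orderedProd (Idx.eltMinus q) (opAct q (ePos q n)) ⊥ 1 (.E n)
    (pairing q (Idx.elt q (.E n)) (Idx.eltMinus q (.E n))) Set.univ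
    (by simp) (by simp [opE_one hq']) ?_ g (fun _ _ => Set.mem_univ _) (Or.inl hg)
  · exact sub_eq_zero.1 ((Submodule.mem_bot ℂ).1 h)
  · intro c _ v hv
    rw [Submodule.mem_bot, sub_eq_zero, opE_mul hq', par_eltMinus, one_mul, smul_mul_assoc]
    congr 1
    by_cases hc : ∃ m, c = .E m
    · obtain ⟨m, rfl⟩ := hc
      have hv' : orderedProd (Idx.eltMinus q) v ∈ phiFixed hq' := by
        refine orderedProd_mem _ (phiFixed hq').toSubmonoid fun c hc => ?_
        obtain ⟨l, rfl⟩ := Idx.exists_eq_E_of_le (hv c hc).1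
        exact fSerB_mem_phiFixed hq' l
      simp only [opPhi_of_mem hq' hv']
      rw [Finset.sum_eq_single (n, 0)]
      · rw [if_pos rfl, ePos_eltMinus hq', smul_one_mul]
      · rintro ⟨a, b⟩ hp hne
        have hp' : a + b = n := by simpa using hp
        rw [if_neg, mul_zero]
        rintro rfl
        exact hne (by rw [← hp', add_zero])
      · simp
    · push Not at hc
      rw [if_neg (hc n), zero_smul]
      refine Finset.sum_eq_zero fun p _ => ?_
      rw [ePos_eltMinus hq', if_neg (hc _), zero_smul, zero_mul]

/-- `C_s` acts on the ordered monomials by a derivation. The vanishing exponent keeps the shape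
common to all four recurrences. -/
theorem cPos_monF (s : ℕ+) (g : Idx →₀ ℕ) : opAct q (cPos q s) (monF q g) =
    ((-1 : ℂ) ^ (0 * oddBefore (.C s) g) * g (.C s) *
      pairing q (Idx.elt q (.C s)) (Idx.eltMinus q (.C s))) • monF q (g -
        Finsupp.single (.C s) 1) := by
  have h := skewDerivation_orderedProd (Idx.eltMinus q) (opAct q (cPos q s)) ⊥ 0 (.C s)
    (pairing q (Idx.elt q (.C s)) (Idx.eltMinus q (.C s))) Set.univ
    (by simp) ?_ ?_ g (fun _ _ => Set.mem_univ _) (Or.inr (by simp))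
  · exact sub_eq_zero.1 ((Submodule.mem_bot ℂ).1 h)
  · have h1 := cPos_mul hq' s 1 1
    rw [mul_one, mul_one, one_mul, left_eq_add] at h1
    rw [h1]
    exact zero_mem _
  · intro c _ v hv
    rw [Submodule.mem_bot, sub_eq_zero, cPos_mul hq', cPos_eltMinus hq', zero_mul, pow_zero,
      one_smul,
      smul_one_mul, add_comm]

/-- `h_s` acts by a derivation on the ordered monomials without factors `F_{-n}`. -/
theorem hPos_monF (s : ℕ+) (g : Idx →₀ ℕ) (hg : ∀ c ∈ g.support, ∀ n, c ≠ .E n) :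
    opAct q (hPos q s) (monF q g) =
    ((-1 : ℂ) ^ (0 * oddBefore (.h s) g) * g (.h s) *
      pairing q (Idx.elt q (.h s)) (Idx.eltMinus q (.h s))) • monF q (g -
        Finsupp.single (.h s) 1) := by
  have h := skewDerivation_orderedProd (Idx.eltMinus q) (opAct q (hPos q s)) ⊥ 0 (.h s)
    (pairing q (Idx.elt q (.h s)) (Idx.eltMinus q (.h s))) {c | ∀ n, c ≠ .E n}
    (by simp) ?_ ?_ g hg (Or.inr (by simp))
  · exact sub_eq_zero.1 ((Submodule.mem_bot ℂ).1 h)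
  · have h1 := hPos_mul hq' s (one_mem (borelB q)) (one_mem (borelB q))
    rw [mul_one, mul_one, one_mul, left_eq_add] at h1
    rw [h1]
    exact zero_mem _
  · intro c hc v hv
    have hv' : orderedProd (Idx.eltMinus q) v ∈ borelB q :=
      orderedProd_mem _ (borelB q).toSubmonoid fun c hc => eltMinus_mem_borelB (hv c hc).2
    rw [Submodule.mem_bot, sub_eq_zero, hPos_mul hq' s (eltMinus_mem_borelB hc) hv',
      hPos_eltMinus hq' s hc, zero_mul, pow_zero, one_smul, smul_one_mul, add_comm]

end Recurrence

/-! ### Invariant subspaces -/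

section Stable

variable {q : ℂ} [hq : NeZero q]

/-- The elements of `A` whose action preserves a subspace of `B`. -/
def stabilizer (M : Submodule ℂ (B q)) : Subalgebra ℂ (A q) where
  carrier := {a | ∀ v ∈ M, opAct q a v ∈ M}
  mul_mem' {a a'} h h' v hv := by
    rw [map_mul, Module.End.mul_apply]
    exact h _ (h' v hv)
  add_mem' {a a'} h h' v hv := by
    rw [map_add, LinearMap.add_apply]
    exact add_mem (h v hv) (h' v hv)
  algebraMap_mem' r v hv := by
    rw [AlgHom.commutes, Module.algebraMap_end_apply]
    exact M.smul_mem r hv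

theorem mem_stabilizer_span {S : Set (B q)} {a : A q}
    (h : ∀ x ∈ S, opAct q a x ∈ Submodule.span ℂ S) : a ∈ stabilizer (Submodule.span ℂ S) :=
  fun _ hv => (Submodule.span_le (p := (Submodule.span ℂ S).comap (opAct q a))).2 h hv

variable (q) in
/-- The left ideal of `B` generated by the `F_{-n}`. -/
def fIdeal : Submodule ℂ (B q) :=
    Submodule.span ℂ {x | ∃ b n, x = b * PowerSeries.coeff n (fSerB q)}

theorem mul_fSerB_mem_fIdeal (b : B q) (n : ℕ) : b * PowerSeries.coeff n (fSerB q) ∈ fIdeal q :=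
  Submodule.subset_span ⟨b, n, rfl⟩

theorem coeff_smul_mem (M : Submodule ℂ (B q)) {w : (B q)⟦X⟧⟦X⟧}
    (hw : ∀ m n, PowerSeries.coeff n (PowerSeries.coeff m w) ∈ M) (c : ℂ⟦X⟧⟦X⟧) (m n : ℕ) :
    PowerSeries.coeff n (PowerSeries.coeff m (c • w)) ∈ M := by
  rw [series_smul_def, PowerSeries.coeff_mul, map_sum]
  refine sum_mem fun p _ => ?_
  rw [PowerSeries.coeff_mul]
  refine sum_mem fun r _ => ?_
  rw [PowerSeries.coeff_map, PowerSeries.coeff_map, ← Algebra.smul_def]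
  exact M.smul_mem _ (hw _ _)

/-- A left ideal is annihilated by the characters `φ(k, ·)` if its generators are. -/
theorem grpChar_span {k : (A q)ˣ} (hk : k ∈ Subgroup.closure (Set.range (kA q))) {S : Set (B q)}
    (h : ∀ x ∈ S, grpChar k hk x = 0) {v : B q} (hv : v ∈ Submodule.span ℂ S) :
    grpChar k hk v = 0 :=
  (Submodule.span_le (p := LinearMap.ker (grpChar k hk).toLinearMap)).2 h hv

theorem grpChar_fIdeal {k : (A q)ˣ} (hk : k ∈ Subgroup.closure (Set.range (kA q))) {v : B q}
    (hv : v ∈ fIdeal q) : grpChar k hk v = 0 := by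
  refine grpChar_span hk ?_ hv
  rintro _ ⟨b, n, rfl⟩
  rw [map_mul, grpChar_fSerB, mul_zero]

variable (hq' : ∀ n : ℕ, 0 < n → q ^ n ≠ 1)
include hq'

theorem actS_gaussF : actSer q (sSeries q 0 0) (PowerSeries.C (gaussF (tSeries q) (kB q 0)⁻¹)) =
    diagScalar (rSeries q 1 1 1 1 * betaInv q) •
      PowerSeries.C (gaussF (tSeries q) (kB q 0)⁻¹) := by
  have h := (gaussAction q hq').S_f (hasTable q) (gaussLeibniz hq') (gaussInverse hq')
  rw [C_gaussF_t, RingHom.map_mul diagScalar]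
  exact h

theorem actS_mul_fSerB (b : B q) : actSer q (sSeries q 0 0) (const₂ b * PowerSeries.C (fSerB q)) =
    diagScalar (rSeries q 1 1 1 1 * betaInv q) •
      (actSer q (sSeries q 0 0) (const₂ b) * PowerSeries.C (fSerB q)) :=
  (gaussAction q hq').S_mul_of_F_eq_zero (actS_gaussF hq') (actF_gaussF hq') (const₂ b)

/-- The left ideal generated by the `F_{-n}` is stable under `s₁₁(z)`, because `F⁺(z)` annihilates
the `F_{-n}`. -/
theorem sA_mem_stabilizer (m : ℕ) : sA q 0 0 m ∈ stabilizer (fIdeal q) := by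
  refine mem_stabilizer_span ?_
  rintro _ ⟨b, n, rfl⟩
  have h := congrArg (fun v => PowerSeries.coeff n (PowerSeries.coeff m v)) (actS_mul_fSerB hq' b)
  have e : const₂ b * PowerSeries.C (fSerB q) = PowerSeries.C (PowerSeries.C b * fSerB q) := by
    rw [map_mul, const₂]
  simp only [e, coeff_actSer_C, PowerSeries.coeff_C_mul] at h
  rw [sSeries, PowerSeries.coeff_mk] at h
  rw [h]
  refine coeff_smul_mem _ (fun i j => ?_) _ m n
  rw [PowerSeries.coeff_mul_C, PowerSeries.coeff_mul]
  exact sum_mem fun p _ => mul_fSerB_mem_fIdeal _ _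

theorem kA_inv_mem_stabilizer : (((kA q 0)⁻¹ : (A q)ˣ) : A q) ∈ stabilizer (fIdeal q) := by
  refine mem_stabilizer_span ?_
  rintro _ ⟨b, n, rfl⟩
  have h : ActsDiag (sSeries q 0 0) (fSerB q) (fSerB q) (rSeries q 1 1 1 1 * betaInv q) :=
    opAct_of_eq_diag (actS_gaussF hq')
  have h0 := h 0 n
  rw [PowerSeries.coeff_zero_eq_constantCoeff_apply, constantCoeff_sSeries, if_pos (Nat.zero_le n),
    Nat.sub_zero] at h0
  rw [opAct_grp_mul (inv_mem (Subgroup.subset_closure ⟨0, rfl⟩)), opAct_inv_of_eq_smul h0,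
    mul_smul_comm]
  exact Submodule.smul_mem _ _ (mul_fSerB_mem_fIdeal _ _)

theorem hPos_mem_stabilizer (s : ℕ) : hPos q s ∈ stabilizer (fIdeal q) := by
  refine (stabilizer (fIdeal q)).smul_mem (logCoeff_mem _ (fun n => ?_) s) _
  rw [← hSer, coeff_hSer]
  exact mul_mem (kA_inv_mem_stabilizer hq') (sA_mem_stabilizer hq' n)

theorem fSer_mem_stabilizer (n : ℕ) : PowerSeries.coeff n (fSer q) ∈ stabilizer (fIdeal q) := by
  refine mem_stabilizer_span ?_
  rintro _ ⟨b, m, rfl⟩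
  rw [opFn_mul hq' n b (fSerB_mem_phiFixed hq' m).2]
  simp only [fSer_fSerB hq' _ m, mul_zero, Finset.sum_const_zero, add_zero]
  exact mul_fSerB_mem_fIdeal _ _

omit hq' hq in
theorem elt_F (s : ℕ+) : Idx.elt q (.F s) = -PowerSeries.coeff s (fSer q) := by
  rw [fSer, PowerSeries.coeff_C_mul, Idx.elt, fPos, mul_neg]

omit hq' in
/-- An ordered monomial with a factor `F_{-n}` ends in such a factor. -/
theorem monF_mem_fIdeal {g : Idx →₀ ℕ} {n : ℕ} (hg : .E n ∈ g.support) : monF q g ∈ fIdeal q := by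
  obtain ⟨c, hc, -, y, hy⟩ := exists_orderedProd_eq (Idx.eltMinus q) hg
  obtain ⟨m, rfl⟩ := Idx.exists_eq_E_of_le hc
  rw [monF, hy]
  exact mul_fSerB_mem_fIdeal _ _

end Stable

section Lower

variable {q : ℂ} [hq : NeZero q]

variable (q) in
/-- The subalgebra generated by the coefficients of `s₁₁⁽⁰⁾ K₁⁻`, `s₁₁⁽⁰⁾ t₂₁`, `(φ₀⁻)⁻¹ φ⁻`, `F⁻`.
It contains all `b⁻` except the `(φ₀⁻)⁻¹ E_{-s}`; the `s₁₁⁽⁰⁾ t₂₁` are needed for stability under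
`F⁺`. -/
def lowerB : Subalgebra ℂ (B q) :=
  Algebra.adjoin ℂ {b | ∃ n, b = PowerSeries.coeff n (hSerB q) ∨ b = PowerSeries.coeff n (gSerB q) ∨
    b = PowerSeries.coeff n (cSerB q) ∨ b = PowerSeries.coeff n (fSerB q)}

theorem hSerB_mem_lowerB (n : ℕ) : PowerSeries.coeff n (hSerB q) ∈ lowerB q :=
  Algebra.subset_adjoin ⟨n, Or.inl rfl⟩

theorem gSerB_mem_lowerB (n : ℕ) : PowerSeries.coeff n (gSerB q) ∈ lowerB q :=
  Algebra.subset_adjoin ⟨n, Or.inr (Or.inl rfl)⟩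

theorem cSerB_mem_lowerB (n : ℕ) : PowerSeries.coeff n (cSerB q) ∈ lowerB q :=
  Algebra.subset_adjoin ⟨n, Or.inr (Or.inr (Or.inl rfl))⟩

theorem fSerB_mem_lowerB (n : ℕ) : PowerSeries.coeff n (fSerB q) ∈ lowerB q :=
  Algebra.subset_adjoin ⟨n, Or.inr (Or.inr (Or.inr rfl))⟩

theorem eltMinus_mem_lowerB {c : Idx} (hc : ∀ s, c ≠ .F s) : Idx.eltMinus q c ∈ lowerB q := by
  rcases c with s | s | s | n
  · exact absurd rfl (hc s)
  · exact (lowerB q).smul_mem (logCoeff_mem _ cSerB_mem_lowerB _) _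
  · exact (lowerB q).smul_mem (logCoeff_mem _ hSerB_mem_lowerB _) _
  · exact fSerB_mem_lowerB n

theorem par_lowerB {y : B q} (hy : y ∈ lowerB q) : par (B q) y ∈ lowerB q := by
  induction hy using Algebra.adjoin_induction with
  | mem x hx =>
    obtain ⟨m, rfl | rfl | rfl | rfl⟩ := hx
    · rw [par_hSerB]; exact hSerB_mem_lowerB m
    · rw [par_gSerB]; exact neg_mem (gSerB_mem_lowerB m)
    · rw [par_cSerB]; exact cSerB_mem_lowerB m
    · rw [par_fSerB]; exact neg_mem (fSerB_mem_lowerB m)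
  | algebraMap r => rw [AlgHom.commutes]; exact (lowerB q).algebraMap_mem r
  | add x y _ _ hx hy => rw [map_add]; exact add_mem hx hy
  | mul x y _ _ hx hy => rw [map_mul]; exact mul_mem hx hy

/-- The left ideal generated by the elements of `lowerB` annihilated by the character `φ(k, ·)`. -/
def lowerIdeal (k : (A q)ˣ) (hk : k ∈ Subgroup.closure (Set.range (kA q))) : Submodule ℂ (B q) :=
  Submodule.span ℂ {x | ∃ b y, y ∈ lowerB q ∧ grpChar k hk y = 0 ∧ x = b * y}

variable {k : (A q)ˣ} (hk : k ∈ Subgroup.closure (Set.range (kA q)))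

theorem mul_mem_lowerIdeal (b : B q) {y : B q} (hy : y ∈ lowerB q) (h : grpChar k hk y = 0) :
    b * y ∈ lowerIdeal k hk := Submodule.subset_span ⟨b, y, hy, h, rfl⟩

theorem grpChar_lowerIdeal {v : B q} (hv : v ∈ lowerIdeal k hk) : grpChar k hk v = 0 := by
  refine grpChar_span hk ?_ hv
  rintro _ ⟨b, y, -, hy, rfl⟩
  rw [map_mul, hy, mul_zero]

/-- An ordered monomial with a factor other than the `(φ₀⁻)⁻¹ E_{-s}` ends in such a factor. -/
theorem monF_mem_lowerIdeal {g : Idx →₀ ℕ} {c : Idx} (hc : c ∈ g.support) (hcF : ∀ s, c ≠ .F s) :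
    monF q g ∈ lowerIdeal k hk := by
  obtain ⟨c', hc', -, y, hy⟩ := exists_orderedProd_eq (Idx.eltMinus q) hc
  rw [monF, hy]
  refine mul_mem_lowerIdeal hk _ (eltMinus_mem_lowerB fun s hs => ?_) (grpChar_eltMinus hk c')
  obtain ⟨m, hm⟩ := Idx.exists_eq_F_of_le (hs ▸ hc')
  exact hcF m hm

variable (hq' : ∀ n : ℕ, 0 < n → q ^ n ≠ 1)
include hq'

theorem phiPlus₀_inv_lowerB {y : B q} (hy : y ∈ lowerB q) :
    opAct q (((phiPlus₀ q)⁻¹ : (A q)ˣ) : A q) y = y := by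
  induction hy using Algebra.adjoin_induction with
  | mem x hx =>
    obtain ⟨m, rfl | rfl | rfl | rfl⟩ := hx
    · rw [hSerB, PowerSeries.coeff_C_mul, tSeries, PowerSeries.coeff_mk, phiPlus₀_inv_kB_mul_tB hq']
    · rw [gSerB, PowerSeries.coeff_C_mul, tSeries, PowerSeries.coeff_mk, phiPlus₀_inv_kB_mul_tB hq']
    · exact (cSerB_mem_phiFixed hq' m).2
    · exact (fSerB_mem_phiFixed hq' m).2
  | algebraMap r =>
    rw [Algebra.algebraMap_eq_smul_one, map_smul, opAct_grp_one (inv_mem phiPlus₀_mem)]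
  | add x y _ _ hx hy => rw [map_add, hx, hy]
  | mul x y _ _ hx hy => rw [opAct_grp_mul (inv_mem phiPlus₀_mem), hx, hy]

theorem cSer_lowerB {y : B q} (hy : y ∈ lowerB q) (n : ℕ) :
    opAct q (PowerSeries.coeff n (cSer q)) y ∈ lowerB q := by
  have hite : ∀ {P : Prop} [Decidable P] {x : B q}, x ∈ lowerB q →
      (if P then x else 0) ∈ lowerB q := by
    intro P _ x hx
    split_ifs
    exacts [hx, zero_mem _]
  induction hy using Algebra.adjoin_induction generalizing n with
  | mem x hx =>
    obtain ⟨c, hc⟩ := exists_cSer_t hq'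
    obtain ⟨m, rfl | rfl | rfl | rfl⟩ := hx
    · exact (hc 0 n m).symm ▸ hite ((lowerB q).smul_mem (hSerB_mem_lowerB _) _)
    · exact (hc 1 n m).symm ▸ hite ((lowerB q).smul_mem (gSerB_mem_lowerB _) _)
    · exact (cSer_cSerB hq' n m).symm ▸ hite (cSerB_mem_lowerB _)
    · exact (cSer_fSerB hq' n m).symm ▸ hite (fSerB_mem_lowerB _)
  | algebraMap r =>
    rw [Algebra.algebraMap_eq_smul_one, map_smul, opC_one hq']
    exact (lowerB q).smul_mem (hite (one_mem _)) _
  | add x y _ _ hx hy => rw [map_add]; exact add_mem (hx n) (hy n)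
  | mul x y _ _ hx hy =>
    rw [opC_mul hq']
    exact sum_mem fun p _ => mul_mem (hx _) (hy _)

/-- The coefficients of `(φ₀⁺)⁻¹ F⁺` map `lowerB` to elements annihilated by the characters
`φ(k, ·)`. -/
theorem fSer_lowerB {y : B q} (hy : y ∈ lowerB q) (n : ℕ) :
    opAct q (PowerSeries.coeff n (fSer q)) y ∈ lowerB q ∧
      grpChar k hk (opAct q (PowerSeries.coeff n (fSer q)) y) = 0 := by
  induction hy using Algebra.adjoin_induction generalizing n with
  | mem x hx =>
    obtain ⟨m, rfl | rfl | rfl | rfl⟩ := hx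
    · obtain ⟨c, hc⟩ := exists_fSer_hSerB hq'
      rw [hc]
      split_ifs
      · exact ⟨(lowerB q).smul_mem (gSerB_mem_lowerB _) _,
          by rw [map_smul, grpChar_gSerB, smul_zero]⟩
      · exact ⟨zero_mem _, map_zero _⟩
    · rw [fSer_gSerB hq' n m]
      exact ⟨zero_mem _, map_zero _⟩
    · rw [fSer_cSerB hq' n m]
      exact ⟨zero_mem _, map_zero _⟩
    · rw [fSer_fSerB hq' n m]
      exact ⟨zero_mem _, map_zero _⟩
  | algebraMap r =>
    rw [Algebra.algebraMap_eq_smul_one, map_smul, opFn_one hq', smul_zero]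
    exact ⟨zero_mem _, map_zero _⟩
  | add x y _ _ hx hy =>
    rw [map_add, map_add, (hx n).2, (hy n).2, add_zero]
    exact ⟨add_mem (hx n).1 (hy n).1, rfl⟩
  | mul x y hx' hy' hx hy =>
    rw [opFn_mul hq' n x (phiPlus₀_inv_lowerB hq' hy')]
    constructor
    · exact add_mem (mul_mem (hx n).1 hy')
        (sum_mem fun p _ => mul_mem (cSer_lowerB hq' (par_lowerB hx') _) (hy _).1)
    · simp only [map_add, map_sum, map_mul, (hx n).2, (hy _).2, zero_mul, mul_zero,
        Finset.sum_const_zero, add_zero]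

theorem fSer_mem_stabilizer_lowerIdeal (n : ℕ) :
    PowerSeries.coeff n (fSer q) ∈ stabilizer (lowerIdeal k hk) := by
  refine mem_stabilizer_span ?_
  rintro _ ⟨b, y, hy, hy0, rfl⟩
  rw [opFn_mul hq' n b (phiPlus₀_inv_lowerB hq' hy)]
  exact add_mem (mul_mem_lowerIdeal hk _ hy hy0) (sum_mem fun p _ =>
    mul_mem_lowerIdeal hk _ (fSer_lowerB hk hq' hy _).1 (fSer_lowerB hk hq' hy _).2)

end Lower

section Upper

variable {q : ℂ} [hq : NeZero q]

variable (q) in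
/-- The subalgebra generated by the coefficients of `(φ₀⁻)⁻¹ E⁻` and `(φ₀⁻)⁻¹ φ⁻`. -/
def upperB : Subalgebra ℂ (B q) :=
  Algebra.adjoin ℂ {b | ∃ n, b = PowerSeries.coeff n (eSerB q) ∨ b = PowerSeries.coeff n (cSerB q)}

theorem eSerB_mem_upperB (n : ℕ) : PowerSeries.coeff n (eSerB q) ∈ upperB q :=
  Algebra.subset_adjoin ⟨n, Or.inl rfl⟩

theorem cSerB_mem_upperB (n : ℕ) : PowerSeries.coeff n (cSerB q) ∈ upperB q :=
  Algebra.subset_adjoin ⟨n, Or.inr rfl⟩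

theorem par_upperB {y : B q} (hy : y ∈ upperB q) : par (B q) y ∈ upperB q := by
  induction hy using Algebra.adjoin_induction with
  | mem x hx =>
    obtain ⟨m, rfl | rfl⟩ := hx
    · rw [par_eSerB]; exact neg_mem (eSerB_mem_upperB m)
    · rw [par_cSerB]; exact cSerB_mem_upperB m
  | algebraMap r => rw [AlgHom.commutes]; exact (upperB q).algebraMap_mem r
  | add x y _ _ hx hy => rw [map_add]; exact add_mem hx hy
  | mul x y _ _ hx hy => rw [map_mul]; exact mul_mem hx hy

variable (q) in
/-- The ideal of `upperB` generated by the higher coefficients of `(φ₀⁻)⁻¹ φ⁻`. -/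
def phiIdeal : Submodule ℂ (B q) :=
    Submodule.span ℂ {x | ∃ u ∈ upperB q, ∃ v ∈ upperB q, ∃ n, n ≠ 0 ∧
  x = u * PowerSeries.coeff n (cSerB q) * v}

theorem mem_phiIdeal {u v : B q} (hu : u ∈ upperB q) (hv : v ∈ upperB q) {n : ℕ} (hn : n ≠ 0) :
    u * PowerSeries.coeff n (cSerB q) * v ∈ phiIdeal q :=
  Submodule.subset_span ⟨u, hu, v, hv, n, hn, rfl⟩

theorem mul_mem_phiIdeal {u v : B q} (hu : u ∈ upperB q) (hv : v ∈ phiIdeal q) :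
    u * v ∈ phiIdeal q := by
  refine (Submodule.span_le (p := (phiIdeal q).comap (LinearMap.mulLeft ℂ u))).2 ?_ hv
  rintro _ ⟨u', hu', v', hv', n, hn, rfl⟩
  change u * (u' * _ * v') ∈ phiIdeal q
  rw [← mul_assoc, ← mul_assoc]
  exact mem_phiIdeal (mul_mem hu hu') hv' hn

theorem grpChar_phiIdeal {k : (A q)ˣ} (hk : k ∈ Subgroup.closure (Set.range (kA q))) {v : B q}
    (hv : v ∈ phiIdeal q) : grpChar k hk v = 0 := by
  refine grpChar_span hk ?_ hv
  rintro _ ⟨u, -, v, -, n, hn, rfl⟩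
  rw [map_mul, map_mul, grpChar_cSerB hk hn, mul_zero, zero_mul]

variable (hq' : ∀ n : ℕ, 0 < n → q ^ n ≠ 1)
include hq'

theorem upperB_le : upperB q ≤ phiFixed hq' := by
  refine Algebra.adjoin_le ?_
  rintro _ ⟨n, rfl | rfl⟩
  exacts [eSerB_mem_phiFixed hq' n, cSerB_mem_phiFixed hq' n]

/-- On `upperB` the coefficients of `(φ₀⁺)⁻¹ F⁺` act by superderivations. -/
theorem fSer_mul_of_mem {v v' : B q} (hv : v ∈ upperB q) (hv' : v' ∈ upperB q) (n : ℕ) :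
    opAct q (PowerSeries.coeff n (fSer q)) (v * v') =
      opAct q (PowerSeries.coeff n (fSer q)) v * v' +
      par (B q) v * opAct q (PowerSeries.coeff n (fSer q)) v' := by
  rw [opFn_mul hq' n v (upperB_le hq' hv').2]
  congr 1
  rw [Finset.sum_eq_single (0, n)]
  · rw [(upperB_le hq' (par_upperB hv)).1, if_pos rfl]
  · rintro ⟨a, b⟩ hp hne
    rw [(upperB_le hq' (par_upperB hv)).1, if_neg, zero_mul]
    rintro rfl
    exact hne (by simpa using hp)
  · simp

theorem fSer_upperB {v : B q} (hv : v ∈ upperB q) (n : ℕ) :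
    opAct q (PowerSeries.coeff n (fSer q)) v ∈ upperB q := by
  induction hv using Algebra.adjoin_induction with
  | mem x hx =>
    obtain ⟨m, rfl | rfl⟩ := hx
    · obtain ⟨c, hc⟩ := exists_fSer_eSerB hq'
      rw [hc]
      split_ifs
      exacts [(upperB q).smul_mem (cSerB_mem_upperB _) _, zero_mem _]
    · rw [fSer_cSerB hq' n m]
      exact zero_mem _
  | algebraMap r =>
    rw [Algebra.algebraMap_eq_smul_one, map_smul, opFn_one hq', smul_zero]
    exact zero_mem _
  | add x y _ _ hx hy => rw [map_add]; exact add_mem hx hy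
  | mul x y hx' hy' hx hy =>
    rw [fSer_mul_of_mem hq' hx' hy']
    exact add_mem (mul_mem hx hy') (mul_mem (par_upperB hx') hy)

theorem fSer_mem_stabilizer_phiIdeal (n : ℕ) :
    PowerSeries.coeff n (fSer q) ∈ stabilizer (phiIdeal q) := by
  refine mem_stabilizer_span ?_
  rintro _ ⟨u, hu, v, hv, m, hm, rfl⟩
  have hu' := mul_mem hu (cSerB_mem_upperB (q := q) m)
  rw [fSer_mul_of_mem hq' hu' hv, fSer_mul_of_mem hq' hu (cSerB_mem_upperB m), fSer_cSerB hq' n m,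
    mul_zero, add_zero, map_mul, par_cSerB]
  exact add_mem (mem_phiIdeal (fSer_upperB hq' hu n) hv hm)
    (mem_phiIdeal (par_upperB hu) (fSer_upperB hq' hv n) hm)

/-- Modulo `phiIdeal`, the factor `(φ₀⁺)⁻¹ F_s` of an ordered monomial acts by a superderivation on
the products of the `(φ₀⁻)⁻¹ E_{-m}`. -/
theorem fPos_monF (s : ℕ+) (g : Idx →₀ ℕ) (hg : ∀ c ∈ g.support, ∃ m, c = .F m)
    (hgs : g (.F s) ≤ 1) :
    opAct q (Idx.elt q (.F s)) (monF q g) - ((-1 : ℂ) ^ (1 * oddBefore (.F s) g) * g (.F s) *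
      pairing q (Idx.elt q (.F s)) (Idx.eltMinus q (.F s))) • monF q (g - Finsupp.single (.F s) 1) ∈
      phiIdeal q := by
  obtain ⟨c₀, hc₀⟩ := exists_fSer_eSerB hq'
  have hD : ∀ m : ℕ+, opAct q (Idx.elt q (.F s)) (Idx.eltMinus q (.F m)) =
      if (s : ℕ) ≤ m then PowerSeries.coeff s c₀ • PowerSeries.coeff ((m : ℕ) - s)
        (cSerB q) else 0 := by
    intro m
    rw [elt_F, eltMinus_F, map_neg, map_neg, LinearMap.neg_apply, neg_neg, hc₀]
  have h0 : PowerSeries.coeff 0 (cSerB q) = 1 := by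
    rw [PowerSeries.coeff_zero_eq_constantCoeff_apply, constantCoeff_cSerB]
  have hd : pairing q (Idx.elt q (.F s)) (Idx.eltMinus q (.F s)) = PowerSeries.coeff s c₀ := by
    rw [pairing_apply, hD, if_pos le_rfl, Nat.sub_self, h0, map_smul, map_one, smul_eq_mul, mul_one]
  have hmem : ∀ m : ℕ+, Idx.eltMinus q (.F m) ∈ upperB q := fun m => by
    rw [eltMinus_F]
    exact neg_mem (eSerB_mem_upperB _)
  rw [hd]
  refine skewDerivation_orderedProd (Idx.eltMinus q) (opAct q (Idx.elt q (.F s))) (phiIdeal q) 1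
    (.F s)
    (PowerSeries.coeff s c₀) {c | ∃ m, c = .F m} ?_ ?_ ?_ g hg (Or.inl hgs)
  · rintro _ ⟨m, rfl⟩ v hv
    exact mul_mem_phiIdeal (hmem m) hv
  · rw [elt_F, map_neg, LinearMap.neg_apply, opFn_one hq', neg_zero]
    exact zero_mem _
  · rintro _ ⟨m, rfl⟩ v hv
    have hv' : orderedProd (Idx.eltMinus q) v ∈ upperB q := by
      refine orderedProd_mem _ (upperB q).toSubmonoid fun c hc => ?_
      obtain ⟨l, rfl⟩ := (hv c hc).2
      exact hmem l
    have h1 : opAct q (Idx.elt q (.F s)) (Idx.eltMinus q (.F m) * orderedProd (Idx.eltMinus q) v) =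
        opAct q (Idx.elt q (.F s)) (Idx.eltMinus q (.F m)) * orderedProd (Idx.eltMinus q) v +
        (-1 : ℂ) ^ (1 * (Idx.F m).par) • (Idx.eltMinus q (.F m) *
          opAct q (Idx.elt q (.F s)) (orderedProd (Idx.eltMinus q) v)) := by
      rw [elt_F, map_neg]
      simp only [LinearMap.neg_apply]
      rw [fSer_mul_of_mem hq' (hmem m) hv', par_eltMinus, one_mul, smul_mul_assoc, neg_add, neg_mul,
        mul_neg, smul_neg]
    rw [h1, hD, add_comm, add_sub_add_left_eq_sub]
    by_cases hms : m = s
    · subst hms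
      rw [if_pos le_rfl, if_pos rfl, Nat.sub_self, h0, smul_one_mul, sub_self]
      exact zero_mem _
    · have hms' : (m : ℕ) ≠ s := fun h => hms (PNat.coe_injective h)
      rw [if_neg (show ¬Idx.F m = Idx.F s by simpa using hms), zero_smul, sub_zero]
      split_ifs with h
      · rw [smul_mul_assoc]
        refine Submodule.smul_mem _ _ ?_
        have := mem_phiIdeal (one_mem (upperB q)) hv' (n := m - s) (by omega)
        rwa [one_mul] at this
      · rw [zero_mul]
        exact zero_mem _

end Upper

/-! ### Signs and factorials -/

section Exponents

theorem mem_Gam_of_le {f g : Idx →₀ ℕ} (hf : f ∈ Gam) (h : g ≤ f) : g ∈ Gam :=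
  ⟨fun s => (h _).trans (hf.1 s), fun n => (h _).trans (hf.2 n)⟩

/-- A new last factor `b` contributes to the sign the number of odd factors before it, if it is
odd. -/
theorem signExp_add_single {b : Idx} {f : Idx →₀ ℕ} (h : ∀ c ∈ f.support, c ≤ b) :
    signExp (f + Finsupp.single b 1) = signExp f +
      b.par * oddBefore b (f + Finsupp.single b 1) := by
  set F := f + Finsupp.single b 1 with hF
  have hb : b ∈ F.support := by simp [hF]
  have hsub : f.support ⊆ F.support := fun c hc => by
    rw [Finsupp.mem_support_iff] at hc ⊢
    simp [hF, hc]
  have hle : ∀ c ∈ F.support, c ≤ b := fun c hc => by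
    by_contra hcb
    have h0 : f c = 0 := Finsupp.notMem_support_iff.1 fun h' => hcb (h c h')
    have h1 : c ≠ b := fun e => hcb e.le
    rw [Finsupp.mem_support_iff] at hc
    simp [hF, h0, Finsupp.single_apply, h1.symm] at hc
  have e1 : signExp f = ∑ p ∈ (F.support ×ˢ F.support) with p.1 < p.2,
      f p.1 * f p.2 * p.1.par * p.2.par := by
    refine Finset.sum_subset (Finset.filter_subset_filter _ (Finset.product_subset_product hsub hsub)) ?_
    intro p hp hp'
    rw [Finset.mem_filter, Finset.mem_product] at hp hp'
    by_cases h1 : f p.1 = 0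
    · simp [h1]
    by_cases h2 : f p.2 = 0
    · simp [h2]
    exact absurd ⟨⟨Finsupp.mem_support_iff.2 h1, Finsupp.mem_support_iff.2 h2⟩, hp.2⟩ hp'
  have e2 : b.par * oddBefore b F = ∑ p ∈ (F.support ×ˢ F.support) with p.1 < p.2,
      if p.2 = b then F p.1 * p.1.par * b.par else 0 := by
    rw [oddBefore, Finset.mul_sum, Finset.sum_filter, Finset.sum_filter, Finset.sum_product]
    refine Finset.sum_congr rfl fun c hc => ?_
    rw [Finset.sum_eq_single b]
    · simp [mul_comm]
    · intro a _ ha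
      simp [ha]
    · exact fun h' => absurd hb h'
  rw [e1, e2, signExp, ← Finset.sum_add_distrib]
  refine Finset.sum_congr rfl fun p hp => ?_
  rw [Finset.mem_filter, Finset.mem_product] at hp
  have h1 : p.1 ≠ b := (hp.2.trans_le (hle _ hp.1.2)).ne
  have h2 : F p.1 = f p.1 := by simp [hF, Finsupp.single_apply, h1.symm]
  have h3 : F p.2 = f p.2 + if p.2 = b then 1 else 0 := by
    simp [hF, Finsupp.single_apply, eq_comm]
  rw [h2, h3]
  split_ifs with h4
  · rw [h4]; ring
  · simp

theorem prod_factorial_add_single (d : Idx → ℂ) (b : Idx) (f : Idx →₀ ℕ) :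
    ∏ c ∈ (f + Finsupp.single b 1 : Idx →₀ ℕ).support,
        (((f + Finsupp.single b 1 : Idx →₀ ℕ) c).factorial : ℂ) *
          d c ^ (f + Finsupp.single b 1 : Idx →₀ ℕ) c =
    (f b + 1) * d b * ∏ c ∈ f.support, ((f c).factorial : ℂ) * d c ^ f c := by
  have key : ∀ f : Idx →₀ ℕ, ∏ c ∈ f.support, ((f c).factorial : ℂ) * d c ^ f c =
      ((f b).factorial : ℂ) * d b ^ f b *
        (f.erase b).prod fun c n => (n.factorial : ℂ) * d c ^ n := fun f =>
    (Finsupp.mul_prod_erase' f b (fun c n => (n.factorial : ℂ) * d c ^ n) (by simp)).symm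
  rw [key, key, Finsupp.erase_add, Finsupp.erase_single, add_zero, Finsupp.add_apply,
    Finsupp.single_eq_same, Nat.factorial_succ, pow_succ]
  push_cast
  ring

end Exponents

/-! ### Evaluation of the pairing -/

section Evaluation

variable {q : ℂ} [hq : NeZero q] (hq' : ∀ n : ℕ, 0 < n → q ^ n ≠ 1)
variable {k : (A q)ˣ} (hk : k ∈ Subgroup.closure (Set.range (kA q)))
include hq'

theorem monE_mem_stabilizer_fIdeal {f : Idx →₀ ℕ}
    (hf : ∀ c ∈ f.support, (∃ m, c = .F m) ∨ ∃ m, c = .h m) : monE q f ∈ stabilizer (fIdeal q) := by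
  refine orderedProd_mem _ (stabilizer (fIdeal q)).toSubmonoid fun c hc => ?_
  obtain ⟨m, rfl⟩ | ⟨m, rfl⟩ := hf c hc
  · rw [elt_F]
    exact (stabilizer (fIdeal q)).neg_mem (fSer_mem_stabilizer hq' m)
  · exact hPos_mem_stabilizer hq' m

theorem monE_mem_stabilizer_of_F {M : Submodule ℂ (B q)}
    (hM : ∀ n, PowerSeries.coeff n (fSer q) ∈ stabilizer M) {f : Idx →₀ ℕ}
    (hf : ∀ c ∈ f.support, ∃ m, c = .F m) : monE q f ∈ stabilizer M := by
  refine orderedProd_mem _ (stabilizer M).toSubmonoid fun c hc => ?_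
  obtain ⟨m, rfl⟩ := hf c hc
  rw [elt_F]
  exact (stabilizer M).neg_mem (hM m)

/-- Removing the last factor `b` of `E(f)` removes one factor `b⁻` of `F(g)`: the other terms are
annihilated by the remaining factors of `E(f)` followed by a character `φ(k, ·)`. -/
theorem grpChar_monE_elt {f g : Idx →₀ ℕ} {b : Idx} (hf : ∀ c ∈ f.support, c ≤ b) (hg : g ∈ Gam) :
    grpChar k hk (opAct q (monE q f) (opAct q (b.elt q) (monF q g))) =
      ((-1 : ℂ) ^ (b.par * oddBefore b g) * g b * pairing q (b.elt q) (b.eltMinus q)) *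
        grpChar k hk (opAct q (monE q f) (monF q (g - Finsupp.single b 1))) := by
  have hsub : ∀ c ∈ g.support, c ≠ b → c ∈ (g - Finsupp.single b 1).support := fun c hc hcb => by
    rw [Finsupp.mem_support_iff] at hc ⊢
    simpa [Finsupp.single_apply, hcb.symm] using hc
  rcases b with s | s | s | n
  · have hfF : ∀ c ∈ f.support, ∃ m, c = .F m := fun c hc => Idx.exists_eq_F_of_le (hf c hc)
    by_cases hgF : ∀ c ∈ g.support, ∃ m, c = .F m
    · have h := grpChar_phiIdeal hk (monE_mem_stabilizer_of_F hq' (fSer_mem_stabilizer_phiIdeal hq') hfF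
        _ (fPos_monF hq' s g hgF (hg.1 s)))
      rw [map_sub, map_sub, map_smul, map_smul, smul_eq_mul, sub_eq_zero] at h
      exact h
    · push Not at hgF
      obtain ⟨c, hc, hcF⟩ := hgF
      have hst := monE_mem_stabilizer_of_F hq' (fSer_mem_stabilizer_lowerIdeal hk hq') hfF
      have hF : Idx.elt q (.F s) ∈ stabilizer (lowerIdeal k hk) := by
        rw [elt_F]
        exact neg_mem (fSer_mem_stabilizer_lowerIdeal hk hq' s)
      rw [grpChar_lowerIdeal hk (hst _ (hF _ (monF_mem_lowerIdeal hk hc hcF))),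
        grpChar_lowerIdeal hk (hst _ (monF_mem_lowerIdeal hk (hsub c hc (hcF s)) hcF)), mul_zero]
  · have hfh := fun c hc => Idx.eq_F_or_h_of_le (hf c hc)
    by_cases hgE : ∀ c ∈ g.support, ∀ n, c ≠ .E n
    · rw [Idx.elt, hPos_monF hq' s g hgE, map_smul, map_smul, smul_eq_mul]
      rfl
    · push Not at hgE
      obtain ⟨c, hc, n, rfl⟩ := hgE
      have hst := monE_mem_stabilizer_fIdeal hq' hfh
      have hh : Idx.elt q (.h s) ∈ stabilizer (fIdeal q) := hPos_mem_stabilizer hq' s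
      rw [grpChar_fIdeal hk (hst _ (hh _ (monF_mem_fIdeal hc))),
        grpChar_fIdeal hk (hst _ (monF_mem_fIdeal (hsub _ hc (by simp)))), mul_zero]
  · rw [Idx.elt, cPos_monF hq' s g, map_smul, map_smul, smul_eq_mul]
    rfl
  · rw [Idx.elt, ePos_monF hq' n g (hg.2 n), map_smul, map_smul, smul_eq_mul]
    rfl

omit hq' in
/-- The case `E(f) = 1`. -/
theorem grpChar_monF (g : Idx →₀ ℕ) : grpChar k hk (monF q g) = if 0 = g then 1 else 0 := by
  split_ifs with h
  · rw [← h, monF, orderedProd_zero, map_one]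
  · obtain ⟨c, hc⟩ := Finsupp.support_nonempty_iff.2 (Ne.symm h)
    obtain ⟨c', -, -, y, hy⟩ := exists_orderedProd_eq (Idx.eltMinus q) hc
    rw [monF, hy, map_mul, grpChar_eltMinus, mul_zero]

/-- The value `φ(k E(f), F(g)) / φ(k, 1)`, by induction on the number of factors of `E(f)`. -/
theorem grpChar_monE_monF (f : Idx →₀ ℕ) (hf : f ∈ Gam) (g : Idx →₀ ℕ) (hg : g ∈ Gam) :
    grpChar k hk (opAct q (monE q f) (monF q g)) = (if f = g then 1 else 0) * (-1) ^ signExp f *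
      ∏ b ∈ f.support, ((f b).factorial : ℂ) * pairing q (b.elt q) (b.eltMinus q) ^ f b := by
  induction hn : f.degree generalizing f g with
  | zero =>
    rw [Finsupp.degree_eq_zero_iff] at hn
    subst hn
    rw [monE, orderedProd_zero, map_one, Module.End.one_apply, grpChar_monF]
    simp [signExp]
  | succ n ih =>
    obtain ⟨b, hbf, hmax⟩ : ∃ b ∈ f.support, ∀ c ∈ f.support, c ≤ b := by
      have hne : f.support.Nonempty := by
        rw [Finsupp.support_nonempty_iff]
        rintro rfl
        simp at hn
      exact ⟨_, Finset.max'_mem _ hne, fun c hc => Finset.le_max' _ c hc⟩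
    obtain ⟨f', rfl⟩ : ∃ f', f = f' + Finsupp.single b 1 :=
      ⟨f - Finsupp.single b 1, (tsub_add_cancel_of_le (by
        rw [Finsupp.single_le_iff]
        exact Nat.one_le_iff_ne_zero.2 (Finsupp.mem_support_iff.1 hbf))).symm⟩
    have hf' : ∀ c ∈ f'.support, c ≤ b := fun c hc => hmax c (by
      rw [Finsupp.mem_support_iff] at hc ⊢
      simp [hc])
    rw [map_add, Finsupp.degree_single, Nat.add_right_cancel_iff] at hn
    have hE : monE q (f' + Finsupp.single b 1) = monE q f' * Idx.elt q b :=
      orderedProd_add_single_one _ hf'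
    rw [hE, map_mul, Module.End.mul_apply, grpChar_monE_elt hq' hk hf' hg,
      ih f' (mem_Gam_of_le hf le_self_add) _ (mem_Gam_of_le hg tsub_le_self) hn]
    by_cases hfg : f' + Finsupp.single b 1 = g
    · subst hfg
      rw [add_tsub_cancel_right, if_pos rfl, if_pos rfl, signExp_add_single hf', pow_add,
        prod_factorial_add_single (fun c => pairing q (c.elt q) (c.eltMinus q)), Finsupp.add_apply,
        Finsupp.single_eq_same]
      push_cast
      ring
    · rw [if_neg hfg]
      by_cases hgb : g b = 0
      · simp [hgb]
      · rw [if_neg]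
        · simp
        · rintro rfl
          exact hfg (tsub_add_cancel_of_le (by
            rw [Finsupp.single_le_iff]
            exact Nat.one_le_iff_ne_zero.2 hgb))

theorem monE_mem_commuting (f : Idx →₀ ℕ) : monE q f ∈ commuting q := by
  refine orderedProd_mem _ (commuting q).toSubmonoid fun c _ => ?_
  rcases c with s | s | s | n
  · rw [elt_F]
    exact (commuting q).neg_mem (fSer_mem_commuting hq' s)
  · exact (commuting q).smul_mem (logCoeff_mem _ (hSer_mem_commuting hq') s) _
  · exact (commuting q).smul_mem (logCoeff_mem _ (cSer_mem_commuting hq') s) _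
  · exact ePos_mem_commuting hq' n

/-- The group-like factors split off: `E(f)` acts linearly with respect to `k'`, and `φ(k, ·)` is a
character. -/
theorem pairing_grp_mul_monE (f : Idx →₀ ℕ) {k' : (B q)ˣ}
    (hk' : k' ∈ Subgroup.closure (Set.range (kB q))) (v : B q) :
    pairing q (k * monE q f) (k' * v) =
      pairing q k k' * grpChar k hk (opAct q (monE q f) v) := by
  rw [pairing_apply, map_mul (opAct q), Module.End.mul_apply,
    commuting_apply (monE_mem_commuting hq' f) hk',
    ← grpChar_apply hk, map_mul, grpChar_apply hk (k' : B q), ← pairing_apply]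

end Evaluation

end QAffineGL11

end

theorem mainTheorem2 (q : ℂ) (hq0 : q ≠ 0) (hq : ∀ n : ℕ, 0 < n → q ^ n ≠ 1) :
    (∃! φ : A q →ₗ[ℂ] B q →ₗ[ℂ] ℂ, IsHopfPairing q φ) ∧
    ∀ φ : A q →ₗ[ℂ] B q →ₗ[ℂ] ℂ, IsHopfPairing q φ →
      ∀ f ∈ Gam, ∀ g ∈ Gam,
      ∀ k ∈ Subgroup.closure (Set.range (kA q)), ∀ k' ∈ Subgroup.closure (Set.range (kB q)),
        φ ((k : A q) * monE q f) ((k' : B q) * monF q g) =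
          φ k k' * (if f = g then 1 else 0) * (-1) ^ signExp f *
            ∏ b ∈ f.support, ((f b).factorial : ℂ) * φ (b.elt q) (b.eltMinus q) ^ f b := by
  haveI : NeZero q := ⟨hq0⟩
  refine ⟨existsUnique_isHopfPairing, ?_⟩
  intro φ hφ f hf g hg k hk k' hk'
  rw [hφ.unique isHopfPairing_pairing, pairing_grp_mul_monE hq hk f hk',
    grpChar_monE_monF hq hk f hf g hg,
    ← mul_assoc, ← mul_assoc]
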